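/- **Lemma (Stability estimates for the spatially discrete parabolic bulk-surface problem).** *Domain and mesh.* Let $\Omega\subset\mathbb{R}^2$ be compact with $\mathcal{C}^3$ boundary $\Gamma=\partial\Omega$ (with $\Omega$ on one side of $\Gamma$), let $d$ be the oriented distance to $\Gamma$ (negative in $\Omega$), $\boldsymbol\nu$ the outward unit normal, and let the Fermi stripe of $\Gamma$ be the largest open set in which every $\boldsymbol{x}$ has a unique decomposition $\boldsymbol{x}=\boldsymbol{a}+d(\boldsymbol{x})\boldsymbol\nu(\boldsymbol{a})$ with $\boldsymbol{a}\in\Gamma$. A *bulk-surface mesh of meshsize $h$ with regularity parameters $\gamma_1,\gamma_2>0$* is a finite set $\mathcal{E}_h$ of simple non-degenerate closed polygons $E$, with $\Omega_h=\bigcup_{E\in\mathcal{E}_h}E$ and $\Gamma_h=\partial\Omega_h$, such that, with $h_E=\operatorname{diam}E$: $h_E\le h$; two distinct elements meet in the empty set, a common vertex or a common edge; all nodes lie in $\Omega$ and the nodes of $\Gamma_h$ lie on $\Gamma$; every boundary edge (an edge contained in $\Gamma_h$) lies in the Fermi stripe of $\Gamma$; every $E$ is star-shaped with respect to a ball of radius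 $\gamma_1h_E$; and any two distinct nodes of $E$ have distance at least $\gamma_2h_E$. *Discrete spaces and forms.* For $E\in\mathcal{E}_h$ let $\tilde{\mathbb{V}}(E)$ be the space of $v\in H^1(E)\cap\mathcal{C}^0(E)$ that are linear on each edge of $E$ and satisfy $\Delta v\in\mathbb{P}_1(E)$. Let $\Pi^\nabla_Ev\in\mathbb{P}_1(E)$ be given by $\int_E\nabla(v-\Pi^\nabla_Ev)\cdot\nabla p=0$ for all $p\in\mathbb{P}_1(E)$ and $\int_{\partial E}(v-\Pi^\nabla_Ev)=0$, let $\Pi^0_E$ be the $L^2(E)$-projection onto $\mathbb{P}_1(E)$, and $$\mathbb{V}(E)=\Big\{v\in\tilde{\mathbb{V}}(E)\ \Big|\ \int_Evp=\int_E(\Pi^\nabla_Ev)p\ \ \forall p\in\mathbb{P}_1(E)\Big\}.$$ With $S_E(v,w)=\sum_{P\in\mathrm{vertices}(E)}v(P)w(P)$ put $$m_E(v,w)=\int_E(\Pi^0_Ev)(\Pi^0_Ew)+\operatorname{area}(E)\,S_E(v-\Pi^0_Ev,w-\Pi^0_Ew),$$ $$a_E(v,w)=\int_E\nabla\Pi^\nabla_Ev\cdot\nabla\Pi^\nabla_Ew+S_E(v-\Pi^\nabla_Ev,w-\Pi^\nabla_Ew),$$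 and let $m_h$, $a_h$ be the sums of $m_E$, $a_E$ over $E\in\mathcal{E}_h$. Let $\mathbb{V}_\Omega$ be the space of $v\in\mathcal{C}^0(\Omega_h)$ with $v_{|E}\in\mathbb{V}(E)$ for all $E$, and $\mathbb{V}_\Gamma$ the space of continuous functions on $\Gamma_h$ that are linear on each boundary edge. $I_\Omega$ denotes elementwise nodal interpolation (on each $E$, in $\mathbb{V}(E)$), $I_\Gamma$ nodal interpolation in $\mathbb{V}_\Gamma$, and $\Pi^0$ the elementwise application of $\Pi^0_E$. *Semi-discrete problem.* Let $d_u,d_v>0$, let $q:\mathbb{R}\to\mathbb{R}$ and $r,s:\mathbb{R}^2\to\mathbb{R}$ be globally Lipschitz, and $T>0$. A solution is a pair of functions of time $U$ and $V$ with values in $\mathbb{V}_\Omega$ and $\mathbb{V}_\Gamma$, absolutely continuous on $[0,T]$ with square integrable time derivatives $\dot U$, $\dot V$ in these spaces, such that for almost every $t\in[0,T]$, for all $\varphi\in\mathbb{V}_\Omega$ and $\psi\in\mathbb{V}_\Gamma$, $$m_h(\dot U,\varphi)+d_u\,a_h(U,\varphi)=m_h\big(\Pi^0I_\Omega(q(\Pi^0U)),\varphi\big)+\int_{\Gamma_h}I_\Gamma(s(U,V))\varphi,$$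 $$\int_{\Gamma_h}\dot V\psi+d_v\int_{\Gamma_h}\nabla_{\Gamma_h}V\cdot\nabla_{\Gamma_h}\psi+\int_{\Gamma_h}I_\Gamma(s(U,V))\psi=\int_{\Gamma_h}I_\Gamma(r(U,V))\psi.$$ Write $U_0=U(0)\in\mathbb{V}_\Omega$, $V_0=V(0)\in\mathbb{V}_\Gamma$. *Claim.* For every $\Omega$, $\gamma_1$, $\gamma_2$ as above there is $h_0>0$, and for all $d_u,d_v,q,r,s$ as above there is $C>0$, depending only on $q,r,s,d_u,d_v,\Omega,\gamma_1,\gamma_2$, such that for every bulk-surface mesh of meshsize $0<h\le h_0$ with parameters $\gamma_1,\gamma_2$, every $T>0$ and every solution $(U,V)$, $$\sup_{t\in[0,T]}\Big(\|U\|_{L^2(\Omega_h)}^2+\|V\|_{L^2(\Gamma_h)}^2\Big)+\int_0^T\Big(|U|_{H^1(\Omega_h)}^2+|V|_{H^1(\Gamma_h)}^2\Big)\,dt\le C\Big(1+\|U_0\|_{L^2(\Omega_h)}^2+\|V_0\|_{L^2(\Gamma_h)}^2\Big)e^{CT},$$ $$\sup_{t\in[0,T]}\Big(|U|_{H^1(\Omega_h)}^2+|V|_{H^1(\Gamma_h)}^2\Big)+\int_0^T\Big(\|\dot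 U\|_{L^2(\Omega_h)}^2+\|\dot V\|_{L^2(\Gamma_h)}^2\Big)\,dt\le C\Big(1+\|U_0\|_{H^1(\Omega_h)}^2+\|V_0\|_{H^1(\Gamma_h)}^2\Big)e^{CT}.$$ -/

import Mathlib

open MeasureTheory Set
open scoped Topology ENNReal ContDiff RealInnerProductSpace

noncomputable section

/-- The Euclidean plane. -/
abbrev Plane : Type := EuclideanSpace ℝ (Fin 2)

/-! ### The exact domain -/

/-- `Ω` is a compact plane set whose boundary is a curve of class `C³`, with `Ω` on one side of it:
near each boundary point, `Ω` is the sublevel set of a `C³` function with non-zero derivative. -/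
def IsC3Domain (Ω : Set Plane) : Prop :=
  IsCompact Ω ∧ ∀ x ∈ frontier Ω, ∃ ρ : Plane → ℝ, ContDiffAt ℝ 3 ρ x ∧ fderiv ℝ ρ x ≠ 0 ∧
    ∀ᶠ y in 𝓝 x, (y ∈ Ω ↔ ρ y ≤ 0)

open Classical in
/-- Oriented distance function: negative inside `Ω`, zero on the boundary, positive outside. -/
def orientedDist (Ω : Set Plane) (x : Plane) : ℝ :=
  if x ∈ Ω then -Metric.infDist x (frontier Ω) else Metric.infDist x (frontier Ω)

/-- Outward unit normal, `∇d / ‖∇d‖`. -/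
def outerNormal (Ω : Set Plane) (a : Plane) : Plane :=
  ‖gradient (orientedDist Ω) a‖⁻¹ • gradient (orientedDist Ω) a

/-- Fermi stripe of `Γ = ∂Ω`: the largest open set all of whose points have a unique decomposition
`x = a + d(x) ν(a)` with `a ∈ Γ`. -/
def fermiStripe (Ω : Set Plane) : Set Plane :=
  interior {x | ∃! a, a ∈ frontier Ω ∧ x = a + orientedDist Ω x • outerNormal Ω a}

/-! ### Sobolev functions of order one on an open set -/

/-- `v ∈ H¹(O)` with weak gradient `g ∈ L²(O)`. -/
def IsH1Grad (O : Set Plane) (v : Plane → ℝ) (g : Plane → Plane) : Prop :=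
  MemLp v 2 (volume.restrict O) ∧ MemLp g 2 (volume.restrict O) ∧
    ∀ φ : Plane → ℝ, ContDiff ℝ ∞ φ → HasCompactSupport φ → tsupport φ ⊆ O →
      ∫ x in O, v x • gradient φ x = -∫ x in O, φ x • g x

/-- `v ∈ H¹(O)`. -/
def MemH1 (O : Set Plane) (v : Plane → ℝ) : Prop := ∃ g, IsH1Grad O v g

/-- The weak gradient of an `H¹(O)` function (unique almost everywhere on `O`). -/
def weakGrad (O : Set Plane) (v : Plane → ℝ) : Plane → Plane :=
  Classical.epsilon (IsH1Grad O v)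

/-- `|v|²_{H¹(O)} = ∫_O |∇v|²`, as an extended number: it is `∞` when `v ∉ H¹(O)`, and otherwise
the infimum runs over almost everywhere equal versions of the weak gradient. -/
def h1SemiSq (O : Set Plane) (v : Plane → ℝ) : ℝ≥0∞ :=
  ⨅ (g : Plane → Plane) (_ : IsH1Grad O v g), ∫⁻ x in O, ‖g x‖ₑ ^ 2

/-- `‖v‖²_{L²(A)}`. -/
def l2Sq (A : Set Plane) (v : Plane → ℝ) : ℝ≥0∞ := ∫⁻ x in A, ‖v x‖ₑ ^ 2

/-! ### Line integrals over a segment -/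

/-- `∫_{[a,b]} f` with respect to arc length. -/
def segInt (a b : Plane) (f : Plane → ℝ) : ℝ :=
  dist a b * ∫ t in (0 : ℝ)..1, f (AffineMap.lineMap a b t)

/-- Derivative of `f` along `[a,b]` with respect to arc length, at parameter `t ∈ (0,1)`. -/
def segDeriv (a b : Plane) (f : Plane → ℝ) (t : ℝ) : ℝ :=
  deriv (fun τ : ℝ => f (AffineMap.lineMap a b τ)) t / dist a b

/-! ### Polygons and local virtual element spaces -/

/-- A simple, non-degenerate closed polygonal region. The vertices are listed cyclically; straight
angles at vertices are allowed. -/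
structure Polygon2 where
  /-- number of vertices -/
  n : ℕ
  three_le : 3 ≤ n
  vertex : Fin n → Plane
  vertex_injective : Function.Injective vertex
  /-- two different edges meet at most in a common endpoint -/
  simple : ∀ i j, i ≠ j →
    segment ℝ (vertex i) (vertex (finRotate n i)) ∩ segment ℝ (vertex j) (vertex (finRotate n j)) ⊆
      {vertex i, vertex (finRotate n i)} ∩ {vertex j, vertex (finRotate n j)}
  /-- the closed region enclosed by the edges -/
  carrier : Set Plane
  isCompact_carrier : IsCompact carrier
  closure_interior : closure (interior carrier) = carrier
  frontier_carrier :
    frontier carrier = ⋃ i, segment ℝ (vertex i) (vertex (finRotate n i))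

namespace Polygon2

variable (E : Polygon2)

/-- second endpoint of the `i`-th edge -/
def nextVertex (i : Fin E.n) : Plane := E.vertex (finRotate E.n i)

/-- the `i`-th edge, as a set -/
def edge (i : Fin E.n) : Set Plane := segment ℝ (E.vertex i) (E.nextVertex i)

/-- diameter `h_E` -/
def diam : ℝ := Metric.diam E.carrier

/-- area of `E` -/
def area : ℝ := (volume E.carrier).toReal

/-- `∫_{∂E} f` -/
def boundaryInt (f : Plane → ℝ) : ℝ := ∑ i, segInt (E.vertex i) (E.nextVertex i) f

/-- `p ∈ ℙ₁(E)` is the elliptic projection `Π^∇_E v`. -/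
def IsEllipticProj (v : Plane → ℝ) (p : Plane →ᵃ[ℝ] ℝ) : Prop :=
  (∀ p₁ : Plane →ᵃ[ℝ] ℝ,
    ∫ x in E.carrier, ⟪weakGrad (interior E.carrier) v x - gradient p x, gradient p₁ x⟫ = 0) ∧
  E.boundaryInt (fun x => v x - p x) = 0

/-- The elliptic projection `Π^∇_E`. -/
def ellipticProj (v : Plane → ℝ) : Plane →ᵃ[ℝ] ℝ := Classical.epsilon (E.IsEllipticProj v)

/-- `p ∈ ℙ₁(E)` is the `L²(E)` projection `Π⁰_E v`. -/
def IsL2Proj (v : Plane → ℝ) (p : Plane →ᵃ[ℝ] ℝ) : Prop :=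
  ∀ p₁ : Plane →ᵃ[ℝ] ℝ, ∫ x in E.carrier, (v x - p x) * p₁ x = 0

/-- The `L²` projection `Π⁰_E`. -/
def l2Proj (v : Plane → ℝ) : Plane →ᵃ[ℝ] ℝ := Classical.epsilon (E.IsL2Proj v)

/-- The preliminary local space: `v ∈ H¹(E) ∩ C⁰(E)`, linear on each edge, `Δv ∈ ℙ₁(E)` in the
sense of distributions. -/
def MemPreSpace (v : Plane → ℝ) : Prop :=
  MemH1 (interior E.carrier) v ∧ ContinuousOn v E.carrier ∧
  (∀ i, ∃ p : Plane →ᵃ[ℝ] ℝ, EqOn v p (E.edge i)) ∧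
  ∃ p : Plane →ᵃ[ℝ] ℝ, ∀ φ : Plane → ℝ, ContDiff ℝ ∞ φ → HasCompactSupport φ →
    tsupport φ ⊆ interior E.carrier →
      ∫ x in E.carrier, ⟪weakGrad (interior E.carrier) v x, gradient φ x⟫ =
        -∫ x in E.carrier, p x * φ x

/-- The enhanced virtual element space `𝕍(E)`. -/
def MemSpace (v : Plane → ℝ) : Prop :=
  E.MemPreSpace v ∧
  ∀ p₁ : Plane →ᵃ[ℝ] ℝ,
    ∫ x in E.carrier, v x * p₁ x = ∫ x in E.carrier, E.ellipticProj v x * p₁ x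

/-- The stabilizing form `S_E`. -/
def stab (v w : Plane → ℝ) : ℝ := ∑ i, v (E.vertex i) * w (E.vertex i)

/-- The approximate mass form `m_E`. -/
def massForm (v w : Plane → ℝ) : ℝ :=
  (∫ x in E.carrier, E.l2Proj v x * E.l2Proj w x) +
    E.area * E.stab (fun x => v x - E.l2Proj v x) (fun x => w x - E.l2Proj w x)

/-- The approximate stiffness form `a_E`. -/
def stiffForm (v w : Plane → ℝ) : ℝ :=
  (∫ x in E.carrier, ⟪gradient (E.ellipticProj v) x, gradient (E.ellipticProj w) x⟫) +
    E.stab (fun x => v x - E.ellipticProj v x) (fun x => w x - E.ellipticProj w x)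

/-- `w` is the virtual Lagrange interpolant of `f` on `E`: the function of `𝕍(E)` with the same
values at the vertices. -/
def IsInterpolant (f w : Plane → ℝ) : Prop :=
  E.MemSpace w ∧ ∀ i, w (E.vertex i) = f (E.vertex i)

/-- `E` is star-shaped with respect to a ball of radius `r`. -/
def StarShapedBall (r : ℝ) : Prop :=
  ∃ c, Metric.ball c r ⊆ E.carrier ∧ ∀ y ∈ Metric.ball c r, StarConvex ℝ y E.carrier

end Polygon2

/-! ### Bulk-surface meshes -/

/-- A finite collection of polygons. -/
structure PolyMesh where
  elems : Finset Polygon2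

namespace PolyMesh

variable (M : PolyMesh)

/-- The polygonal bulk `Ω_h`. -/
def bulk : Set Plane := ⋃ E ∈ M.elems, E.carrier

/-- The polygonal curve `Γ_h = ∂Ω_h`. -/
def surf : Set Plane := frontier M.bulk

open Classical in
/-- The boundary edges, i.e. the edges of elements that lie on `Γ_h`. In a conforming mesh each of
them belongs to exactly one element, so none is listed twice. -/
def bdryEdges : Finset (Σ E : Polygon2, Fin E.n) :=
  M.elems.sigma fun E => Finset.univ.filter fun i => E.edge i ⊆ M.surf

/-- `∫_{Γ_h} f` -/
def surfInt (f : Plane → ℝ) : ℝ :=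
  ∑ e ∈ M.bdryEdges, segInt (e.1.vertex e.2) (e.1.nextVertex e.2) f

/-- `∫_{Γ_h} ∇_{Γ_h} v · ∇_{Γ_h} w` -/
def surfStiff (v w : Plane → ℝ) : ℝ :=
  ∑ e ∈ M.bdryEdges, dist (e.1.vertex e.2) (e.1.nextVertex e.2) *
    ∫ t in (0 : ℝ)..1, segDeriv (e.1.vertex e.2) (e.1.nextVertex e.2) v t *
      segDeriv (e.1.vertex e.2) (e.1.nextVertex e.2) w t

/-- `‖v‖²_{L²(Γ_h)}` -/
def surfL2Sq (v : Plane → ℝ) : ℝ≥0∞ :=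
  ∑ e ∈ M.bdryEdges, ENNReal.ofReal (dist (e.1.vertex e.2) (e.1.nextVertex e.2)) *
    ∫⁻ t in Icc (0 : ℝ) 1,
      ‖v (AffineMap.lineMap (e.1.vertex e.2) (e.1.nextVertex e.2) t)‖ₑ ^ 2

/-- `|v|²_{H¹(Γ_h)}`, for `v` continuous on `Γ_h` and smooth along each boundary edge -/
def surfH1SemiSq (v : Plane → ℝ) : ℝ≥0∞ :=
  ∑ e ∈ M.bdryEdges, ENNReal.ofReal (dist (e.1.vertex e.2) (e.1.nextVertex e.2)) *
    ∫⁻ t in Icc (0 : ℝ) 1, ‖segDeriv (e.1.vertex e.2) (e.1.nextVertex e.2) v t‖ₑ ^ 2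

/-- The continuous bulk virtual element space `𝕍_Ω`. Functions are extended arbitrarily outside
`Ω_h`; nothing below depends on the extension. -/
def MemBulkSpace (v : Plane → ℝ) : Prop :=
  (∀ E ∈ M.elems, E.MemSpace v) ∧ ContinuousOn v M.bulk

/-- The surface finite element space `𝕍_Γ`. Functions are extended arbitrarily outside `Γ_h`. -/
def MemSurfSpace (v : Plane → ℝ) : Prop :=
  ContinuousOn v M.surf ∧
    ∀ e ∈ M.bdryEdges, ∃ p : Plane →ᵃ[ℝ] ℝ, EqOn v p (e.1.edge e.2)

/-- `w` is the surface Lagrange interpolant of `g`: the function of `𝕍_Γ` with the same values at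
the nodes of `Γ_h`. -/
def IsSurfInterpolant (g w : Plane → ℝ) : Prop :=
  M.MemSurfSpace w ∧ ∀ E ∈ M.elems, ∀ i, E.vertex i ∈ M.surf → w (E.vertex i) = g (E.vertex i)

/-- `m_h`, for elementwise defined functions (`v E` is the function on the element `E`). -/
def massForm (v w : Polygon2 → Plane → ℝ) : ℝ := ∑ E ∈ M.elems, E.massForm (v E) (w E)

/-- `a_h`, for elementwise defined functions. -/
def stiffForm (v w : Polygon2 → Plane → ℝ) : ℝ := ∑ E ∈ M.elems, E.stiffForm (v E) (w E)

/-- `M` is a polygonal bulk-surface mesh of `Ω` of meshsize `h` with regularity parameters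
`γ₁`, `γ₂`. -/
structure IsBSMesh (Ω : Set Plane) (h γ₁ γ₂ : ℝ) : Prop where
  diam_le : ∀ E ∈ M.elems, E.diam ≤ h
  /-- distinct elements meet in nothing, in a common vertex, or in a common edge -/
  conforming : ∀ E₁ ∈ M.elems, ∀ E₂ ∈ M.elems, E₁ ≠ E₂ →
    E₁.carrier ∩ E₂.carrier = ∅ ∨
    (∃ i j, E₁.vertex i = E₂.vertex j ∧ E₁.carrier ∩ E₂.carrier = {E₁.vertex i}) ∨
    (∃ i j, E₁.edge i = E₂.edge j ∧ E₁.carrier ∩ E₂.carrier = E₁.edge i)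
  /-- all nodes belong to the domain -/
  vertex_mem : ∀ E ∈ M.elems, ∀ i, E.vertex i ∈ Ω
  /-- the nodes of `Γ_h` lie on `Γ` -/
  vertex_mem_frontier : ∀ E ∈ M.elems, ∀ i, E.vertex i ∈ M.surf → E.vertex i ∈ frontier Ω
  /-- the boundary edges lie in the Fermi stripe of `Γ` -/
  edge_subset_fermi : ∀ e ∈ M.bdryEdges, e.1.edge e.2 ⊆ fermiStripe Ω
  starShaped : ∀ E ∈ M.elems, E.StarShapedBall (γ₁ * E.diam)
  vertex_dist : ∀ E ∈ M.elems, ∀ i j, i ≠ j → γ₂ * E.diam ≤ dist (E.vertex i) (E.vertex j)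

/-- `(U, V)`, with time derivative `(dU, dV)`, solves the spatially discrete parabolic problem on
`[0, T]`. The functions `U`, `V` are (the continuous representatives of) elements of
`H¹(0,T; 𝕍_Ω)` and `H¹(0,T; 𝕍_Γ)`, and the equations hold at almost every time. At such a time
`W`, `S`, `R` are the interpolants `I_Ω(q(Π⁰U))`, `I_Γ(s(U,V))`, `I_Γ(r(U,V))`. -/
structure IsSemidiscreteSolution (d_u d_v : ℝ) (q : ℝ → ℝ) (r s : ℝ × ℝ → ℝ) (T : ℝ)
    (U V dU dV : ℝ → Plane → ℝ) : Prop where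
  bulk_mem : ∀ t ∈ Icc 0 T, M.MemBulkSpace (U t) ∧ M.MemBulkSpace (dU t)
  surf_mem : ∀ t ∈ Icc 0 T, M.MemSurfSpace (V t) ∧ M.MemSurfSpace (dV t)
  bulk_memLp : ∀ x ∈ M.bulk, MemLp (fun t => dU t x) 2 (volume.restrict (Icc 0 T))
  surf_memLp : ∀ x ∈ M.surf, MemLp (fun t => dV t x) 2 (volume.restrict (Icc 0 T))
  bulk_deriv : ∀ x ∈ M.bulk, ∀ t ∈ Icc 0 T, U t x = U 0 x + ∫ τ in (0 : ℝ)..t, dU τ x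
  surf_deriv : ∀ x ∈ M.surf, ∀ t ∈ Icc 0 T, V t x = V 0 x + ∫ τ in (0 : ℝ)..t, dV τ x
  equations : ∀ᵐ t ∂(volume.restrict (Icc 0 T)),
    ∃ (W : Polygon2 → Plane → ℝ) (S R : Plane → ℝ),
      (∀ E ∈ M.elems, E.IsInterpolant (fun x => q (E.l2Proj (U t) x)) (W E)) ∧
      M.IsSurfInterpolant (fun x => s (U t x, V t x)) S ∧
      M.IsSurfInterpolant (fun x => r (U t x, V t x)) R ∧
      (∀ φ : Plane → ℝ, M.MemBulkSpace φ →
        M.massForm (fun _ => dU t) (fun _ => φ) + d_u * M.stiffForm (fun _ => U t) (fun _ => φ) =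
          M.massForm (fun E => E.l2Proj (W E)) (fun _ => φ) + M.surfInt (fun x => S x * φ x)) ∧
      (∀ ψ : Plane → ℝ, M.MemSurfSpace ψ →
        M.surfInt (fun x => dV t x * ψ x) + d_v * M.surfStiff (V t) ψ +
          M.surfInt (fun x => S x * ψ x) = M.surfInt (fun x => R x * ψ x))

end PolyMesh

end

open MeasureTheory Set
open scoped Topology ENNReal ContDiff RealInnerProductSpace

/-! The proof is the energy method, carried out on vertex values, with constants that depend only on
shape regularity, on the domain and on the data.

Reduction to vertex values. A function of 𝕍(E) is affine on each edge, so by the divergence theorem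
the mean of its weak gradient, and with it Π^∇, is an explicit linear function `proj` of its vertex
values (`isEllipticProj_iff`). The enhancement condition then gives Π⁰ = Π^∇ on 𝕍(E)
(`MemSpace.l2Proj_eq`), so m_E and a_E become the quadratic forms `massB` and `stiffB`. The
Gauss-Green formulas behind this are first proved for smooth functions on the fan of triangles
around a star centre. They pass to H¹ functions that are continuous up to the boundary by a dilation
followed by mollification (`exists_smooth_approx`, `gauss_green`).

Norm equivalence. Three estimates on a regular polygon carry `exists_massB_equiv` and
`exists_stiffB_equiv`. The gradient is bounded by the vertex values (`exists_grad_bound`): subtract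
the conical extension of the boundary data, test the affine Laplacian with the difference, and use
enhancement to replace v by its projection against the Laplacian. Increments along edges are bounded
by the gradient (`exists_increment_bound`): integrating the gradient against a rotated gradient of a
cut-off leaves only tangential boundary terms. Finally, the divergence theorem for v²(x - c)
compares the L² norm with the vertex values.

Trace inequality. The boundary of the domain is locally almost straight, so finitely many cut-offs
χ_k and unit vectors ν_k suffice: on a fine mesh each boundary edge met by χ_k is transversal to ν_k
(`exists_transversal`). Apply the divergence theorem to v²χ_kν_k on every element and sum. Fluxes
through inner edges cancel (`sum_flux`), and Young's inequality puts an arbitrarily small factor in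
front of the gradient (`bdrySq_le`).

First estimate. Test with (U, V). The boundary loads grow linearly, so they are bounded by traces.
The trace of U is absorbed with a small factor, and Gronwall's inequality concludes
(`exists_energy_l2`, `exists_gronwall`).

Second estimate. Test with (dU, dV). The load on the boundary paired with dU cannot be handled by a
trace inequality, since no gradient of dU is available. It is first replaced by its lumped version;
the defect is a sum of products of increments and is controlled by an inverse estimate
(`IsNodal.edgeMass_le_edgeLump`). Up to an error of the form |U||dV|, the lumped term is the time
derivative of a sum of primitives of s(·, V) at the vertices (`exists_hasAEDeriv_loadPrim`). This
primitive grows quadratically, so after integration in time it is absorbed into the H¹ energy by the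
trace inequality. What remains is bounded by the first estimate (`exists_energy1_bound`). -/

noncomputable section

/-! ### Mollification combined with a dilation -/

/-- The dilation with centre `c` and ratio `μ`. -/
def dil (c : Plane) (μ : ℝ) (x : Plane) : Plane := c + μ • (x - c)

/-- Mollification with a normed bump function. -/
def moll {F : Type*} [NormedAddCommGroup F] [NormedSpace ℝ F] (φ : ContDiffBump (0 : Plane))
    (f : Plane → F) : Plane → F :=
  convolution (φ.normed volume) f (ContinuousLinearMap.lsmul ℝ ℝ) volume

section Mollification

variable {F : Type*} [NormedAddCommGroup F] [NormedSpace ℝ F]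

lemma eLpNorm_two_sq {α : Type*} [MeasurableSpace α] {G : Type*} [NormedAddCommGroup G]
    (f : α → G) (μ : Measure α) : eLpNorm f 2 μ ^ 2 = ∫⁻ x, ‖f x‖ₑ ^ 2 ∂μ := by
  have h := eLpNorm_nnreal_pow_eq_lintegral (f := f) (μ := μ) (p := 2) (by norm_num)
  have h2 : ((2 : NNReal) : ℝ) = ((2 : ℕ) : ℝ) := by norm_num
  rw [h2, ENNReal.rpow_natCast] at h
  simp only [ENNReal.rpow_natCast] at h
  exact h

lemma lintegral_sq_le_of_isProbabilityMeasure {α : Type*} [MeasurableSpace α] (ν : Measure α)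
    [IsProbabilityMeasure ν] {g : α → ℝ≥0∞} (hg : AEMeasurable g ν) :
    (∫⁻ x, g x ∂ν) ^ 2 ≤ ∫⁻ x, g x ^ 2 ∂ν := by
  have h := ENNReal.lintegral_mul_le_Lp_mul_Lq ν (p := 2) (q := 2)
    (by constructor <;> norm_num) hg (aemeasurable_const (b := (1 : ℝ≥0∞)))
  simp only [Pi.mul_apply, mul_one, ENNReal.one_rpow, lintegral_const, measure_univ] at h
  calc (∫⁻ x, g x ∂ν) ^ 2 ≤ ((∫⁻ x, g x ^ (2 : ℝ) ∂ν) ^ (1 / 2 : ℝ)) ^ 2 := by gcongr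
    _ = ∫⁻ x, g x ^ 2 ∂ν := by
        rw [← ENNReal.rpow_natCast, ← ENNReal.rpow_mul]
        norm_num

lemma moll_congr_ae (φ : ContDiffBump (0 : Plane)) {f g : Plane → F} (h : f =ᵐ[volume] g) :
    moll φ f = moll φ g :=
  convolution_congr _ (ae_eq_refl _) h

/-- The kernel is a probability density: Jensen's inequality bounds the square pointwise by an
average of translates, and Tonelli together with translation invariance gives the constant 1. -/
lemma lintegral_enorm_moll_sq_le (φ : ContDiffBump (0 : Plane)) {f : Plane → F}
    (hf : AEStronglyMeasurable f volume) :
    ∫⁻ x, ‖moll φ f x‖ₑ ^ 2 ≤ ∫⁻ x, ‖f x‖ₑ ^ 2 := by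
  -- A strongly measurable representative supplies the joint measurability needed to exchange the
  -- integrals.
  rw [moll_congr_ae φ hf.ae_eq_mk]
  have h0 : ∫⁻ x, ‖f x‖ₑ ^ 2 = ∫⁻ x, ‖hf.mk f x‖ₑ ^ 2 :=
    lintegral_congr_ae (hf.ae_eq_mk.fun_comp (fun z => ‖z‖ₑ ^ 2))
  rw [h0]
  set g := hf.mk f
  have hg : StronglyMeasurable g := hf.stronglyMeasurable_mk
  set ν : Measure Plane := volume.withDensity (fun y => ENNReal.ofReal (φ.normed volume y))
  have hm : Measurable (fun y => ENNReal.ofReal (φ.normed volume y)) :=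
    (φ.continuous_normed.measurable).ennreal_ofReal
  have hp : IsProbabilityMeasure ν := by
    refine ⟨?_⟩
    rw [withDensity_apply _ MeasurableSet.univ, Measure.restrict_univ, ← ofReal_integral_eq_lintegral_ofReal φ.integrable_normed
      (Filter.Eventually.of_forall φ.nonneg_normed), φ.integral_normed]
    simp
  have h1 : ∀ x, ‖moll φ g x‖ₑ ^ 2 ≤
      ∫⁻ y, ENNReal.ofReal (φ.normed volume y) * ‖g (x - y)‖ₑ ^ 2 := by
    intro x
    have hgx : Measurable (fun y => ‖g (x - y)‖ₑ) :=
      (hg.comp_measurable (measurable_const.sub measurable_id)).enorm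
    calc ‖moll φ g x‖ₑ ^ 2
        ≤ (∫⁻ y, ‖φ.normed volume y • g (x - y)‖ₑ) ^ 2 := by
          gcongr
          exact enorm_integral_le_lintegral_enorm _
      _ = (∫⁻ y, ‖g (x - y)‖ₑ ∂ν) ^ 2 := by
          rw [lintegral_withDensity_eq_lintegral_mul _ hm hgx]
          congr 1
          refine lintegral_congr fun y => ?_
          rw [enorm_smul, Real.enorm_of_nonneg (φ.nonneg_normed y)]
          rfl
      _ ≤ ∫⁻ y, ‖g (x - y)‖ₑ ^ 2 ∂ν :=
          lintegral_sq_le_of_isProbabilityMeasure ν hgx.aemeasurable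
      _ = _ := by
          rw [lintegral_withDensity_eq_lintegral_mul _ hm (hgx.pow_const 2)]
          rfl
  calc ∫⁻ x, ‖moll φ g x‖ₑ ^ 2
      ≤ ∫⁻ x, ∫⁻ y, ENNReal.ofReal (φ.normed volume y) * ‖g (x - y)‖ₑ ^ 2 := lintegral_mono h1
    _ = ∫⁻ y, ∫⁻ x, ENNReal.ofReal (φ.normed volume y) * ‖g (x - y)‖ₑ ^ 2 := by
        refine lintegral_lintegral_swap (Measurable.aemeasurable ?_)
        refine (hm.comp measurable_snd).mul (Measurable.pow_const ?_ 2)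
        exact (hg.comp_measurable (measurable_fst.sub measurable_snd)).enorm
    _ = ∫⁻ y, ENNReal.ofReal (φ.normed volume y) * ∫⁻ x, ‖g x‖ₑ ^ 2 := by
        refine lintegral_congr fun y => ?_
        rw [lintegral_const_mul]
        · rw [lintegral_sub_right_eq_self (fun x => ‖g x‖ₑ ^ 2) y]
        · exact (hg.comp_measurable (measurable_id.sub measurable_const)).enorm.pow_const 2
    _ = ∫⁻ x, ‖g x‖ₑ ^ 2 := by
        rw [lintegral_mul_const _ hm,
          ← ofReal_integral_eq_lintegral_ofReal φ.integrable_normed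
            (Filter.Eventually.of_forall φ.nonneg_normed), φ.integral_normed]
        simp

lemma eLpNorm_moll_le (φ : ContDiffBump (0 : Plane)) {f : Plane → F}
    (hf : AEStronglyMeasurable f volume) :
    eLpNorm (moll φ f) 2 volume ≤ eLpNorm f 2 volume := by
  have h := lintegral_enorm_moll_sq_le φ hf
  rw [← eLpNorm_two_sq, ← eLpNorm_two_sq] at h
  exact (ENNReal.pow_le_pow_left_iff (by norm_num)).1 h

lemma continuous_dil (c : Plane) (μ : ℝ) : Continuous (dil c μ) := by
  unfold dil; fun_prop

lemma dil_dil_inv (c : Plane) {μ : ℝ} (hμ : μ ≠ 0) (x : Plane) : dil c μ (dil c μ⁻¹ x) = x := by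
  simp [dil, smul_smul, hμ]

lemma dil_inv_dil (c : Plane) {μ : ℝ} (hμ : μ ≠ 0) (x : Plane) : dil c μ⁻¹ (dil c μ x) = x := by
  simp [dil, smul_smul, hμ]

/-- The dilation as a homeomorphism. -/
def dilHomeo (c : Plane) {μ : ℝ} (hμ : μ ≠ 0) : Plane ≃ₜ Plane where
  toFun := dil c μ
  invFun := dil c μ⁻¹
  left_inv := dil_inv_dil c hμ
  right_inv := dil_dil_inv c hμ
  continuous_toFun := continuous_dil c μ
  continuous_invFun := continuous_dil c μ⁻¹

lemma map_dil_volume (c : Plane) {μ : ℝ} (hμ : μ ≠ 0) :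
    Measure.map (dil c μ) volume = ENNReal.ofReal ((μ ^ 2)⁻¹) • (volume : Measure Plane) := by
  have h1 : dil c μ = (fun x => c + x) ∘ (fun x => μ • x) ∘ (fun x => x - c) := by
    ext1 x; simp [dil]
  rw [h1, ← Measure.map_map (measurable_const_add c) ((measurable_const_smul μ).comp
    (measurable_sub_const c)), ← Measure.map_map (measurable_const_smul μ) (measurable_sub_const c),
    (measurePreserving_sub_right volume c).map_eq, Measure.map_addHaar_smul _ hμ,
    Measure.map_smul, (measurePreserving_add_left volume c).map_eq]
  simp

lemma eLpNorm_comp_dil {G : Type*} [NormedAddCommGroup G] (c : Plane) {μ : ℝ} (hμ : 0 < μ) (f : Plane → G) :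
    eLpNorm (f ∘ dil c μ) 2 volume = ENNReal.ofReal μ⁻¹ * eLpNorm f 2 volume := by
  have he : MeasurableEmbedding (dil c μ) := (dilHomeo c hμ.ne').measurableEmbedding
  rw [← he.eLpNorm_map_measure, map_dil_volume c hμ.ne',
    eLpNorm_smul_measure_of_ne_top (by norm_num)]
  congr 1
  rw [ENNReal.ofReal_rpow_of_nonneg (by positivity) (by positivity)]
  congr 1
  rw [← inv_pow, ← Real.rpow_natCast, ← Real.rpow_mul (by positivity)]
  norm_num

lemma aestronglyMeasurable_comp_dil {G : Type*} [NormedAddCommGroup G] (c : Plane) {μ : ℝ} (hμ : μ ≠ 0) {f : Plane → G}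
    (hf : AEStronglyMeasurable f volume) : AEStronglyMeasurable (f ∘ dil c μ) volume := by
  refine hf.comp_quasiMeasurePreserving ⟨(continuous_dil c μ).measurable, ?_⟩
  rw [map_dil_volume c hμ]
  exact Measure.smul_absolutelyContinuous

lemma memLp_comp_dil {G : Type*} [NormedAddCommGroup G] (c : Plane) {μ : ℝ} (hμ : 0 < μ) {f : Plane → G} (hf : MemLp f 2 volume) :
    MemLp (f ∘ dil c μ) 2 volume := by
  refine ⟨aestronglyMeasurable_comp_dil c hμ.ne' hf.1, ?_⟩
  rw [eLpNorm_comp_dil c hμ]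
  exact ENNReal.mul_lt_top ENNReal.ofReal_lt_top hf.2

lemma moll_sub (φ : ContDiffBump (0 : Plane)) {f g : Plane → F} (hf : LocallyIntegrable f volume)
    (hg : LocallyIntegrable g volume) : moll φ (f - g) = moll φ f - moll φ g := by
  have h := φ.hasCompactSupport_normed (μ := volume)
  have e1 := h.convolutionExists_left (ContinuousLinearMap.lsmul ℝ ℝ) φ.continuous_normed hf
  have e2 := h.convolutionExists_left (ContinuousLinearMap.lsmul ℝ ℝ) φ.continuous_normed hg
  ext1 x
  have := integral_sub (e1 x) (e2 x)
  simp only [moll, convolution, Pi.sub_apply, map_sub] at this ⊢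
  exact this

lemma norm_dil_sub_le (c x y : Plane) (μ : ℝ) :
    ‖dil c μ y - x‖ ≤ |μ - 1| * ‖y - c‖ + ‖y - x‖ := by
  have : dil c μ y - x = (μ - 1) • (y - c) + (y - x) := by
    simp only [dil, sub_smul, one_smul]; abel
  rw [this]
  refine (norm_add_le _ _).trans ?_
  rw [norm_smul, Real.norm_eq_abs]

/-- The mollification is an average over a ball of radius `φ.rOut`. This bound serves both the `L²`
convergence and the uniform convergence up to the boundary of a polygon. -/
lemma norm_moll_comp_dil_sub_le [CompleteSpace F] (φ : ContDiffBump (0 : Plane)) (c : Plane) (μ : ℝ)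
    {f : Plane → F} (hf : AEStronglyMeasurable (f ∘ dil c μ) volume) (x : Plane) {δ : ℝ}
    (h : ∀ y ∈ Metric.ball x φ.rOut, ‖f (dil c μ y) - f x‖ ≤ δ) :
    ‖moll φ (f ∘ dil c μ) x - f x‖ ≤ δ := by
  have hδ : 0 ≤ δ := (norm_nonneg _).trans (h x (Metric.mem_ball_self φ.rOut_pos))
  rw [← dist_eq_norm]
  refine dist_convolution_le (f := φ.normed volume) (R := φ.rOut) hδ ?_ φ.nonneg_normed
    φ.integral_normed hf ?_
  · rw [φ.support_normed_eq]
  · intro y hy; rw [dist_eq_norm]; exact h y hy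

lemma exists_eLpNorm_moll_comp_dil_sub_le_of_continuous [CompleteSpace F] (c : Plane)
    {f : Plane → F} (hf : Continuous f) (hs : HasCompactSupport f) {δ : ℝ≥0∞} (hδ : δ ≠ 0) :
    ∃ η > 0, ∀ μ : ℝ, |μ - 1| < η → ∀ φ : ContDiffBump (0 : Plane), φ.rOut < η →
      eLpNorm (moll φ (f ∘ dil c μ) - f) 2 volume ≤ δ := by
  obtain ⟨R, hR0, hR⟩ : ∃ R : ℝ, 0 < R ∧ ∀ x, R ≤ ‖x - c‖ → f x = 0 := by
    obtain ⟨R, hR⟩ := hs.isCompact.isBounded.subset_ball c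
    refine ⟨max R 1, by positivity, fun x hx => ?_⟩
    by_contra h0
    have := hR (subset_tsupport f h0)
    rw [Metric.mem_ball, dist_eq_norm] at this
    exact absurd this (not_lt.2 ((le_max_left _ _).trans hx))
  -- Outside this ball nothing happens: the kernel radius is below 1/2 and μ exceeds 1/2, so every
  -- dilated point entering the average is still at distance at least `R` from `c`, where `f`
  -- vanishes.
  set B : Set Plane := Metric.closedBall c (2 * R + 1)
  have hBfin : volume B ≠ ⊤ := measure_closedBall_lt_top.ne
  obtain ⟨κ, hκ0, hκ⟩ : ∃ κ : ℝ, 0 < κ ∧ ENNReal.ofReal κ * (volume B) ^ (1 / 2 : ℝ) ≤ δ := by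
    have hne : (volume B) ^ (1 / 2 : ℝ) ≠ ⊤ := ENNReal.rpow_ne_top_of_nonneg (by norm_num) hBfin
    by_cases hδt : δ = ⊤
    · exact ⟨1, one_pos, by rw [hδt]; exact le_top⟩
    refine ⟨(δ / ((volume B) ^ (1 / 2 : ℝ) + 1)).toReal, ?_, ?_⟩
    · refine ENNReal.toReal_pos ?_ ?_
      · exact (ENNReal.div_pos hδ (by simp [hBfin])).ne'
      · exact (ENNReal.div_lt_top hδt (by simp)).ne
    · rw [ENNReal.ofReal_toReal (ENNReal.div_lt_top hδt (by simp)).ne]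
      calc δ / ((volume B) ^ (1 / 2 : ℝ) + 1) * (volume B) ^ (1 / 2 : ℝ)
          ≤ δ / ((volume B) ^ (1 / 2 : ℝ) + 1) * ((volume B) ^ (1 / 2 : ℝ) + 1) := by
            gcongr; exact le_self_add
        _ ≤ δ := by rw [mul_comm]; exact ENNReal.mul_div_le
  obtain ⟨θ, hθ0, hθ⟩ := Metric.uniformContinuous_iff.1
    (hs.uniformContinuous_of_continuous hf) κ hκ0
  refine ⟨min (1 / 2) (θ / (2 * R + 4)), by positivity, fun μ hμ φ hφ => ?_⟩
  have hμ1 : |μ - 1| < 1 / 2 := hμ.trans_le (min_le_left _ _)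
  have hμ2 : |μ - 1| < θ / (2 * R + 4) := hμ.trans_le (min_le_right _ _)
  have hφ1 : φ.rOut < 1 / 2 := hφ.trans_le (min_le_left _ _)
  have hφ2 : φ.rOut < θ / (2 * R + 4) := hφ.trans_le (min_le_right _ _)
  have hμp : 1 / 2 < μ := by rw [abs_lt] at hμ1; linarith
  have key : ∀ x, ‖(moll φ (f ∘ dil c μ) - f) x‖ ≤ B.indicator (fun _ => κ) x := by
    intro x
    by_cases hx : x ∈ B
    · rw [indicator_of_mem hx]
      refine norm_moll_comp_dil_sub_le φ c μ
        (hf.comp (continuous_dil c μ)).aestronglyMeasurable x fun y hy => ?_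
      rw [← dist_eq_norm]
      refine (hθ ?_).le
      rw [dist_eq_norm]
      rw [Metric.mem_ball, dist_eq_norm] at hy
      have hxc : ‖x - c‖ ≤ 2 * R + 1 := by rwa [← dist_eq_norm]
      have hyc : ‖y - c‖ ≤ 2 * R + 2 := by
        calc ‖y - c‖ = ‖(y - x) + (x - c)‖ := by congr 1; abel
          _ ≤ _ := norm_add_le _ _
          _ ≤ _ := by linarith
      calc ‖dil c μ y - x‖ ≤ |μ - 1| * ‖y - c‖ + ‖y - x‖ := norm_dil_sub_le c x y μ
        _ ≤ |μ - 1| * (2 * R + 2) + φ.rOut := by gcongr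
        _ < θ / (2 * R + 4) * (2 * R + 2) + θ / (2 * R + 4) := by gcongr
        _ ≤ θ / (2 * R + 4) * (2 * R + 4) := by
            have : 0 < θ / (2 * R + 4) := by positivity
            nlinarith
        _ = θ := by field_simp
    · rw [indicator_of_notMem hx]
      have hxc : 2 * R + 1 < ‖x - c‖ := by
        have : ¬ dist x c ≤ 2 * R + 1 := hx
        rw [dist_eq_norm] at this; exact not_le.1 this
      have hfx : f x = 0 := hR x (by linarith)
      refine norm_moll_comp_dil_sub_le φ c μ
        (hf.comp (continuous_dil c μ)).aestronglyMeasurable x fun y hy => ?_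
      rw [Metric.mem_ball, dist_eq_norm] at hy
      have hyc : 2 * R < ‖y - c‖ := by
        have : ‖x - c‖ ≤ ‖y - x‖ + ‖y - c‖ := by
          calc ‖x - c‖ = ‖(y - c) - (y - x)‖ := by congr 1; abel
            _ ≤ _ := (norm_sub_le _ _).trans (by linarith)
        linarith
      have : f (dil c μ y) = 0 := by
        refine hR _ ?_
        have : dil c μ y - c = μ • (y - c) := by simp [dil]
        rw [this, norm_smul, Real.norm_eq_abs, abs_of_pos (by linarith)]
        nlinarith
      rw [this, hfx]; simp
  calc eLpNorm (moll φ (f ∘ dil c μ) - f) 2 volume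
      ≤ eLpNorm (B.indicator (fun _ => κ)) 2 volume := by
        refine eLpNorm_mono_real key
    _ = ENNReal.ofReal κ * (volume B) ^ (1 / 2 : ℝ) := by
        rw [eLpNorm_indicator_const Metric.isClosed_closedBall.measurableSet (by norm_num) (by norm_num), Real.enorm_of_nonneg hκ0.le,
          ENNReal.toReal_ofNat]
    _ ≤ δ := hκ

/-- Mollification of a dilation converges in `L²`. -/
theorem exists_eLpNorm_moll_comp_dil_sub_le [CompleteSpace F] (c : Plane) {f : Plane → F}
    (hf : MemLp f 2 volume) {δ : ℝ≥0∞} (hδ : δ ≠ 0) :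
    ∃ η > 0, ∀ μ : ℝ, |μ - 1| < η → ∀ φ : ContDiffBump (0 : Plane), φ.rOut < η →
      eLpNorm (moll φ (f ∘ dil c μ) - f) 2 volume ≤ δ := by
  -- Density argument in quarters: one for `g - f`, one for the continuous function `g`, and two for
  -- the mollified dilation of `f - g`, because the dilation costs the factor μ⁻¹ ≤ 2.
  have hδ4 : δ / 4 ≠ 0 := (ENNReal.div_pos hδ (by norm_num)).ne'
  obtain ⟨g, hgs, hfg, hg, hgL⟩ := hf.exists_hasCompactSupport_eLpNorm_sub_le (by norm_num) hδ4
  obtain ⟨η, hη0, hη⟩ := exists_eLpNorm_moll_comp_dil_sub_le_of_continuous c hg hgs hδ4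
  refine ⟨min η (1 / 2), by positivity, fun μ hμ φ hφ => ?_⟩
  have hμ1 : |μ - 1| < 1 / 2 := hμ.trans_le (min_le_right _ _)
  have hμp : 1 / 2 < μ := by rw [abs_lt] at hμ1; linarith
  have h0 := hη μ (hμ.trans_le (min_le_left _ _)) φ (hφ.trans_le (min_le_left _ _))
  have lf := (memLp_comp_dil c (by linarith : 0 < μ) hf).locallyIntegrable (by norm_num)
  have lg := (memLp_comp_dil c (by linarith : 0 < μ) hgL).locallyIntegrable (by norm_num)
  have e1 : moll φ (f ∘ dil c μ) - f =
      moll φ ((f - g) ∘ dil c μ) + (moll φ (g ∘ dil c μ) - g) + (g - f) := by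
    have : (f - g) ∘ dil c μ = f ∘ dil c μ - g ∘ dil c μ := rfl
    rw [this, moll_sub φ lf lg]; abel
  have mm : ∀ {u : Plane → F}, LocallyIntegrable u volume →
      AEStronglyMeasurable (moll φ u) volume := fun {u} hu =>
    ((φ.hasCompactSupport_normed).continuous_convolution_left _
      φ.continuous_normed hu).aestronglyMeasurable
  have m1 : AEStronglyMeasurable (moll φ ((f - g) ∘ dil c μ)) volume :=
    mm ((memLp_comp_dil c (by linarith : 0 < μ) (hf.sub hgL)).locallyIntegrable (by norm_num))
  have m2 : AEStronglyMeasurable (moll φ (g ∘ dil c μ) - g) volume := (mm lg).sub hgL.1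
  rw [e1]
  refine (eLpNorm_add_le (m1.add m2) (hgL.1.sub hf.1) (by norm_num)).trans ?_
  have hA : eLpNorm (moll φ ((f - g) ∘ dil c μ)) 2 volume ≤ 2 * (δ / 4) := by
    refine (eLpNorm_moll_le φ (aestronglyMeasurable_comp_dil c (by linarith) (hf.1.sub hgL.1))).trans ?_
    rw [eLpNorm_comp_dil c (by linarith)]
    gcongr
    rw [← ENNReal.ofReal_ofNat]
    apply ENNReal.ofReal_le_ofReal
    rw [inv_le_comm₀ (by linarith) (by norm_num)]; linarith
  have hB : eLpNorm (g - f) 2 volume ≤ δ / 4 := by rw [eLpNorm_sub_comm]; exact hfg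
  calc _ ≤ (2 * (δ / 4) + δ / 4) + δ / 4 := by
        gcongr
        exact (eLpNorm_add_le m1 m2 (by norm_num)).trans (add_le_add hA h0)
    _ = 4 * (δ / 4) := by ring
    _ ≤ δ := ENNReal.mul_div_le

end Mollification

/-! ### Geometry of star-shaped polygons -/

/-- The determinant of two plane vectors. -/
def det2 (a b : Plane) : ℝ := a 0 * b 1 - a 1 * b 0

section Det2

lemma det2_add_left (a b c : Plane) : det2 (a + b) c = det2 a c + det2 b c := by
  simp [det2]; ring
lemma det2_add_right (a b c : Plane) : det2 a (b + c) = det2 a b + det2 a c := by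
  simp [det2]; ring
lemma det2_sub_left (a b c : Plane) : det2 (a - b) c = det2 a c - det2 b c := by
  simp [det2]; ring
lemma det2_sub_right (a b c : Plane) : det2 a (b - c) = det2 a b - det2 a c := by
  simp [det2]; ring
lemma det2_smul_left (s : ℝ) (a b : Plane) : det2 (s • a) b = s * det2 a b := by
  simp [det2]; ring
lemma det2_smul_right (s : ℝ) (a b : Plane) : det2 a (s • b) = s * det2 a b := by
  simp [det2]; ring
lemma det2_self (a : Plane) : det2 a a = 0 := by simp [det2]; ring
lemma det2_swap (a b : Plane) : det2 a b = -det2 b a := by simp [det2]; ring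
lemma det2_zero_left (a : Plane) : det2 0 a = 0 := by simp [det2]
lemma det2_zero_right (a : Plane) : det2 a 0 = 0 := by simp [det2]

lemma plane_inner_eq (a b : Plane) : ⟪a, b⟫ = a 0 * b 0 + a 1 * b 1 := by
  simp [PiLp.inner_apply, Fin.sum_univ_two]; ring

lemma plane_norm_sq (a : Plane) : ‖a‖ ^ 2 = a 0 ^ 2 + a 1 ^ 2 := by
  rw [← real_inner_self_eq_norm_sq, plane_inner_eq]; ring

lemma plane_ext {a b : Plane} (h0 : a 0 = b 0) (h1 : a 1 = b 1) : a = b := by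
  ext i; fin_cases i <;> assumption

lemma det2_sq_add_inner_sq (a b : Plane) : det2 a b ^ 2 + ⟪a, b⟫ ^ 2 = ‖a‖ ^ 2 * ‖b‖ ^ 2 := by
  rw [plane_inner_eq, plane_norm_sq, plane_norm_sq, det2]; ring

lemma abs_det2_le (a b : Plane) : |det2 a b| ≤ ‖a‖ * ‖b‖ := by
  refine abs_le_of_sq_le_sq ?_ (by positivity)
  rw [mul_pow, ← det2_sq_add_inner_sq a b]; nlinarith [sq_nonneg ⟪a, b⟫]

lemma det2_smul_eq (p q z : Plane) : det2 p q • z = det2 z q • p + det2 p z • q := by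
  apply plane_ext <;> simp [det2] <;> ring

lemma continuous_det2_left (a : Plane) : Continuous fun z => det2 z a := by
  unfold det2; fun_prop

lemma continuous_det2_right (a : Plane) : Continuous fun z => det2 a z := by
  unfold det2; fun_prop

end Det2

namespace Polygon2

/-- `E` is star-shaped with respect to every point of the ball of centre `c` and radius `r`. -/
structure StarAt (E : Polygon2) (c : Plane) (r : ℝ) : Prop where
  pos : 0 < r
  ball : Metric.ball c r ⊆ E.carrier
  star : ∀ y ∈ Metric.ball c r, StarConvex ℝ y E.carrier

variable {E : Polygon2} {c : Plane} {r : ℝ}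

lemma isClosed_carrier (E : Polygon2) : IsClosed E.carrier := E.isCompact_carrier.isClosed

lemma edge_subset_frontier (E : Polygon2) (i : Fin E.n) : E.edge i ⊆ frontier E.carrier := by
  rw [E.frontier_carrier]
  exact subset_iUnion (fun i => segment ℝ (E.vertex i) (E.vertex (finRotate E.n i))) i

lemma edge_subset_carrier (E : Polygon2) (i : Fin E.n) : E.edge i ⊆ E.carrier :=
  (E.edge_subset_frontier i).trans E.isClosed_carrier.frontier_subset

lemma vertex_mem_edge (E : Polygon2) (i : Fin E.n) : E.vertex i ∈ E.edge i := left_mem_segment _ _ _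

lemma nextVertex_mem_edge (E : Polygon2) (i : Fin E.n) : E.nextVertex i ∈ E.edge i :=
  right_mem_segment _ _ _

lemma vertex_mem_carrier (E : Polygon2) (i : Fin E.n) : E.vertex i ∈ E.carrier :=
  E.edge_subset_carrier i (E.vertex_mem_edge i)

lemma finRotate_ne (E : Polygon2) (i : Fin E.n) : finRotate E.n i ≠ i := by
  have h3 := E.three_le
  obtain ⟨n, hn⟩ : ∃ n, E.n = n + 1 := ⟨E.n - 1, by omega⟩
  revert i; rw [hn]; intro i h
  rw [finRotate_apply] at h
  have h2 := congrArg Fin.val h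
  rw [Fin.val_add_one] at h2
  split_ifs at h2 with h4
  · have : (i : ℕ) = n := by rw [h4]; simp
    omega
  · omega

lemma vertex_ne_nextVertex (E : Polygon2) (i : Fin E.n) : E.vertex i ≠ E.nextVertex i :=
  fun h => E.finRotate_ne i (E.vertex_injective h).symm

/-- The edge vector. -/
def tau (E : Polygon2) (i : Fin E.n) : Plane := E.nextVertex i - E.vertex i

lemma norm_tau (E : Polygon2) (i : Fin E.n) : ‖E.tau i‖ = dist (E.vertex i) (E.nextVertex i) := by
  rw [tau, dist_comm, dist_eq_norm]

lemma norm_tau_pos (E : Polygon2) (i : Fin E.n) : 0 < ‖E.tau i‖ := by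
  rw [norm_tau]; exact dist_pos.2 (E.vertex_ne_nextVertex i)

/-- Parametrisation of an edge by the unit interval. -/
def edgePt (E : Polygon2) (i : Fin E.n) (t : ℝ) : Plane :=
  AffineMap.lineMap (E.vertex i) (E.nextVertex i) t

lemma edgePt_eq (E : Polygon2) (i : Fin E.n) (t : ℝ) :
    E.edgePt i t = E.vertex i + t • E.tau i := by
  rw [edgePt, AffineMap.lineMap_apply_module', tau, add_comm]

lemma continuous_edgePt (E : Polygon2) (i : Fin E.n) : Continuous (E.edgePt i) := by
  have : E.edgePt i = fun t => E.vertex i + t • E.tau i := funext (E.edgePt_eq i)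
  rw [this]; fun_prop

lemma edgePt_mem_edge (E : Polygon2) (i : Fin E.n) {t : ℝ} (ht : t ∈ Icc (0 : ℝ) 1) :
    E.edgePt i t ∈ E.edge i := by
  rw [edge, segment_eq_image_lineMap]; exact ⟨t, ht, rfl⟩

lemma mem_edge_iff (E : Polygon2) (i : Fin E.n) (x : Plane) :
    x ∈ E.edge i ↔ ∃ t ∈ Icc (0 : ℝ) 1, E.edgePt i t = x := by
  rw [edge, segment_eq_image_lineMap]; rfl

namespace StarAt

lemma center_mem_ball (h : E.StarAt c r) : c ∈ Metric.ball c r := Metric.mem_ball_self h.pos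

lemma ball_subset_interior (h : E.StarAt c r) : Metric.ball c r ⊆ interior E.carrier :=
  interior_maximal h.ball Metric.isOpen_ball

/-- The convex combinations of `y` with all points of the ball fill a ball of radius `(1 - s) * r`
around the given point. -/
lemma mem_interior (h : E.StarAt c r) {y : Plane} (hy : y ∈ E.carrier) {s : ℝ} (hs0 : 0 ≤ s)
    (hs1 : s < 1) : c + s • (y - c) ∈ interior E.carrier := by
  have hp : 0 < 1 - s := by linarith
  refine interior_maximal (t := Metric.ball (c + s • (y - c)) ((1 - s) * r)) ?_ Metric.isOpen_ball
    (Metric.mem_ball_self (mul_pos hp h.pos))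
  intro z hz
  rw [Metric.mem_ball, dist_eq_norm] at hz
  set w : Plane := c + (1 - s)⁻¹ • (z - (c + s • (y - c)))
  have hw : w ∈ Metric.ball c r := by
    rw [Metric.mem_ball, dist_eq_norm]
    have : w - c = (1 - s)⁻¹ • (z - (c + s • (y - c))) := by simp [w]
    rw [this, norm_smul, Real.norm_eq_abs, abs_of_pos (inv_pos.2 hp), inv_mul_lt_iff₀ hp]
    exact hz
  have : z = (1 - s) • w + s • y := by
    simp only [w, smul_add, smul_smul, mul_inv_cancel₀ hp.ne', one_smul]
    simp only [smul_sub, sub_smul, one_smul]; abel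
  rw [this]
  exact h.star w hw hy hp.le hs0 (by ring)

/-- Lets the star centre move inside the ball, as is needed in `le_abs_det`. -/
lemma shift (h : E.StarAt c r) {y : Plane} (hy : y ∈ Metric.ball c r) :
    E.StarAt y (r - dist y c) := by
  have hsub : Metric.ball y (r - dist y c) ⊆ Metric.ball c r :=
    Metric.ball_subset_ball' (by linarith)
  exact ⟨by rw [Metric.mem_ball] at hy; linarith, hsub.trans h.ball, fun z hz => h.star z (hsub hz)⟩

lemma not_mem_frontier_of_lt (h : E.StarAt c r) {y : Plane} (hy : y ∈ E.carrier) {s : ℝ}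
    (hs0 : 0 ≤ s) (hs1 : s < 1) : c + s • (y - c) ∉ frontier E.carrier := fun hf =>
  hf.2 (h.mem_interior hy hs0 hs1)

/-- A ray from a star centre meets the boundary only once: of two boundary points on the ray, the
nearer one would be an interior point. -/
lemma frontier_unique (h : E.StarAt c r) {x x' : Plane} (hx : x ∈ frontier E.carrier)
    (hx' : x' ∈ frontier E.carrier) {s : ℝ} (hs : 0 < s) (he : x' - c = s • (x - c)) : s = 1 := by
  have hcl := E.isClosed_carrier.frontier_subset
  rcases lt_trichotomy s 1 with h1 | h1 | h1
  · exfalso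
    refine h.not_mem_frontier_of_lt (hcl hx) hs.le h1 ?_
    rw [← he]; simpa using hx'
  · exact h1
  · exfalso
    refine h.not_mem_frontier_of_lt (hcl hx') (inv_pos.2 hs).le (inv_lt_one_of_one_lt₀ h1) ?_
    rw [he, smul_smul, inv_mul_cancel₀ hs.ne', one_smul]; simpa using hx

/-- The determinant is the edge length times the distance of `c` from the line of the edge. If that
distance were below `r`, the foot `y` of the perpendicular would itself be a star centre. Either `y`
lies on the edge, although it is an interior point, or both endpoints lie on one ray from `y`,
against `frontier_unique`. -/
lemma le_abs_det (h : E.StarAt c r) (i : Fin E.n) :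
    r * ‖E.tau i‖ ≤ |det2 (E.vertex i - c) (E.nextVertex i - c)| := by
  by_contra! hlt
  set P := E.vertex i
  set Q := E.nextVertex i
  set τ := E.tau i with hτ
  have hτp : 0 < ‖τ‖ := E.norm_tau_pos i
  set t : ℝ := ⟪c - P, τ⟫ / ‖τ‖ ^ 2
  set y : Plane := P + t • τ with hy
  have hdet : det2 (P - c) (Q - c) = det2 (P - c) τ := by
    have : Q - c = (P - c) + τ := by rw [hτ, tau]; abel
    rw [this, det2_add_right, det2_self, zero_add]
  have hdist : (‖y - c‖ * ‖τ‖) ^ 2 = det2 (P - c) τ ^ 2 := by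
    have e1 : det2 (y - c) τ = det2 (P - c) τ := by
      have : y - c = (P - c) + t • τ := by rw [hy]; abel
      rw [this, det2_add_left, det2_smul_left, det2_self]; ring
    have e2 : ⟪y - c, τ⟫ = 0 := by
      have : y - c = t • τ - (c - P) := by rw [hy]; abel
      rw [this, inner_sub_left, inner_smul_left, real_inner_self_eq_norm_sq]
      have hn : ‖τ‖ ^ 2 ≠ 0 := by positivity
      simp only [conj_trivial, t, div_mul_cancel₀ _ hn, sub_self]
    rw [mul_pow, ← det2_sq_add_inner_sq, e1, e2]; ring
  have hyc : y ∈ Metric.ball c r := by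
    rw [Metric.mem_ball, dist_eq_norm]
    have h1 : ‖y - c‖ * ‖τ‖ = |det2 (P - c) τ| := by
      rw [← sq_eq_sq₀ (by positivity) (abs_nonneg _), sq_abs, hdist]
    rw [hdet, ← h1] at hlt
    exact lt_of_mul_lt_mul_right hlt hτp.le
  have hsy := h.shift hyc
  have hPf : P ∈ frontier E.carrier := E.edge_subset_frontier i (E.vertex_mem_edge i)
  have hQf : Q ∈ frontier E.carrier := E.edge_subset_frontier i (E.nextVertex_mem_edge i)
  have ePy : P - y = (-t) • τ := by rw [hy, neg_smul]; abel
  have eQy : Q - y = (1 - t) • τ := by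
    have : Q = P + τ := by rw [hτ, tau]; abel
    rw [this, hy, sub_smul, one_smul]; abel
  rcases lt_or_ge t 0 with h0 | h0
  · have := hsy.frontier_unique hPf hQf (s := (1 - t) / (-t)) (div_pos (by linarith) (by linarith))
      (by rw [ePy, eQy, smul_smul, div_mul_cancel₀ _ (by linarith)])
    rw [div_eq_one_iff_eq (by linarith)] at this
    linarith
  rcases lt_or_ge 1 t with h1 | h1
  · have := hsy.frontier_unique hPf hQf (s := (1 - t) / (-t))
      (div_pos_of_neg_of_neg (by linarith) (by linarith))
      (by rw [ePy, eQy, smul_smul, div_mul_cancel₀ _ (by linarith)])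
    rw [div_eq_one_iff_eq (by linarith)] at this
    linarith
  · have : y ∈ frontier E.carrier := by
      refine E.edge_subset_frontier i ?_
      rw [mem_edge_iff]
      exact ⟨t, ⟨h0, h1⟩, E.edgePt_eq i t⟩
    exact this.2 (h.ball_subset_interior hyc)

end StarAt

/-- The determinant spanned by the centre and an edge. -/
def coneDet (E : Polygon2) (c : Plane) (i : Fin E.n) : ℝ :=
  det2 (E.vertex i - c) (E.nextVertex i - c)

/-- First coordinate in the cone over an edge. -/
def coneA (E : Polygon2) (c : Plane) (i : Fin E.n) (z : Plane) : ℝ :=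
  det2 (z - c) (E.nextVertex i - c) / E.coneDet c i

/-- Second coordinate in the cone over an edge. -/
def coneB (E : Polygon2) (c : Plane) (i : Fin E.n) (z : Plane) : ℝ :=
  det2 (E.vertex i - c) (z - c) / E.coneDet c i

/-- The closed cone with apex `c` over an edge. -/
def cone (E : Polygon2) (c : Plane) (i : Fin E.n) : Set Plane :=
  {z | 0 ≤ E.coneA c i z ∧ 0 ≤ E.coneB c i z}

/-- The closed triangle spanned by `c` and an edge. -/
def tri (E : Polygon2) (c : Plane) (i : Fin E.n) : Set Plane :=
  {z | z ∈ E.cone c i ∧ E.coneA c i z + E.coneB c i z ≤ 1}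

lemma coneDet_eq (E : Polygon2) (c : Plane) (i : Fin E.n) :
    E.coneDet c i = det2 (E.vertex i - c) (E.tau i) := by
  have : E.nextVertex i - c = (E.vertex i - c) + E.tau i := by rw [tau]; abel
  rw [coneDet, this, det2_add_right, det2_self, zero_add]

lemma continuous_coneA (E : Polygon2) (c : Plane) (i : Fin E.n) : Continuous (E.coneA c i) :=
  ((continuous_det2_left _).comp (continuous_id.sub continuous_const)).div_const _

lemma continuous_coneB (E : Polygon2) (c : Plane) (i : Fin E.n) : Continuous (E.coneB c i) :=
  ((continuous_det2_right _).comp (continuous_id.sub continuous_const)).div_const _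

lemma isClosed_cone (E : Polygon2) (c : Plane) (i : Fin E.n) : IsClosed (E.cone c i) :=
  (isClosed_le continuous_const (E.continuous_coneA c i)).inter
    (isClosed_le continuous_const (E.continuous_coneB c i))

lemma isClosed_tri (E : Polygon2) (c : Plane) (i : Fin E.n) : IsClosed (E.tri c i) :=
  (E.isClosed_cone c i).inter
    (isClosed_le ((E.continuous_coneA c i).add (E.continuous_coneB c i)) continuous_const)

lemma coneA_ray (E : Polygon2) (c : Plane) (i : Fin E.n) (z : Plane) (s : ℝ) :
    E.coneA c i (c + s • (z - c)) = s * E.coneA c i z := by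
  simp only [coneA, add_sub_cancel_left, det2_smul_left]; ring

lemma coneB_ray (E : Polygon2) (c : Plane) (i : Fin E.n) (z : Plane) (s : ℝ) :
    E.coneB c i (c + s • (z - c)) = s * E.coneB c i z := by
  simp only [coneB, add_sub_cancel_left, det2_smul_right]; ring

lemma coneA_center (E : Polygon2) (c : Plane) (i : Fin E.n) : E.coneA c i c = 0 := by
  simp [coneA, det2_zero_left]

lemma coneB_center (E : Polygon2) (c : Plane) (i : Fin E.n) : E.coneB c i c = 0 := by
  simp [coneB, det2_zero_right]

namespace StarAt

lemma coneDet_ne (h : E.StarAt c r) (i : Fin E.n) : E.coneDet c i ≠ 0 := by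
  have h1 := h.le_abs_det i
  have h2 := mul_pos h.pos (E.norm_tau_pos i)
  exact abs_pos.1 (h2.trans_le h1)

lemma cone_repr (h : E.StarAt c r) (i : Fin E.n) (z : Plane) :
    z - c = E.coneA c i z • (E.vertex i - c) + E.coneB c i z • (E.nextVertex i - c) := by
  have := det2_smul_eq (E.vertex i - c) (E.nextVertex i - c) (z - c)
  have hD := h.coneDet_ne i
  apply smul_right_injective _ hD
  simp only [smul_add, smul_smul, coneA, coneB, mul_div_cancel₀ _ hD]
  exact this

lemma coneA_comb (h : E.StarAt c r) (i : Fin E.n) (a b : ℝ) :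
    E.coneA c i (c + a • (E.vertex i - c) + b • (E.nextVertex i - c)) = a := by
  have hD := h.coneDet_ne i
  rw [coneA, div_eq_iff hD]
  have : c + a • (E.vertex i - c) + b • (E.nextVertex i - c) - c =
    a • (E.vertex i - c) + b • (E.nextVertex i - c) := by abel
  rw [this, det2_add_left, det2_smul_left, det2_smul_left, det2_self, coneDet]; ring

lemma coneB_comb (h : E.StarAt c r) (i : Fin E.n) (a b : ℝ) :
    E.coneB c i (c + a • (E.vertex i - c) + b • (E.nextVertex i - c)) = b := by
  have hD := h.coneDet_ne i
  rw [coneB, div_eq_iff hD]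
  have : c + a • (E.vertex i - c) + b • (E.nextVertex i - c) - c =
    a • (E.vertex i - c) + b • (E.nextVertex i - c) := by abel
  rw [this, det2_add_right, det2_smul_right, det2_smul_right, det2_self, coneDet]; ring

lemma edgePt_comb (c : Plane) (i : Fin E.n) (t : ℝ) : E.edgePt i t =
    c + (1 - t) • (E.vertex i - c) + t • (E.nextVertex i - c) := by
  rw [edgePt_eq, tau]; simp only [smul_sub, sub_smul, one_smul]; abel

lemma coneA_edgePt (h : E.StarAt c r) (i : Fin E.n) (t : ℝ) :
    E.coneA c i (E.edgePt i t) = 1 - t := by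
  rw [edgePt_comb c, h.coneA_comb]

lemma coneB_edgePt (h : E.StarAt c r) (i : Fin E.n) (t : ℝ) :
    E.coneB c i (E.edgePt i t) = t := by
  rw [edgePt_comb c, h.coneB_comb]

/-- In the cone over an edge, the edge is given by the sum of the coordinates being one. -/
lemma mem_edge_of_cone (h : E.StarAt c r) {i : Fin E.n} {z : Plane} (hz : z ∈ E.cone c i)
    (hs : E.coneA c i z + E.coneB c i z = 1) : z ∈ E.edge i := by
  rw [mem_edge_iff]
  refine ⟨E.coneB c i z, ⟨hz.2, by linarith [hz.1]⟩, ?_⟩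
  rw [edgePt_comb c]
  have := h.cone_repr i z
  have e : 1 - E.coneB c i z = E.coneA c i z := by linarith
  rw [e, add_assoc, ← this]; abel

lemma cone_sum_pos (h : E.StarAt c r) {i : Fin E.n} {z : Plane} (hz : z ∈ E.cone c i)
    (hc : z ≠ c) : 0 < E.coneA c i z + E.coneB c i z := by
  rcases (add_nonneg hz.1 hz.2).eq_or_lt with h0 | h0
  · exfalso
    have ha : E.coneA c i z = 0 := by linarith [hz.1, hz.2]
    have hb : E.coneB c i z = 0 := by linarith [hz.1, hz.2]
    have := h.cone_repr i z
    rw [ha, hb] at this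
    simp only [zero_smul, add_zero] at this
    exact hc (sub_eq_zero.1 this)
  · exact h0

/-- The radial projection to the boundary. -/
lemma radial_mem_edge (h : E.StarAt c r) {i : Fin E.n} {z : Plane} (hz : z ∈ E.cone c i)
    (hc : z ≠ c) : c + (E.coneA c i z + E.coneB c i z)⁻¹ • (z - c) ∈ E.edge i := by
  have hp := h.cone_sum_pos hz hc
  refine h.mem_edge_of_cone ?_ ?_
  · refine ⟨?_, ?_⟩
    · rw [coneA_ray]; exact mul_nonneg (inv_pos.2 hp).le hz.1
    · rw [coneB_ray]; exact mul_nonneg (inv_pos.2 hp).le hz.2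
  · rw [coneA_ray, coneB_ray, ← mul_add, inv_mul_cancel₀ hp.ne']

/-- The sum of the cone coordinates is the gauge of the polygon with respect to `c`: it is fixed by
the radial projection to the boundary, which is unique, and so does not depend on the cone. -/
lemma cone_sum_eq (h : E.StarAt c r) {i j : Fin E.n} {z : Plane} (hi : z ∈ E.cone c i)
    (hj : z ∈ E.cone c j) : E.coneA c i z + E.coneB c i z = E.coneA c j z + E.coneB c j z := by
  by_cases hc : z = c
  · simp [hc, coneA_center, coneB_center]
  have pi := h.cone_sum_pos hi hc
  have pj := h.cone_sum_pos hj hc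
  have := h.frontier_unique (E.edge_subset_frontier i (h.radial_mem_edge hi hc))
    (E.edge_subset_frontier j (h.radial_mem_edge hj hc))
    (s := (E.coneA c i z + E.coneB c i z) / (E.coneA c j z + E.coneB c j z)) (div_pos pi pj)
    (by simp only [add_sub_cancel_left, smul_smul]; congr 1; field_simp)
  rwa [div_eq_one_iff_eq pj.ne'] at this

/-- A point in two cones projects radially to a point common to two edges, hence to an endpoint of
edge `i`; but there one of the two coordinates with respect to `i` vanishes. -/
lemma eq_of_mem_interior_cone (h : E.StarAt c r) {i j : Fin E.n} {z : Plane}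
    (ha : 0 < E.coneA c i z) (hb : 0 < E.coneB c i z) (hj : z ∈ E.cone c j) : i = j := by
  by_contra hne
  have hi : z ∈ E.cone c i := ⟨ha.le, hb.le⟩
  have hc : z ≠ c := by
    rintro rfl; rw [coneA_center] at ha; exact lt_irrefl _ ha
  have hp := h.cone_sum_pos hi hc
  have h1 := h.radial_mem_edge hi hc
  have h2 := h.radial_mem_edge hj hc
  rw [← h.cone_sum_eq hi hj] at h2
  have h3 := (E.simple i j hne ⟨h1, h2⟩).1
  have hv : E.vertex i = E.edgePt i 0 := by simp [edgePt]
  have hn : E.nextVertex i = E.edgePt i 1 := by simp [edgePt]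
  rcases h3 with h3 | h3
  · have := congrArg (E.coneB c i) h3
    rw [hv, h.coneB_edgePt, coneB_ray] at this
    exact (mul_pos (inv_pos.2 hp) hb).ne' this
  · have := congrArg (E.coneA c i) h3
    change _ = E.coneA c i (E.nextVertex i) at this
    rw [hn, h.coneA_edgePt, coneA_ray] at this
    exact (mul_pos (inv_pos.2 hp) ha).ne' (by linarith)

end StarAt

end Polygon2

/-! ### Rays, fan decomposition and orientation of a star-shaped polygon -/

namespace Polygon2

variable {E : Polygon2} {c : Plane} {r : ℝ}

namespace StarAt

/-- The last parameter at which the ray is still in the compact carrier gives a boundary point. -/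
lemma exists_ray_frontier (h : E.StarAt c r) {u : Plane} (hu : u ≠ 0) :
    ∃ s : ℝ, 0 < s ∧ c + s • u ∈ frontier E.carrier := by
  have hcont : Continuous fun s : ℝ => c + s • u := by fun_prop
  set K : Set ℝ := {s | 0 ≤ s ∧ c + s • u ∈ E.carrier} with hK
  have hKc : IsClosed K := isClosed_Ici.inter (E.isClosed_carrier.preimage hcont)
  obtain ⟨R, hR⟩ := E.isCompact_carrier.isBounded.subset_closedBall c
  have hup : 0 < ‖u‖ := norm_pos_iff.2 hu
  have hKb : K ⊆ Icc 0 (R / ‖u‖) := by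
    rintro s ⟨hs, hsE⟩
    refine ⟨hs, ?_⟩
    have := hR hsE
    rw [Metric.mem_closedBall, dist_eq_norm, add_sub_cancel_left, norm_smul, Real.norm_eq_abs,
      abs_of_nonneg hs] at this
    rwa [le_div_iff₀ hup]
  have hKcomp : IsCompact K := isCompact_Icc.of_isClosed_subset hKc hKb
  have h0 : (0 : ℝ) ∈ K := ⟨le_rfl, by simpa using h.ball h.center_mem_ball⟩
  obtain ⟨s, hsK, hs⟩ := hKcomp.exists_isGreatest ⟨0, h0⟩
  have hsf : c + s • u ∈ frontier E.carrier := by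
    refine ⟨subset_closure hsK.2, fun hint => ?_⟩
    have h1 : ∀ᶠ s' in 𝓝 s, c + s' • u ∈ E.carrier :=
      (hcont.continuousAt.preimage_mem_nhds (mem_interior_iff_mem_nhds.1 hint))
    obtain ⟨ε, hε, hb⟩ := Metric.eventually_nhds_iff.1 h1
    have h2 : s + ε / 2 ∈ K := ⟨by linarith [hsK.1], hb (by simp [abs_of_pos hε]; linarith)⟩
    have := hs h2
    linarith
  refine ⟨s, lt_of_le_of_ne hsK.1 ?_, hsf⟩
  rintro rfl
  refine hsf.2 ?_
  simpa using h.ball_subset_interior h.center_mem_ball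

lemma mem_cone_of_mem_edge (h : E.StarAt c r) {i : Fin E.n} {x : Plane} (hx : x ∈ E.edge i) :
    x ∈ E.cone c i ∧ E.coneA c i x + E.coneB c i x = 1 := by
  rw [mem_edge_iff] at hx
  obtain ⟨t, ht, rfl⟩ := hx
  refine ⟨⟨?_, ?_⟩, ?_⟩
  · rw [h.coneA_edgePt]; linarith [ht.2]
  · rw [h.coneB_edgePt]; exact ht.1
  · rw [h.coneA_edgePt, h.coneB_edgePt]; ring

lemma mem_frontier_iff (x : Plane) : x ∈ frontier E.carrier ↔ ∃ i, x ∈ E.edge i := by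
  rw [E.frontier_carrier, mem_iUnion]; rfl

lemma exists_mem_cone (h : E.StarAt c r) (z : Plane) : ∃ i, z ∈ E.cone c i := by
  by_cases hz : z = c
  · have := E.three_le
    refine ⟨⟨0, by omega⟩, ?_, ?_⟩ <;> simp [hz, coneA_center, coneB_center]
  obtain ⟨s, hs, hf⟩ := h.exists_ray_frontier (sub_ne_zero.2 hz)
  obtain ⟨i, hi⟩ := (mem_frontier_iff _).1 hf
  have h1 := (h.mem_cone_of_mem_edge hi).1
  refine ⟨i, ?_, ?_⟩
  · have := h1.1; rw [coneA_ray] at this; exact nonneg_of_mul_nonneg_right this hs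
  · have := h1.2; rw [coneB_ray] at this; exact nonneg_of_mul_nonneg_right this hs

/-- The polygon is the unit sublevel set of its gauge. -/
lemma mem_carrier_iff (h : E.StarAt c r) {i : Fin E.n} {z : Plane} (hz : z ∈ E.cone c i) :
    z ∈ E.carrier ↔ E.coneA c i z + E.coneB c i z ≤ 1 := by
  by_cases hc : z = c
  · subst hc
    simp only [coneA_center, coneB_center, add_zero, zero_le_one, iff_true]
    exact h.ball h.center_mem_ball
  have hp := h.cone_sum_pos hz hc
  have hx := h.radial_mem_edge hz hc
  constructor
  · intro hzE
    by_contra! hlt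
    exact h.not_mem_frontier_of_lt hzE (inv_pos.2 hp).le (inv_lt_one_of_one_lt₀ hlt)
      (E.edge_subset_frontier i hx)
  · intro hle
    have h1 := h.star c h.center_mem_ball (E.edge_subset_carrier i hx)
      (a := 1 - (E.coneA c i z + E.coneB c i z)) (b := E.coneA c i z + E.coneB c i z)
      (by linarith) hp.le (by ring)
    convert h1 using 1
    rw [smul_add, smul_smul, mul_inv_cancel₀ hp.ne']
    simp only [sub_smul, one_smul]; abel

lemma carrier_eq_iUnion_tri (h : E.StarAt c r) : E.carrier = ⋃ i, E.tri c i := by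
  ext z
  rw [mem_iUnion]
  constructor
  · intro hz
    obtain ⟨i, hi⟩ := h.exists_mem_cone z
    exact ⟨i, hi, (h.mem_carrier_iff hi).1 hz⟩
  · rintro ⟨i, hi, hs⟩
    exact (h.mem_carrier_iff hi).2 hs

/-- If two consecutive determinants had opposite signs, the fan would fold back at the common
vertex: points in the cone of the second edge, close enough to the direction of that vertex, would
lie in the open cone of the first edge. -/
lemma coneDet_mul_succ_pos (h : E.StarAt c r) (i : Fin E.n) :
    0 < E.coneDet c i * E.coneDet c (finRotate E.n i) := by
  set j := finRotate E.n i with hj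
  have hne : i ≠ j := (E.finRotate_ne i).symm
  by_contra! hle
  have hlt : E.coneDet c i * E.coneDet c j < 0 :=
    lt_of_le_of_ne hle (mul_ne_zero (h.coneDet_ne i) (h.coneDet_ne j))
  set p := E.vertex i - c
  set q := E.nextVertex i - c
  set w := E.nextVertex j - c
  have hqj : E.vertex j - c = q := rfl
  -- Large enough that the second coordinate of `z` in the cone over edge `i`, which is `k + det2 p
  -- w / coneDet`, becomes positive.
  set k : ℝ := |det2 p w / E.coneDet c i| + 1
  set z : Plane := c + k • (E.vertex j - c) + (1 : ℝ) • (E.nextVertex j - c) with hz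
  have hk : 0 < k := by positivity
  have hzj : z ∈ E.cone c j := by
    refine ⟨?_, ?_⟩
    · rw [hz, h.coneA_comb]; exact hk.le
    · rw [hz, h.coneB_comb]; exact zero_le_one
  have hDj : E.coneDet c j = det2 q w := rfl
  have hDi : E.coneDet c i = det2 p q := rfl
  have hzc : z - c = k • q + w := by rw [hz, hqj, one_smul]; simp only [w]; abel
  have ha : 0 < E.coneA c i z := by
    have : E.coneA c i z = -(E.coneDet c j / E.coneDet c i) := by
      rw [coneA, hzc]
      change det2 (k • q + w) q / _ = _
      rw [det2_add_left, det2_smul_left, det2_self, hDj, det2_swap w q]; ring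
    rw [this, neg_pos]
    rcases mul_neg_iff.1 hlt with h1 | h1
    · exact div_neg_of_neg_of_pos h1.2 h1.1
    · exact div_neg_of_pos_of_neg h1.2 h1.1
  have hb : 0 < E.coneB c i z := by
    have : E.coneB c i z = k + det2 p w / E.coneDet c i := by
      rw [coneB, hzc]
      change det2 p (k • q + w) / _ = _
      rw [det2_add_right, det2_smul_right, add_div, ← hDi, mul_div_assoc,
        div_self (h.coneDet_ne i), mul_one]
    rw [this]
    have := neg_abs_le (det2 p w / E.coneDet c i)
    linarith
  exact hne (h.eq_of_mem_interior_cone ha hb hzj)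

end StarAt

/-- A reference index. -/
def zeroIdx (E : Polygon2) : Fin E.n := ⟨0, by have := E.three_le; omega⟩

/-- The orientation of the boundary, as a sign. -/
def orient (E : Polygon2) (c : Plane) : ℝ := SignType.sign (E.coneDet c E.zeroIdx)

namespace StarAt

lemma coneDet_mul_zeroIdx_pos (h : E.StarAt c r) (i : Fin E.n) :
    0 < E.coneDet c E.zeroIdx * E.coneDet c i := by
  obtain ⟨k, hk⟩ := i
  induction k with
  | zero => exact mul_self_pos.2 (h.coneDet_ne _)
  | succ k ih =>
    have h1 := ih (by omega)
    have h2 := h.coneDet_mul_succ_pos ⟨k, by omega⟩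
    have h3 : finRotate E.n ⟨k, by omega⟩ = ⟨k + 1, hk⟩ := by
      obtain ⟨n, hn⟩ : ∃ n, E.n = n + 1 := ⟨E.n - 1, by omega⟩
      have : ∀ (m : ℕ) (hm : m = n + 1) (h1 : k < m) (h2 : k + 1 < m),
          finRotate m ⟨k, h1⟩ = ⟨k + 1, h2⟩ := by
        rintro m rfl h1 h2
        exact finRotate_of_lt (by omega)
      exact this _ hn _ _
    rw [h3] at h2
    have h4 := mul_pos h1 h2
    have h5 : 0 < E.coneDet c ⟨k, by omega⟩ ^ 2 :=
      lt_of_le_of_ne (sq_nonneg _) (pow_ne_zero 2 (h.coneDet_ne _)).symm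
    refine (mul_pos_iff_of_pos_right h5).1 ?_
    convert h4 using 1; ring

lemma orient_mul_coneDet (h : E.StarAt c r) (i : Fin E.n) :
    E.orient c * E.coneDet c i = |E.coneDet c i| := by
  have h1 := h.coneDet_mul_zeroIdx_pos i
  unfold orient
  rcases mul_pos_iff.1 h1 with ⟨h2, h3⟩ | ⟨h2, h3⟩
  · rw [sign_pos h2, abs_of_pos h3]; simp
  · rw [sign_neg h2, abs_of_neg h3]; simp

lemma orient_sq (h : E.StarAt c r) : E.orient c * E.orient c = 1 := by
  unfold orient
  rcases lt_or_gt_of_ne (h.coneDet_ne E.zeroIdx) with h1 | h1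
  · rw [sign_neg h1]; simp
  · rw [sign_pos h1]; simp

lemma abs_orient (h : E.StarAt c r) : |E.orient c| = 1 := by
  rw [← sq_eq_sq₀ (abs_nonneg _) zero_le_one, sq_abs, sq, h.orient_sq]; norm_num

lemma orient_eq (h : E.StarAt c r) : E.orient c = 1 ∨ E.orient c = -1 :=
  mul_self_eq_one_iff.1 h.orient_sq

end StarAt

end Polygon2

/-! ### Integration over triangles -/

lemma volume_line_eq_zero {a : Plane} (ha : a ≠ 0) (k : ℝ) :
    volume {z : Plane | det2 z a = k} = 0 := by
  set S : AffineSubspace ℝ Plane := 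
    { carrier := {z : Plane | det2 z a = k}
      smul_vsub_vadd_mem' := by
        intro s p1 p2 p3 h1 h2 h3
        simp only [mem_ofPred_eq] at *
        simp only [vsub_eq_sub, vadd_eq_add, det2_add_left, det2_smul_left, det2_sub_left, h1, h2, h3]
        ring } with hS
  have : volume (S : Set Plane) = 0 := by
    refine Measure.addHaar_affineSubspace volume S ?_
    intro htop
    have h1 : ∀ z : Plane, det2 z a = k := fun z => by
      have : z ∈ S := by rw [htop]; trivial
      exact this
    apply ha
    have h0 := h1 0
    rw [det2_zero_left] at h0
    have e0 := h1 (EuclideanSpace.single 0 1)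
    have e1 := h1 (EuclideanSpace.single 1 1)
    simp [det2, ← h0] at e0 e1
    exact plane_ext (by simpa using e1) (by simpa using e0)
  exact this

/-- The parametrisation of a triangle by the reference triangle. -/
def triMap (c p q : Plane) (x : ℝ × ℝ) : Plane := c + x.1 • p + x.2 • q

/-- The reference triangle. -/
def refTri : Set (ℝ × ℝ) := {x | 0 ≤ x.1 ∧ 0 ≤ x.2 ∧ x.1 + x.2 ≤ 1}

lemma continuous_triMap (c p q : Plane) : Continuous (triMap c p q) := by
  unfold triMap; fun_prop

lemma isClosed_refTri : IsClosed refTri := by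
  refine (isClosed_le continuous_const continuous_fst).inter
    ((isClosed_le continuous_const continuous_snd).inter
    (isClosed_le (continuous_fst.add continuous_snd) continuous_const))

lemma isCompact_refTri : IsCompact refTri := by
  refine (isCompact_Icc (a := ((0 : ℝ), (0 : ℝ))) (b := (1, 1))).of_isClosed_subset isClosed_refTri ?_
  rintro ⟨a, b⟩ ⟨h1, h2, h3⟩
  simp only at h1 h2 h3
  exact ⟨⟨h1, h2⟩, ⟨by simp; linarith, by simp; linarith⟩⟩

/-- The plane as a product. -/
def planeEquivProd : Plane ≃ᵐ ℝ × ℝ :=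
  (MeasurableEquiv.toLp 2 (Fin 2 → ℝ)).symm.trans MeasurableEquiv.finTwoArrow

lemma planeEquivProd_apply (x : Plane) : planeEquivProd x = (x 0, x 1) := rfl

lemma measurePreserving_planeEquivProd : MeasurePreserving planeEquivProd volume volume :=
  (volume_preserving_finTwoArrow ℝ).comp (PiLp.volume_preserving_ofLp (Fin 2))

lemma integral_triMap_image (c : Plane) {p q : Plane} (hD : det2 p q ≠ 0) (f : Plane → ℝ) :
    ∫ x in triMap c p q '' refTri, f x = |det2 p q| * ∫ x in refTri, f (triMap c p q x) := by
  set L : Plane →L[ℝ] Plane :=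
    (EuclideanSpace.proj (𝕜 := ℝ) (0 : Fin 2)).smulRight p +
      (EuclideanSpace.proj (𝕜 := ℝ) (1 : Fin 2)).smulRight q with hL
  have hLa : ∀ x : Plane, L x = x 0 • p + x 1 • q := fun x => by simp [hL]
  have hdet : L.det = det2 p q := by
    change LinearMap.det (L : Plane →ₗ[ℝ] Plane) = _
    rw [← LinearMap.det_toMatrix (EuclideanSpace.basisFun (Fin 2) ℝ).toBasis, Matrix.det_fin_two]
    simp [LinearMap.toMatrix_apply, hLa, det2]
    ring
  set S : Set Plane := planeEquivProd ⁻¹' refTri with hS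
  have hSm : MeasurableSet S := planeEquivProd.measurable isClosed_refTri.measurableSet
  have himg : triMap c p q '' refTri = (fun x => c + L x) '' S := by
    ext z; constructor
    · rintro ⟨x, hx, rfl⟩
      refine ⟨planeEquivProd.symm x, by simpa [hS] using hx, ?_⟩
      have : planeEquivProd (planeEquivProd.symm x) = x := by simp
      rw [planeEquivProd_apply] at this
      have h0 : (planeEquivProd.symm x) 0 = x.1 := congrArg Prod.fst this
      have h1 : (planeEquivProd.symm x) 1 = x.2 := congrArg Prod.snd this
      simp only [hLa, triMap, h0, h1, add_assoc]
    · rintro ⟨x, hx, rfl⟩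
      exact ⟨planeEquivProd x, hx, by simp [triMap, hLa, planeEquivProd_apply, add_assoc]⟩
  have hinj : InjOn (fun x => c + L x) S := by
    intro x _ y _ hxy
    have h1 : L x = L y := add_left_cancel hxy
    have h2 : L (x - y) = 0 := by rw [map_sub, h1, sub_self]
    rw [hLa] at h2
    have e1 : det2 ((x - y) 0 • p + (x - y) 1 • q) q = 0 := by rw [h2, det2_zero_left]
    have e2 : det2 p ((x - y) 0 • p + (x - y) 1 • q) = 0 := by rw [h2, det2_zero_right]
    rw [det2_add_left, det2_smul_left, det2_smul_left, det2_self, mul_zero, add_zero] at e1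
    rw [det2_add_right, det2_smul_right, det2_smul_right, det2_self, mul_zero, zero_add] at e2
    have e1' := (mul_eq_zero.1 e1).resolve_right hD
    have e2' := (mul_eq_zero.1 e2).resolve_right hD
    exact sub_eq_zero.1 (plane_ext (by simpa using e1') (by simpa using e2'))
  rw [himg, integral_image_eq_integral_abs_det_fderiv_smul volume hSm
    (f' := fun _ => L) (fun x _ => (L.hasFDerivAt.const_add c).hasFDerivWithinAt) hinj]
  simp only [hdet, smul_eq_mul]
  rw [integral_const_mul]
  congr 1
  rw [hS, ← measurePreserving_planeEquivProd.setIntegral_preimage_emb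
    planeEquivProd.measurableEmbedding (fun x => f (triMap c p q x)) refTri]
  refine setIntegral_congr_fun hSm fun x _ => ?_
  simp [hLa, triMap, planeEquivProd_apply, add_assoc]

lemma integral_refTri {G : ℝ × ℝ → ℝ} (hG : Continuous G) :
    ∫ x in refTri, G x = ∫ a in (0 : ℝ)..1, ∫ b in (0 : ℝ)..(1 - a), G (a, b) := by
  have hm := isClosed_refTri.measurableSet
  have hint : Integrable (refTri.indicator G) (volume.prod volume) := by
    rw [integrable_indicator_iff hm]
    exact hG.continuousOn.integrableOn_compact isCompact_refTri
  rw [← integral_indicator hm, Measure.volume_eq_prod, integral_prod _ hint,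
    intervalIntegral.integral_of_le zero_le_one, ← integral_Icc_eq_integral_Ioc,
    ← integral_indicator measurableSet_Icc]
  refine integral_congr_ae (Filter.Eventually.of_forall fun a => ?_)
  change ∫ b, refTri.indicator G (a, b) = _
  by_cases ha : a ∈ Icc (0 : ℝ) 1
  · rw [indicator_of_mem ha, intervalIntegral.integral_of_le (by linarith [ha.2]),
      ← integral_Icc_eq_integral_Ioc, ← integral_indicator measurableSet_Icc]
    refine integral_congr_ae (Filter.Eventually.of_forall fun b => ?_)
    change refTri.indicator G (a, b) = _
    by_cases hb : b ∈ Icc (0 : ℝ) (1 - a)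
    · rw [indicator_of_mem hb, indicator_of_mem]
      exact ⟨ha.1, hb.1, by simp only; linarith [hb.2]⟩
    · rw [indicator_of_notMem hb, indicator_of_notMem]
      rintro ⟨h1, h2, h3⟩
      exact hb ⟨h2, by simp only at h3; linarith⟩
  · rw [indicator_of_notMem ha]
    have : ∀ b, refTri.indicator G (a, b) = 0 := fun b => by
      rw [indicator_of_notMem]
      rintro ⟨h1, h2, h3⟩
      simp only at h1 h2 h3
      exact ha ⟨h1, by linarith⟩
    simp [this]

lemma integral_refTri' {G : ℝ × ℝ → ℝ} (hG : Continuous G) :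
    ∫ x in refTri, G x = ∫ b in (0 : ℝ)..1, ∫ a in (0 : ℝ)..(1 - b), G (a, b) := by
  have h1 := integral_refTri (G := G ∘ Prod.swap) (hG.comp continuous_swap)
  have h2 : ∫ x in refTri, (G ∘ Prod.swap) x = ∫ x in refTri, G x := by
    have hs : Prod.swap ⁻¹' refTri = refTri := by
      ext ⟨a, b⟩
      simp only [refTri, mem_preimage, Prod.swap_prod_mk, mem_ofPred_eq]
      rw [add_comm b a]; tauto
    have hp : MeasurePreserving (Prod.swap : ℝ × ℝ → ℝ × ℝ) volume volume := by
      rw [Measure.volume_eq_prod]; exact Measure.measurePreserving_swap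
    have h3 := hp.setIntegral_preimage_emb
      (MeasurableEquiv.prodComm (α := ℝ) (β := ℝ)).measurableEmbedding G refTri
    rw [hs] at h3
    exact h3
  rw [← h2, h1]
  rfl

/-- The fundamental theorem of calculus on each slice in the direction of `q`: the slices start on
the leg along `p` and end on the side opposite to `c`. -/
lemma integral_refTri_fderiv_snd {f : Plane → ℝ} (hf : ContDiff ℝ 1 f) (c p q : Plane) :
    ∫ x in refTri, fderiv ℝ f (triMap c p q x) q =
      (∫ t in (0 : ℝ)..1, f (c + (1 - t) • p + t • q)) - ∫ t in (0 : ℝ)..1, f (c + t • p) := by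
  have hcf : Continuous (fderiv ℝ f) := hf.continuous_fderiv (by norm_num)
  rw [integral_refTri (G := fun x => fderiv ℝ f (triMap c p q x) q)
    ((hcf.comp (continuous_triMap c p q)).clm_apply continuous_const)]
  have hinner : ∀ a : ℝ, ∫ b in (0 : ℝ)..(1 - a), fderiv ℝ f (triMap c p q (a, b)) q =
      f (c + (1 - (1 - a)) • p + (1 - a) • q) - f (c + a • p) := by
    intro a
    have hd : ∀ b : ℝ, HasDerivAt (fun b => f (triMap c p q (a, b)))
        (fderiv ℝ f (triMap c p q (a, b)) q) b := by
      intro b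
      have h1 : HasDerivAt (fun b : ℝ => triMap c p q (a, b)) q b := by
        have := ((hasDerivAt_id b).smul_const q).const_add (c + a • p)
        simpa [triMap] using this
      exact ((hf.differentiable (by norm_num)).differentiableAt.hasFDerivAt).comp_hasDerivAt b h1
    rw [intervalIntegral.integral_eq_sub_of_hasDerivAt (fun b _ => hd b)]
    · simp [triMap]
    · refine Continuous.intervalIntegrable ?_ _ _
      exact (hcf.comp ((continuous_triMap c p q).comp (by fun_prop))).clm_apply continuous_const
  simp_rw [hinner]
  have hc := hf.continuous
  rw [intervalIntegral.integral_sub, intervalIntegral.integral_comp_sub_left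
    (fun t => f (c + (1 - t) • p + t • q)) 1]
  · simp
  · exact (hc.comp (by fun_prop)).intervalIntegrable _ _
  · exact (hc.comp (by fun_prop)).intervalIntegrable _ _

lemma integral_refTri_fderiv_fst {f : Plane → ℝ} (hf : ContDiff ℝ 1 f) (c p q : Plane) :
    ∫ x in refTri, fderiv ℝ f (triMap c p q x) p =
      (∫ t in (0 : ℝ)..1, f (c + (1 - t) • p + t • q)) - ∫ t in (0 : ℝ)..1, f (c + t • q) := by
  have hcf : Continuous (fderiv ℝ f) := hf.continuous_fderiv (by norm_num)
  rw [integral_refTri' (G := fun x => fderiv ℝ f (triMap c p q x) p)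
    ((hcf.comp (continuous_triMap c p q)).clm_apply continuous_const)]
  have hinner : ∀ b : ℝ, ∫ a in (0 : ℝ)..(1 - b), fderiv ℝ f (triMap c p q (a, b)) p =
      f (c + (1 - b) • p + b • q) - f (c + b • q) := by
    intro b
    have hd : ∀ a : ℝ, HasDerivAt (fun a => f (triMap c p q (a, b)))
        (fderiv ℝ f (triMap c p q (a, b)) p) a := by
      intro a
      have h1 : HasDerivAt (fun a : ℝ => triMap c p q (a, b)) p a := by
        have := (((hasDerivAt_id a).smul_const p).const_add c).add_const (b • q)
        simpa [triMap] using this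
      exact ((hf.differentiable (by norm_num)).differentiableAt.hasFDerivAt).comp_hasDerivAt a h1
    rw [intervalIntegral.integral_eq_sub_of_hasDerivAt (fun b _ => hd b)]
    · simp [triMap]
    · refine Continuous.intervalIntegrable ?_ _ _
      exact (hcf.comp ((continuous_triMap c p q).comp (by fun_prop))).clm_apply continuous_const
  simp_rw [hinner]
  have hc := hf.continuous
  rw [intervalIntegral.integral_sub]
  · exact (hc.comp (by fun_prop)).intervalIntegrable _ _
  · exact (hc.comp (by fun_prop)).intervalIntegrable _ _

/-! ### Divergence theorem on the fan of triangles -/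

namespace Polygon2

variable {E : Polygon2} {c : Plane} {r : ℝ}

lemma volume_edge (E : Polygon2) (i : Fin E.n) : volume (E.edge i) = 0 := by
  refine measure_mono_null ?_ (volume_line_eq_zero (a := E.tau i)
    (norm_pos_iff.1 (E.norm_tau_pos i)) (det2 (E.vertex i) (E.tau i)))
  intro x hx
  rw [mem_edge_iff] at hx
  obtain ⟨t, -, rfl⟩ := hx
  simp [edgePt_eq, det2_add_left, det2_smul_left, det2_self]

lemma volume_frontier (E : Polygon2) : volume (frontier E.carrier) = 0 := by
  rw [E.frontier_carrier]
  exact measure_iUnion_null fun i => E.volume_edge i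

lemma interior_ae_eq_carrier (E : Polygon2) :
    interior E.carrier =ᵐ[volume] E.carrier := by
  refine (show interior E.carrier ≤ E.carrier from interior_subset).eventuallyLE.antisymm ?_
  have h : E.carrier \ interior E.carrier = frontier E.carrier := by
    rw [frontier, E.isClosed_carrier.closure_eq]
  have h2 := E.volume_frontier
  rw [← h] at h2
  exact ae_le_set.2 h2

lemma restrict_interior (E : Polygon2) :
    volume.restrict (interior E.carrier) = volume.restrict E.carrier :=
  Measure.restrict_congr_set E.interior_ae_eq_carrier

lemma volume_carrier_ne_top (E : Polygon2) : volume E.carrier ≠ ⊤ :=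
  E.isCompact_carrier.measure_lt_top.ne

namespace StarAt

lemma tri_eq_image (h : E.StarAt c r) (i : Fin E.n) :
    E.tri c i = triMap c (E.vertex i - c) (E.nextVertex i - c) '' refTri := by
  ext z; constructor
  · rintro ⟨⟨h1, h2⟩, h3⟩
    refine ⟨(E.coneA c i z, E.coneB c i z), ⟨h1, h2, h3⟩, ?_⟩
    have := h.cone_repr i z
    simp only [triMap]
    rw [add_assoc, ← this]; abel
  · rintro ⟨x, ⟨h1, h2, h3⟩, rfl⟩
    simp only [tri, cone, mem_ofPred_eq, triMap, h.coneA_comb, h.coneB_comb]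
    exact ⟨⟨h1, h2⟩, h3⟩

/-- An overlap of two triangles is contained in the two lines that bound the cone of the first. -/
lemma aedisjoint_tri (h : E.StarAt c r) :
    Pairwise (fun i j => AEDisjoint volume (E.tri c i) (E.tri c j)) := by
  intro i j hij
  have hp : E.vertex i - c ≠ 0 := fun h0 => h.coneDet_ne i (by rw [coneDet, h0, det2_zero_left])
  have hq : E.nextVertex i - c ≠ 0 := fun h0 =>
    h.coneDet_ne i (by rw [coneDet, h0, det2_zero_right])
  refine measure_mono_null ?_ (measure_union_null
    (volume_line_eq_zero hq (det2 c (E.nextVertex i - c)))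
    (volume_line_eq_zero hp (det2 c (E.vertex i - c))))
  rintro z ⟨⟨⟨ha, hb⟩, -⟩, ⟨hj, -⟩⟩
  rcases ha.eq_or_lt with ha | ha
  · left
    have := ha.symm
    rw [coneA, div_eq_zero_iff, or_iff_left (h.coneDet_ne i), det2_sub_left] at this
    exact sub_eq_zero.1 this
  rcases hb.eq_or_lt with hb | hb
  · right
    have := hb.symm
    rw [coneB, div_eq_zero_iff, or_iff_left (h.coneDet_ne i), det2_swap, det2_sub_left] at this
    exact sub_eq_zero.1 (neg_eq_zero.1 this)
  exact absurd (h.eq_of_mem_interior_cone ha hb hj) hij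

lemma integral_carrier_eq_sum (h : E.StarAt c r) {f : Plane → ℝ}
    (hf : IntegrableOn f E.carrier volume) :
    ∫ x in E.carrier, f x = ∑ i, ∫ x in E.tri c i, f x := by
  have he := h.carrier_eq_iUnion_tri
  rw [he] at hf
  conv_lhs => rw [he]
  rw [integral_iUnion_ae (fun i => (E.isClosed_tri c i).measurableSet.nullMeasurableSet)
    h.aedisjoint_tri hf, tsum_fintype]

/-- Divergence theorem on one triangle of the fan. -/
lemma integral_tri_fderiv (h : E.StarAt c r) (i : Fin E.n) {f : Plane → ℝ} (hf : ContDiff ℝ 1 f)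
    (a : Plane) : ∫ x in E.tri c i, fderiv ℝ f x a = E.orient c *
      (det2 a (E.tau i) * (∫ t in (0 : ℝ)..1, f (E.edgePt i t))
        + det2 a (E.vertex i - c) * (∫ t in (0 : ℝ)..1, f (c + t • (E.vertex i - c)))
        - det2 a (E.nextVertex i - c) * (∫ t in (0 : ℝ)..1, f (c + t • (E.nextVertex i - c)))) := by
  set p := E.vertex i - c with hp
  set q := E.nextVertex i - c with hq
  have hD : det2 p q ≠ 0 := h.coneDet_ne i
  have hσ : E.orient c * det2 p q = |det2 p q| := h.orient_mul_coneDet i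
  have hcf : Continuous (fderiv ℝ f) := hf.continuous_fderiv (by norm_num)
  have hct : ∀ b, IntegrableOn (fun x => fderiv ℝ f (triMap c p q x) b) refTri volume := fun b =>
    (((hcf.comp (continuous_triMap c p q)).clm_apply
      continuous_const).continuousOn).integrableOn_compact isCompact_refTri
  have hedge : ∀ t : ℝ, E.edgePt i t = c + (1 - t) • p + t • q := fun t => edgePt_comb c i t
  have htau : E.tau i = q - p := by rw [hp, hq, tau]; abel
  rw [h.tri_eq_image, integral_triMap_image c hD, htau]
  simp_rw [hedge]
  -- The direction `a` is expanded in the basis `p`, `q`, so that only derivatives along the two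
  -- legs from `c` occur.
  have h1 : det2 p q * ∫ x in refTri, fderiv ℝ f (triMap c p q x) a =
      det2 a q * (∫ x in refTri, fderiv ℝ f (triMap c p q x) p) +
      det2 p a * (∫ x in refTri, fderiv ℝ f (triMap c p q x) q) := by
    rw [← integral_const_mul, ← integral_const_mul, ← integral_const_mul,
      ← integral_add ((hct p).const_mul _) ((hct q).const_mul _)]
    refine integral_congr_ae (Filter.Eventually.of_forall fun x => ?_)
    have := congrArg (fderiv ℝ f (triMap c p q x)) (det2_smul_eq p q a)
    simpa only [map_add, map_smul, smul_eq_mul] using this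
  rw [integral_refTri_fderiv_fst hf, integral_refTri_fderiv_snd hf] at h1
  rw [← hσ, mul_assoc, h1, det2_sub_right a q p, det2_swap p a]
  ring

/-- Divergence theorem on a star-shaped polygon for continuously differentiable functions. -/
theorem integral_carrier_fderiv (h : E.StarAt c r) {f : Plane → ℝ} (hf : ContDiff ℝ 1 f)
    (a : Plane) : ∫ x in E.carrier, fderiv ℝ f x a = E.orient c *
      ∑ i, det2 a (E.tau i) * (∫ t in (0 : ℝ)..1, f (E.edgePt i t)) := by
  have hcf : Continuous (fderiv ℝ f) := hf.continuous_fderiv (by norm_num)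
  rw [h.integral_carrier_eq_sum ((hcf.clm_apply
    continuous_const).continuousOn.integrableOn_compact E.isCompact_carrier)]
  simp_rw [h.integral_tri_fderiv _ hf a]
  rw [← Finset.mul_sum]
  congr 1
  rw [Finset.sum_sub_distrib, Finset.sum_add_distrib]
  -- Each spoke from `c` belongs to two neighbouring triangles with opposite signs; the cyclic shift
  -- of the index exhibits the cancellation.
  have : ∑ i, det2 a (E.nextVertex i - c) * (∫ t in (0 : ℝ)..1, f (c + t • (E.nextVertex i - c))) =
      ∑ i, det2 a (E.vertex i - c) * (∫ t in (0 : ℝ)..1, f (c + t • (E.vertex i - c))) :=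
    Equiv.sum_comp (finRotate E.n) (fun i => det2 a (E.vertex i - c) *
      (∫ t in (0 : ℝ)..1, f (c + t • (E.vertex i - c))))
  rw [this]; ring

end StarAt

end Polygon2

/-! ### Square integrable functions and weak gradients -/

lemma memLp_indicator_of_restrict {F : Type*} [NormedAddCommGroup F] {S : Set Plane}
    (hS : MeasurableSet S) {f : Plane → F} (hf : MemLp f 2 (volume.restrict S)) :
    MemLp (S.indicator f) 2 volume := (memLp_indicator_iff_restrict hS).2 hf

lemma integral_comp_dil (c : Plane) {μ : ℝ} (hμ : μ ≠ 0) (f : Plane → ℝ) :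
    ∫ y, f (dil c μ y) = (μ ^ 2)⁻¹ * ∫ z, f z := by
  have he : MeasurableEmbedding (dil c μ) := (dilHomeo c hμ).measurableEmbedding
  rw [← he.integral_map, map_dil_volume c hμ, integral_smul_measure,
    ENNReal.toReal_ofReal (by positivity), smul_eq_mul]

/-- The cut-off shape seen by a mollified dilation. -/
lemma hasFDerivAt_moll_test (φ : ContDiffBump (0 : Plane)) (c : Plane) (μ : ℝ) (x z : Plane) :
    HasFDerivAt (fun z => φ.normed volume (x - dil c μ⁻¹ z))
      (-μ⁻¹ • fderiv ℝ (φ.normed volume) (x - dil c μ⁻¹ z)) z := by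
  have h1 : HasFDerivAt (fun z => x - dil c μ⁻¹ z) (-(μ⁻¹ • ContinuousLinearMap.id ℝ Plane)) z := by
    unfold dil
    have := ((((hasFDerivAt_id (𝕜 := ℝ) z).sub_const c).const_smul μ⁻¹).const_add c).const_sub x
    simpa using this
  have h2 := ((φ.contDiff_normed (μ := volume) (n := 1)).differentiable (by norm_num)
    (x - dil c μ⁻¹ z)).hasFDerivAt.comp z h1
  refine HasFDerivAt.congr_fderiv h2 ?_
  ext a; simp

/-- The gradient of a mollified dilation, where the weak gradient can be tested. -/
lemma fderiv_moll_comp_dil (φ : ContDiffBump (0 : Plane)) (c : Plane) {μ : ℝ} (hμ : 0 < μ)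
    {u : Plane → ℝ} {g : Plane → Plane} (hu : MemLp u 2 volume) (hg : MemLp g 2 volume) (x : Plane)
    (hw : ∀ a : Plane, ∫ z, u z * fderiv ℝ (fun z => φ.normed volume (x - dil c μ⁻¹ z)) z a =
      -∫ z, φ.normed volume (x - dil c μ⁻¹ z) * ⟪g z, a⟫) :
    gradient (moll φ (u ∘ dil c μ)) x = μ • moll φ (g ∘ dil c μ) x := by
  have hφ := φ.hasCompactSupport_normed (μ := volume)
  have hul : LocallyIntegrable (u ∘ dil c μ) volume :=
    (memLp_comp_dil c hμ hu).locallyIntegrable (by norm_num)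
  have hgl : LocallyIntegrable (g ∘ dil c μ) volume :=
    (memLp_comp_dil c hμ hg).locallyIntegrable (by norm_num)
  have hd := hφ.hasFDerivAt_convolution_left (ContinuousLinearMap.lsmul ℝ ℝ)
    (φ.contDiff_normed (n := 1)) hul x
  have hcx : ConvolutionExistsAt (fderiv ℝ (φ.normed volume)) (u ∘ dil c μ) x
      ((ContinuousLinearMap.lsmul ℝ ℝ).precompL Plane) volume :=
    (hφ.fderiv ℝ).convolutionExists_left _
      ((φ.contDiff_normed (n := 1)).continuous_fderiv (by norm_num)) hul x
  refine ext_inner_right ℝ fun a => ?_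
  rw [inner_gradient_left, moll, hd.fderiv, convolution_eq_swap] 
  rw [ContinuousLinearMap.integral_apply]
  swap
  · exact hcx.integrable_swap
  have e1 : ∀ y, (((ContinuousLinearMap.lsmul ℝ ℝ).precompL Plane)
      (fderiv ℝ (φ.normed volume) (x - y)) ((u ∘ dil c μ) y)) a =
      fderiv ℝ (φ.normed volume) (x - y) a * u (dil c μ y) := fun y => by
    simp [ContinuousLinearMap.precompL_apply]
  simp_rw [e1]
  -- The substitution `z = dil c μ y` turns the derivative of the kernel into a derivative of the
  -- test function; the factor `-μ` compensates the `-μ⁻¹` from the chain rule.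
  set A : Plane → ℝ :=
    fun z => -μ * (u z * fderiv ℝ (fun z => φ.normed volume (x - dil c μ⁻¹ z)) z a) with hA
  have e2 : ∀ y, fderiv ℝ (φ.normed volume) (x - y) a * u (dil c μ y) = A (dil c μ y) := fun y => by
    simp only [hA, (hasFDerivAt_moll_test φ c μ x _).fderiv, dil_inv_dil c hμ.ne']
    simp only [smul_apply, smul_eq_mul]
    field_simp
  rw [integral_congr_ae (Filter.Eventually.of_forall e2), integral_comp_dil c hμ.ne' A, hA,
    integral_const_mul, hw a]
  have hgx : ConvolutionExistsAt (φ.normed volume) (g ∘ dil c μ) x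
      (ContinuousLinearMap.lsmul ℝ ℝ) volume :=
    hφ.convolutionExists_left _ φ.continuous_normed hgl x
  rw [inner_smul_left, moll, convolution_eq_swap, ← real_inner_comm, ← integral_inner hgx.integrable_swap]
  set B : Plane → ℝ := fun z => φ.normed volume (x - dil c μ⁻¹ z) * ⟪g z, a⟫ with hB
  have e3 : ∀ y, ⟪a, ((ContinuousLinearMap.lsmul ℝ ℝ) (φ.normed volume (x - y)))
      ((g ∘ dil c μ) y)⟫ = B (dil c μ y) := fun y => by
    simp only [hB, dil_inv_dil c hμ.ne', ContinuousLinearMap.lsmul_apply, inner_smul_right,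
      Function.comp, real_inner_comm]
  rw [integral_congr_ae (Filter.Eventually.of_forall e3), integral_comp_dil c hμ.ne' B]
  simp only [conj_trivial]
  field_simp

lemma contDiff_moll (φ : ContDiffBump (0 : Plane)) {u : Plane → ℝ}
    (hu : LocallyIntegrable u volume) : ContDiff ℝ ∞ (moll φ u) :=
  (φ.hasCompactSupport_normed).contDiff_convolution_left _ φ.contDiff_normed hu

lemma eLpNorm_smul_moll_sub_le (φ : ContDiffBump (0 : Plane)) (c : Plane) {μ : ℝ}
    {g : Plane → Plane} (hg : MemLp g 2 volume) (hm : AEStronglyMeasurable (moll φ (g ∘ dil c μ)) volume) :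
    eLpNorm (μ • moll φ (g ∘ dil c μ) - g) 2 volume ≤
      ENNReal.ofReal |μ| * eLpNorm (moll φ (g ∘ dil c μ) - g) 2 volume +
        ENNReal.ofReal |μ - 1| * eLpNorm g 2 volume := by
  have : μ • moll φ (g ∘ dil c μ) - g = μ • (moll φ (g ∘ dil c μ) - g) + (μ - 1) • g := by
    rw [smul_sub, sub_smul, one_smul]; abel
  rw [this]
  refine (eLpNorm_add_le ((hm.sub hg.1).const_smul μ) (hg.1.const_smul _) (by norm_num)).trans ?_
  rw [eLpNorm_const_smul, eLpNorm_const_smul, ← Real.norm_eq_abs, ← Real.norm_eq_abs,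
    ofReal_norm, ofReal_norm]

/-- Gradients of mollified dilations are close to the weak gradient. -/
lemma exists_eLpNorm_smul_moll_sub_le (c : Plane) {g : Plane → Plane} (hg : MemLp g 2 volume)
    {δ : ℝ} (hδ : 0 < δ) :
    ∃ η > 0, ∀ μ : ℝ, |μ - 1| < η → ∀ φ : ContDiffBump (0 : Plane), φ.rOut < η →
      eLpNorm (μ • moll φ (g ∘ dil c μ) - g) 2 volume ≤ ENNReal.ofReal δ := by
  obtain ⟨η, hη0, hη⟩ := exists_eLpNorm_moll_comp_dil_sub_le c hg
    (δ := ENNReal.ofReal (δ / 4)) (by simpa using hδ)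
  set N := (eLpNorm g 2 volume).toReal with hN
  have hNn : 0 ≤ N := ENNReal.toReal_nonneg
  refine ⟨min η (min (1 / 2) (δ / (2 * (N + 1)))), by positivity, fun μ hμ φ hφ => ?_⟩
  have h1 : |μ - 1| < η := hμ.trans_le (min_le_left _ _)
  have h2 : |μ - 1| < 1 / 2 := hμ.trans_le ((min_le_right _ _).trans (min_le_left _ _))
  have h3 : |μ - 1| < δ / (2 * (N + 1)) := hμ.trans_le ((min_le_right _ _).trans (min_le_right _ _))
  have hμp : 0 < μ ∧ μ < 2 := by rw [abs_lt] at h2; constructor <;> linarith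
  have hgl : LocallyIntegrable (g ∘ dil c μ) volume :=
    (memLp_comp_dil c hμp.1 hg).locallyIntegrable (by norm_num)
  have hm : AEStronglyMeasurable (moll φ (g ∘ dil c μ)) volume :=
    ((φ.hasCompactSupport_normed).continuous_convolution_left _
      φ.continuous_normed hgl).aestronglyMeasurable
  refine (eLpNorm_smul_moll_sub_le φ c hg hm).trans ?_
  have hgN : eLpNorm g 2 volume = ENNReal.ofReal N := by
    rw [hN, ENNReal.ofReal_toReal hg.2.ne]
  rw [hgN, ← ENNReal.ofReal_mul (abs_nonneg _)]
  calc _ ≤ ENNReal.ofReal 2 * ENNReal.ofReal (δ / 4) + ENNReal.ofReal (|μ - 1| * N) := by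
        gcongr
        · rw [abs_of_pos hμp.1]; exact hμp.2.le
        · exact hη μ h1 φ (hφ.trans_le (min_le_left _ _))
    _ ≤ ENNReal.ofReal (2 * (δ / 4) + δ / 2) := by
        rw [← ENNReal.ofReal_mul (by norm_num), ← ENNReal.ofReal_add (by positivity) (by positivity)]
        apply ENNReal.ofReal_le_ofReal
        have : |μ - 1| * N ≤ δ / (2 * (N + 1)) * (N + 1) := by gcongr; linarith
        have h5 : δ / (2 * (N + 1)) * (N + 1) = δ / 2 := by field_simp
        linarith
    _ = ENNReal.ofReal δ := by congr 1; ring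

lemma IsH1Grad.integral_mul_fderiv {O : Set Plane} {v : Plane → ℝ}
    {g : Plane → Plane} (h : IsH1Grad O v g) {χ : Plane → ℝ} (hχ : ContDiff ℝ ∞ χ)
    (hs : HasCompactSupport χ) (hO : tsupport χ ⊆ O) (a : Plane) :
    ∫ x in O, v x * fderiv ℝ χ x a = -∫ x in O, χ x * ⟪g x, a⟫ := by
  have h1 := congrArg (fun b => ⟪a, b⟫) (h.2.2 χ hχ hs hO)
  have hcg : Continuous (gradient χ) := by
    have := hχ.continuous_fderiv (by norm_num)
    exact (InnerProductSpace.toDual ℝ Plane).symm.continuous.comp this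
  have hgs : HasCompactSupport (gradient χ) := by
    have := hs.fderiv ℝ
    exact this.comp_left (g := (InnerProductSpace.toDual ℝ Plane).symm) (map_zero _)
  have hi1 : Integrable (fun x => v x • gradient χ x) (volume.restrict O) :=
    memLp_one_iff_integrable.1 (MemLp.smul (p := 2) (q := 2) (r := 1)
      ((hcg.memLp_of_hasCompactSupport (μ := volume) hgs).restrict O) h.1)
  have hi2 : Integrable (fun x => χ x • g x) (volume.restrict O) :=
    memLp_one_iff_integrable.1 (MemLp.smul (p := 2) (q := 2) (r := 1) h.2.1
      ((hχ.continuous.memLp_of_hasCompactSupport (μ := volume) hs).restrict O))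
  simp only [inner_neg_right] at h1
  rw [← integral_inner hi1, ← integral_inner hi2] at h1
  simpa only [inner_smul_right, inner_gradient_right, conj_trivial, real_inner_comm] using h1

/-! ### Smooth approximation up to the boundary of a polygon -/

namespace Polygon2

variable {E : Polygon2} {c : Plane} {r : ℝ}

namespace StarAt

/-- A contraction towards the star centre moves the polygon inside itself with the margin `(1 - s) *
r`. This is the room in which one can mollify. -/
lemma ball_dil_subset (h : E.StarAt c r) {y : Plane} (hy : y ∈ E.carrier) {s : ℝ} (hs0 : 0 ≤ s)
    (hs1 : s < 1) : Metric.ball (dil c s y) ((1 - s) * r) ⊆ interior E.carrier := by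
  have hp : 0 < 1 - s := by linarith
  refine interior_maximal ?_ Metric.isOpen_ball
  intro z hz
  rw [Metric.mem_ball, dist_eq_norm] at hz
  set w : Plane := c + (1 - s)⁻¹ • (z - (c + s • (y - c)))
  have hw : w ∈ Metric.ball c r := by
    rw [Metric.mem_ball, dist_eq_norm]
    have : w - c = (1 - s)⁻¹ • (z - (c + s • (y - c))) := by simp [w]
    rw [this, norm_smul, Real.norm_eq_abs, abs_of_pos (inv_pos.2 hp), inv_mul_lt_iff₀ hp]
    exact hz
  have : z = (1 - s) • w + s • y := by
    simp only [w, smul_add, smul_smul, mul_inv_cancel₀ hp.ne', one_smul]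
    simp only [smul_sub, sub_smul, one_smul]; abel
  rw [this]
  exact h.star w hw hy hp.le hs0 (by ring)

/-- Interior approximation of `H¹` functions that are continuous up to the boundary. -/
theorem exists_smooth_approx (h : E.StarAt c r) {v : Plane → ℝ} {g : Plane → Plane}
    (hv : IsH1Grad (interior E.carrier) v g) (hc : ContinuousOn v E.carrier) {δ : ℝ} (hδ : 0 < δ) :
    ∃ w : Plane → ℝ, ContDiff ℝ ∞ w ∧ (∀ x ∈ E.carrier, |w x - v x| ≤ δ) ∧
      eLpNorm (gradient w - g) 2 (volume.restrict E.carrier) ≤ ENNReal.ofReal δ := by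
  have hEm : MeasurableSet E.carrier := E.isClosed_carrier.measurableSet
  set u := E.carrier.indicator v with hu
  set G := E.carrier.indicator g with hG
  have hvL := hv.1
  have hgL := hv.2.1
  rw [E.restrict_interior] at hvL hgL
  have hu2 : MemLp u 2 volume := memLp_indicator_of_restrict hEm hvL
  have hG2 : MemLp G 2 volume := memLp_indicator_of_restrict hEm hgL
  obtain ⟨η, hη0, hη⟩ := exists_eLpNorm_smul_moll_sub_le c hG2 hδ
  obtain ⟨θ, hθ0, hθ⟩ := Metric.uniformContinuousOn_iff.1
    (E.isCompact_carrier.uniformContinuousOn_of_continuous hc) δ hδ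
  obtain ⟨R, hR0, hR⟩ := E.isCompact_carrier.isBounded.subset_closedBall_lt 0 c
  -- The dilation with ratio `1 - κ` makes the dilated function live on a neighbourhood of the
  -- polygon. The mollification radius `ε` is kept at half the margin `κ * r` or less, so no value
  -- from outside is ever used.
  set κ := min (min (η / 2) (1 / 2)) (θ / (4 * (R + 1))) with hκ
  have hκ0 : 0 < κ := by positivity
  have hκ1 : κ ≤ η / 2 := (min_le_left _ _).trans (min_le_left _ _)
  have hκ2 : κ ≤ 1 / 2 := (min_le_left _ _).trans (min_le_right _ _)
  have hκ3 : κ ≤ θ / (4 * (R + 1)) := min_le_right _ _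
  set μ := 1 - κ with hμ
  have hμ0 : 0 < μ := by linarith
  have hμ1 : μ < 1 := by linarith
  have hμa : |μ - 1| = κ := by rw [hμ]; simp [abs_of_pos hκ0]
  set ε := min (min (η / 2) 1) (min (κ * r / 2) (θ / 4)) with hε
  have hrp := h.pos
  have hε0 : 0 < ε := by positivity
  have hε1 : ε ≤ η / 2 := (min_le_left _ _).trans (min_le_left _ _)
  have hε1' : ε ≤ 1 := (min_le_left _ _).trans (min_le_right _ _)
  have hε2 : ε ≤ κ * r / 2 := (min_le_right _ _).trans (min_le_left _ _)
  have hε3 : ε ≤ θ / 4 := (min_le_right _ _).trans (min_le_right _ _)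
  set φ : ContDiffBump (0 : Plane) := ⟨ε / 2, ε, by positivity, by linarith⟩ with hφ
  have hφr : φ.rOut = ε := rfl
  have hul : LocallyIntegrable (u ∘ dil c μ) volume :=
    (memLp_comp_dil c hμ0 hu2).locallyIntegrable (by norm_num)
  have hdil : ∀ x ∈ E.carrier, ∀ y, ‖y - x‖ ≤ ε → dil c μ y ∈ interior E.carrier := by
    intro x hx y hy
    refine h.ball_dil_subset hx hμ0.le hμ1 ?_
    rw [Metric.mem_ball, dist_eq_norm]
    have : dil c μ y - dil c μ x = μ • (y - x) := by
      simp only [dil, smul_sub]; abel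
    rw [this, norm_smul, Real.norm_eq_abs, abs_of_pos hμ0]
    have : κ * r = (1 - μ) * r := by rw [hμ]; ring
    nlinarith [norm_nonneg (y - x), mul_pos hκ0 hrp]
  refine ⟨moll φ (u ∘ dil c μ), contDiff_moll φ hul, fun x hx => ?_, ?_⟩
  · have hux : v x = u x := (indicator_of_mem hx v).symm
    rw [hux, ← Real.norm_eq_abs]
    refine norm_moll_comp_dil_sub_le φ c μ hul.aestronglyMeasurable x fun y hy => ?_
    rw [Metric.mem_ball, dist_eq_norm, hφr] at hy
    have hD := interior_subset (hdil x hx y hy.le)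
    rw [← hux, hu, indicator_of_mem hD, ← dist_eq_norm]
    refine (hθ _ hD _ hx ?_).le
    rw [dist_eq_norm]
    refine (norm_dil_sub_le c x y μ).trans_lt ?_
    rw [hμa]
    have hxc : ‖x - c‖ ≤ R := by have := hR hx; rwa [Metric.mem_closedBall, dist_eq_norm] at this
    have hyc : ‖y - c‖ ≤ R + 1 := by
      calc ‖y - c‖ = ‖(y - x) + (x - c)‖ := by congr 1; abel
        _ ≤ _ := norm_add_le _ _
        _ ≤ _ := by linarith
    have : κ * ‖y - c‖ ≤ θ / (4 * (R + 1)) * (R + 1) := by gcongr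
    have h5 : θ / (4 * (R + 1)) * (R + 1) = θ / 4 := by field_simp
    linarith
  · have hgrad : ∀ x ∈ E.carrier, gradient (moll φ (u ∘ dil c μ)) x = μ • moll φ (G ∘ dil c μ) x := by
      intro x hx
      refine fderiv_moll_comp_dil φ c hμ0 hu2 hG2 x fun a => ?_
      -- The kernel centred at `x`, seen after the dilation. Its support is compact in the interior,
      -- so it may be tested against the weak gradient of `v`.
      set χ : Plane → ℝ := fun z => φ.normed volume (x - dil c μ⁻¹ z) with hχ
      have hχs : Function.support χ ⊆ dil c μ '' Metric.closedBall x ε := by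
        intro z hz
        have : x - dil c μ⁻¹ z ∈ Function.support (φ.normed volume) := hz
        rw [φ.support_normed_eq, Metric.mem_ball, dist_eq_norm, sub_zero, hφr] at this
        refine ⟨dil c μ⁻¹ z, ?_, dil_dil_inv c hμ0.ne' z⟩
        rw [Metric.mem_closedBall, dist_comm, dist_eq_norm]; exact this.le
      have hKc : IsCompact (dil c μ '' Metric.closedBall x ε) :=
        (isCompact_closedBall x ε).image (continuous_dil c μ)
      have hts : tsupport χ ⊆ dil c μ '' Metric.closedBall x ε :=
        closure_minimal hχs hKc.isClosed
      have hKi : dil c μ '' Metric.closedBall x ε ⊆ interior E.carrier := by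
        rintro _ ⟨y, hy, rfl⟩
        rw [Metric.mem_closedBall, dist_eq_norm] at hy
        exact hdil x hx y hy
      have hχd : ContDiff ℝ ∞ χ := by
        refine φ.contDiff_normed.comp ?_
        unfold dil; fun_prop
      have h1 := hv.integral_mul_fderiv hχd
        (HasCompactSupport.of_support_subset_isCompact hKc hχs) (hts.trans hKi) a
      rw [E.restrict_interior, ← integral_indicator hEm, ← integral_indicator hEm] at h1
      have i1 : E.carrier.indicator (fun x => v x * fderiv ℝ χ x a) =
          fun z => u z * fderiv ℝ χ z a := by
        ext z
        by_cases hz : z ∈ E.carrier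
        · simp only [hu, indicator_of_mem hz]
        · simp only [hu, indicator_of_notMem hz, zero_mul]
      have i2 : E.carrier.indicator (fun x => χ x * ⟪g x, a⟫) = fun z => χ z * ⟪G z, a⟫ := by
        ext z
        by_cases hz : z ∈ E.carrier
        · simp only [hG, indicator_of_mem hz]
        · simp only [hG, indicator_of_notMem hz, inner_zero_left, mul_zero]
      rw [i1, i2] at h1
      exact h1
    refine le_trans ?_ (hη μ (by rw [hμa]; linarith) φ (by rw [hφr]; linarith))
    refine le_trans (le_of_eq ?_) (eLpNorm_restrict_le _ _ _ E.carrier)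
    refine eLpNorm_congr_ae ?_
    refine (ae_restrict_iff' hEm).2 (Filter.Eventually.of_forall fun x hx => ?_)
    simp only [Pi.sub_apply, hgrad x hx, Pi.smul_apply, hG, indicator_of_mem hx]

end StarAt

end Polygon2

/-! ### Cauchy-Schwarz inequalities and the Gauss-Green formula for H¹ functions -/

/-- Cauchy-Schwarz inequality in `L²`. -/
lemma abs_integral_inner_le {F : Type*} [NormedAddCommGroup F] [InnerProductSpace ℝ F]
    {α : Type*} [MeasurableSpace α] {μ : Measure α} {f g : α → F} (hf : MemLp f 2 μ)
    (hg : MemLp g 2 μ) :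
    |∫ x, ⟪f x, g x⟫ ∂μ| ≤ (eLpNorm f 2 μ).toReal * (eLpNorm g 2 μ).toReal := by
  have h1 : ∫ x, ⟪f x, g x⟫ ∂μ = ⟪hf.toLp f, hg.toLp g⟫ := by
    rw [L2.inner_def]
    refine integral_congr_ae ?_
    filter_upwards [hf.coeFn_toLp, hg.coeFn_toLp] with x hx hy
    rw [hx, hy]
  rw [h1, ← Lp.norm_toLp f hf, ← Lp.norm_toLp g hg]
  exact abs_real_inner_le_norm _ _

lemma toReal_eLpNorm_two_sq {F : Type*} [NormedAddCommGroup F] {α : Type*} [MeasurableSpace α]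
    {μ : Measure α} {f : α → F} (hf : MemLp f 2 μ) :
    (eLpNorm f 2 μ).toReal ^ 2 = ∫ x, ‖f x‖ ^ 2 ∂μ := by
  rw [← ENNReal.toReal_pow, eLpNorm_two_sq, integral_eq_lintegral_of_nonneg_ae (f := fun x => ‖f x‖ ^ 2)
    (Filter.Eventually.of_forall fun x => by positivity) (hf.1.norm.pow 2)]
  congr 1
  refine lintegral_congr fun x => ?_
  rw [ENNReal.ofReal_pow (norm_nonneg _), ofReal_norm]

/-- Cauchy-Schwarz inequality in `L²`, squared. -/
lemma sq_integral_inner_le {F : Type*} [NormedAddCommGroup F] [InnerProductSpace ℝ F]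
    {α : Type*} [MeasurableSpace α] {μ : Measure α} {f g : α → F} (hf : MemLp f 2 μ)
    (hg : MemLp g 2 μ) :
    (∫ x, ⟪f x, g x⟫ ∂μ) ^ 2 ≤ (∫ x, ‖f x‖ ^ 2 ∂μ) * ∫ x, ‖g x‖ ^ 2 ∂μ := by
  rw [← toReal_eLpNorm_two_sq hf, ← toReal_eLpNorm_two_sq hg, ← mul_pow, ← sq_abs]
  exact pow_le_pow_left₀ (abs_nonneg _) (abs_integral_inner_le hf hg) 2

lemma sq_integral_mul_le {α : Type*} [MeasurableSpace α] {μ : Measure α} {f g : α → ℝ}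
    (hf : MemLp f 2 μ) (hg : MemLp g 2 μ) :
    (∫ x, f x * g x ∂μ) ^ 2 ≤ (∫ x, f x ^ 2 ∂μ) * ∫ x, g x ^ 2 ∂μ := by
  have := sq_integral_inner_le hg hf
  simp only [Real.norm_eq_abs, sq_abs, RCLike.inner_apply, conj_trivial] at this
  rwa [mul_comm (∫ x, f x ^ 2 ∂μ)]

lemma integrable_inner_of_memLp {F : Type*} [NormedAddCommGroup F] [InnerProductSpace ℝ F]
    {α : Type*} [MeasurableSpace α] {μ : Measure α} {f g : α → F} (hf : MemLp f 2 μ)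
    (hg : MemLp g 2 μ) : Integrable (fun x => ⟪f x, g x⟫) μ := by
  refine (L2.integrable_inner (𝕜 := ℝ) (hf.toLp f) (hg.toLp g)).congr ?_
  filter_upwards [hf.coeFn_toLp, hg.coeFn_toLp] with x hx hy
  rw [hx, hy]

/-- Write f_n G_n - f₀ G₀ = (f_n - f₀) G_n + f₀ (G_n - G₀) and apply Cauchy-Schwarz on the finite
measure space to both terms: the first is small uniformly, the second in `L²`. -/
lemma tendsto_integral_mul_inner {S : Set Plane} (hSc : IsCompact S) {f : ℕ → Plane → ℝ} {f₀ : Plane → ℝ}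
    {G : ℕ → Plane → Plane} {G₀ : Plane → Plane} (hf : ∀ n, ContinuousOn (f n) S)
    (hf₀ : ContinuousOn f₀ S) (hu : TendstoUniformlyOn f f₀ Filter.atTop S)
    (hG : ∀ n, MemLp (G n) 2 (volume.restrict S)) (hG₀ : MemLp G₀ 2 (volume.restrict S))
    (hL : Filter.Tendsto (fun n => eLpNorm (G n - G₀) 2 (volume.restrict S)) Filter.atTop (𝓝 0))
    (a : Plane) :
    Filter.Tendsto (fun n => ∫ x in S, f n x * ⟪G n x, a⟫) Filter.atTop
      (𝓝 (∫ x in S, f₀ x * ⟪G₀ x, a⟫)) := by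
  have hSm := hSc.isClosed.measurableSet
  have hfin : IsFiniteMeasure (volume.restrict S) := ⟨by
    rw [Measure.restrict_apply_univ]; exact hSc.measure_lt_top⟩
  obtain ⟨M, hM⟩ : ∃ M : ℝ, ∀ x ∈ S, ‖f₀ x‖ ≤ M := hSc.exists_bound_of_continuousOn hf₀
  have bound : ∀ (g : Plane → ℝ) (K : ℝ), ContinuousOn g S → (∀ x ∈ S, ‖g x‖ ≤ K) →
      ∀ H : Plane → Plane, MemLp H 2 (volume.restrict S) →
      Integrable (fun x => g x * ⟪H x, a⟫) (volume.restrict S) ∧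
      |∫ x in S, g x * ⟪H x, a⟫| ≤
        K * ‖a‖ * (volume.real S) ^ (1 / 2 : ℝ) * (eLpNorm H 2 (volume.restrict S)).toReal := by
    intro g K hg hK H hH
    have hga : AEStronglyMeasurable (fun x => g x • a) (volume.restrict S) :=
      (hg.aestronglyMeasurable hSm).smul aestronglyMeasurable_const
    have hgb : ∀ᵐ x ∂(volume.restrict S), ‖g x • a‖ ≤ ‖K * ‖a‖‖ := by
      refine (ae_restrict_iff' hSm).2 (Filter.Eventually.of_forall fun x hx => ?_)
      have hK0 : 0 ≤ K := (norm_nonneg _).trans (hK x hx)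
      rw [norm_smul, Real.norm_of_nonneg (by positivity : 0 ≤ K * ‖a‖)]
      exact mul_le_mul_of_nonneg_right (hK x hx) (norm_nonneg _)
    have hgL : MemLp (fun x => g x • a) 2 (volume.restrict S) :=
      (memLp_const (K * ‖a‖)).mono hga hgb
    have e : ∀ x, g x * ⟪H x, a⟫ = ⟪g x • a, H x⟫ := fun x => by
      rw [inner_smul_left, real_inner_comm]; simp
    simp only [e]
    refine ⟨integrable_inner_of_memLp hgL hH, (abs_integral_inner_le hgL hH).trans ?_⟩
    gcongr
    by_cases hS : S.Nonempty
    · obtain ⟨x₀, hx₀⟩ := hS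
      have hK0 : 0 ≤ K := (norm_nonneg _).trans (hK x₀ hx₀)
      have h1 : eLpNorm (fun x => g x • a) 2 (volume.restrict S) ≤
          eLpNorm (fun _ : Plane => K * ‖a‖) 2 (volume.restrict S) := eLpNorm_mono_ae hgb
      rw [eLpNorm_const' _ (by norm_num) (by norm_num), Measure.restrict_apply_univ] at h1
      refine (ENNReal.toReal_mono ?_ h1).trans (le_of_eq ?_)
      · exact ENNReal.mul_ne_top enorm_ne_top
          (ENNReal.rpow_ne_top_of_nonneg (by norm_num) hSc.measure_lt_top.ne)
      · rw [ENNReal.toReal_mul, toReal_enorm, Real.norm_of_nonneg (by positivity),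
          ← ENNReal.toReal_rpow]; rfl
    · rw [not_nonempty_iff_eq_empty] at hS
      subst hS
      simp
  rw [Metric.tendsto_atTop]
  intro ε hε
  set B := ‖a‖ * (volume.real S) ^ (1 / 2 : ℝ) with hB
  have hB0 : 0 ≤ B := by positivity
  set N₀ := (eLpNorm G₀ 2 (volume.restrict S)).toReal with hN₀
  have hN0 : 0 ≤ N₀ := ENNReal.toReal_nonneg
  have hMp : 0 ≤ max M 0 := le_max_right _ _
  set κ := min 1 (ε / (2 * (B * (N₀ + 1) + B * max M 0 + 1))) with hκ
  have hκ0 : 0 < κ := by positivity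
  have h1 := Metric.tendstoUniformlyOn_iff.1 hu κ hκ0
  have h2 : ∀ᶠ n in Filter.atTop, (eLpNorm (G n - G₀) 2 (volume.restrict S)).toReal < κ := by
    have : Filter.Tendsto (fun n => (eLpNorm (G n - G₀) 2 (volume.restrict S)).toReal)
        Filter.atTop (𝓝 0) := by
      simpa [Function.comp_def] using (ENNReal.tendsto_toReal ENNReal.zero_ne_top).comp hL
    exact this.eventually_lt_const hκ0
  obtain ⟨N, hN⟩ := Filter.eventually_atTop.1 (h1.and h2)
  refine ⟨N, fun n hn => ?_⟩
  obtain ⟨hn1, hn2⟩ := hN n hn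
  have hb1 := bound (fun x => f n x - f₀ x) κ ((hf n).sub hf₀) (fun x hx => by
    have := (hn1 x hx).le
    rwa [dist_comm, dist_eq_norm] at this) (G n) (hG n)
  have hb2 := bound f₀ (max M 0) hf₀ (fun x hx => (hM x hx).trans (le_max_left _ _)) (G n - G₀)
    ((hG n).sub hG₀)
  have hb3 := bound f₀ (max M 0) hf₀ (fun x hx => (hM x hx).trans (le_max_left _ _)) G₀ hG₀
  have hGn : (eLpNorm (G n) 2 (volume.restrict S)).toReal ≤ N₀ + 1 := by
    have h3 : eLpNorm (G n) 2 (volume.restrict S) ≤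
        eLpNorm (G n - G₀) 2 (volume.restrict S) + eLpNorm G₀ 2 (volume.restrict S) := by
      have := eLpNorm_add_le ((hG n).sub hG₀).1 hG₀.1 (p := 2) (by norm_num)
      simpa using this
    have h4 := ENNReal.toReal_mono (ENNReal.add_ne_top.2 ⟨((hG n).sub hG₀).2.ne, hG₀.2.ne⟩) h3
    rw [ENNReal.toReal_add ((hG n).sub hG₀).2.ne hG₀.2.ne] at h4
    have : κ ≤ 1 := min_le_left _ _
    linarith
  have e : (∫ x in S, f n x * ⟪G n x, a⟫) - ∫ x in S, f₀ x * ⟪G₀ x, a⟫ =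
      (∫ x in S, (f n x - f₀ x) * ⟪G n x, a⟫) + ∫ x in S, f₀ x * ⟪(G n - G₀) x, a⟫ := by
    have hb12 : Integrable (fun x => (f n x - f₀ x) * ⟪G n x, a⟫ + f₀ x * ⟪(G n - G₀) x, a⟫)
      (volume.restrict S) := hb1.1.add hb2.1
    rw [← integral_add hb1.1 hb2.1, sub_eq_iff_eq_add, ← integral_add hb12 hb3.1]
    refine integral_congr_ae (Filter.Eventually.of_forall fun x => ?_)
    simp only [Pi.sub_apply, inner_sub_left]
    ring
  rw [Real.dist_eq, e]
  refine (abs_add_le _ _).trans_lt ?_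
  have k1 : |∫ x in S, (f n x - f₀ x) * ⟪G n x, a⟫| ≤ κ * (B * (N₀ + 1)) := by
    refine hb1.2.trans ?_
    rw [mul_assoc κ, mul_assoc κ]
    gcongr
  have k2 : |∫ x in S, f₀ x * ⟪(G n - G₀) x, a⟫| ≤ κ * (B * max M 0) := by
    refine hb2.2.trans ?_
    rw [mul_assoc (max M 0), ← hB]
    calc _ ≤ max M 0 * B * κ := by gcongr
      _ = _ := by ring
  have k3 : κ * (2 * (B * (N₀ + 1) + B * max M 0 + 1)) ≤ ε := by
    rw [← le_div_iff₀ (by positivity)]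
    exact min_le_right _ _
  nlinarith

lemma TendstoUniformlyOn.mul_of_isCompact {S : Set Plane} (hS : IsCompact S)
    {f g : ℕ → Plane → ℝ} {f₀ g₀ : Plane → ℝ} (hf : TendstoUniformlyOn f f₀ Filter.atTop S)
    (hg : TendstoUniformlyOn g g₀ Filter.atTop S) (hf₀ : ContinuousOn f₀ S)
    (hg₀ : ContinuousOn g₀ S) :
    TendstoUniformlyOn (fun n x => f n x * g n x) (fun x => f₀ x * g₀ x) Filter.atTop S :=
  (tendstoLocallyUniformlyOn_iff_tendstoUniformlyOn_of_compact hS).1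
    (hf.tendstoLocallyUniformlyOn.mul₀ hg.tendstoLocallyUniformlyOn hf₀ hg₀)

lemma continuous_gradient {f : Plane → ℝ} (hf : ContDiff ℝ 1 f) : Continuous (gradient f) :=
  (InnerProductSpace.toDual ℝ Plane).symm.continuous.comp (hf.continuous_fderiv (by norm_num))

namespace Polygon2

variable {E : Polygon2} {c : Plane} {r : ℝ}

lemma memLp_of_continuousOn {F : Type*} [NormedAddCommGroup F] (E : Polygon2) {f : Plane → F}
    (hf : ContinuousOn f E.carrier) : MemLp f 2 (volume.restrict E.carrier) := by
  have hEm : MeasurableSet E.carrier := E.isClosed_carrier.measurableSet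
  have hfin : IsFiniteMeasure (volume.restrict E.carrier) := ⟨by
    rw [Measure.restrict_apply_univ]; exact E.isCompact_carrier.measure_lt_top⟩
  obtain ⟨M, hM⟩ := E.isCompact_carrier.exists_bound_of_continuousOn hf
  refine MemLp.of_bound (hf.aestronglyMeasurable_of_isCompact E.isCompact_carrier hEm) M ?_
  exact (ae_restrict_iff' hEm).2 (Filter.Eventually.of_forall fun x hx => hM x hx)

namespace StarAt

lemma exists_smooth_seq (h : E.StarAt c r) {v : Plane → ℝ} {g : Plane → Plane}
    (hv : IsH1Grad (interior E.carrier) v g) (hc : ContinuousOn v E.carrier) :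
    ∃ w : ℕ → Plane → ℝ, (∀ n, ContDiff ℝ ∞ (w n)) ∧
      TendstoUniformlyOn w v Filter.atTop E.carrier ∧
      Filter.Tendsto (fun n => eLpNorm (gradient (w n) - g) 2 (volume.restrict E.carrier))
        Filter.atTop (𝓝 0) := by
  choose w hw1 hw2 hw3 using fun n : ℕ =>
    h.exists_smooth_approx hv hc (δ := 1 / ((n : ℝ) + 1)) (by positivity)
  refine ⟨w, hw1, ?_, ?_⟩
  · rw [Metric.tendstoUniformlyOn_iff]
    intro ε hε
    filter_upwards [tendsto_one_div_add_atTop_nhds_zero_nat.eventually_lt_const hε] with n hn x hx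
    rw [dist_comm, Real.dist_eq]
    exact (hw2 n x hx).trans_lt hn
  · refine tendsto_of_tendsto_of_tendsto_of_le_of_le tendsto_const_nhds ?_ (fun n => zero_le) hw3
    have := ENNReal.tendsto_ofReal (tendsto_one_div_add_atTop_nhds_zero_nat (𝕜 := ℝ))
    simpa using this

lemma tendsto_edge_integral {f : ℕ → Plane → ℝ} {f₀ : Plane → ℝ} (i : Fin E.n)
    (hf : ∀ n, ContinuousOn (f n) E.carrier) (hf₀ : ContinuousOn f₀ E.carrier)
    (hu : TendstoUniformlyOn f f₀ Filter.atTop E.carrier) :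
    Filter.Tendsto (fun n => ∫ t in (0 : ℝ)..1, f n (E.edgePt i t)) Filter.atTop
      (𝓝 (∫ t in (0 : ℝ)..1, f₀ (E.edgePt i t))) := by
  have hmap : MapsTo (E.edgePt i) (Icc 0 1) E.carrier := fun t ht =>
    E.edge_subset_carrier i (E.edgePt_mem_edge i ht)
  have hint : ∀ {f : Plane → ℝ}, ContinuousOn f E.carrier →
      IntervalIntegrable (fun t => f (E.edgePt i t)) volume 0 1 := fun {f} hf =>
    (hf.comp (E.continuous_edgePt i).continuousOn hmap).intervalIntegrable_of_Icc zero_le_one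
  rw [Metric.tendsto_atTop]
  intro ε hε
  obtain ⟨N, hN⟩ := Filter.eventually_atTop.1 (Metric.tendstoUniformlyOn_iff.1 hu (ε / 2)
    (by positivity))
  refine ⟨N, fun n hn => ?_⟩
  rw [dist_eq_norm, ← intervalIntegral.integral_sub (hint (hf n)) (hint hf₀)]
  have := intervalIntegral.norm_integral_le_of_norm_le_const (a := (0 : ℝ)) (b := 1) (C := ε / 2)
    (f := fun t => f n (E.edgePt i t) - f₀ (E.edgePt i t)) (fun t ht => by
      rw [uIoc_of_le zero_le_one] at ht
      have := hN n hn _ (hmap (Ioc_subset_Icc_self ht))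
      rw [dist_comm, dist_eq_norm] at this
      exact this.le)
  simp only [sub_zero, abs_one, mul_one] at this
  linarith

/-- Gauss-Green formula for a product of functions in `H¹` that are continuous up to the boundary,
and a smooth function. -/
theorem gauss_green (h : E.StarAt c r) {v w F : Plane → ℝ} {gv gw : Plane → Plane}
    (hv : IsH1Grad (interior E.carrier) v gv) (hvc : ContinuousOn v E.carrier)
    (hw : IsH1Grad (interior E.carrier) w gw) (hwc : ContinuousOn w E.carrier)
    (hF : ContDiff ℝ 1 F) (a : Plane) :
    (∫ x in E.carrier, (v x * F x) * ⟪gw x, a⟫) + (∫ x in E.carrier, (w x * F x) * ⟪gv x, a⟫) +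
      (∫ x in E.carrier, v x * w x * ⟪gradient F x, a⟫) =
    E.orient c * ∑ i, det2 a (E.tau i) *
      ∫ t in (0 : ℝ)..1, v (E.edgePt i t) * w (E.edgePt i t) * F (E.edgePt i t) := by
  -- For the smooth approximants the formula is the divergence theorem for `vn * wn * F`. Uniform
  -- convergence of the functions with `L²` convergence of the gradients suffices for each volume
  -- term, and uniform convergence for each edge term.
  obtain ⟨vn, hvn, hvu, hvL⟩ := h.exists_smooth_seq hv hvc
  obtain ⟨wn, hwn, hwu, hwL⟩ := h.exists_smooth_seq hw hwc
  have hK := E.isCompact_carrier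
  have hgv := hv.2.1
  have hgw := hw.2.1
  rw [E.restrict_interior] at hgv hgw
  have hFc : ContinuousOn F E.carrier := hF.continuous.continuousOn
  have hFu : TendstoUniformlyOn (fun _ : ℕ => F) F Filter.atTop E.carrier := by
    rw [Metric.tendstoUniformlyOn_iff]; intro ε hε; simp [hε]
  have hvs : ∀ n, ContDiff ℝ 1 (vn n) := fun n => (hvn n).of_le (by norm_num)
  have hws : ∀ n, ContDiff ℝ 1 (wn n) := fun n => (hwn n).of_le (by norm_num)
  have hgF := continuous_gradient hF
  have l1 := tendsto_integral_mul_inner hK (f := fun n x => vn n x * F x) (G := fun n => gradient (wn n))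
    (fun n => ((hvs n).continuous.mul hF.continuous).continuousOn) (hvc.mul hFc)
    (hvu.mul_of_isCompact hK hFu hvc hFc)
    (fun n => E.memLp_of_continuousOn (continuous_gradient (hws n)).continuousOn) hgw hwL a
  have l2 := tendsto_integral_mul_inner hK (f := fun n x => wn n x * F x) (G := fun n => gradient (vn n))
    (fun n => ((hws n).continuous.mul hF.continuous).continuousOn) (hwc.mul hFc)
    (hwu.mul_of_isCompact hK hFu hwc hFc)
    (fun n => E.memLp_of_continuousOn (continuous_gradient (hvs n)).continuousOn) hgv hvL a
  have hvw := hvu.mul_of_isCompact hK hwu hvc hwc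
  have l3 := tendsto_integral_mul_inner hK (f := fun n x => vn n x * wn n x) (G := fun _ => gradient F)
    (fun n => ((hvs n).continuous.mul (hws n).continuous).continuousOn) (hvc.mul hwc)
    hvw (fun n => E.memLp_of_continuousOn hgF.continuousOn) (E.memLp_of_continuousOn hgF.continuousOn)
    (by simp) a
  have hvwF := hvw.mul_of_isCompact hK hFu (hvc.mul hwc) hFc
  have r1 : Filter.Tendsto (fun n => E.orient c * ∑ i, det2 a (E.tau i) *
      ∫ t in (0 : ℝ)..1, vn n (E.edgePt i t) * wn n (E.edgePt i t) * F (E.edgePt i t)) Filter.atTop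
      (𝓝 (E.orient c * ∑ i, det2 a (E.tau i) *
      ∫ t in (0 : ℝ)..1, v (E.edgePt i t) * w (E.edgePt i t) * F (E.edgePt i t))) := by
    refine Filter.Tendsto.const_mul _ (tendsto_finsetSum _ fun i _ => Filter.Tendsto.const_mul _ ?_)
    exact tendsto_edge_integral i
      (fun n => (((hvs n).continuous.mul (hws n).continuous).mul hF.continuous).continuousOn)
      ((hvc.mul hwc).mul hFc) hvwF
  refine tendsto_nhds_unique ((l1.add l2).add l3) (r1.congr fun n => ?_)
  have hp : ContDiff ℝ 1 (fun x => vn n x * wn n x * F x) := ((hvs n).mul (hws n)).mul hF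
  rw [← h.integral_carrier_fderiv hp a]
  have ci : ∀ {f : Plane → ℝ} {G : Plane → Plane}, Continuous f → Continuous G →
      Integrable (fun x => f x * ⟪G x, a⟫) (volume.restrict E.carrier) := fun {f G} hf hG =>
    ((hf.mul (hG.inner continuous_const)).continuousOn).integrableOn_compact hK
  have i1 : Integrable (fun x => vn n x * F x * ⟪gradient (wn n) x, a⟫)
      (volume.restrict E.carrier) := ci ((hvs n).continuous.mul hF.continuous) (continuous_gradient (hws n))
  have i2 : Integrable (fun x => wn n x * F x * ⟪gradient (vn n) x, a⟫)
      (volume.restrict E.carrier) := ci ((hws n).continuous.mul hF.continuous) (continuous_gradient (hvs n))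
  have i3 : Integrable (fun x => vn n x * wn n x * ⟪gradient F x, a⟫)
      (volume.restrict E.carrier) := ci ((hvs n).continuous.mul (hws n).continuous) hgF
  have i12 : Integrable (fun x => vn n x * F x * ⟪gradient (wn n) x, a⟫ +
      wn n x * F x * ⟪gradient (vn n) x, a⟫) (volume.restrict E.carrier) := i1.add i2
  rw [← integral_add i1 i2, ← integral_add i12 i3]
  refine integral_congr_ae (Filter.Eventually.of_forall fun x => ?_)
  have dv := (hvs n).differentiable (by norm_num) x
  have dw := (hws n).differentiable (by norm_num) x
  have dF := hF.differentiable (by norm_num) x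
  have dvw : DifferentiableAt ℝ (fun x => vn n x * wn n x) x := dv.mul dw
  simp only [inner_gradient_left]
  rw [fderiv_fun_mul dvw dF, fderiv_fun_mul dv dw]
  simp only [add_apply, smul_apply, smul_eq_mul]
  ring

end StarAt

end Polygon2

/-! ### Weak gradients of smooth and of Lipschitz functions -/

lemma integrable_mul_inner_of_memLp {α : Type*} [MeasurableSpace α] {μ : Measure α} {f : α → ℝ}
    {g : α → Plane} (hf : MemLp f 2 μ) (hg : MemLp g 2 μ) (a : Plane) :
    Integrable (fun x => f x * ⟪g x, a⟫) μ := by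
  have h1 : Integrable (fun x => f x • g x) μ := memLp_one_iff_integrable.1
    (MemLp.smul (p := 2) (q := 2) (r := 1) hg hf)
  refine (h1.inner_const a).congr (Filter.Eventually.of_forall fun x => ?_)
  simp [inner_smul_left]

/-- Testing against fixed directions reduces the vector identity to the scalar identities that the
divergence theorem provides. -/
lemma isH1Grad_of_scalar {O : Set Plane} {v : Plane → ℝ} {g : Plane → Plane}
    (hv : MemLp v 2 (volume.restrict O)) (hg : MemLp g 2 (volume.restrict O))
    (hs : ∀ φ : Plane → ℝ, ContDiff ℝ ∞ φ → HasCompactSupport φ → tsupport φ ⊆ O → ∀ a : Plane,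
      ∫ x in O, v x * ⟪gradient φ x, a⟫ = -∫ x in O, φ x * ⟪g x, a⟫) :
    IsH1Grad O v g := by
  refine ⟨hv, hg, fun φ hφ hc hO => ?_⟩
  have hcg : Continuous (gradient φ) := continuous_gradient (hφ.of_le (by norm_num))
  have hgs : HasCompactSupport (gradient φ) :=
    (hc.fderiv ℝ).comp_left (g := (InnerProductSpace.toDual ℝ Plane).symm) (map_zero _)
  have hi1 : Integrable (fun x => v x • gradient φ x) (volume.restrict O) :=
    memLp_one_iff_integrable.1 (MemLp.smul (p := 2) (q := 2) (r := 1)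
      ((hcg.memLp_of_hasCompactSupport (μ := volume) hgs).restrict O) hv)
  have hi2 : Integrable (fun x => φ x • g x) (volume.restrict O) :=
    memLp_one_iff_integrable.1 (MemLp.smul (p := 2) (q := 2) (r := 1) hg
      ((hφ.continuous.memLp_of_hasCompactSupport (μ := volume) hc).restrict O))
  refine ext_inner_left ℝ fun a => ?_
  rw [inner_neg_right, ← integral_inner hi1, ← integral_inner hi2]
  simpa only [inner_smul_right, real_inner_comm] using hs φ hφ hc hO a

lemma IsH1Grad.sub {O : Set Plane} {v w : Plane → ℝ} {gv gw : Plane → Plane}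
    (hv : IsH1Grad O v gv) (hw : IsH1Grad O w gw) : IsH1Grad O (v - w) (gv - gw) := by
  refine isH1Grad_of_scalar (hv.1.sub hw.1) (hv.2.1.sub hw.2.1) fun φ hφ hc hO a => ?_
  have h1 := hv.integral_mul_fderiv hφ hc hO a
  have h2 := hw.integral_mul_fderiv hφ hc hO a
  have hcg : Continuous (gradient φ) := continuous_gradient (hφ.of_le (by norm_num))
  have hgs : HasCompactSupport (gradient φ) :=
    (hc.fderiv ℝ).comp_left (g := (InnerProductSpace.toDual ℝ Plane).symm) (map_zero _)
  have mg := (hcg.memLp_of_hasCompactSupport (μ := volume) (p := 2) hgs).restrict O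
  have mφ := (hφ.continuous.memLp_of_hasCompactSupport (μ := volume) (p := 2) hc).restrict O
  have i1 := integrable_mul_inner_of_memLp hv.1 mg a
  have i2 := integrable_mul_inner_of_memLp hw.1 mg a
  have i3 := integrable_mul_inner_of_memLp mφ hv.2.1 a
  have i4 := integrable_mul_inner_of_memLp mφ hw.2.1 a
  simp only [← inner_gradient_left] at h1 h2
  simp only [Pi.sub_apply, sub_mul, inner_sub_left, mul_sub]
  rw [integral_sub i1 i2, integral_sub i3 i4, h1, h2]; ring

/-- By Rademacher's theorem the pointwise gradient exists almost everywhere, and Lipschitz functions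
may be integrated by parts against compactly supported ones. -/
lemma isH1Grad_of_lipschitz {O : Set Plane} (hOb : volume O ≠ ⊤)
    {w : Plane → ℝ} {L : NNReal} (hw : LipschitzWith L w)
    (hwO : MemLp w 2 (volume.restrict O)) : IsH1Grad O w (gradient w) := by
  have hfin : IsFiniteMeasure (volume.restrict O) := ⟨by
    rw [Measure.restrict_apply_univ]; exact hOb.lt_top⟩
  have hm : Measurable (gradient w) :=
    ((InnerProductSpace.toDual ℝ Plane).symm.continuous.measurable).comp (measurable_fderiv ℝ w)
  have hb : ∀ x, ‖gradient w x‖ ≤ L := fun x => by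
    rw [gradient, LinearIsometryEquiv.norm_map]
    exact norm_fderiv_le_of_lipschitz ℝ hw
  refine isH1Grad_of_scalar hwO (MemLp.of_bound hm.aestronglyMeasurable L
    (Filter.Eventually.of_forall hb)) fun φ hφ hc hφO a => ?_
  have hφ1 : ContDiff ℝ 1 φ := hφ.of_le (by norm_num)
  obtain ⟨D, hD⟩ := (hφ1.lipschitzWith_of_hasCompactSupport hc (by norm_num))
  have h1 := hw.integral_lineDeriv_mul_eq (μ := volume) hD hc a
  have hdφ : ∀ x, lineDeriv ℝ φ x (-a) = -⟪gradient φ x, a⟫ := fun x => by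
    rw [(hφ1.differentiable (by norm_num) x).lineDeriv_eq_fderiv, map_neg, inner_gradient_left]
  have hz : ∀ x ∉ O, gradient φ x = 0 := fun x hx => by
    have : x ∉ tsupport (fderiv ℝ φ) := fun h => hx (hφO (tsupport_fderiv_subset ℝ h))
    rw [gradient, image_eq_zero_of_notMem_tsupport this, map_zero]
  have hz' : ∀ x ∉ O, φ x = 0 := fun x hx => image_eq_zero_of_notMem_tsupport fun h => hx (hφO h)
  rw [setIntegral_eq_integral_of_forall_compl_eq_zero (fun x hx => by rw [hz x hx]; simp),
    setIntegral_eq_integral_of_forall_compl_eq_zero (fun x hx => by rw [hz' x hx]; simp)]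
  have e1 : ∫ x, lineDeriv ℝ w x a * φ x = ∫ x, φ x * ⟪gradient w x, a⟫ := by
    refine integral_congr_ae ?_
    filter_upwards [hw.ae_differentiableAt (μ := volume)] with x hx
    rw [hx.lineDeriv_eq_fderiv, inner_gradient_left, mul_comm]
  have e2 : ∫ x, lineDeriv ℝ φ x (-a) * w x = -∫ x, w x * ⟪gradient φ x, a⟫ := by
    rw [← integral_neg]
    refine integral_congr_ae (Filter.Eventually.of_forall fun x => ?_)
    simp only [hdφ]; ring
  rw [← e1, h1, e2, neg_neg]

/-- A function that is Lipschitz on each member of a finite closed cover is Lipschitz. -/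
lemma abs_sub_le_of_closed_cover {ι : Type*} [Finite ι] (A : ι → Set Plane)
    (hA : ∀ i, IsClosed (A i)) (hcov : ∀ x, ∃ i, x ∈ A i) {f : Plane → ℝ} {L : ℝ} (hL : 0 ≤ L)
    (hf : ∀ i, ∀ x ∈ A i, ∀ y ∈ A i, |f x - f y| ≤ L * ‖x - y‖) (x y : Plane) :
    |f x - f y| ≤ L * ‖x - y‖ := by
  have hcont : Continuous f := by
    refine (locallyFinite_of_finite A).continuous (iUnion_eq_univ_iff.2 hcov) hA fun i => ?_
    refine LipschitzOnWith.continuousOn (K := L.toNNReal) ?_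
    refine LipschitzOnWith.of_dist_le_mul fun x hx y hy => ?_
    rw [Real.dist_eq, dist_eq_norm, Real.coe_toNNReal _ hL]
    exact hf i x hx y hy
  set z : ℝ → Plane := fun τ => x + τ • (y - x) with hz
  have hzc : Continuous z := by rw [hz]; fun_prop
  -- Continuous induction along the segment from `x` to `y`: the set is closed in the unit interval,
  -- and beyond each of its points below 1 there are further ones arbitrarily near.
  set s : Set ℝ := {τ | |f (z τ) - f x| ≤ L * (τ * ‖y - x‖)} with hs
  have hsub : Icc (0 : ℝ) 1 ⊆ s := by
    refine IsClosed.Icc_subset_of_forall_exists_gt ?_ ?_ ?_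
    · refine IsClosed.inter ?_ isClosed_Icc
      exact isClosed_le ((hcont.comp hzc).sub continuous_const).abs (by fun_prop)
    · simp [hs, hz]
    · rintro τ ⟨hτs, hτ0, hτ1⟩ τ' hτ'
      have hlt : τ < τ' := hτ'
      set u : ℕ → ℝ := fun k => τ + (τ' - τ) * (1 / ((k : ℝ) + 1)) with hu
      have hut : Filter.Tendsto u Filter.atTop (𝓝 τ) := by
        have := ((tendsto_one_div_add_atTop_nhds_zero_nat (𝕜 := ℝ)).const_mul (τ' - τ)).const_add τ
        simpa [hu] using this
      -- The cover is finite, so one member contains infinitely many of the points `z (u k)` and,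
      -- being closed, their limit `z τ`. The Lipschitz bound on that member gives the next point.
      obtain ⟨i, hi⟩ : ∃ i, ∃ᶠ k in Filter.atTop, z (u k) ∈ A i := by
        by_contra! hcon
        have h2 : ∀ i, ∀ᶠ k in Filter.atTop, z (u k) ∉ A i := fun i => by
          have := hcon i
          exact this
        obtain ⟨k, hk⟩ := (Filter.eventually_all.2 h2).exists
        obtain ⟨i, hi⟩ := hcov (z (u k))
        exact hk i hi
      have hτi : z τ ∈ A i := (hA i).mem_of_frequently_of_tendsto hi ((hzc.tendsto τ).comp hut)
      obtain ⟨k, hk⟩ := hi.exists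
      have hk1 : (1 : ℝ) / ((k : ℝ) + 1) ≤ 1 := by
        rw [div_le_one (by positivity)]; linarith [(Nat.cast_nonneg k : (0 : ℝ) ≤ k)]
      have hk0 : 0 < (1 : ℝ) / ((k : ℝ) + 1) := by positivity
      have hd : 0 < τ' - τ := by linarith
      refine ⟨u k, ?_, by simp only [hu]; nlinarith, by simp only [hu]; nlinarith⟩
      have h1 := hf i _ hk _ hτi
      have h2 : z (u k) - z τ = (u k - τ) • (y - x) := by
        simp only [hz, sub_smul]; abel
      have h5 : 0 < u k - τ := by simp only [hu]; nlinarith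
      rw [h2, norm_smul, Real.norm_eq_abs, abs_of_pos h5] at h1
      have h3 : |f (z τ) - f x| ≤ L * (τ * ‖y - x‖) := hτs
      have h4 := abs_sub_le (f (z (u k))) (f (z τ)) (f x)
      change |f (z (u k)) - f x| ≤ _
      nlinarith
  have h1 := hsub (right_mem_Icc.2 zero_le_one)
  have h2 : z 1 = y := by simp [hz]
  simp only [hs, mem_ofPred_eq, h2, one_mul] at h1
  rw [abs_sub_comm, norm_sub_rev]; exact h1

namespace Polygon2

variable {E : Polygon2} {c : Plane} {r : ℝ}

namespace StarAt

/-- The divergence theorem for `w * φ`; the boundary terms vanish with the test function. -/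
lemma isH1Grad_of_contDiff (h : E.StarAt c r) {w : Plane → ℝ} (hw : ContDiff ℝ 1 w) :
    IsH1Grad (interior E.carrier) w (gradient w) := by
  have hgw := continuous_gradient hw
  refine isH1Grad_of_scalar ?_ ?_ fun φ hφ hc hO a => ?_
  · rw [E.restrict_interior]; exact E.memLp_of_continuousOn hw.continuous.continuousOn
  · rw [E.restrict_interior]; exact E.memLp_of_continuousOn hgw.continuousOn
  rw [E.restrict_interior]
  have hφ1 : ContDiff ℝ 1 φ := hφ.of_le (by norm_num)
  have hgφ := continuous_gradient hφ1
  have h1 := h.integral_carrier_fderiv (hw.mul hφ1) a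
  have h2 : ∀ i, (∫ t in (0 : ℝ)..1, w (E.edgePt i t) * φ (E.edgePt i t)) = 0 := fun i => by
    rw [intervalIntegral.integral_congr (g := fun _ => 0), intervalIntegral.integral_zero]
    intro t ht
    rw [uIcc_of_le zero_le_one] at ht
    have h3 := E.edge_subset_frontier i (E.edgePt_mem_edge i ht)
    have h4 : φ (E.edgePt i t) = 0 := image_eq_zero_of_notMem_tsupport fun h5 => h3.2 (hO h5)
    simp [h4]
  simp only [h2, mul_zero, Finset.sum_const_zero] at h1
  have ci : ∀ {f : Plane → ℝ} {G : Plane → Plane}, Continuous f → Continuous G →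
      Integrable (fun x => f x * ⟪G x, a⟫) (volume.restrict E.carrier) := fun {f G} hf hG =>
    ((hf.mul (hG.inner continuous_const)).continuousOn).integrableOn_compact E.isCompact_carrier
  rw [eq_neg_iff_add_eq_zero, ← integral_add (ci hw.continuous hgφ) (ci hφ1.continuous hgw), ← h1]
  refine integral_congr_ae (Filter.Eventually.of_forall fun x => ?_)
  have dw := hw.differentiable (by norm_num) x
  have dφ := hφ1.differentiable (by norm_num) x
  simp only [inner_gradient_left]
  rw [fderiv_fun_mul dw dφ]
  simp only [add_apply, smul_apply, smul_eq_mul]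

set_option maxHeartbeats 1000000 in
/-- Functions in `H¹` that vanish on the boundary may be used as test functions. -/
theorem integral_inner_eq_of_eq_zero_on_frontier (h : E.StarAt c r) {u p : Plane → ℝ}
    {g G : Plane → Plane} (hu : IsH1Grad (interior E.carrier) u g) (hc : ContinuousOn u E.carrier)
    (h0 : ∀ x ∈ frontier E.carrier, u x = 0) (hG : MemLp G 2 (volume.restrict E.carrier))
    (hp : MemLp p 2 (volume.restrict E.carrier))
    (htest : ∀ φ : Plane → ℝ, ContDiff ℝ ∞ φ → HasCompactSupport φ → tsupport φ ⊆ interior E.carrier →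
      ∫ x in E.carrier, ⟪G x, gradient φ x⟫ = -∫ x in E.carrier, p x * φ x) :
    ∫ x in E.carrier, ⟪G x, g x⟫ = -∫ x in E.carrier, p x * u x := by
  have hEm : MeasurableSet E.carrier := E.isClosed_carrier.measurableSet
  set U := E.carrier.indicator u with hU
  set g₀ := E.carrier.indicator g with hg₀
  have huL := hu.1
  have hgL := hu.2.1
  rw [E.restrict_interior] at huL hgL
  have hU2 : MemLp U 2 volume := memLp_indicator_of_restrict hEm huL
  have hg2 : MemLp g₀ 2 volume := memLp_indicator_of_restrict hEm hgL
  have hone : IsH1Grad (interior E.carrier) (fun _ => (1 : ℝ)) (gradient fun _ : Plane => (1 : ℝ)) :=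
    h.isH1Grad_of_contDiff contDiff_const
  -- Extended by zero, `u` has the zero extension of `g` as weak gradient on the whole plane: its
  -- vanishing on the boundary removes the boundary terms of Gauss-Green for every C¹ function `χ`,
  -- whatever its support.
  have hrel : ∀ χ : Plane → ℝ, ContDiff ℝ 1 χ → ∀ a : Plane,
      ∫ z, U z * fderiv ℝ χ z a = -∫ z, χ z * ⟪g₀ z, a⟫ := by
    intro χ hχ a
    have h1 := h.gauss_green hu hc hone continuousOn_const hχ a
    have h2 : ∀ i, (∫ t in (0 : ℝ)..1, u (E.edgePt i t) * 1 * χ (E.edgePt i t)) = 0 := fun i => by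
      rw [intervalIntegral.integral_congr (g := fun _ => 0), intervalIntegral.integral_zero]
      intro t ht
      rw [uIcc_of_le zero_le_one] at ht
      simp [h0 _ (E.edge_subset_frontier i (E.edgePt_mem_edge i ht))]
    simp only [h2, mul_zero, Finset.sum_const_zero] at h1
    simp only [gradient_fun_const, inner_zero_left, mul_zero,
      integral_zero, zero_add, one_mul, mul_one, inner_gradient_left] at h1
    have i1 : E.carrier.indicator (fun x => u x * fderiv ℝ χ x a) =
        fun z => U z * fderiv ℝ χ z a := by
      ext z
      by_cases hz : z ∈ E.carrier
      · simp only [hU, indicator_of_mem hz]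
      · simp only [hU, indicator_of_notMem hz, zero_mul]
    have i2 : E.carrier.indicator (fun x => χ x * ⟪g x, a⟫) = fun z => χ z * ⟪g₀ z, a⟫ := by
      ext z
      by_cases hz : z ∈ E.carrier
      · simp only [hg₀, indicator_of_mem hz]
      · simp only [hg₀, indicator_of_notMem hz, inner_zero_left, mul_zero]
    rw [← integral_indicator hEm, ← integral_indicator hEm, i1, i2] at h1
    linarith
  have key : ∀ δ : ℝ, 0 < δ → |(∫ x in E.carrier, ⟪G x, g x⟫) + ∫ x in E.carrier, p x * u x| ≤
      ((eLpNorm G 2 (volume.restrict E.carrier)).toReal +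
        (eLpNorm p 2 (volume.restrict E.carrier)).toReal) * δ := by
    intro δ hδ
    obtain ⟨η₁, hη₁0, hη₁⟩ := exists_eLpNorm_smul_moll_sub_le c hg2 hδ
    obtain ⟨η₂, hη₂0, hη₂⟩ := exists_eLpNorm_moll_comp_dil_sub_le c hU2
      (δ := ENNReal.ofReal δ) (by simpa using hδ)
    -- Now the ratio exceeds 1: composing with the dilation shrinks the support of `U` into the
    -- interior, so that its mollification is an admissible test function.
    set μ := 1 + min η₁ η₂ / 2 with hμ
    have hmn : 0 < min η₁ η₂ := lt_min hη₁0 hη₂0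
    have hμ1 : 1 < μ := by linarith
    have hμ0 : 0 < μ := by linarith
    have hμa : |μ - 1| < min η₁ η₂ := by
      rw [hμ, add_sub_cancel_left, abs_of_pos (by linarith)]; linarith
    have hμi : μ⁻¹ < 1 := inv_lt_one_of_one_lt₀ hμ1
    have hμi0 : 0 < μ⁻¹ := inv_pos.2 hμ0
    set ε := min (min η₁ η₂) ((1 - μ⁻¹) * r) / 2 with hε
    have hrp := h.pos
    have hεp : 0 < min (min η₁ η₂) ((1 - μ⁻¹) * r) :=
      lt_min hmn (mul_pos (by linarith) hrp)
    have hε0 : 0 < ε := by positivity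
    have hε1 : ε < min η₁ η₂ := by
      have := min_le_left (min η₁ η₂) ((1 - μ⁻¹) * r); linarith
    have hε2 : ε < (1 - μ⁻¹) * r := by
      have := min_le_right (min η₁ η₂) ((1 - μ⁻¹) * r); linarith
    set φ : ContDiffBump (0 : Plane) := ⟨ε / 2, ε, by positivity, by linarith⟩ with hφ
    have hφr : φ.rOut = ε := rfl
    have hUl : LocallyIntegrable (U ∘ dil c μ) volume :=
      (memLp_comp_dil c hμ0 hU2).locallyIntegrable (by norm_num)
    set ψ := moll φ (U ∘ dil c μ) with hψ
    have hψs : ContDiff ℝ ∞ ψ := contDiff_moll φ hUl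
    -- The contracted polygon, thickened by the mollification radius. It contains the support of `ψ`
    -- and is compact in the interior because `ε < (1 - μ⁻¹) * r`.
    set K : Set Plane := (fun y : Plane × Plane => dil c μ⁻¹ y.1 + y.2) ''
      (E.carrier ×ˢ Metric.closedBall (0 : Plane) ε) with hK
    have hKc : IsCompact K := by
      refine (E.isCompact_carrier.prod (isCompact_closedBall _ _)).image ?_
      exact ((continuous_dil c μ⁻¹).comp continuous_fst).add continuous_snd
    have hKi : K ⊆ interior E.carrier := by
      rintro _ ⟨⟨e, b⟩, ⟨he, hb⟩, rfl⟩
      refine h.ball_dil_subset he hμi0.le hμi ?_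
      rw [mem_closedBall_zero_iff] at hb
      rw [Metric.mem_ball, dist_eq_norm, add_sub_cancel_left]
      exact lt_of_le_of_lt hb hε2
    have hsup : Function.support ψ ⊆ K := by
      intro x hx
      by_contra hxK
      apply hx
      change ∫ t, (φ.normed volume t) • (U ∘ dil c μ) (x - t) = 0
      rw [integral_congr_ae (g := fun _ => (0 : ℝ)) (Filter.Eventually.of_forall fun t => ?_)]
      · simp
      change (φ.normed volume t) • U (dil c μ (x - t)) = 0
      by_cases ht : t ∈ Metric.ball (0 : Plane) φ.rOut
      · have : dil c μ (x - t) ∉ E.carrier := fun hin => hxK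
          ⟨(dil c μ (x - t), t), ⟨hin, Metric.ball_subset_closedBall ht⟩, by
            simp [dil_inv_dil c hμ0.ne']⟩
        rw [hU, indicator_of_notMem this, smul_zero]
      · have : φ.normed volume t = 0 := by
          rw [← φ.support_normed_eq (μ := volume)] at ht
          exact Function.notMem_support.1 ht
        rw [this, zero_smul]
    have hψc : HasCompactSupport ψ := HasCompactSupport.of_support_subset_isCompact hKc hsup
    have hψt : tsupport ψ ⊆ interior E.carrier := (closure_minimal hsup hKc.isClosed).trans hKi
    have hT := htest ψ hψs hψc hψt
    have hgrad : gradient ψ = μ • moll φ (g₀ ∘ dil c μ) := by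
      ext1 x
      refine fderiv_moll_comp_dil φ c hμ0 hU2 hg2 x fun a => ?_
      refine hrel (fun z => φ.normed volume (x - dil c μ⁻¹ z)) ?_ a
      refine (φ.contDiff_normed (n := 1)).comp ?_
      unfold dil; fun_prop
    have hL1 : eLpNorm (gradient ψ - g) 2 (volume.restrict E.carrier) ≤ ENNReal.ofReal δ := by
      refine le_trans ?_ (hη₁ μ (hμa.trans_le (min_le_left _ _)) φ
        (hε1.trans_le (min_le_left _ _)))
      rw [← hgrad]
      refine le_trans (le_of_eq ?_) (eLpNorm_restrict_le _ _ _ E.carrier)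
      refine eLpNorm_congr_ae ?_
      refine (ae_restrict_iff' hEm).2 (Filter.Eventually.of_forall fun x hx => ?_)
      simp only [Pi.sub_apply, hg₀, indicator_of_mem hx]
    have hL2 : eLpNorm (ψ - u) 2 (volume.restrict E.carrier) ≤ ENNReal.ofReal δ := by
      refine le_trans ?_ (hη₂ μ (hμa.trans_le (min_le_right _ _)) φ
        (hε1.trans_le (min_le_right _ _)))
      refine le_trans (le_of_eq ?_) (eLpNorm_restrict_le _ _ _ E.carrier)
      refine eLpNorm_congr_ae ?_
      refine (ae_restrict_iff' hEm).2 (Filter.Eventually.of_forall fun x hx => ?_)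
      simp only [Pi.sub_apply, hU, indicator_of_mem hx, hψ]
    have mψg : MemLp (gradient ψ) 2 (volume.restrict E.carrier) :=
      E.memLp_of_continuousOn (continuous_gradient (hψs.of_le (by norm_num))).continuousOn
    have mψ : MemLp ψ 2 (volume.restrict E.carrier) :=
      E.memLp_of_continuousOn hψs.continuous.continuousOn
    have e : (∫ x in E.carrier, ⟪G x, g x⟫) + ∫ x in E.carrier, p x * u x =
        -((∫ x in E.carrier, ⟪G x, (gradient ψ - g) x⟫) +
          ∫ x in E.carrier, ⟪p x, (ψ - u) x⟫) := by
      have e1 : ∫ x in E.carrier, ⟪G x, (gradient ψ - g) x⟫ =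
          (∫ x in E.carrier, ⟪G x, gradient ψ x⟫) - ∫ x in E.carrier, ⟪G x, g x⟫ := by
        rw [← integral_sub (integrable_inner_of_memLp hG mψg) (integrable_inner_of_memLp hG hgL)]
        simp only [Pi.sub_apply, inner_sub_right]
      have e2 : ∫ x in E.carrier, ⟪p x, (ψ - u) x⟫ =
          (∫ x in E.carrier, p x * ψ x) - ∫ x in E.carrier, p x * u x := by
        have i1 : Integrable (fun x => p x * ψ x) (volume.restrict E.carrier) :=
          MemLp.integrable_mul hp mψ
        have i2 : Integrable (fun x => p x * u x) (volume.restrict E.carrier) :=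
          MemLp.integrable_mul hp huL
        rw [← integral_sub i1 i2]
        refine integral_congr_ae (Filter.Eventually.of_forall fun x => ?_)
        simp only [Pi.sub_apply, RCLike.inner_apply, conj_trivial]; ring
      rw [e1, e2, hT]; ring
    rw [e, abs_neg]
    refine (abs_add_le _ _).trans ?_
    rw [add_mul]
    have t1 := ENNReal.toReal_mono ENNReal.ofReal_ne_top hL1
    have t2 := ENNReal.toReal_mono ENNReal.ofReal_ne_top hL2
    rw [ENNReal.toReal_ofReal hδ.le] at t1 t2
    refine add_le_add ((abs_integral_inner_le hG (mψg.sub hgL)).trans ?_)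
      ((abs_integral_inner_le hp (mψ.sub huL)).trans ?_)
    · exact mul_le_mul_of_nonneg_left t1 ENNReal.toReal_nonneg
    · exact mul_le_mul_of_nonneg_left t2 ENNReal.toReal_nonneg
  set B := (eLpNorm G 2 (volume.restrict E.carrier)).toReal +
        (eLpNorm p 2 (volume.restrict E.carrier)).toReal with hB
  have hB0 : 0 ≤ B := add_nonneg ENNReal.toReal_nonneg ENNReal.toReal_nonneg
  -- The bound `key` holds for every positive `δ`, so the defect vanishes.
  have hz : |(∫ x in E.carrier, ⟪G x, g x⟫) + ∫ x in E.carrier, p x * u x| ≤ 0 := by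
    refine le_of_forall_pos_le_add fun ε hε => ?_
    refine (key (ε / (B + 1)) (by positivity)).trans ?_
    rw [zero_add, mul_div_assoc', div_le_iff₀ (by positivity)]
    nlinarith
  exact eq_neg_of_add_eq_zero_left (abs_nonpos_iff.1 hz)

end StarAt

end Polygon2

/-! ### Affine functions -/

/-- The gradient of an affine function. -/
def affGrad (p : Plane →ᵃ[ℝ] ℝ) : Plane :=
  (InnerProductSpace.toDual ℝ Plane).symm (LinearMap.toContinuousLinearMap p.linear)

lemma inner_affGrad (p : Plane →ᵃ[ℝ] ℝ) (x : Plane) : ⟪affGrad p, x⟫ = p.linear x := by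
  rw [affGrad, InnerProductSpace.toDual_symm_apply]; rfl

lemma affine_apply (p : Plane →ᵃ[ℝ] ℝ) (x y : Plane) : p x = p y + ⟪affGrad p, x - y⟫ := by
  rw [inner_affGrad, ← vsub_eq_sub, p.linearMap_vsub]; simp

lemma hasGradientAt_affine (p : Plane →ᵃ[ℝ] ℝ) (x : Plane) : HasGradientAt p (affGrad p) x := by
  rw [hasGradientAt_iff_hasFDerivAt, affGrad, LinearIsometryEquiv.apply_symm_apply]
  have h1 := (LinearMap.toContinuousLinearMap p.linear).hasFDerivAt (x := x)
  have h2 : (p : Plane → ℝ) = fun y => LinearMap.toContinuousLinearMap p.linear y + p 0 := by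
    ext y
    exact congrFun p.decomp y
  rw [h2]
  exact h1.add_const _

lemma gradient_affine (p : Plane →ᵃ[ℝ] ℝ) (x : Plane) : gradient p x = affGrad p :=
  (hasGradientAt_affine p x).gradient

lemma contDiff_affine (p : Plane →ᵃ[ℝ] ℝ) : ContDiff ℝ ∞ p := by
  have h2 : (p : Plane → ℝ) = fun y => LinearMap.toContinuousLinearMap p.linear y + p 0 := by
    ext y
    exact congrFun p.decomp y
  rw [h2]
  exact (LinearMap.toContinuousLinearMap p.linear).contDiff.add contDiff_const

lemma affGrad_sub (p q : Plane →ᵃ[ℝ] ℝ) : affGrad (p - q) = affGrad p - affGrad q := by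
  refine ext_inner_right ℝ fun x => ?_
  simp [inner_affGrad, inner_sub_left]

lemma affine_ext {p q : Plane →ᵃ[ℝ] ℝ} (c : Plane) (hc : p c = q c)
    (hg : affGrad p = affGrad q) : p = q := by
  ext x
  rw [affine_apply p x c, affine_apply q x c, hc, hg]

/-- The affine function with given gradient and given value at a point. -/
def mkAff (a c : Plane) (k : ℝ) : Plane →ᵃ[ℝ] ℝ :=
  (innerSL ℝ a : Plane →L[ℝ] ℝ).toLinearMap.toAffineMap + AffineMap.const ℝ Plane (k - ⟪a, c⟫)

lemma mkAff_apply (a c : Plane) (k : ℝ) (x : Plane) : mkAff a c k x = k + ⟪a, x - c⟫ := by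
  simp [mkAff, inner_sub_right]; ring

lemma affGrad_mkAff (a c : Plane) (k : ℝ) : affGrad (mkAff a c k) = a := by
  refine ext_inner_right ℝ fun x => ?_
  simp [inner_affGrad, mkAff]

lemma abs_affine_le (p : Plane →ᵃ[ℝ] ℝ) {x c : Plane} {h : ℝ} (hx : ‖x - c‖ ≤ h) :
    |p x| ≤ |p c| + h * ‖affGrad p‖ := by
  rw [affine_apply p x c]
  refine (abs_add_le _ _).trans (add_le_add le_rfl ((abs_real_inner_le_norm _ _).trans ?_))
  rw [mul_comm]
  exact mul_le_mul_of_nonneg_right hx (norm_nonneg _)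

/-- An affine function is controlled by its mean square on a ball. -/
lemma sq_affine_le_integral_ball (p : Plane →ᵃ[ℝ] ℝ) (c : Plane) {ρ : ℝ} (hρ : 0 < ρ) :
    ρ ^ 2 * (|p c| + ρ * ‖affGrad p‖) ^ 2 ≤ 200 * ∫ x in Metric.ball c ρ, p x ^ 2 := by
  set a := affGrad p with ha
  -- Moving from `c` by `ρ / 2` along the gradient, with or against it according to the sign of `p
  -- c`, makes both contributions add up. On the ball of radius `ρ / 8` around that point |p| is
  -- still at least 3/8 of |p c| + ρ‖a‖.
  obtain ⟨y, hyc, hy⟩ : ∃ y : Plane, ‖y - c‖ ≤ ρ / 2 ∧ |p y| = |p c| + ρ / 2 * ‖a‖ := by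
    by_cases h0 : a = 0
    · exact ⟨c, by simp; positivity, by simp [h0]⟩
    have hn : 0 < ‖a‖ := norm_pos_iff.2 h0
    rcases le_total 0 (p c) with h1 | h1
    · refine ⟨c + (ρ / 2 * ‖a‖⁻¹) • a, ?_, ?_⟩
      · rw [add_sub_cancel_left, norm_smul, Real.norm_eq_abs, abs_of_pos (by positivity)]
        apply le_of_eq; field_simp
      · rw [affine_apply p _ c, add_sub_cancel_left, ← ha, inner_smul_right,
          real_inner_self_eq_norm_sq, abs_of_nonneg h1, abs_of_nonneg (by positivity)]
        field_simp
    · refine ⟨c - (ρ / 2 * ‖a‖⁻¹) • a, ?_, ?_⟩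
      · rw [sub_sub_cancel_left, norm_neg, norm_smul, Real.norm_eq_abs, abs_of_pos (by positivity)]
        apply le_of_eq; field_simp
      · rw [affine_apply p _ c, sub_sub_cancel_left, ← ha, inner_neg_right, inner_smul_right,
          real_inner_self_eq_norm_sq, abs_of_nonpos h1,
          abs_of_nonpos (by have : 0 ≤ ρ / 2 * ‖a‖⁻¹ * ‖a‖ ^ 2 := by positivity
                            linarith)]
        field_simp; ring
  have hsub : Metric.ball y (ρ / 8) ⊆ Metric.ball c ρ :=
    Metric.ball_subset_ball' (by rw [dist_eq_norm]; linarith)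
  have hpc : Continuous p := (contDiff_affine p).continuous
  have hint : IntegrableOn (fun x => p x ^ 2) (Metric.ball c ρ) volume :=
    ((hpc.pow 2).continuousOn.integrableOn_compact (isCompact_closedBall c ρ)).mono_set
      Metric.ball_subset_closedBall
  have h1 : ∫ x in Metric.ball y (ρ / 8), (3 / 8 * (|p c| + ρ * ‖a‖)) ^ 2 ≤
      ∫ x in Metric.ball y (ρ / 8), p x ^ 2 := by
    refine setIntegral_mono_on ?_ (hint.mono_set hsub) Metric.isOpen_ball.measurableSet
      fun x hx => ?_
    · exact integrableOn_const Metric.isBounded_ball.measure_lt_top.ne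
    have h2 : |p y| - |p x| ≤ ρ / 8 * ‖a‖ := by
      rw [Metric.mem_ball, dist_comm, dist_eq_norm] at hx
      refine (abs_sub_abs_le_abs_sub _ _).trans ?_
      rw [affine_apply p y x, add_sub_cancel_left]
      refine (abs_real_inner_le_norm _ _).trans ?_
      rw [mul_comm]
      exact mul_le_mul_of_nonneg_right hx.le (norm_nonneg _)
    rw [hy] at h2
    have h3 := abs_nonneg (p c)
    have h4 : 0 ≤ ρ * ‖a‖ := by positivity
    rw [← sq_abs (p x)]
    refine pow_le_pow_left₀ (by positivity) ?_ 2
    nlinarith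
  have h2 : ∫ x in Metric.ball y (ρ / 8), p x ^ 2 ≤ ∫ x in Metric.ball c ρ, p x ^ 2 :=
    setIntegral_mono_set hint (Filter.Eventually.of_forall fun x => sq_nonneg _) hsub.eventuallyLE
  rw [setIntegral_const, smul_eq_mul, Measure.real, EuclideanSpace.volume_ball_fin_two,
    ENNReal.toReal_mul, ENNReal.toReal_pow, ENNReal.toReal_ofReal (by positivity)] at h1
  rw [ENNReal.toReal_ofReal Real.pi_pos.le] at h1
  -- The factor obtained is (3/8)² π/64 = 9π/4096, which exceeds 1/200 since π > 3.
  have hpi := Real.pi_gt_three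
  have h6 : 0 ≤ ρ ^ 2 * (|p c| + ρ * ‖a‖) ^ 2 := by positivity
  nlinarith

lemma volume_real_ball (c : Plane) {ρ : ℝ} (hρ : 0 ≤ ρ) :
    (volume (Metric.ball c ρ)).toReal = ρ ^ 2 * Real.pi := by
  rw [EuclideanSpace.volume_ball_fin_two, ENNReal.toReal_mul, ENNReal.toReal_pow,
    ENNReal.toReal_ofReal hρ, ENNReal.toReal_ofReal Real.pi_pos.le]

/-! ### A scaled bump function -/

/-- Smooth cut-offs: one near a point, supported in a ball, with derivative of the right size. -/
lemma exists_bump : ∃ K : ℝ, 0 < K ∧ ∀ (y : Plane) (s : ℝ), 0 < s → ∃ ψ : Plane → ℝ,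
    ContDiff ℝ ∞ ψ ∧ HasCompactSupport ψ ∧ tsupport ψ ⊆ Metric.closedBall y s ∧
    (∀ x, ‖x - y‖ ≤ s / 2 → ψ x = 1) ∧ (∀ x, 0 ≤ ψ x) ∧ (∀ x, ψ x ≤ 1) ∧
    ∀ x, ‖gradient ψ x‖ ≤ K / s := by
  set φ : ContDiffBump (0 : Plane) := ⟨1 / 2, 1, by norm_num, by norm_num⟩ with hφ
  have hφs : ContDiff ℝ ∞ φ := φ.contDiff
  have hc : Continuous (fderiv ℝ φ) := hφs.continuous_fderiv (by norm_num)
  obtain ⟨K, hK⟩ := (φ.hasCompactSupport.fderiv ℝ).exists_bound_of_continuous hc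
  refine ⟨|K| + 1, by positivity, fun y s hs => ?_⟩
  set A : Plane → Plane := fun x => s⁻¹ • (x - y) with hA
  have hAd : ContDiff ℝ ∞ A := by fun_prop
  have hsupp : Function.support (φ ∘ A) ⊆ Metric.closedBall y s := by
    intro x hx
    have h1 : A x ∈ Function.support φ := hx
    rw [φ.support_eq, Metric.mem_ball, dist_zero_right, hA] at h1
    rw [norm_smul, Real.norm_eq_abs, abs_of_pos (inv_pos.2 hs), inv_mul_lt_iff₀ hs] at h1
    rw [Metric.mem_closedBall, dist_eq_norm]
    have : φ.rOut = 1 := rfl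
    rw [this] at h1; linarith
  refine ⟨φ ∘ A, hφs.comp hAd, HasCompactSupport.of_support_subset_isCompact
    (isCompact_closedBall y s) hsupp, closure_minimal hsupp Metric.isClosed_closedBall,
    fun x hx => ?_, fun x => φ.nonneg, fun x => φ.le_one, fun x => ?_⟩
  · refine φ.one_of_mem_closedBall ?_
    rw [Metric.mem_closedBall, dist_zero_right, hA]
    rw [norm_smul, Real.norm_eq_abs, abs_of_pos (inv_pos.2 hs), inv_mul_le_iff₀ hs]
    have : φ.rIn = 1 / 2 := rfl
    rw [this]; linarith
  · rw [gradient, LinearIsometryEquiv.norm_map]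
    have h1 : HasFDerivAt A (s⁻¹ • ContinuousLinearMap.id ℝ Plane) x :=
      ((hasFDerivAt_id x).sub_const y).const_smul s⁻¹
    have h2 := (hφs.differentiable (by norm_num) (A x)).hasFDerivAt.comp x h1
    rw [h2.fderiv, ContinuousLinearMap.comp_smul, ContinuousLinearMap.comp_id, norm_smul,
      Real.norm_eq_abs, abs_of_pos (inv_pos.2 hs), div_eq_inv_mul]
    refine mul_le_mul_of_nonneg_left ?_ (inv_pos.2 hs).le
    have := hK (A x)
    have := le_abs_self K
    linarith

/-! ### Edgewise affine functions and their conical extension -/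

namespace Polygon2

variable {E : Polygon2} {c : Plane} {r : ℝ}

/-- `v` is affine along each edge. -/
def EdgeLinear (E : Polygon2) (v : Plane → ℝ) : Prop :=
  ∀ i, ∃ p : Plane →ᵃ[ℝ] ℝ, EqOn v p (E.edge i)

lemma EdgeLinear.apply_edgePt {v : Plane → ℝ} (hv : E.EdgeLinear v) (i : Fin E.n) {t : ℝ}
    (ht : t ∈ Icc (0 : ℝ) 1) :
    v (E.edgePt i t) = (1 - t) * v (E.vertex i) + t * v (E.nextVertex i) := by
  obtain ⟨p, hp⟩ := hv i
  rw [hp (E.edgePt_mem_edge i ht), hp (E.vertex_mem_edge i), hp (E.nextVertex_mem_edge i),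
    Polygon2.edgePt, AffineMap.apply_lineMap, AffineMap.lineMap_apply]
  simp; ring

namespace StarAt

/-- The conical extension of boundary values. -/
lemma exists_conical_extension (h : E.StarAt c r) {v : Plane → ℝ} (hv : E.EdgeLinear v)
    {m H ρ : ℝ} (hm : ∀ i, |v (E.vertex i)| ≤ m) (hH : ∀ x ∈ E.carrier, ‖x - c‖ ≤ H) (hρ : 0 < ρ)
    (hρE : ∀ i, ρ ≤ ‖E.tau i‖) :
    ∃ w : Plane → ℝ, (∀ x ∈ frontier E.carrier, w x = v x) ∧
      (∀ x y, |w x - w y| ≤ 2 * H * m / (r * ρ) * ‖x - y‖) ∧ ∀ x ∈ E.carrier, |w x| ≤ m := by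
  choose κ hκ using h.exists_mem_cone
  have hm0 : 0 ≤ m := (abs_nonneg _).trans (hm E.zeroIdx)
  have hH0 : 0 ≤ H := (norm_nonneg _).trans (hH _ (E.vertex_mem_carrier E.zeroIdx))
  have hr := h.pos
  -- Linear in each cone with value zero at the apex, thus positively homogeneous of degree one. The
  -- choice of the cone `κ z` is arbitrary; `hwi` shows that it does not matter.
  set w : Plane → ℝ := fun z => E.coneA c (κ z) z * v (E.vertex (κ z)) +
    E.coneB c (κ z) z * v (E.nextVertex (κ z)) with hw
  have hmn : ∀ i, |v (E.nextVertex i)| ≤ m := fun i => hm _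
  have hwi : ∀ i, ∀ z ∈ E.cone c i,
      w z = E.coneA c i z * v (E.vertex i) + E.coneB c i z * v (E.nextVertex i) := by
    -- The value is the gauge of `z` times the boundary value at the radial projection of `z`;
    -- neither depends on the cone.
    have key : ∀ i z, z ∈ E.cone c i → z ≠ c →
        E.coneA c i z * v (E.vertex i) + E.coneB c i z * v (E.nextVertex i) =
        (E.coneA c i z + E.coneB c i z) *
          v (c + (E.coneA c i z + E.coneB c i z)⁻¹ • (z - c)) := by
      intro i z hz hzc
      have hp := h.cone_sum_pos hz hzc
      obtain ⟨t, ht, hte⟩ := (E.mem_edge_iff i _).1 (h.radial_mem_edge hz hzc)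
      have h1 := h.coneB_edgePt i t
      rw [hte, coneB_ray] at h1
      rw [← hte, hv.apply_edgePt i ht, ← h1]
      field_simp
      ring
    intro i z hz
    by_cases hzc : z = c
    · simp only [hw, hzc, coneA_center, coneB_center]; ring
    · simp only [hw]
      rw [key _ _ (hκ z) hzc, key _ _ hz hzc, h.cone_sum_eq (hκ z) hz]
  refine ⟨w, fun x hx => ?_, fun x y => ?_, fun x hx => ?_⟩
  · obtain ⟨i, hi⟩ := (mem_frontier_iff x).1 hx
    rw [hwi i x (h.mem_cone_of_mem_edge hi).1]
    obtain ⟨t, ht, rfl⟩ := (E.mem_edge_iff i _).1 hi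
    rw [h.coneA_edgePt, h.coneB_edgePt, hv.apply_edgePt i ht]
  · refine abs_sub_le_of_closed_cover (E.cone c) (E.isClosed_cone c) (fun x => ⟨κ x, hκ x⟩)
      (by positivity) (fun i x hx y hy => ?_) x y
    rw [hwi i x hx, hwi i y hy]
    -- The cone coordinates are determinants divided by `coneDet`, so their Lipschitz constants are
    -- at most `H / (r * ρ)`.
    have hD : r * ρ ≤ |E.coneDet c i| :=
      (mul_le_mul_of_nonneg_left (hρE i) hr.le).trans (h.le_abs_det i)
    have hD0 : 0 < r * ρ := by positivity
    have hq : ∀ q : Plane, ‖q‖ ≤ H → |det2 (x - y) q| / |E.coneDet c i| ≤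
        H / (r * ρ) * ‖x - y‖ := fun q hq => by
      rw [div_mul_eq_mul_div]
      refine div_le_div₀ (by positivity) ((abs_det2_le _ _).trans ?_) hD0 hD
      rw [mul_comm]; exact mul_le_mul_of_nonneg_right hq (norm_nonneg _)
    have eA : E.coneA c i x - E.coneA c i y =
        det2 (x - y) (E.nextVertex i - c) / E.coneDet c i := by
      rw [coneA, coneA, ← sub_div, ← det2_sub_left, sub_sub_sub_cancel_right]
    have eB : E.coneB c i x - E.coneB c i y =
        -(det2 (x - y) (E.vertex i - c) / E.coneDet c i) := by
      rw [coneB, coneB, ← sub_div, ← det2_sub_right, sub_sub_sub_cancel_right, det2_swap]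
      ring
    have hA := hq _ (hH _ (E.edge_subset_carrier i (E.nextVertex_mem_edge i)))
    have hB := hq _ (hH _ (E.vertex_mem_carrier i))
    rw [← abs_div, ← eA] at hA
    rw [← abs_div, ← abs_neg, ← eB] at hB
    have e : E.coneA c i x * v (E.vertex i) + E.coneB c i x * v (E.nextVertex i) -
        (E.coneA c i y * v (E.vertex i) + E.coneB c i y * v (E.nextVertex i)) =
        (E.coneA c i x - E.coneA c i y) * v (E.vertex i) +
        (E.coneB c i x - E.coneB c i y) * v (E.nextVertex i) := by ring
    rw [e]
    refine (abs_add_le _ _).trans ?_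
    rw [abs_mul, abs_mul]
    have e2 : 2 * H * m / (r * ρ) * ‖x - y‖ = H / (r * ρ) * ‖x - y‖ * m +
        H / (r * ρ) * ‖x - y‖ * m := by ring
    rw [e2]
    exact add_le_add (mul_le_mul hA (hm i) (abs_nonneg _) (by positivity))
      (mul_le_mul hB (hmn i) (abs_nonneg _) (by positivity))
  · have h1 := hκ x
    have h2 := (h.mem_carrier_iff h1).1 hx
    have hA := h1.1
    have hB := h1.2
    refine (abs_add_le _ _).trans ?_
    rw [abs_mul, abs_mul, abs_of_nonneg hA, abs_of_nonneg hB]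
    have := mul_le_mul_of_nonneg_left (hm (κ x)) hA
    have := mul_le_mul_of_nonneg_left (hmn (κ x)) hB
    nlinarith

end StarAt

end Polygon2

/-! ### Boundary identities on a star-shaped polygon -/

/-- A coordinate unit vector of the plane. -/
def unitVec (k : Fin 2) : Plane := EuclideanSpace.single k 1

lemma inner_unitVec (a : Plane) (k : Fin 2) : ⟪a, unitVec k⟫ = a k := by
  simp [unitVec, EuclideanSpace.inner_single_right]

lemma inner_unitVec_left (a : Plane) (k : Fin 2) : ⟪unitVec k, a⟫ = a k := by
  rw [real_inner_comm, inner_unitVec]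

lemma det2_unitVec_zero (a : Plane) : det2 (unitVec 0) a = a 1 := by
  simp [det2, unitVec]

lemma det2_unitVec_one (a : Plane) : det2 (unitVec 1) a = -a 0 := by
  simp [det2, unitVec]

/-- The vector representing `a ↦ det2 a τ`. -/
def rotVec (τ : Plane) : Plane := !₂[τ 1, -τ 0]

lemma inner_rotVec (a τ : Plane) : ⟪rotVec τ, a⟫ = det2 a τ := by
  rw [plane_inner_eq, det2]; simp [rotVec]; ring

lemma intervalIntegral_linear_sq (p q : ℝ) :
    ∫ t in (0 : ℝ)..1, ((1 - t) * p + t * q) * ((1 - t) * p + t * q) =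
      (p ^ 2 + p * q + q ^ 2) / 3 := by
  have hd : ∀ t ∈ uIcc (0 : ℝ) 1, HasDerivAt (fun t : ℝ => p ^ 2 * t + p * (q - p) * t ^ 2 +
      (q - p) ^ 2 * t ^ 3 / 3) (((1 - t) * p + t * q) * ((1 - t) * p + t * q)) t := fun t _ => by
    have h1 := ((hasDerivAt_id t).const_mul (p ^ 2)).add
      (((hasDerivAt_pow 2 t).const_mul (p * (q - p))).add
        (((hasDerivAt_pow 3 t).const_mul ((q - p) ^ 2)).div_const 3))
    refine (h1.congr_of_eventuallyEq (Filter.Eventually.of_forall fun s => ?_)).congr_deriv ?_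
    · simp; ring
    · simp; ring
  rw [intervalIntegral.integral_eq_sub_of_hasDerivAt hd
    ((by fun_prop : Continuous _).intervalIntegrable _ _)]
  ring

lemma intervalIntegral_linear (p q : ℝ) :
    ∫ t in (0 : ℝ)..1, ((1 - t) * p + t * q) = (p + q) / 2 := by
  have hd : ∀ t ∈ uIcc (0 : ℝ) 1, HasDerivAt (fun t : ℝ => p * t + (q - p) * t ^ 2 / 2)
      ((1 - t) * p + t * q) t := fun t _ => by
    have h1 := ((hasDerivAt_id t).const_mul p).add
      (((hasDerivAt_pow 2 t).const_mul (q - p)).div_const 2)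
    refine (h1.congr_of_eventuallyEq (Filter.Eventually.of_forall fun s => ?_)).congr_deriv ?_
    · simp
    · simp; ring
  rw [intervalIntegral.integral_eq_sub_of_hasDerivAt hd
    ((by fun_prop : Continuous _).intervalIntegrable _ _)]
  ring

namespace Polygon2

variable {E : Polygon2} {c : Plane} {r : ℝ}

/-- Values at the vertices. -/
def vals (E : Polygon2) (v : Plane → ℝ) (i : Fin E.n) : ℝ := v (E.vertex i)

/-- Total length of the edges. -/
def perim (E : Polygon2) : ℝ := ∑ i, ‖E.tau i‖

lemma perim_pos (E : Polygon2) : 0 < E.perim :=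
  Finset.sum_pos (fun i _ => E.norm_tau_pos i) ⟨E.zeroIdx, Finset.mem_univ _⟩

lemma sum_tau (E : Polygon2) : ∑ i, E.tau i = 0 := by
  simp only [tau, nextVertex, Finset.sum_sub_distrib]
  rw [Equiv.sum_comp (finRotate E.n) E.vertex, sub_self]

lemma EdgeLinear.integral_edge {v : Plane → ℝ} (hv : E.EdgeLinear v) (i : Fin E.n) :
    ∫ t in (0 : ℝ)..1, v (E.edgePt i t) = (v (E.vertex i) + v (E.nextVertex i)) / 2 := by
  rw [← intervalIntegral_linear]
  refine intervalIntegral.integral_congr fun t ht => ?_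
  rw [uIcc_of_le zero_le_one] at ht
  exact hv.apply_edgePt i ht

lemma EdgeLinear.integral_edge_sq {v : Plane → ℝ} (hv : E.EdgeLinear v) (i : Fin E.n) :
    ∫ t in (0 : ℝ)..1, v (E.edgePt i t) * v (E.edgePt i t) =
      (v (E.vertex i) ^ 2 + v (E.vertex i) * v (E.nextVertex i) + v (E.nextVertex i) ^ 2) / 3 := by
  rw [← intervalIntegral_linear_sq]
  refine intervalIntegral.integral_congr fun t ht => ?_
  rw [uIcc_of_le zero_le_one] at ht
  simp only [hv.apply_edgePt i ht]

lemma edgeLinear_affine (p : Plane →ᵃ[ℝ] ℝ) : E.EdgeLinear p := fun _ => ⟨p, fun _ _ => rfl⟩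

lemma EdgeLinear.sub {v w : Plane → ℝ} (hv : E.EdgeLinear v) (hw : E.EdgeLinear w) :
    E.EdgeLinear (fun x => v x - w x) := fun i => by
  obtain ⟨p, hp⟩ := hv i
  obtain ⟨q, hq⟩ := hw i
  exact ⟨p - q, fun x hx => by simp [hp hx, hq hx]⟩

lemma integral_const_carrier (E : Polygon2) (k : ℝ) : ∫ _ in E.carrier, k = E.area * k := by
  rw [setIntegral_const, smul_eq_mul]; rfl

namespace StarAt

lemma isH1Grad_one (h : E.StarAt c r) :
    IsH1Grad (interior E.carrier) (fun _ => (1 : ℝ)) (fun _ => 0) := by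
  have := h.isH1Grad_of_contDiff (contDiff_const (c := (1 : ℝ)))
  simpa [gradient_fun_const'] using this

lemma integral_inner_const_eq (h : E.StarAt c r) {v F : Plane → ℝ} {g : Plane → Plane}
    (hv : IsH1Grad (interior E.carrier) v g) (hc : ContinuousOn v E.carrier)
    (hF : ContDiff ℝ 1 F) (a : Plane) :
    (∫ x in E.carrier, F x * ⟪g x, a⟫) + ∫ x in E.carrier, v x * ⟪gradient F x, a⟫ =
      E.orient c * ∑ i, det2 a (E.tau i) * ∫ t in (0 : ℝ)..1, v (E.edgePt i t) * F (E.edgePt i t) := by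
  have := h.gauss_green hv hc h.isH1Grad_one continuousOn_const hF a
  simpa using this

/-- The mean of the weak gradient in terms of boundary values. -/
lemma integral_grad_inner (h : E.StarAt c r) {v : Plane → ℝ} {g : Plane → Plane}
    (hv : IsH1Grad (interior E.carrier) v g) (hc : ContinuousOn v E.carrier)
    (hl : E.EdgeLinear v) (a : Plane) :
    ∫ x in E.carrier, ⟪g x, a⟫ = E.orient c * ∑ i, det2 a (E.tau i) *
      ((v (E.vertex i) + v (E.nextVertex i)) / 2) := by
  have := h.integral_inner_const_eq hv hc (contDiff_const (c := (1 : ℝ))) a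
  simpa [gradient_fun_const', hl.integral_edge] using this

/-- The divergence theorem for `v² (x - c)`. -/
lemma radial_identity (h : E.StarAt c r) {v : Plane → ℝ} {g : Plane → Plane}
    (hv : IsH1Grad (interior E.carrier) v g) (hc : ContinuousOn v E.carrier)
    (hl : E.EdgeLinear v) :
    2 * (∫ x in E.carrier, v x * ⟪g x, x - c⟫) + 2 * ∫ x in E.carrier, v x ^ 2 =
      ∑ i, |E.coneDet c i| * ((v (E.vertex i) ^ 2 + v (E.vertex i) * v (E.nextVertex i) +
        v (E.nextVertex i) ^ 2) / 3) := by
  have hgL := hv.2.1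
  rw [E.restrict_interior] at hgL
  have key : ∀ k : Fin 2, 2 * (∫ x in E.carrier, v x * ((x - c) k * g x k)) +
      ∫ x in E.carrier, v x ^ 2 = E.orient c * ∑ i, det2 (unitVec k) (E.tau i) *
        ∫ t in (0 : ℝ)..1, v (E.edgePt i t) * v (E.edgePt i t) * (E.edgePt i t - c) k := fun k => by
    have h1 := h.gauss_green hv hc hv hc
      ((contDiff_affine (mkAff (unitVec k) c 0)).of_le (by norm_num)) (unitVec k)
    simp only [gradient_affine, affGrad_mkAff, mkAff_apply, inner_unitVec_left, inner_unitVec,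
      zero_add] at h1
    rw [← h1]
    have : (unitVec k) k = 1 := by simp [unitVec]
    simp only [this, mul_one, mul_assoc, pow_two]
    ring
  have hint : ∀ k : Fin 2, Integrable (fun x => v x * ((x - c) k * g x k))
      (volume.restrict E.carrier) := fun k => by
    have := integrable_mul_inner_of_memLp (E.memLp_of_continuousOn
      (f := fun x => v x * (x - c) k) (hc.mul (by fun_prop))) hgL (unitVec k)
    simpa only [inner_unitVec, mul_assoc] using this
  have e1 : ∫ x in E.carrier, v x * ⟪g x, x - c⟫ =
      (∫ x in E.carrier, v x * ((x - c) 0 * g x 0)) +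
        ∫ x in E.carrier, v x * ((x - c) 1 * g x 1) := by
    rw [← integral_add (hint 0) (hint 1)]
    refine integral_congr_ae (Filter.Eventually.of_forall fun x => ?_)
    simp only [plane_inner_eq]; ring
  have hve : ∀ i, ContinuousOn (fun t => v (E.edgePt i t)) (uIcc 0 1) := fun i => by
    refine hc.comp (E.continuous_edgePt i).continuousOn fun t ht => ?_
    rw [uIcc_of_le zero_le_one] at ht
    exact E.edge_subset_carrier i (E.edgePt_mem_edge i ht)
  have hie : ∀ i, ∀ k : Fin 2, IntervalIntegrable
      (fun t => v (E.edgePt i t) * v (E.edgePt i t) * (E.edgePt i t - c) k) volume 0 1 :=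
    fun i k => by
      refine (((hve i).mul (hve i)).mul ?_).intervalIntegrable
      have := E.continuous_edgePt i
      exact Continuous.continuousOn (by fun_prop)
  -- Along an edge the flux density of `x - c` is constant, equal to the cone determinant, because
  -- `det2 (x - c) τ` does not change when `x` moves along `τ`.
  have e2 : ∀ i, |E.coneDet c i| * ((v (E.vertex i) ^ 2 + v (E.vertex i) * v (E.nextVertex i) +
        v (E.nextVertex i) ^ 2) / 3) = E.orient c * (det2 (unitVec 0) (E.tau i) *
        (∫ t in (0 : ℝ)..1, v (E.edgePt i t) * v (E.edgePt i t) * (E.edgePt i t - c) 0) +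
        det2 (unitVec 1) (E.tau i) *
        ∫ t in (0 : ℝ)..1, v (E.edgePt i t) * v (E.edgePt i t) * (E.edgePt i t - c) 1) := fun i => by
    rw [← h.orient_mul_coneDet, ← hl.integral_edge_sq i, mul_assoc]
    congr 1
    rw [← intervalIntegral.integral_const_mul, ← intervalIntegral.integral_const_mul,
      ← intervalIntegral.integral_const_mul, ← intervalIntegral.integral_add
        ((hie i 0).const_mul _) ((hie i 1).const_mul _)]
    refine intervalIntegral.integral_congr fun t _ => ?_
    simp only [coneDet_eq, edgePt_eq, det2_unitVec_zero, det2_unitVec_one]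
    simp only [det2, PiLp.sub_apply, PiLp.add_apply, PiLp.smul_apply, smul_eq_mul]
    ring
  rw [Finset.sum_congr rfl fun i _ => e2 i, ← Finset.mul_sum, Finset.sum_add_distrib, mul_add,
    ← key 0, ← key 1, e1]
  ring

/-- The radial identity for the constant function 1. -/
lemma two_mul_area (h : E.StarAt c r) : 2 * E.area = ∑ i, |E.coneDet c i| := by
  have := h.radial_identity h.isH1Grad_one continuousOn_const
    (fun i => ⟨AffineMap.const ℝ Plane 1, fun x _ => by simp⟩)
  simp only [inner_zero_left, mul_zero, integral_zero, one_pow, integral_const_carrier] at this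
  norm_num at this
  exact this

/-- Integration of the gradient against a rotated gradient only sees tangential derivatives. -/
lemma curl_identity (h : E.StarAt c r) {v ψ : Plane → ℝ} {g : Plane → Plane}
    (hv : IsH1Grad (interior E.carrier) v g) (hc : ContinuousOn v E.carrier)
    (hψ : ContDiff ℝ 2 ψ) :
    ∫ x in E.carrier, ⟪g x, rotVec (gradient ψ x)⟫ = E.orient c * ∑ i,
      ∫ t in (0 : ℝ)..1, v (E.edgePt i t) * ⟪gradient ψ (E.edgePt i t), E.tau i⟫ := by
  have hgL := hv.2.1
  rw [E.restrict_interior] at hgL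
  have hd1 : ContDiff ℝ 1 (fderiv ℝ ψ) := hψ.fderiv_right (by norm_num)
  have hgr : ContDiff ℝ 1 (gradient ψ) := (InnerProductSpace.toDual ℝ Plane).symm.contDiff.comp hd1
  have hF : ∀ k : Fin 2, ContDiff ℝ 1 (fun x => gradient ψ x k) := fun k => by
    have : (fun x => gradient ψ x k) = fun x => ⟪gradient ψ x, unitVec k⟫ := by
      ext x; rw [inner_unitVec]
    rw [this]; exact hgr.inner ℝ contDiff_const
  have h0 := h.integral_inner_const_eq hv hc (hF 1) (unitVec 0)
  have h1 := h.integral_inner_const_eq hv hc (hF 0) (unitVec 1)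
  -- The two volume integrals of `v` against second derivatives of `ψ` cancel by the symmetry of the
  -- Hessian, and only the boundary terms survive.
  have hsym : ∀ x, ⟪gradient (fun y => gradient ψ y 1) x, unitVec 0⟫ =
      ⟪gradient (fun y => gradient ψ y 0) x, unitVec 1⟫ := fun x => by
    have e : ∀ k : Fin 2, (fun y => gradient ψ y k) = fun y => fderiv ℝ ψ y (unitVec k) := fun k => by
      ext y; rw [← inner_gradient_left, inner_unitVec]
    have hdx := (hd1.differentiable (by norm_num)) x
    have e2 : ∀ k : Fin 2, ∀ a, fderiv ℝ (fun y => fderiv ℝ ψ y (unitVec k)) x a =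
        fderiv ℝ (fderiv ℝ ψ) x a (unitVec k) := fun k a => by
      have := (hdx.hasFDerivAt.clm_apply (hasFDerivAt_const (unitVec k) x)).fderiv
      rw [this]; simp
    rw [inner_gradient_left, inner_gradient_left, e, e, e2, e2]
    exact (hψ.contDiffAt.isSymmSndFDerivAt (by simp)) _ _
  have hcg := continuous_gradient (hψ.of_le (by norm_num))
  have hint : ∀ k j : Fin 2, Integrable (fun x => gradient ψ x k * g x j)
      (volume.restrict E.carrier) := fun k j => by
    have := integrable_mul_inner_of_memLp (E.memLp_of_continuousOn
      (hF k).continuous.continuousOn) hgL (unitVec j)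
    simpa only [inner_unitVec] using this
  have e1 : ∫ x in E.carrier, ⟪g x, rotVec (gradient ψ x)⟫ =
      (∫ x in E.carrier, gradient ψ x 1 * g x 0) - ∫ x in E.carrier, gradient ψ x 0 * g x 1 := by
    rw [← integral_sub (hint 1 0) (hint 0 1)]
    refine integral_congr_ae (Filter.Eventually.of_forall fun x => ?_)
    simp only [real_inner_comm (rotVec _), inner_rotVec, det2]; ring
  have hve : ∀ i, ContinuousOn (fun t => v (E.edgePt i t)) (uIcc 0 1) := fun i => by
    refine hc.comp (E.continuous_edgePt i).continuousOn fun t ht => ?_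
    rw [uIcc_of_le zero_le_one] at ht
    exact E.edge_subset_carrier i (E.edgePt_mem_edge i ht)
  have hie : ∀ i, ∀ k : Fin 2, IntervalIntegrable
      (fun t => v (E.edgePt i t) * gradient ψ (E.edgePt i t) k) volume 0 1 := fun i k =>
    ((hve i).mul ((hF k).continuous.comp (E.continuous_edgePt i)).continuousOn).intervalIntegrable
  have e2 : ∀ i, (∫ t in (0 : ℝ)..1, v (E.edgePt i t) * ⟪gradient ψ (E.edgePt i t), E.tau i⟫) =
      det2 (unitVec 0) (E.tau i) *
        (∫ t in (0 : ℝ)..1, v (E.edgePt i t) * gradient ψ (E.edgePt i t) 1) -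
      det2 (unitVec 1) (E.tau i) *
        ∫ t in (0 : ℝ)..1, v (E.edgePt i t) * gradient ψ (E.edgePt i t) 0 := fun i => by
    rw [← intervalIntegral.integral_const_mul, ← intervalIntegral.integral_const_mul,
      ← intervalIntegral.integral_sub ((hie i 1).const_mul _) ((hie i 0).const_mul _)]
    refine intervalIntegral.integral_congr fun t _ => ?_
    simp only [plane_inner_eq, det2_unitVec_zero, det2_unitVec_one]
    ring
  simp only [inner_unitVec] at h0 h1 hsym
  simp only [hsym] at h0
  rw [Finset.sum_congr rfl fun i _ => e2 i, Finset.sum_sub_distrib, mul_sub, e1]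
  linarith

end StarAt

end Polygon2

lemma mkAff_add (a a' c : Plane) (k k' : ℝ) : mkAff (a + a') c (k + k') =
    mkAff a c k + mkAff a' c k' := by
  ext x; simp only [AffineMap.coe_add, Pi.add_apply, mkAff_apply, inner_add_left]; ring

lemma mkAff_smul (a c : Plane) (s k : ℝ) : mkAff (s • a) c (s * k) = s • mkAff a c k := by
  ext x; simp only [AffineMap.coe_smul, Pi.smul_apply, mkAff_apply, inner_smul_left,
    smul_eq_mul, conj_trivial]; ring

namespace Polygon2

variable {E : Polygon2} {c : Plane} {r : ℝ}

/-! ### The projection onto affine functions in terms of vertex values -/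

/-- Mean of vertex values over an edge. -/
def edgeMean (E : Polygon2) (i : Fin E.n) : (Fin E.n → ℝ) →ₗ[ℝ] ℝ :=
  (2⁻¹ : ℝ) • (LinearMap.proj (R := ℝ) (φ := fun _ : Fin E.n => ℝ) i +
    LinearMap.proj (R := ℝ) (φ := fun _ : Fin E.n => ℝ) (finRotate E.n i))

lemma edgeMean_apply (E : Polygon2) (i : Fin E.n) (β : Fin E.n → ℝ) :
    E.edgeMean i β = (β i + β (finRotate E.n i)) / 2 := by
  simp only [edgeMean, LinearMap.smul_apply, LinearMap.add_apply, LinearMap.proj_apply, smul_eq_mul]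
  ring

/-- The gradient of the projection. -/
def projGrad (E : Polygon2) (c : Plane) : (Fin E.n → ℝ) →ₗ[ℝ] Plane :=
  (E.area⁻¹ * E.orient c) • ∑ i, (E.edgeMean i).smulRight (rotVec (E.tau i))

lemma projGrad_apply (E : Polygon2) (c : Plane) (β : Fin E.n → ℝ) : E.projGrad c β =
    (E.area⁻¹ * E.orient c) • ∑ i, E.edgeMean i β • rotVec (E.tau i) := by
  simp [projGrad]

/-- The first moment of the boundary with respect to `c`. -/
def bdryMoment (E : Polygon2) (c : Plane) : Plane :=
  ∑ i, (‖E.tau i‖ / 2) • ((E.vertex i - c) + (E.nextVertex i - c))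

/-- The value at `c` of the projection. -/
def projVal (E : Polygon2) (c : Plane) : (Fin E.n → ℝ) →ₗ[ℝ] ℝ :=
  E.perim⁻¹ • (∑ i, ‖E.tau i‖ • E.edgeMean i -
    (innerₛₗ ℝ (E.bdryMoment c)).comp (E.projGrad c))

lemma projVal_apply (E : Polygon2) (c : Plane) (β : Fin E.n → ℝ) : E.projVal c β =
    E.perim⁻¹ * (∑ i, ‖E.tau i‖ * E.edgeMean i β - ⟪E.bdryMoment c, E.projGrad c β⟫) := by
  simp [projVal]

/-- The affine function determined by vertex values through the elliptic projection. -/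
def proj (E : Polygon2) (c : Plane) : (Fin E.n → ℝ) →ₗ[ℝ] (Plane →ᵃ[ℝ] ℝ) where
  toFun β := mkAff (E.projGrad c β) c (E.projVal c β)
  map_add' β β' := by rw [map_add, map_add, mkAff_add]
  map_smul' s β := by simp only [map_smul, smul_eq_mul, mkAff_smul, RingHom.id_apply]

lemma proj_apply (E : Polygon2) (c : Plane) (β : Fin E.n → ℝ) (x : Plane) :
    E.proj c β x = E.projVal c β + ⟪E.projGrad c β, x - c⟫ := mkAff_apply _ _ _ _

lemma affGrad_proj (E : Polygon2) (c : Plane) (β : Fin E.n → ℝ) :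
    affGrad (E.proj c β) = E.projGrad c β := affGrad_mkAff _ _ _

lemma proj_center (E : Polygon2) (c : Plane) (β : Fin E.n → ℝ) :
    E.proj c β c = E.projVal c β := by rw [proj_apply]; simp

/-- The edge vectors of a closed polygon add up to zero. -/
lemma projGrad_const (E : Polygon2) (c : Plane) (k : ℝ) : E.projGrad c (fun _ => k) = 0 := by
  have h1 : ∑ i, E.edgeMean i (fun _ => k) • rotVec (E.tau i) = 0 := by
    refine ext_inner_right ℝ fun a => ?_
    rw [sum_inner, inner_zero_left]
    simp only [edgeMean_apply, inner_smul_left, inner_rotVec, conj_trivial]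
    rw [← Finset.mul_sum]
    have h2 : ∑ i, det2 a (E.tau i) = det2 a (∑ i, E.tau i) := by
      simp only [← inner_rotVec a, ← sum_inner]
      congr 1
      refine ext_inner_right ℝ fun b => ?_
      simp only [sum_inner, inner_rotVec]
      simp only [det2, WithLp.ofLp_sum, Finset.sum_apply, Finset.mul_sum, Finset.sum_sub_distrib]
    rw [h2, E.sum_tau]; simp [det2]
  rw [projGrad_apply, h1, smul_zero]

lemma projVal_const (E : Polygon2) (c : Plane) (k : ℝ) : E.projVal c (fun _ => k) = k := by
  rw [projVal_apply, projGrad_const, inner_zero_right, sub_zero]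
  simp only [edgeMean_apply, add_self_div_two, ← Finset.sum_mul]
  change E.perim⁻¹ * (E.perim * k) = k
  rw [inv_mul_cancel_left₀ E.perim_pos.ne']

lemma projGrad_sub_const (E : Polygon2) (c : Plane) (β : Fin E.n → ℝ) (k : ℝ) :
    E.projGrad c (fun i => β i - k) = E.projGrad c β := by
  have := (E.projGrad c).map_sub β (fun _ => k)
  rw [projGrad_const, sub_zero] at this
  exact this

lemma proj_sub_const (E : Polygon2) (c : Plane) (β : Fin E.n → ℝ) (k : ℝ) (x : Plane) :
    E.proj c (fun i => β i - k) x = E.proj c β x - k := by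
  have := (E.projVal c).map_sub β (fun _ => k)
  rw [projVal_const] at this
  rw [proj_apply, proj_apply, projGrad_sub_const]
  change E.projVal c (β - fun _ => k) + _ = _
  rw [this]; ring

lemma boundaryInt_eq {f : Plane → ℝ} (hf : E.EdgeLinear f) :
    E.boundaryInt f = ∑ i, ‖E.tau i‖ * E.edgeMean i (E.vals f) := by
  refine Finset.sum_congr rfl fun i _ => ?_
  rw [segInt, ← E.norm_tau, edgeMean_apply]
  congr 1
  exact hf.integral_edge i

lemma sum_edgeMean_affine (p : Plane →ᵃ[ℝ] ℝ) : ∑ i, ‖E.tau i‖ * E.edgeMean i (E.vals p) =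
    E.perim * p c + ⟪E.bdryMoment c, affGrad p⟫ := by
  rw [perim, bdryMoment, Finset.sum_mul, sum_inner, ← Finset.sum_add_distrib]
  refine Finset.sum_congr rfl fun i _ => ?_
  rw [edgeMean_apply]
  change ‖E.tau i‖ * ((p (E.vertex i) + p (E.nextVertex i)) / 2) = _
  rw [affine_apply p (E.vertex i) c, affine_apply p (E.nextVertex i) c, inner_smul_left,
    inner_add_left, real_inner_comm (affGrad p), real_inner_comm (affGrad p)]
  simp; ring

/-- The difference of two projections is orthogonal to itself, so it vanishes on a ball and, being
affine, everywhere. Uniqueness is what identifies the projection chosen by `Classical.epsilon`. -/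
lemma isL2Proj_unique (hr : 0 < r) (hb : Metric.ball c r ⊆ E.carrier) {v : Plane → ℝ}
    (hv : ContinuousOn v E.carrier) {p q : Plane →ᵃ[ℝ] ℝ}
    (hp : E.IsL2Proj v p) (hq : E.IsL2Proj v q) : p = q := by
  have hpc := (contDiff_affine p).continuous
  have hqc := (contDiff_affine q).continuous
  have hdc := (contDiff_affine (p - q)).continuous
  have ip : IntegrableOn (fun x => (v x - p x) * (p - q) x) E.carrier volume :=
    ((hv.sub hpc.continuousOn).mul hdc.continuousOn).integrableOn_compact E.isCompact_carrier
  have iq : IntegrableOn (fun x => (v x - q x) * (p - q) x) E.carrier volume :=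
    ((hv.sub hqc.continuousOn).mul hdc.continuousOn).integrableOn_compact E.isCompact_carrier
  have h1 : ∫ x in E.carrier, (p - q) x ^ 2 = 0 := by
    have h2 := integral_sub iq ip
    rw [hp (p - q), hq (p - q), sub_zero] at h2
    rw [← h2]
    refine integral_congr_ae (Filter.Eventually.of_forall fun x => ?_)
    simp only [AffineMap.coe_sub, Pi.sub_apply]; ring
  have hi : IntegrableOn (fun x => (p - q) x ^ 2) E.carrier volume :=
    (hdc.pow 2).continuousOn.integrableOn_compact E.isCompact_carrier
  have h2 := sq_affine_le_integral_ball (p - q) c hr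
  have h3 := setIntegral_mono_set hi (Filter.Eventually.of_forall fun x => sq_nonneg ((p - q) x))
    hb.eventuallyLE
  rw [h1] at h3
  have h4 : r ^ 2 * (|(p - q) c| + r * ‖affGrad (p - q)‖) ^ 2 ≤ 0 := by linarith
  have h5 : |(p - q) c| + r * ‖affGrad (p - q)‖ = 0 := by
    by_contra hne
    have : 0 < r ^ 2 * (|(p - q) c| + r * ‖affGrad (p - q)‖) ^ 2 := by positivity
    linarith
  have h6 := abs_nonneg ((p - q) c)
  have h7 : 0 ≤ r * ‖affGrad (p - q)‖ := by positivity
  have h8 : (p - q) c = 0 := abs_eq_zero.1 (by linarith)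
  have h9 : ‖affGrad (p - q)‖ = 0 := by
    have : r * ‖affGrad (p - q)‖ = 0 := by linarith
    simpa [hr.ne'] using this
  refine affine_ext c (by simpa [sub_eq_zero] using h8) ?_
  rw [norm_eq_zero, affGrad_sub, sub_eq_zero] at h9
  exact h9

lemma area_pos (h : E.StarAt c r) : 0 < E.area := by
  have h1 : (volume (Metric.ball c r)).toReal ≤ E.area :=
    ENNReal.toReal_mono E.volume_carrier_ne_top (measure_mono h.ball)
  rw [volume_real_ball c h.pos.le] at h1
  have := h.pos
  have := Real.pi_pos
  have : 0 < r ^ 2 * Real.pi := by positivity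
  linarith

lemma l2Proj_eq (h : E.StarAt c r) {v : Plane → ℝ} (hv : ContinuousOn v E.carrier)
    {p : Plane →ᵃ[ℝ] ℝ} (hp : E.IsL2Proj v p) : E.l2Proj v = p :=
  isL2Proj_unique h.pos h.ball hv (Classical.epsilon_spec (p := E.IsL2Proj v) ⟨p, hp⟩) hp

lemma l2Proj_affine (h : E.StarAt c r) (p : Plane →ᵃ[ℝ] ℝ) : E.l2Proj p = p :=
  l2Proj_eq h (contDiff_affine p).continuous.continuousOn fun p₁ => by simp

lemma weakGrad_spec {O : Set Plane} {v : Plane → ℝ} (hv : MemH1 O v) :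
    IsH1Grad O v (weakGrad O v) := Classical.epsilon_spec hv

lemma integral_inner_projGrad (h : E.StarAt c r) {v : Plane → ℝ} {g : Plane → Plane}
    (hg : IsH1Grad (interior E.carrier) v g) (hc : ContinuousOn v E.carrier)
    (hl : E.EdgeLinear v) (a : Plane) :
    ∫ x in E.carrier, ⟪g x, a⟫ = E.area * ⟪E.projGrad c (E.vals v), a⟫ := by
  rw [h.integral_grad_inner hg hc hl a, projGrad_apply, inner_smul_left, sum_inner, conj_trivial,
    mul_assoc, mul_inv_cancel_left₀ (area_pos h).ne']
  congr 1
  refine Finset.sum_congr rfl fun i _ => ?_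
  rw [inner_smul_left, inner_rotVec, edgeMean_apply, conj_trivial, mul_comm]
  rfl

/-- Against constant vectors only the mean of the weak gradient matters, and by the divergence
theorem this mean and the boundary integral see only the vertex values of an edgewise affine
function. Both defining conditions thus become linear equations with exactly one solution. -/
lemma isEllipticProj_iff (h : E.StarAt c r) {v : Plane → ℝ}
    (hv : MemH1 (interior E.carrier) v) (hc : ContinuousOn v E.carrier)
    (hl : E.EdgeLinear v) (p : Plane →ᵃ[ℝ] ℝ) :
    E.IsEllipticProj v p ↔ p = E.proj c (E.vals v) := by
  have hA := area_pos h
  have hg := weakGrad_spec hv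
  set g := weakGrad (interior E.carrier) v with hgdef
  have hgL := hg.2.1
  rw [E.restrict_interior] at hgL
  have hfin : IsFiniteMeasure (volume.restrict E.carrier) :=
    ⟨by rw [Measure.restrict_apply_univ]; exact E.volume_carrier_ne_top.lt_top⟩
  have e1 : ∀ p₁ : Plane →ᵃ[ℝ] ℝ,
      ∫ x in E.carrier, ⟪g x - gradient p x, gradient p₁ x⟫ =
      E.area * ⟪E.projGrad c (E.vals v) - affGrad p, affGrad p₁⟫ := fun p₁ => by
    simp only [gradient_affine, inner_sub_left]
    rw [integral_sub ((hgL.integrable (by norm_num)).inner_const _) (integrable_const _),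
      integral_inner_projGrad h hg hc hl, integral_const_carrier]
    ring
  have e2 : E.boundaryInt (fun x => v x - p x) = ∑ i, ‖E.tau i‖ * E.edgeMean i (E.vals v) -
      (E.perim * p c + ⟪E.bdryMoment c, affGrad p⟫) := by
    rw [boundaryInt_eq (hl.sub (edgeLinear_affine p)), ← sum_edgeMean_affine,
      ← Finset.sum_sub_distrib]
    refine Finset.sum_congr rfl fun i _ => ?_
    rw [← mul_sub, ← map_sub]; rfl
  have hP := E.perim_pos
  constructor
  · rintro ⟨h1, h2⟩
    have h3 : affGrad p = E.projGrad c (E.vals v) := by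
      have h4 := h1 (mkAff (E.projGrad c (E.vals v) - affGrad p) c 0)
      rw [e1, affGrad_mkAff, real_inner_self_eq_norm_sq] at h4
      have h5 : E.projGrad c (E.vals v) - affGrad p = 0 := by
        simpa [hA.ne'] using h4
      exact (sub_eq_zero.1 h5).symm
    refine affine_ext c ?_ (by rw [h3, affGrad_proj])
    rw [proj_center, projVal_apply, ← h3]
    rw [e2] at h2
    field_simp
    linarith
  · rintro rfl
    refine ⟨fun p₁ => by rw [e1, affGrad_proj, sub_self, inner_zero_left, mul_zero], ?_⟩
    rw [e2, proj_center, affGrad_proj, projVal_apply]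
    field_simp
    ring

lemma ellipticProj_eq (h : E.StarAt c r) {v : Plane → ℝ}
    (hv : MemH1 (interior E.carrier) v) (hc : ContinuousOn v E.carrier)
    (hl : E.EdgeLinear v) : E.ellipticProj v = E.proj c (E.vals v) :=
  (isEllipticProj_iff h hv hc hl _).1 (Classical.epsilon_spec (p := E.IsEllipticProj v)
    ⟨_, (isEllipticProj_iff h hv hc hl _).2 rfl⟩)

namespace MemSpace

variable {v w : Plane → ℝ}

lemma isH1Grad (hv : E.MemSpace v) :
    IsH1Grad (interior E.carrier) v (weakGrad (interior E.carrier) v) := weakGrad_spec hv.1.1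

lemma continuousOn (hv : E.MemSpace v) : ContinuousOn v E.carrier := hv.1.2.1

lemma edgeLinear (hv : E.MemSpace v) : E.EdgeLinear v := hv.1.2.2.1

lemma ellipticProj_eq (hv : E.MemSpace v) (h : E.StarAt c r) :
    E.ellipticProj v = E.proj c (E.vals v) :=
  Polygon2.ellipticProj_eq h hv.1.1 hv.continuousOn hv.edgeLinear

lemma integral_mul_eq (hv : E.MemSpace v) (h : E.StarAt c r) (p : Plane →ᵃ[ℝ] ℝ) :
    ∫ x in E.carrier, v x * p x = ∫ x in E.carrier, E.proj c (E.vals v) x * p x := by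
  rw [hv.2 p, hv.ellipticProj_eq h]

/-- This is the purpose of the enhancement: moments of `v` against affine functions are those of its
elliptic projection, so the two projections coincide. -/
lemma l2Proj_eq (hv : E.MemSpace v) (h : E.StarAt c r) : E.l2Proj v = E.proj c (E.vals v) := by
  refine Polygon2.l2Proj_eq h hv.continuousOn fun p₁ => ?_
  have hpc := (contDiff_affine p₁).continuous
  have hqc := (contDiff_affine (E.proj c (E.vals v))).continuous
  have i1 : IntegrableOn (fun x => v x * p₁ x) E.carrier volume :=
    (hv.continuousOn.mul hpc.continuousOn).integrableOn_compact E.isCompact_carrier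
  have i2 : IntegrableOn (fun x => E.proj c (E.vals v) x * p₁ x) E.carrier volume :=
    (hqc.mul hpc).continuousOn.integrableOn_compact E.isCompact_carrier
  simp only [sub_mul]
  rw [integral_sub i1 i2, hv.integral_mul_eq h, sub_self]

end MemSpace

/-! ### The discrete forms in terms of vertex values -/

/-- Deviation of vertex values from their projection. -/
def dev (E : Polygon2) (c : Plane) (β : Fin E.n → ℝ) (i : Fin E.n) : ℝ :=
  β i - E.proj c β (E.vertex i)

/-- The mass form on vertex values. -/
def massB (E : Polygon2) (c : Plane) (β β' : Fin E.n → ℝ) : ℝ :=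
  (∫ x in E.carrier, E.proj c β x * E.proj c β' x) + E.area * ∑ i, E.dev c β i * E.dev c β' i

/-- The stiffness form on vertex values. -/
def stiffB (E : Polygon2) (c : Plane) (β β' : Fin E.n → ℝ) : ℝ :=
  E.area * ⟪E.projGrad c β, E.projGrad c β'⟫ + ∑ i, E.dev c β i * E.dev c β' i

lemma MemSpace.massForm_eq {v w : Plane → ℝ} (hv : E.MemSpace v) (hw : E.MemSpace w)
    (h : E.StarAt c r) : E.massForm v w = E.massB c (E.vals v) (E.vals w) := by
  rw [massForm, hv.l2Proj_eq h, hw.l2Proj_eq h]; rfl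

lemma MemSpace.stiffForm_eq {v w : Plane → ℝ} (hv : E.MemSpace v) (hw : E.MemSpace w)
    (h : E.StarAt c r) : E.stiffForm v w = E.stiffB c (E.vals v) (E.vals w) := by
  rw [stiffForm, hv.ellipticProj_eq h, hw.ellipticProj_eq h]
  simp only [gradient_affine, affGrad_proj, integral_const_carrier]
  rfl

/-- An affine first argument is its own projection, so the stabilisation drops out. The load enters
the scheme in this form. -/
lemma MemSpace.massForm_affine {w : Plane → ℝ} (hw : E.MemSpace w) (h : E.StarAt c r)
    (p : Plane →ᵃ[ℝ] ℝ) :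
    E.massForm p w = ∫ x in E.carrier, p x * E.proj c (E.vals w) x := by
  rw [massForm, hw.l2Proj_eq h, l2Proj_affine h]
  simp [stab]

end Polygon2

namespace Polygon2

variable {E : Polygon2} {c : Plane} {r H a b : ℝ}

/-! ### Shape-regular polygons -/

/-- `E` has size `H`, is star-shaped with respect to the ball of centre `c` and radius `a H`, and its
edges have length at least `b H`. -/
structure Reg (E : Polygon2) (c : Plane) (H a b : ℝ) : Prop where
  star : E.StarAt c (a * H)
  H_pos : 0 < H
  a_pos : 0 < a
  b_pos : 0 < b
  norm_le : ∀ x ∈ E.carrier, ‖x - c‖ ≤ H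
  tau_ge : ∀ i, b * H ≤ ‖E.tau i‖

lemma integral_sq_le {f : Plane → ℝ} {M : ℝ} (hM : ∀ x ∈ E.carrier, |f x| ≤ M) :
    ∫ x in E.carrier, f x ^ 2 ≤ E.area * M ^ 2 := by
  have h1 := norm_setIntegral_le_of_norm_le_const (f := fun x => f x ^ 2) (C := M ^ 2)
    E.volume_carrier_ne_top.lt_top (fun x hx => by
      rw [Real.norm_eq_abs, abs_pow]
      exact pow_le_pow_left₀ (abs_nonneg _) (hM x hx) 2)
  rw [mul_comm]
  exact (Real.le_norm_self _).trans h1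

lemma integral_norm_sq_le {f : Plane → Plane} {M : ℝ} (hM : ∀ x ∈ E.carrier, ‖f x‖ ≤ M) :
    ∫ x in E.carrier, ‖f x‖ ^ 2 ≤ E.area * M ^ 2 :=
  integral_sq_le (f := fun x => ‖f x‖) fun x hx => by rw [abs_norm]; exact hM x hx

namespace Reg

lemma area_le (h : E.Reg c H a b) : E.area ≤ 4 * H ^ 2 := by
  have h1 : E.carrier ⊆ Metric.closedBall c H := fun x hx => by
    rw [Metric.mem_closedBall, dist_eq_norm]; exact h.norm_le x hx
  have h2 : E.area ≤ (volume (Metric.closedBall c H)).toReal :=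
    ENNReal.toReal_mono Metric.isBounded_closedBall.measure_lt_top.ne (measure_mono h1)
  rw [EuclideanSpace.volume_closedBall_fin_two, ENNReal.toReal_mul, ENNReal.toReal_pow,
    ENNReal.toReal_ofReal h.H_pos.le, ENNReal.toReal_ofReal Real.pi_pos.le] at h2
  have := Real.pi_le_four
  nlinarith [sq_nonneg H]

lemma le_area (h : E.Reg c H a b) : 3 * a ^ 2 * H ^ 2 ≤ E.area := by
  have h1 : (volume (Metric.ball c (a * H))).toReal ≤ E.area :=
    ENNReal.toReal_mono E.volume_carrier_ne_top (measure_mono h.star.ball)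
  rw [volume_real_ball c h.star.pos.le] at h1
  have := Real.pi_gt_three
  nlinarith [sq_nonneg (a * H)]

lemma area_pos (h : E.Reg c H a b) : 0 < E.area := Polygon2.area_pos h.star

/-- The triangles of the fan have height at least `a * H` over the edges, so `a * H * perim` is at
most twice the area. -/
lemma perim_le (h : E.Reg c H a b) : a * E.perim ≤ 8 * H := by
  have h1 : a * H * E.perim ≤ 2 * E.area := by
    rw [h.star.two_mul_area, perim, Finset.mul_sum]
    exact Finset.sum_le_sum fun i _ => h.star.le_abs_det i
  have h2 := h.area_le
  have h3 := h.H_pos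
  have : H * (a * E.perim) ≤ H * (8 * H) := by nlinarith
  exact le_of_mul_le_mul_left this h3

/-- The perimeter is bounded by a multiple of `H`, while each edge has length at least `b * H`. -/
lemma card_le (h : E.Reg c H a b) : a * b * E.n ≤ 8 := by
  have h1 : E.n * (b * H) ≤ E.perim := by
    have := Finset.sum_le_sum fun i (_ : i ∈ Finset.univ) => h.tau_ge i
    simpa [perim] using this
  have h2 := h.perim_le
  have h3 := h.H_pos
  have h4 := mul_le_mul_of_nonneg_left h1 h.a_pos.le
  have : H * (a * b * E.n) ≤ H * 8 := by nlinarith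
  exact le_of_mul_le_mul_left this h3

lemma norm_projGrad_le (h : E.Reg c H a b) {β : Fin E.n → ℝ} {m : ℝ} (hm : ∀ i, |β i| ≤ m) :
    H * ‖E.projGrad c β‖ ≤ 8 / (3 * a ^ 3) * m := by
  have hA := h.area_pos
  have ha := h.a_pos
  have hH := h.H_pos
  have hm0 : 0 ≤ m := (abs_nonneg _).trans (hm E.zeroIdx)
  have h1 : E.area * ‖E.projGrad c β‖ ≤ E.perim * m := by
    rw [projGrad_apply, norm_smul, norm_mul, Real.norm_eq_abs, Real.norm_eq_abs, h.star.abs_orient,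
      abs_of_pos (inv_pos.2 hA), mul_one, mul_inv_cancel_left₀ hA.ne', perim, Finset.sum_mul]
    refine (norm_sum_le _ _).trans (Finset.sum_le_sum fun i _ => ?_)
    rw [norm_smul, mul_comm]
    refine mul_le_mul ?_ ?_ (norm_nonneg _) (norm_nonneg _)
    · rw [← sq_le_sq₀ (norm_nonneg _) (norm_nonneg _), plane_norm_sq, plane_norm_sq]
      simp [rotVec]; linarith
    · rw [edgeMean_apply, Real.norm_eq_abs, abs_le]
      have h1 := abs_le.1 (hm i)
      have h2 := abs_le.1 (hm (finRotate E.n i))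
      constructor <;> linarith
  have h2 := h.le_area
  have h3 := h.perim_le
  have h4 := norm_nonneg (E.projGrad c β)
  have h5 : 3 * a ^ 2 * H ^ 2 * ‖E.projGrad c β‖ ≤ E.perim * m :=
    (mul_le_mul_of_nonneg_right h2 h4).trans h1
  have h6 : a * (3 * a ^ 2 * H ^ 2 * ‖E.projGrad c β‖) ≤ 8 * H * m := by
    calc _ ≤ a * (E.perim * m) := mul_le_mul_of_nonneg_left h5 ha.le
      _ = (a * E.perim) * m := by ring
      _ ≤ _ := mul_le_mul_of_nonneg_right h3 hm0
  have h7 : H * (3 * a ^ 3 * (H * ‖E.projGrad c β‖)) ≤ H * (8 * m) := by linarith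
  have h8 := le_of_mul_le_mul_left h7 hH
  rw [div_mul_eq_mul_div, le_div_iff₀ (by positivity)]
  linarith

lemma norm_bdryMoment_le (h : E.Reg c H a b) : ‖E.bdryMoment c‖ ≤ E.perim * H := by
  rw [bdryMoment, perim, Finset.sum_mul]
  refine (norm_sum_le _ _).trans (Finset.sum_le_sum fun i _ => ?_)
  rw [norm_smul, Real.norm_eq_abs, abs_of_nonneg (by positivity)]
  have h1 := norm_add_le (E.vertex i - c) (E.nextVertex i - c)
  have h2 := h.norm_le _ (E.vertex_mem_carrier i)
  have h3 := h.norm_le _ (E.edge_subset_carrier i (E.nextVertex_mem_edge i))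
  have h4 := norm_nonneg (E.tau i)
  nlinarith

lemma abs_projVal_le (h : E.Reg c H a b) {β : Fin E.n → ℝ} {m : ℝ} (hm : ∀ i, |β i| ≤ m) :
    |E.projVal c β| ≤ (1 + 8 / (3 * a ^ 3)) * m := by
  have hP := E.perim_pos
  rw [projVal_apply, abs_mul, abs_of_pos (inv_pos.2 hP), inv_mul_le_iff₀ hP]
  have h1 : |∑ i, ‖E.tau i‖ * E.edgeMean i β| ≤ E.perim * m := by
    rw [perim, Finset.sum_mul]
    refine (Finset.abs_sum_le_sum_abs _ _).trans (Finset.sum_le_sum fun i _ => ?_)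
    rw [abs_mul, abs_norm]
    refine mul_le_mul_of_nonneg_left ?_ (norm_nonneg _)
    rw [edgeMean_apply, abs_le]
    have h1 := abs_le.1 (hm i)
    have h2 := abs_le.1 (hm (finRotate E.n i))
    constructor <;> linarith
  have h2 : |⟪E.bdryMoment c, E.projGrad c β⟫| ≤ E.perim * (8 / (3 * a ^ 3) * m) := by
    refine (abs_real_inner_le_norm _ _).trans ?_
    refine (mul_le_mul_of_nonneg_right h.norm_bdryMoment_le (norm_nonneg _)).trans ?_
    rw [mul_assoc]
    exact mul_le_mul_of_nonneg_left (h.norm_projGrad_le hm) hP.le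
  refine (abs_sub _ _).trans ?_
  linarith

lemma abs_proj_le (h : E.Reg c H a b) {β : Fin E.n → ℝ} {m : ℝ} (hm : ∀ i, |β i| ≤ m) {x : Plane}
    (hx : x ∈ E.carrier) : |E.proj c β x| ≤ (1 + 16 / (3 * a ^ 3)) * m := by
  have h1 := abs_affine_le (E.proj c β) (h.norm_le x hx)
  rw [proj_center, affGrad_proj] at h1
  have h2 := h.abs_projVal_le hm
  have h3 := h.norm_projGrad_le hm
  have e : (1 + 16 / (3 * a ^ 3)) * m = (1 + 8 / (3 * a ^ 3)) * m + 8 / (3 * a ^ 3) * m := by ring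
  linarith

/-- An affine function on a regular polygon is controlled by its mean square on a small ball. -/
lemma sq_affine_le_ball (h : E.Reg c H a b) (p : Plane →ᵃ[ℝ] ℝ) :
    H ^ 2 * (|p c| + H * ‖affGrad p‖) ^ 2 ≤ 200 * (4 / a) ^ 2 * (1 + 4 / a) ^ 2 *
      ∫ x in Metric.ball c (a * H / 4), p x ^ 2 := by
  have ha := h.a_pos
  have hH := h.H_pos
  have h1 := sq_affine_le_integral_ball p c (ρ := a * H / 4) (by positivity)
  have h2 := abs_nonneg (p c)
  have h3 := norm_nonneg (affGrad p)
  have h4 : |p c| + H * ‖affGrad p‖ ≤ (1 + 4 / a) * (|p c| + a * H / 4 * ‖affGrad p‖) := by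
    have e : (1 + 4 / a) * (|p c| + a * H / 4 * ‖affGrad p‖) = |p c| + H * ‖affGrad p‖ +
        (4 / a * |p c| + a * H / 4 * ‖affGrad p‖) := by field_simp; ring
    rw [e]
    have : 0 ≤ 4 / a * |p c| + a * H / 4 * ‖affGrad p‖ := by positivity
    linarith
  have h5 := pow_le_pow_left₀ (by positivity) h4 2
  have h6 := mul_le_mul_of_nonneg_left h5 (sq_nonneg H)
  refine h6.trans ?_
  have h7 := mul_le_mul_of_nonneg_left h1 (by positivity : 0 ≤ (4 / a) ^ 2 * (1 + 4 / a) ^ 2)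
  refine le_trans (le_of_eq ?_) (h7.trans (le_of_eq ?_))
  · field_simp
  · ring

lemma ball_subset (h : E.Reg c H a b) : Metric.ball c (a * H / 4) ⊆ E.carrier := by
  have := h.star.pos
  exact (Metric.ball_subset_ball (by linarith)).trans h.star.ball

lemma sq_affine_le (h : E.Reg c H a b) (p : Plane →ᵃ[ℝ] ℝ) :
    H ^ 2 * (|p c| + H * ‖affGrad p‖) ^ 2 ≤ 200 * (4 / a) ^ 2 * (1 + 4 / a) ^ 2 *
      ∫ x in E.carrier, p x ^ 2 := by
  refine (h.sq_affine_le_ball p).trans (mul_le_mul_of_nonneg_left ?_ (by positivity))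
  have hi : IntegrableOn (fun x => p x ^ 2) E.carrier volume :=
    ((contDiff_affine p).continuous.pow 2).continuousOn.integrableOn_compact E.isCompact_carrier
  exact setIntegral_mono_set hi (Filter.Eventually.of_forall fun x => sq_nonneg (p x))
    h.ball_subset.eventuallyLE

end Reg

/-- An affine distributional Laplacian is controlled by the gradient. -/
lemma exists_laplacian_bound {a : ℝ} (ha : 0 < a) (b : ℝ) : ∃ K : ℝ, 0 < K ∧
    ∀ (E : Polygon2) (c : Plane) (H : ℝ), E.Reg c H a b → ∀ (g : Plane → Plane)
      (p : Plane →ᵃ[ℝ] ℝ), MemLp g 2 (volume.restrict E.carrier) →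
      (∀ φ : Plane → ℝ, ContDiff ℝ ∞ φ → HasCompactSupport φ → tsupport φ ⊆ interior E.carrier →
        ∫ x in E.carrier, ⟪g x, gradient φ x⟫ = -∫ x in E.carrier, p x * φ x) →
      H ^ 2 * ∫ x in E.carrier, p x ^ 2 ≤ K * ∫ x in E.carrier, ‖g x‖ ^ 2 := by
  obtain ⟨Kb, hKb, hbump⟩ := exists_bump
  set K₁ := 200 * (4 / a) ^ 2 * (1 + 4 / a) ^ 2 with hK₁
  have hK₁0 : 0 < K₁ := by positivity
  set K₂ := (1 + 2 * Kb / a) with hK₂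
  have hK₂0 : 0 < K₂ := by positivity
  refine ⟨16 * K₁ ^ 2 * K₂ ^ 2, by positivity, fun E c H h g p hg ht => ?_⟩
  have hH := h.H_pos
  have haH : 0 < a * H / 2 := by positivity
  -- The test function is `p * ψ`, with a cut-off supported in the star ball and equal to 1 on the
  -- ball of radius `a * H / 4`, where the mean square already controls all of `p`.
  obtain ⟨ψ, hψs, hψc, hψt, hψ1, hψ0, hψle, hψg⟩ := hbump c (a * H / 2) haH
  have hpc := contDiff_affine p
  have hφs : ContDiff ℝ ∞ (fun x => p x * ψ x) := hpc.mul hψs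
  have hφt : tsupport (fun x => p x * ψ x) ⊆ interior E.carrier := by
    refine (tsupport_mul_subset_right (f := p) (g := ψ)).trans (hψt.trans ?_)
    refine (Metric.closedBall_subset_ball ?_).trans h.star.ball_subset_interior
    linarith [h.star.pos]
  have h1 := ht _ hφs (hψc.mul_left (f := p)) hφt
  set Y := |p c| + H * ‖affGrad p‖ with hY
  have hY0 : 0 ≤ Y := by positivity
  have hpY : ∀ x ∈ E.carrier, |p x| ≤ Y := fun x hx => abs_affine_le p (h.norm_le x hx)
  have hcg : Continuous (gradient fun x => p x * ψ x) :=
    continuous_gradient (hφs.of_le (by norm_num))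
  have hgb : ∀ x ∈ E.carrier, ‖gradient (fun x => p x * ψ x) x‖ ≤ Y / H * K₂ := fun x hx => by
    have e : gradient (fun x => p x * ψ x) x = p x • gradient ψ x + ψ x • affGrad p := by
      refine ext_inner_right ℝ fun y => ?_
      rw [inner_gradient_left, fderiv_fun_mul (hpc.differentiable (by norm_num) x)
        (hψs.differentiable (by norm_num) x), inner_add_left, inner_smul_left, inner_smul_left,
        inner_gradient_left, ← gradient_affine p x, inner_gradient_left]
      simp
    rw [e]
    refine (norm_add_le _ _).trans ?_
    rw [norm_smul, norm_smul, Real.norm_eq_abs, Real.norm_eq_abs, abs_of_nonneg (hψ0 x)]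
    have t1 : |p x| * ‖gradient ψ x‖ ≤ Y * (Kb / (a * H / 2)) :=
      mul_le_mul (hpY x hx) (hψg x) (norm_nonneg _) hY0
    have t2 : ψ x * ‖affGrad p‖ ≤ Y / H := by
      rw [le_div_iff₀ hH]
      have := mul_le_mul_of_nonneg_right (hψle x) (norm_nonneg (affGrad p))
      have := abs_nonneg (p c)
      nlinarith
    have e2 : Y / H * K₂ = Y * (Kb / (a * H / 2)) + Y / H := by
      rw [hK₂]; field_simp; ring
    linarith
  have h2 := sq_integral_inner_le hg (E.memLp_of_continuousOn hcg.continuousOn)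
  rw [h1, neg_sq] at h2
  have h3 := integral_norm_sq_le hgb
  have h4 : ∫ x in Metric.ball c (a * H / 4), p x ^ 2 ≤ ∫ x in E.carrier, p x * (p x * ψ x) := by
    have hi : IntegrableOn (fun x => p x * (p x * ψ x)) E.carrier volume :=
      (hpc.continuous.mul hφs.continuous).continuousOn.integrableOn_compact E.isCompact_carrier
    refine le_trans (le_of_eq ?_) (setIntegral_mono_set hi (Filter.Eventually.of_forall fun x => ?_)
      h.ball_subset.eventuallyLE)
    · refine setIntegral_congr_fun Metric.isOpen_ball.measurableSet fun x hx => ?_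
      rw [Metric.mem_ball, dist_eq_norm] at hx
      simp only [hψ1 x (by linarith)]; ring
    · have := mul_nonneg (mul_self_nonneg (p x)) (hψ0 x)
      simp only [Pi.zero_apply]; linarith
  have h5 := h.sq_affine_le_ball p
  rw [← hK₁, ← hY] at h5
  have h6 : H ^ 2 * Y ^ 2 ≤ K₁ * ∫ x in E.carrier, p x * (p x * ψ x) :=
    h5.trans (mul_le_mul_of_nonneg_left h4 hK₁0.le)
  set X := ∫ x in E.carrier, ‖g x‖ ^ 2 with hX
  have hX0 : 0 ≤ X := integral_nonneg fun x => sq_nonneg _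
  have hA := h.area_le
  have h7 : (H ^ 2 * Y ^ 2) ^ 2 ≤ K₁ ^ 2 * (X * (4 * (Y ^ 2 * K₂ ^ 2))) := by
    calc (H ^ 2 * Y ^ 2) ^ 2 ≤ (K₁ * ∫ x in E.carrier, p x * (p x * ψ x)) ^ 2 :=
          pow_le_pow_left₀ (by positivity) h6 2
      _ = K₁ ^ 2 * (∫ x in E.carrier, p x * (p x * ψ x)) ^ 2 := by ring
      _ ≤ K₁ ^ 2 * (X * (E.area * (Y / H * K₂) ^ 2)) :=
          mul_le_mul_of_nonneg_left (h2.trans (mul_le_mul_of_nonneg_left h3 hX0)) (by positivity)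
      _ ≤ K₁ ^ 2 * (X * ((4 * H ^ 2) * (Y / H * K₂) ^ 2)) := by gcongr
      _ = _ := by field_simp
  -- Both sides of `h7` carry a factor `Y ^ 2`, coming from the test function on the right; it is
  -- cancelled unless it is zero.
  have h8 : H ^ 4 * Y ^ 2 ≤ 4 * K₁ ^ 2 * K₂ ^ 2 * X := by
    rcases hY0.eq_or_lt with h0 | h0
    · rw [← h0]; simp only [ne_eq, OfNat.ofNat_ne_zero, not_false_eq_true, zero_pow, mul_zero]
      positivity
    · have hY2 : 0 < Y ^ 2 := by positivity
      refine le_of_mul_le_mul_left ?_ hY2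
      linarith
  have h9 := integral_sq_le hpY
  calc H ^ 2 * ∫ x in E.carrier, p x ^ 2 ≤ H ^ 2 * (E.area * Y ^ 2) := by gcongr
    _ ≤ H ^ 2 * (4 * H ^ 2 * Y ^ 2) := by gcongr
    _ = 4 * (H ^ 4 * Y ^ 2) := by ring
    _ ≤ _ := by linarith

end Polygon2

namespace Polygon2

variable {E : Polygon2} {c : Plane} {r H a b : ℝ}

/-! ### Local estimates for virtual element functions -/

/-- A function of the local virtual element space, with its weak gradient. -/
structure LocalVE (E : Polygon2) (c : Plane) (v : Plane → ℝ) (g : Plane → Plane) : Prop where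
  isH1 : IsH1Grad (interior E.carrier) v g
  cont : ContinuousOn v E.carrier
  edgeLin : E.EdgeLinear v
  lap : ∃ p : Plane →ᵃ[ℝ] ℝ, ∀ φ : Plane → ℝ, ContDiff ℝ ∞ φ → HasCompactSupport φ →
    tsupport φ ⊆ interior E.carrier →
      ∫ x in E.carrier, ⟪g x, gradient φ x⟫ = -∫ x in E.carrier, p x * φ x
  enh : ∀ q : Plane →ᵃ[ℝ] ℝ, ∫ x in E.carrier, v x * q x =
    ∫ x in E.carrier, E.proj c (E.vals v) x * q x

lemma MemSpace.localVE {v : Plane → ℝ} (hv : E.MemSpace v) (h : E.StarAt c r) :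
    E.LocalVE c v (weakGrad (interior E.carrier) v) :=
  ⟨hv.isH1Grad, hv.continuousOn, hv.edgeLinear, hv.1.2.2.2, hv.integral_mul_eq h⟩

namespace LocalVE

variable {v : Plane → ℝ} {g : Plane → Plane}

lemma memLp_grad (hv : E.LocalVE c v g) : MemLp g 2 (volume.restrict E.carrier) := by
  have := hv.isH1.2.1
  rwa [E.restrict_interior] at this

lemma integrableOn_mul (hv : E.LocalVE c v g) {f : Plane → ℝ} (hf : ContinuousOn f E.carrier) :
    IntegrableOn (fun x => v x * f x) E.carrier volume :=
  (hv.cont.mul hf).integrableOn_compact E.isCompact_carrier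

/-- Constants are reproduced by the projection. A gradient can therefore be estimated by the
deviation of the vertex values from any constant. -/
lemma sub_const (hv : E.LocalVE c v g) (h : E.StarAt c r) (k : ℝ) :
    E.LocalVE c (fun x => v x - k) g := by
  refine ⟨?_, hv.cont.sub continuousOn_const, ?_, hv.lap, fun q => ?_⟩
  · have := hv.isH1.sub (h.isH1Grad_of_contDiff (contDiff_const (c := k)))
    have e : g - (gradient fun _ : Plane => k) = g := by
      ext1 x; simp [gradient_fun_const']
    rw [e] at this
    exact this
  · intro i
    obtain ⟨p, hp⟩ := hv.edgeLin i
    exact ⟨p - AffineMap.const ℝ Plane k, fun x hx => by simp [hp hx]⟩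
  · have hq := (contDiff_affine q).continuous
    have hP := (contDiff_affine (E.proj c (E.vals v))).continuous
    have e : E.vals (fun x => v x - k) = fun i => E.vals v i - k := rfl
    have i1 := hv.integrableOn_mul hq.continuousOn
    have i2 : IntegrableOn (fun x => E.proj c (E.vals v) x * q x) E.carrier volume :=
      (hP.mul hq).continuousOn.integrableOn_compact E.isCompact_carrier
    have i3 : IntegrableOn (fun x => k * q x) E.carrier volume :=
      (continuous_const.mul hq).continuousOn.integrableOn_compact E.isCompact_carrier
    simp only [e, proj_sub_const, sub_mul]
    rw [integral_sub i1 i3, integral_sub i2 i3, hv.enh q]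

end LocalVE

/-- The gradient is controlled by the size of the vertex values. -/
lemma exists_grad_bound {a b : ℝ} (ha : 0 < a) (hb : 0 < b) : ∃ K : ℝ, 0 < K ∧
    ∀ (E : Polygon2) (c : Plane) (H : ℝ), E.Reg c H a b → ∀ (v : Plane → ℝ) (g : Plane → Plane),
      E.LocalVE c v g → ∀ m : ℝ, (∀ i, |E.vals v i| ≤ m) →
      ∫ x in E.carrier, ‖g x‖ ^ 2 ≤ K * m ^ 2 := by
  obtain ⟨K₁, hK₁, hlap⟩ := exists_laplacian_bound ha b
  set K₂ := 1 + 16 / (3 * a ^ 3) with hK₂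
  have hK₂0 : 0 < K₂ := by positivity
  refine ⟨2 * (16 / (a * b) ^ 2) + 2 * (4 * K₁ * (1 + K₂) ^ 2), by positivity,
    fun E c H h v g hv m hm => ?_⟩
  have hH := h.H_pos
  have hm0 : 0 ≤ m := (abs_nonneg _).trans (hm E.zeroIdx)
  obtain ⟨p, hp⟩ := hv.lap
  have hgL := hv.memLp_grad
  have hpb := hlap E c H h g p hgL hp
  -- An explicit lifting of the boundary values with gradient of order `m / H`. The difference `v -
  -- w` vanishes on the boundary and can be tested against the distributional Laplacian.
  obtain ⟨w, hwf, hwl, hwm⟩ := h.star.exists_conical_extension hv.edgeLin (m := m) (H := H)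
    (ρ := b * H) hm h.norm_le (by positivity) h.tau_ge
  set L := 2 * H * m / (a * H * (b * H)) with hL
  have hL0 : 0 ≤ L := by positivity
  have hwL : LipschitzWith L.toNNReal w := by
    refine LipschitzWith.of_dist_le_mul fun x y => ?_
    rw [Real.dist_eq, dist_eq_norm, Real.coe_toNNReal _ hL0]
    exact hwl x y
  have hwO : MemLp w 2 (volume.restrict (interior E.carrier)) := by
    rw [E.restrict_interior]; exact E.memLp_of_continuousOn hwL.continuous.continuousOn
  have hwH : IsH1Grad (interior E.carrier) w (gradient w) :=
    isH1Grad_of_lipschitz (fun htop => E.volume_carrier_ne_top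
      (top_le_iff.1 (htop ▸ measure_mono interior_subset))) hwL hwO
  have hgwL : MemLp (gradient w) 2 (volume.restrict E.carrier) := by
    have := hwH.2.1
    rwa [E.restrict_interior] at this
  have hpc := (contDiff_affine p).continuous
  have hPc := (contDiff_affine (E.proj c (E.vals v))).continuous
  have h1 := h.star.integral_inner_eq_of_eq_zero_on_frontier (hv.isH1.sub hwH)
    (hv.cont.sub hwL.continuous.continuousOn)
    (fun x hx => by simp [hwf x hx]) hgL (E.memLp_of_continuousOn hpc.continuousOn) hp
  set X := ∫ x in E.carrier, ‖g x‖ ^ 2 with hX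
  have hX0 : 0 ≤ X := integral_nonneg fun x => sq_nonneg _
  have ip : ∀ {f : Plane → ℝ}, ContinuousOn f E.carrier →
      IntegrableOn (fun x => p x * f x) E.carrier volume := fun hf =>
    (hpc.continuousOn.mul hf).integrableOn_compact E.isCompact_carrier
  -- Enhancement enters here: in the integral of `p * v` the unknown interior values of `v` are
  -- replaced by the projection, which is bounded by the vertex values.
  have h2 : X = (∫ x in E.carrier, ⟪g x, gradient w x⟫) +
      ∫ x in E.carrier, p x * (w x - E.proj c (E.vals v) x) := by
    have e1 : ∫ x in E.carrier, ⟪g x, (g - gradient w) x⟫ =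
        X - ∫ x in E.carrier, ⟪g x, gradient w x⟫ := by
      simp only [Pi.sub_apply, inner_sub_right]
      rw [integral_sub (integrable_inner_of_memLp hgL hgL) (integrable_inner_of_memLp hgL hgwL)]
      simp only [real_inner_self_eq_norm_sq, hX]
    have e2 : ∫ x in E.carrier, p x * (v - w) x =
        (∫ x in E.carrier, p x * v x) - ∫ x in E.carrier, p x * w x := by
      rw [← integral_sub (ip hv.cont) (ip hwL.continuous.continuousOn)]
      simp only [Pi.sub_apply, mul_sub]
    have e3 : ∫ x in E.carrier, p x * (w x - E.proj c (E.vals v) x) =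
        (∫ x in E.carrier, p x * w x) - ∫ x in E.carrier, p x * E.proj c (E.vals v) x := by
      rw [← integral_sub (ip hwL.continuous.continuousOn) (ip hPc.continuousOn)]
      simp only [mul_sub]
    have e4 := hv.enh p
    simp only [mul_comm _ (p _)] at e4
    rw [e1, e2] at h1
    rw [e3]
    linarith
  have b1 : (∫ x in E.carrier, ⟪g x, gradient w x⟫) ^ 2 ≤ X * (16 / (a * b) ^ 2 * m ^ 2) := by
    refine (sq_integral_inner_le hgL hgwL).trans (mul_le_mul_of_nonneg_left ?_ hX0)
    have hb' : ∀ x ∈ E.carrier, ‖gradient w x‖ ≤ L := fun x _ => by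
      rw [gradient, LinearIsometryEquiv.norm_map]
      have := norm_fderiv_le_of_lipschitz ℝ hwL (x₀ := x)
      rwa [Real.coe_toNNReal _ hL0] at this
    refine (integral_norm_sq_le hb').trans ?_
    refine (mul_le_mul_of_nonneg_right h.area_le (sq_nonneg L)).trans (le_of_eq ?_)
    rw [hL]; field_simp; ring
  have b2 : (∫ x in E.carrier, p x * (w x - E.proj c (E.vals v) x)) ^ 2 ≤
      X * (4 * K₁ * (1 + K₂) ^ 2 * m ^ 2) := by
    have hd : ContinuousOn (fun x => w x - E.proj c (E.vals v) x) E.carrier :=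
      hwL.continuous.continuousOn.sub hPc.continuousOn
    refine (sq_integral_mul_le (E.memLp_of_continuousOn hpc.continuousOn)
      (E.memLp_of_continuousOn hd)).trans ?_
    have t1 : ∫ x in E.carrier, (w x - E.proj c (E.vals v) x) ^ 2 ≤
        4 * H ^ 2 * ((1 + K₂) * m) ^ 2 := by
      refine (integral_sq_le (M := (1 + K₂) * m) fun x hx => ?_).trans
        (mul_le_mul_of_nonneg_right h.area_le (sq_nonneg _))
      refine (abs_sub _ _).trans ?_
      have := hwm x hx
      have := h.abs_proj_le hm hx
      rw [← hK₂] at this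
      linarith
    have t2 : 0 ≤ ∫ x in E.carrier, p x ^ 2 := integral_nonneg fun x => sq_nonneg _
    calc _ ≤ (∫ x in E.carrier, p x ^ 2) * (4 * H ^ 2 * ((1 + K₂) * m) ^ 2) :=
          mul_le_mul_of_nonneg_left t1 t2
      _ = (H ^ 2 * ∫ x in E.carrier, p x ^ 2) * (4 * ((1 + K₂) * m) ^ 2) := by ring
      _ ≤ (K₁ * X) * (4 * ((1 + K₂) * m) ^ 2) := by gcongr
      _ = _ := by ring
  -- Both terms of `h2` are at most a multiple of √X · m, so one factor `X` can be cancelled.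
  have h3 : X * X ≤ X * ((2 * (16 / (a * b) ^ 2) + 2 * (4 * K₁ * (1 + K₂) ^ 2)) * m ^ 2) := by
    have : X * X = ((∫ x in E.carrier, ⟪g x, gradient w x⟫) +
      ∫ x in E.carrier, p x * (w x - E.proj c (E.vals v) x)) ^ 2 := by rw [← h2]; ring
    rw [this]
    refine (add_sq_le (a := ∫ x in E.carrier, ⟪g x, gradient w x⟫)
      (b := ∫ x in E.carrier, p x * (w x - E.proj c (E.vals v) x))).trans ?_
    linarith
  rcases hX0.eq_or_lt with h0 | h0
  · rw [← h0]; positivity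
  · exact le_of_mul_le_mul_left h3 h0

/-- The increments of the vertex values are controlled by the gradient. -/
lemma exists_increment_bound {a b : ℝ} (ha : 0 < a) (hb : 0 < b) : ∃ K : ℝ, 0 < K ∧
    ∀ (E : Polygon2) (c : Plane) (H : ℝ), E.Reg c H a b → ∀ (v : Plane → ℝ) (g : Plane → Plane),
      E.LocalVE c v g → ∀ i, (E.vals v (finRotate E.n i) - E.vals v i) ^ 2 ≤
        K * ∫ x in E.carrier, ‖g x‖ ^ 2 := by
  obtain ⟨Kb, hKb, hbump⟩ := exists_bump
  refine ⟨(8 / (a * b)) ^ 2 * (64 * Kb ^ 2 / (a * b) ^ 2), by positivity,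
    fun E c H h v g hv i => ?_⟩
  have hH := h.H_pos
  have hgL := hv.memLp_grad
  -- In the ball of this radius around the edge midpoint both cone coordinates stay within 1/4 of
  -- 1/2, because their Lipschitz constant is at most `1 / (a * b * H)`. Hence the cut-off meets
  -- neither another edge nor the endpoints of edge `i`.
  set s := a * b * H / 4 with hs
  have hs0 : 0 < s := by positivity
  set y := E.edgePt i (1 / 2) with hy
  obtain ⟨ψ, hψs, hψc, hψt, hψ1, hψ0, hψle, hψg⟩ := hbump y s hs0
  have hcg := continuous_gradient (hψs.of_le (by norm_num) : ContDiff ℝ 1 ψ)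
  have hgt : ∀ x, x ∉ tsupport ψ → gradient ψ x = 0 := fun x hx => by
    have : x ∉ tsupport (fderiv ℝ ψ) := fun h => hx (tsupport_fderiv_subset ℝ h)
    rw [gradient, image_eq_zero_of_notMem_tsupport this, map_zero]
  have hD : a * H * (b * H) ≤ |E.coneDet c i| :=
    (mul_le_mul_of_nonneg_left (h.tau_ge i) h.star.pos.le).trans (h.star.le_abs_det i)
  have hq : ∀ q z : Plane, ‖q‖ ≤ H → ‖z‖ ≤ s → |det2 z q| / |E.coneDet c i| ≤ 1 / 4 :=
    fun q z hq hz => by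
      rw [div_le_div_iff₀ (lt_of_lt_of_le (by positivity) hD) (by norm_num)]
      have h1 := (abs_det2_le z q).trans (mul_le_mul hz hq (norm_nonneg _) hs0.le)
      have h2 : s * H * 4 = a * H * (b * H) := by rw [hs]; ring
      linarith
  have hA : ∀ x ∈ tsupport ψ, |E.coneA c i x - 1 / 2| ≤ 1 / 4 := fun x hx => by
    have h1 := hψt hx
    rw [Metric.mem_closedBall, dist_eq_norm] at h1
    have h2 : E.coneA c i y = 1 / 2 := by rw [hy, h.star.coneA_edgePt]; norm_num
    rw [← h2, coneA, coneA, ← sub_div, ← det2_sub_left, sub_sub_sub_cancel_right, abs_div]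
    exact hq _ _ (h.norm_le _ (E.edge_subset_carrier i (E.nextVertex_mem_edge i))) h1
  have hB : ∀ x ∈ tsupport ψ, |E.coneB c i x - 1 / 2| ≤ 1 / 4 := fun x hx => by
    have h1 := hψt hx
    rw [Metric.mem_closedBall, dist_eq_norm] at h1
    have h2 : E.coneB c i y = 1 / 2 := by rw [hy, h.star.coneB_edgePt]
    rw [← h2, coneB, coneB, ← sub_div, ← det2_sub_right, sub_sub_sub_cancel_right, abs_div,
      det2_swap, abs_neg]
    exact hq _ _ (h.norm_le _ (E.vertex_mem_carrier i)) h1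
  have hother : ∀ j, j ≠ i → ∀ t ∈ Icc (0 : ℝ) 1, gradient ψ (E.edgePt j t) = 0 :=
    fun j hj t ht => hgt _ fun hx => hj (h.star.eq_of_mem_interior_cone
      (by linarith [(abs_le.1 (hA _ hx)).1]) (by linarith [(abs_le.1 (hB _ hx)).1])
      (h.star.mem_cone_of_mem_edge (E.edgePt_mem_edge j ht)).1).symm
  have hend0 : ψ (E.edgePt i 0) = 0 := image_eq_zero_of_notMem_tsupport fun hx => by
    have := hA _ hx
    rw [h.star.coneA_edgePt] at this
    norm_num [abs_of_pos] at this
  have hend1 : ψ (E.edgePt i 1) = 0 := image_eq_zero_of_notMem_tsupport fun hx => by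
    have := hB _ hx
    rw [h.star.coneB_edgePt] at this
    norm_num [abs_of_pos] at this
  set Δ := E.vals v (finRotate E.n i) - E.vals v i with hΔ
  have hde : ∀ t, HasDerivAt (fun t => ψ (E.edgePt i t)) ⟪gradient ψ (E.edgePt i t), E.tau i⟫ t :=
    fun t => by
      have h1 : HasDerivAt (fun t => E.edgePt i t) (E.tau i) t := by
        simp only [edgePt_eq]
        simpa using ((hasDerivAt_id t).smul_const (E.tau i)).const_add (E.vertex i)
      have h2 := (hψs.differentiable (by norm_num) (E.edgePt i t)).hasFDerivAt.comp_hasDerivAt t h1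
      rw [← inner_gradient_left] at h2
      exact h2
  have hψe : Continuous fun t => ψ (E.edgePt i t) := hψs.continuous.comp (E.continuous_edgePt i)
  have hge : Continuous fun t => ⟪gradient ψ (E.edgePt i t), E.tau i⟫ :=
    (hcg.comp (E.continuous_edgePt i)).inner continuous_const
  -- Integration by parts on the edge: `v` has constant slope `Δ` there and the cut-off vanishes at
  -- both ends.
  have hedge : ∫ t in (0 : ℝ)..1, v (E.edgePt i t) * ⟪gradient ψ (E.edgePt i t), E.tau i⟫ =
      -(Δ * ∫ t in (0 : ℝ)..1, ψ (E.edgePt i t)) := by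
    have h1 : ∫ t in (0 : ℝ)..1, v (E.edgePt i t) * ⟪gradient ψ (E.edgePt i t), E.tau i⟫ =
        ∫ t in (0 : ℝ)..1, (E.vals v i + t * Δ) * ⟪gradient ψ (E.edgePt i t), E.tau i⟫ := by
      refine intervalIntegral.integral_congr fun t ht => ?_
      rw [uIcc_of_le zero_le_one] at ht
      simp only [hv.edgeLin.apply_edgePt i ht, hΔ, vals, nextVertex]
      ring
    have h2 := intervalIntegral.integral_mul_deriv_eq_deriv_mul (a := (0 : ℝ)) (b := 1)
      (u := fun t => E.vals v i + t * Δ) (u' := fun _ => Δ) (v := fun t => ψ (E.edgePt i t))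
      (v' := fun t => ⟪gradient ψ (E.edgePt i t), E.tau i⟫)
      (fun t _ => by simpa using ((hasDerivAt_id t).mul_const Δ).const_add (E.vals v i))
      (fun t _ => hde t) (continuous_const.intervalIntegrable _ _) (hge.intervalIntegrable _ _)
    rw [h1, h2, hend0, hend1, intervalIntegral.integral_const_mul]
    ring
  have hsum : ∑ j, ∫ t in (0 : ℝ)..1, v (E.edgePt j t) * ⟪gradient ψ (E.edgePt j t), E.tau j⟫ =
      -(Δ * ∫ t in (0 : ℝ)..1, ψ (E.edgePt i t)) := by
    rw [Finset.sum_eq_single i (fun j _ hj => ?_) (fun hi => absurd (Finset.mem_univ i) hi), hedge]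
    rw [intervalIntegral.integral_congr (g := fun _ => 0), intervalIntegral.integral_zero]
    intro t ht
    rw [uIcc_of_le zero_le_one] at ht
    simp [hother j hj t ht]
  have h1 := h.star.curl_identity hv.isH1 hv.cont (contDiff_infty.1 hψs 2)
  rw [hsum] at h1
  have hτ : ‖E.tau i‖ ≤ 2 * H := by
    have e : E.tau i = (E.nextVertex i - c) - (E.vertex i - c) := by rw [tau]; abel
    rw [e]
    refine (norm_sub_le _ _).trans ?_
    linarith [h.norm_le _ (E.vertex_mem_carrier i),
      h.norm_le _ (E.edge_subset_carrier i (E.nextVertex_mem_edge i))]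
  have hab : a * b ≤ 8 / 3 := by
    have h1 := h.card_le
    have h2 : (3 : ℝ) ≤ E.n := by exact_mod_cast E.three_le
    have : 0 < a * b := by positivity
    nlinarith
  -- Since the edge is no longer than `2 * H`, the cut-off equals 1 for |t - 1/2| ≤ `a * b / 16`, an
  -- interval of length `a * b / 8`. It lies in the unit interval because `a * b ≤ 8 / 3`.
  have hlow : a * b / 8 ≤ ∫ t in (0 : ℝ)..1, ψ (E.edgePt i t) := by
    have hab0 : 0 < a * b := by positivity
    set δ := a * b / 16 with hδ
    have h2 : ∫ t in (1 / 2 - δ)..(1 / 2 + δ), ψ (E.edgePt i t) ≤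
        ∫ t in (0 : ℝ)..1, ψ (E.edgePt i t) :=
      intervalIntegral.integral_mono_interval (by linarith) (by linarith) (by linarith)
        (Filter.Eventually.of_forall fun t => hψ0 _) (hψe.intervalIntegrable _ _)
    refine le_trans (le_of_eq ?_) h2
    rw [intervalIntegral.integral_congr (g := fun _ => (1 : ℝ)), intervalIntegral.integral_const]
    · simp; ring
    · intro t ht
      rw [uIcc_of_le (by linarith)] at ht
      refine hψ1 _ ?_
      have e : E.edgePt i t - y = (t - 1 / 2) • E.tau i := by
        rw [hy, edgePt_eq, edgePt_eq, sub_smul]; abel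
      rw [e, norm_smul, Real.norm_eq_abs]
      have h3 : |t - 1 / 2| ≤ δ := by rw [abs_le]; constructor <;> linarith [ht.1, ht.2]
      refine (mul_le_mul h3 hτ (norm_nonneg _) (by positivity)).trans (le_of_eq ?_)
      rw [hδ, hs]; ring
  have hrotL : MemLp (fun x => rotVec (gradient ψ x)) 2 (volume.restrict E.carrier) := by
    refine E.memLp_of_continuousOn (Continuous.continuousOn ?_)
    unfold rotVec
    fun_prop
  have hrn : ∀ x ∈ E.carrier, ‖rotVec (gradient ψ x)‖ ≤ Kb / s := fun x _ => by
    refine le_trans (le_of_eq ?_) (hψg x)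
    rw [← sq_eq_sq₀ (norm_nonneg _) (norm_nonneg _), plane_norm_sq, plane_norm_sq]
    simp [rotVec]; ring
  have h2 := sq_integral_inner_le hgL hrotL
  set X := ∫ x in E.carrier, ‖g x‖ ^ 2 with hX
  have hX0 : 0 ≤ X := integral_nonneg fun x => sq_nonneg _
  rw [h1, mul_pow, sq (E.orient c), h.star.orient_sq, one_mul, neg_sq] at h2
  have h3 := integral_norm_sq_le hrn
  have hab0 : 0 < a * b := by positivity
  have h4 : Δ ^ 2 * (a * b / 8) ^ 2 ≤ X * (64 * Kb ^ 2 / (a * b) ^ 2) := by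
    calc Δ ^ 2 * (a * b / 8) ^ 2 ≤ Δ ^ 2 * (∫ t in (0 : ℝ)..1, ψ (E.edgePt i t)) ^ 2 := by gcongr
      _ = (Δ * ∫ t in (0 : ℝ)..1, ψ (E.edgePt i t)) ^ 2 := by ring
      _ ≤ X * (E.area * (Kb / s) ^ 2) := h2.trans (mul_le_mul_of_nonneg_left h3 hX0)
      _ ≤ X * (4 * H ^ 2 * (Kb / s) ^ 2) := by
          have := h.area_le
          gcongr
      _ = _ := by rw [hs]; field_simp; ring
  have e : Δ ^ 2 = (8 / (a * b)) ^ 2 * (Δ ^ 2 * (a * b / 8) ^ 2) := by field_simp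
  rw [e, mul_assoc]
  refine mul_le_mul_of_nonneg_left ?_ (by positivity)
  linarith

end Polygon2

/-! ### Equivalence of the discrete forms with the norms -/

namespace Polygon2

variable {E : Polygon2} {c : Plane} {r H a b : ℝ}

lemma vals_le_sqrt_sum (β : Fin E.n → ℝ) (i : Fin E.n) : |β i| ≤ √(∑ j, β j ^ 2) := by
  refine Real.abs_le_sqrt ?_
  exact Finset.single_le_sum (f := fun j => β j ^ 2) (fun j _ => sq_nonneg _) (Finset.mem_univ i)

lemma sum_sq_nonneg (β : Fin E.n → ℝ) : 0 ≤ ∑ j, β j ^ 2 :=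
  Finset.sum_nonneg fun _ _ => sq_nonneg _

lemma LocalVE.integral_sq_nonneg (v : Plane → ℝ) : 0 ≤ ∫ x in E.carrier, v x ^ 2 :=
  integral_nonneg fun _ => sq_nonneg _

/-- The radial term is of lower order. -/
lemma LocalVE.sq_integral_radial_le {v : Plane → ℝ} {g : Plane → Plane} (hv : E.LocalVE c v g)
    (h : E.Reg c H a b) : (∫ x in E.carrier, v x * ⟪g x, x - c⟫) ^ 2 ≤
      (∫ x in E.carrier, ‖g x‖ ^ 2) * (H ^ 2 * ∫ x in E.carrier, v x ^ 2) := by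
  have hgL := hv.memLp_grad
  have hvx : ContinuousOn (fun x => v x • (x - c)) E.carrier :=
    hv.cont.smul (by fun_prop)
  have e : ∫ x in E.carrier, v x * ⟪g x, x - c⟫ = ∫ x in E.carrier, ⟪g x, v x • (x - c)⟫ := by
    simp only [inner_smul_right]
  rw [e]
  refine (sq_integral_inner_le hgL (E.memLp_of_continuousOn hvx)).trans
    (mul_le_mul_of_nonneg_left ?_ (integral_nonneg fun x => sq_nonneg _))
  rw [← integral_const_mul]
  have hi1 : IntegrableOn (fun x => ‖v x • (x - c)‖ ^ 2) E.carrier volume :=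
    (hvx.norm.pow 2).integrableOn_compact E.isCompact_carrier
  have hi2 : IntegrableOn (fun x => H ^ 2 * v x ^ 2) E.carrier volume :=
    (continuousOn_const.mul (hv.cont.pow 2)).integrableOn_compact E.isCompact_carrier
  refine setIntegral_mono_on hi1 hi2 E.isClosed_carrier.measurableSet fun x hx => ?_
  rw [norm_smul, mul_pow, Real.norm_eq_abs, sq_abs, mul_comm]
  exact mul_le_mul_of_nonneg_right (pow_le_pow_left₀ (norm_nonneg _) (h.norm_le x hx) 2)
    (sq_nonneg _)

/-- The `L²` norm is controlled by the vertex values. -/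
lemma exists_l2_upper {a b : ℝ} (ha : 0 < a) (hb : 0 < b) : ∃ K : ℝ, 0 < K ∧
    ∀ (E : Polygon2) (c : Plane) (H : ℝ), E.Reg c H a b → ∀ (v : Plane → ℝ) (g : Plane → Plane),
      E.LocalVE c v g → ∫ x in E.carrier, v x ^ 2 ≤ K * (H ^ 2 * ∑ i, E.vals v i ^ 2) := by
  obtain ⟨K₁, hK₁, hgrad⟩ := exists_grad_bound ha hb
  refine ⟨8 + K₁, by positivity, fun E c H h v g hv => ?_⟩
  have hH := h.H_pos
  set S := ∑ i, E.vals v i ^ 2 with hS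
  have hS0 : 0 ≤ S := sum_sq_nonneg _
  have h1 := hgrad E c H h v g hv (√S) (vals_le_sqrt_sum _)
  rw [Real.sq_sqrt hS0] at h1
  have h2 := hv.sq_integral_radial_le h
  have h3 := h.star.radial_identity hv.isH1 hv.cont hv.edgeLin
  have h4 : ∑ i, |E.coneDet c i| * ((v (E.vertex i) ^ 2 + v (E.vertex i) * v (E.nextVertex i) +
      v (E.nextVertex i) ^ 2) / 3) ≤ 8 * (H ^ 2 * S) := by
    have hA := h.area_le
    calc _ ≤ ∑ i, |E.coneDet c i| * S := by
          refine Finset.sum_le_sum fun i _ => mul_le_mul_of_nonneg_left ?_ (abs_nonneg _)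
          have s1 : E.vals v i ^ 2 ≤ S := Finset.single_le_sum
            (f := fun j => E.vals v j ^ 2) (fun j _ => sq_nonneg _) (Finset.mem_univ i)
          have s2 : E.vals v (finRotate E.n i) ^ 2 ≤ S := Finset.single_le_sum
            (f := fun j => E.vals v j ^ 2) (fun j _ => sq_nonneg _) (Finset.mem_univ _)
          change (E.vals v i ^ 2 + E.vals v i * E.vals v (finRotate E.n i) +
            E.vals v (finRotate E.n i) ^ 2) / 3 ≤ S
          have := sq_nonneg (E.vals v i - E.vals v (finRotate E.n i))
          linarith
      _ = 2 * E.area * S := by rw [← Finset.sum_mul, ← h.star.two_mul_area]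
      _ ≤ _ := by nlinarith
  set X := ∫ x in E.carrier, v x ^ 2 with hX
  have hX0 : 0 ≤ X := LocalVE.integral_sq_nonneg v
  set Y := ∫ x in E.carrier, v x * ⟪g x, x - c⟫ with hY
  have h5 : Y ^ 2 ≤ K₁ * S * (H ^ 2 * X) :=
    h2.trans (mul_le_mul_of_nonneg_right h1 (by positivity))
  -- Young's inequality. In X = (boundary sum)/2 - Y half of X is absorbed, which leaves the
  -- constant 8 + K₁.
  have h6 : |Y| ≤ (K₁ * S * H ^ 2 + X) / 2 := by
    refine abs_le_of_sq_le_sq ?_ (by positivity)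
    have := sq_nonneg (K₁ * S * H ^ 2 - X)
    nlinarith
  have h7 := (abs_le.1 h6).1
  nlinarith

/-- The vertex values are controlled by the `L²` norm. -/
lemma exists_l2_lower {a b : ℝ} (ha : 0 < a) (hb : 0 < b) : ∃ K : ℝ, 0 < K ∧
    ∀ (E : Polygon2) (c : Plane) (H : ℝ), E.Reg c H a b → ∀ (v : Plane → ℝ) (g : Plane → Plane),
      E.LocalVE c v g → H ^ 2 * ∑ i, E.vals v i ^ 2 ≤ K * ∫ x in E.carrier, v x ^ 2 := by
  obtain ⟨K₁, hK₁, hgrad⟩ := exists_grad_bound ha hb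
  refine ⟨6 / (a * b) * (2 + 6 * K₁ / (a * b)), by positivity, fun E c H h v g hv => ?_⟩
  have hH := h.H_pos
  set S := ∑ i, E.vals v i ^ 2 with hS
  have hS0 : 0 ≤ S := sum_sq_nonneg _
  have h1 := hgrad E c H h v g hv (√S) (vals_le_sqrt_sum _)
  rw [Real.sq_sqrt hS0] at h1
  have h2 := hv.sq_integral_radial_le h
  have h3 := h.star.radial_identity hv.isH1 hv.cont hv.edgeLin
  -- Pointwise p² + pq + q² ≥ (p² + q²)/2, and every vertex belongs to two edges.
  have h4 : a * b / 3 * (H ^ 2 * S) ≤ ∑ i, |E.coneDet c i| * ((v (E.vertex i) ^ 2 +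
      v (E.vertex i) * v (E.nextVertex i) + v (E.nextVertex i) ^ 2) / 3) := by
    have e : a * b / 3 * (H ^ 2 * S) = ∑ i, a * H * (b * H) *
        ((E.vals v i ^ 2 + E.vals v (finRotate E.n i) ^ 2) / 6) := by
      rw [← Finset.mul_sum, ← Finset.sum_div, Finset.sum_add_distrib,
        Equiv.sum_comp (finRotate E.n) (fun j => E.vals v j ^ 2), ← hS]
      ring
    rw [e]
    refine Finset.sum_le_sum fun i _ => mul_le_mul ((mul_le_mul_of_nonneg_left (h.tau_ge i)
      h.star.pos.le).trans (h.star.le_abs_det i)) ?_ (by positivity) (abs_nonneg _)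
    change _ ≤ (E.vals v i ^ 2 + E.vals v i * E.vals v (finRotate E.n i) +
            E.vals v (finRotate E.n i) ^ 2) / 3
    have := sq_nonneg (E.vals v i + E.vals v (finRotate E.n i))
    linarith
  set X := ∫ x in E.carrier, v x ^ 2 with hX
  have hX0 : 0 ≤ X := LocalVE.integral_sq_nonneg v
  set Y := ∫ x in E.carrier, v x * ⟪g x, x - c⟫ with hY
  have h5 : Y ^ 2 ≤ K₁ * S * (H ^ 2 * X) :=
    h2.trans (mul_le_mul_of_nonneg_right h1 (by positivity))
  have hab : 0 < a * b := by positivity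
  -- The weights are chosen so that `2 * |Y|` uses up exactly half of the lower bound `h4`; the
  -- other half remains on the left.
  have h6 : |Y| ≤ a * b / 12 * (H ^ 2 * S) + 3 * K₁ / (a * b) * X := by
    refine abs_le_of_sq_le_sq (h5.trans ?_) (by positivity)
    have h7 := sq_nonneg (a * b / 12 * (H ^ 2 * S) - 3 * K₁ / (a * b) * X)
    have h8 : 4 * (a * b / 12 * (H ^ 2 * S)) * (3 * K₁ / (a * b) * X) = K₁ * S * (H ^ 2 * X) := by
      field_simp; ring
    linarith
  have h7 := (abs_le.1 h6).2
  have e : 6 / (a * b) * (2 + 6 * K₁ / (a * b)) * X =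
    6 / (a * b) * ((2 + 6 * K₁ / (a * b)) * X) := by ring
  have e2 : H ^ 2 * S = 6 / (a * b) * (a * b / 6 * (H ^ 2 * S)) := by field_simp
  rw [e, e2]
  refine mul_le_mul_of_nonneg_left ?_ (by positivity)
  have e3 : 6 * K₁ / (a * b) = 2 * (3 * K₁ / (a * b)) := by ring
  rw [e3]
  linarith

/-- All vertex values differ by at most the gradient. -/
lemma exists_oscillation_bound {a b : ℝ} (ha : 0 < a) (hb : 0 < b) : ∃ K : ℝ, 0 < K ∧
    ∀ (E : Polygon2) (c : Plane) (H : ℝ), E.Reg c H a b → ∀ (v : Plane → ℝ) (g : Plane → Plane),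
      E.LocalVE c v g → ∃ k : ℝ, ∀ i, (E.vals v i - k) ^ 2 ≤ K * ∫ x in E.carrier, ‖g x‖ ^ 2 := by
  obtain ⟨K₁, hK₁, hinc⟩ := exists_increment_bound ha hb
  refine ⟨(8 / (a * b)) ^ 2 * K₁, by positivity, fun E c H h v g hv => ⟨E.vals v E.zeroIdx, ?_⟩⟩
  set X := ∫ x in E.carrier, ‖g x‖ ^ 2 with hX
  have hX0 : 0 ≤ X := integral_nonneg fun x => sq_nonneg _
  set D := √(K₁ * X) with hD
  have hD0 : 0 ≤ D := Real.sqrt_nonneg _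
  have hD2 : D ^ 2 = K₁ * X := Real.sq_sqrt (by positivity)
  have hstep : ∀ i, |E.vals v (finRotate E.n i) - E.vals v i| ≤ D := fun i =>
    Real.abs_le_sqrt (hinc E c H h v g hv i)
  -- Walk along the boundary from the reference vertex. The number of steps is bounded by `card_le`,
  -- uniformly in the shape.
  have hwalk : ∀ (k : ℕ) (hk : k < E.n), |E.vals v ⟨k, hk⟩ - E.vals v E.zeroIdx| ≤ k * D := by
    intro k
    induction k with
    | zero => intro hk; simp [zeroIdx]
    | succ k ih =>
      intro hk
      have h1 := ih (by omega)
      have h2 := hstep ⟨k, by omega⟩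
      have h3 : finRotate E.n ⟨k, by omega⟩ = ⟨k + 1, hk⟩ := by
        obtain ⟨n, hn⟩ : ∃ n, E.n = n + 1 := ⟨E.n - 1, by omega⟩
        have key : ∀ (N : ℕ) (hN : N = n + 1) (h' : k < N) (h'' : k + 1 < N),
            finRotate N ⟨k, h'⟩ = ⟨k + 1, h''⟩ := by
          rintro N rfl h' h''
          exact finRotate_of_lt (by omega)
        exact key _ hn _ _
      rw [h3] at h2
      have h4 := abs_add_le (E.vals v ⟨k + 1, hk⟩ - E.vals v ⟨k, by omega⟩)
        (E.vals v ⟨k, by omega⟩ - E.vals v E.zeroIdx)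
      rw [sub_add_sub_cancel] at h4
      push_cast
      linarith
  intro i
  have h1 := hwalk i.1 i.2
  have h2 : (i.1 : ℝ) ≤ 8 / (a * b) := by
    rw [le_div_iff₀ (by positivity), mul_comm]
    refine le_trans ?_ h.card_le
    have : (i.1 : ℝ) ≤ E.n := by exact_mod_cast i.2.le
    exact mul_le_mul_of_nonneg_left this (by positivity)
  have h3 : |E.vals v i - E.vals v E.zeroIdx| ≤ 8 / (a * b) * D :=
    h1.trans (mul_le_mul_of_nonneg_right h2 hD0)
  rw [← sq_abs]
  refine (pow_le_pow_left₀ (abs_nonneg _) h3 2).trans (le_of_eq ?_)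
  rw [mul_pow, hD2]; ring

lemma abs_dev_le (h : E.Reg c H a b) {β : Fin E.n → ℝ} {m : ℝ} (hm : ∀ i, |β i| ≤ m)
    (i : Fin E.n) : |E.dev c β i| ≤ (2 + 16 / (3 * a ^ 3)) * m := by
  refine (abs_sub _ _).trans ?_
  have := h.abs_proj_le hm (E.vertex_mem_carrier i)
  have := hm i
  linarith

lemma sum_dev_sq_le (h : E.Reg c H a b) {β : Fin E.n → ℝ} {m : ℝ} (hm : ∀ i, |β i| ≤ m) :
    ∑ i, E.dev c β i * E.dev c β i ≤ 8 / (a * b) * (2 + 16 / (3 * a ^ 3)) ^ 2 * m ^ 2 := by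
  have ha := h.a_pos
  have hb := h.b_pos
  have h1 : ∀ i ∈ Finset.univ, E.dev c β i * E.dev c β i ≤ ((2 + 16 / (3 * a ^ 3)) * m) ^ 2 :=
    fun i _ => by
      rw [← sq, ← sq_abs]
      exact pow_le_pow_left₀ (abs_nonneg _) (abs_dev_le h hm i) 2
  refine (Finset.sum_le_card_nsmul _ _ _ h1).trans ?_
  rw [Finset.card_univ, Fintype.card_fin, nsmul_eq_mul, mul_assoc, ← mul_pow]
  refine mul_le_mul_of_nonneg_right ?_ (sq_nonneg _)
  rw [le_div_iff₀ (by positivity), mul_comm]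
  exact h.card_le

lemma dev_sub_const (E : Polygon2) (c : Plane) (β : Fin E.n → ℝ) (k : ℝ) (i : Fin E.n) :
    E.dev c (fun i => β i - k) i = E.dev c β i := by
  rw [dev, dev, proj_sub_const]; ring

lemma stiffB_sub_const (E : Polygon2) (c : Plane) (β : Fin E.n → ℝ) (k : ℝ) :
    E.stiffB c (fun i => β i - k) (fun i => β i - k) = E.stiffB c β β := by
  simp only [stiffB, projGrad_sub_const, dev_sub_const]

lemma integral_proj_sq_le_massB (h : E.Reg c H a b) (β : Fin E.n → ℝ) :
    ∫ x in E.carrier, E.proj c β x ^ 2 ≤ E.massB c β β := by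
  simp only [massB, sq]
  have := mul_nonneg h.area_pos.le (Finset.sum_nonneg fun i (_ : i ∈ Finset.univ) =>
    mul_self_nonneg (E.dev c β i))
  linarith

lemma massB_self_nonneg (h : E.Reg c H a b) (β : Fin E.n → ℝ) : 0 ≤ E.massB c β β :=
  (integral_nonneg fun _ => sq_nonneg _).trans (integral_proj_sq_le_massB h β)

lemma stiffB_self_nonneg (h : E.Reg c H a b) (β : Fin E.n → ℝ) : 0 ≤ E.stiffB c β β :=
  add_nonneg (mul_nonneg h.area_pos.le real_inner_self_nonneg)
    (Finset.sum_nonneg fun i _ => mul_self_nonneg (E.dev c β i))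

/-- Equivalence of the discrete mass form with the `L²` norm. -/
theorem exists_massB_equiv {a b : ℝ} (ha : 0 < a) (hb : 0 < b) : ∃ K : ℝ, 0 < K ∧
    ∀ (E : Polygon2) (c : Plane) (H : ℝ), E.Reg c H a b → ∀ (v : Plane → ℝ) (g : Plane → Plane),
      E.LocalVE c v g → ∫ x in E.carrier, v x ^ 2 ≤ K * E.massB c (E.vals v) (E.vals v) ∧
        E.massB c (E.vals v) (E.vals v) ≤ K * ∫ x in E.carrier, v x ^ 2 := by
  obtain ⟨K₁, hK₁, hup⟩ := exists_l2_upper ha hb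
  obtain ⟨K₂, hK₂, hlow⟩ := exists_l2_lower ha hb
  set A := 200 * (4 / a) ^ 2 * (1 + 4 / a) ^ 2 with hA
  have hA0 : 0 < A := by positivity
  set B := 4 * (1 + 16 / (3 * a ^ 3)) ^ 2 + 4 * (8 / (a * b) * (2 + 16 / (3 * a ^ 3)) ^ 2) with hB
  have hB0 : 0 < B := by positivity
  set D := 2 / (3 * a ^ 2) + 2 * (8 / (a * b)) * A with hD
  have hD0 : 0 < D := by positivity
  refine ⟨K₁ * D + B * K₂, by positivity, fun E c H h v g hv => ⟨?_, ?_⟩⟩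
  · set β := E.vals v
    have hH := h.H_pos
    have h1 := hup E c H h v g hv
    set P := ∫ x in E.carrier, E.proj c β x ^ 2 with hP
    have hP0 : 0 ≤ P := integral_nonneg fun x => sq_nonneg _
    set Q := ∑ i, E.dev c β i * E.dev c β i with hQ
    have hQ0 : 0 ≤ Q := Finset.sum_nonneg fun i _ => mul_self_nonneg _
    have hm : E.massB c β β = P + E.area * Q := by
      simp only [massB, hP, hQ, sq]
    -- A vertex value is projection plus deviation. The projection is controlled by its mean square
    -- (inverse estimate), the deviation by the stabilisation with weight `area`, comparable to `H ^
    -- 2`.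
    have h2 : ∀ i, H ^ 2 * E.proj c β (E.vertex i) ^ 2 ≤ A * P := fun i => by
      refine le_trans ?_ (h.sq_affine_le (E.proj c β))
      refine mul_le_mul_of_nonneg_left ?_ (sq_nonneg H)
      rw [← sq_abs]
      exact pow_le_pow_left₀ (abs_nonneg _)
        (abs_affine_le _ (h.norm_le _ (E.vertex_mem_carrier i))) 2
    have h3 : H ^ 2 * ∑ i, β i ^ 2 ≤ 2 * (H ^ 2 * Q) + 2 * (E.n * (A * P)) := by
      have h4 : ∑ i, H ^ 2 * E.proj c β (E.vertex i) ^ 2 ≤ E.n * (A * P) := by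
        have := Finset.sum_le_card_nsmul Finset.univ _ _ fun i _ => h2 i
        simpa using this
      have h5 : H ^ 2 * ∑ i, β i ^ 2 ≤ ∑ i, (2 * (H ^ 2 * (E.dev c β i * E.dev c β i)) +
          2 * (H ^ 2 * E.proj c β (E.vertex i) ^ 2)) := by
        rw [Finset.mul_sum]
        refine Finset.sum_le_sum fun i _ => ?_
        have e : β i = E.dev c β i + E.proj c β (E.vertex i) := by rw [dev]; ring
        have := mul_nonneg (sq_nonneg H) (sq_nonneg (E.dev c β i - E.proj c β (E.vertex i)))
        rw [e]; linarith
      rw [Finset.sum_add_distrib, ← Finset.mul_sum, ← Finset.mul_sum, ← Finset.mul_sum] at h5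
      linarith
    have h4 : H ^ 2 * Q ≤ 1 / (3 * a ^ 2) * (E.area * Q) := by
      have := mul_le_mul_of_nonneg_right h.le_area hQ0
      rw [one_div, ← div_eq_inv_mul, le_div_iff₀ (by positivity)]
      linarith
    have h5 : (E.n : ℝ) * (A * P) ≤ 8 / (a * b) * (A * P) := by
      refine mul_le_mul_of_nonneg_right ?_ (by positivity)
      rw [le_div_iff₀ (by positivity), mul_comm]
      exact h.card_le
    have hAQ : 0 ≤ E.area * Q := mul_nonneg h.area_pos.le hQ0
    have h6 : H ^ 2 * ∑ i, β i ^ 2 ≤ D * E.massB c β β := by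
      rw [hm, hD]
      have t1 : 0 ≤ 2 / (3 * a ^ 2) * P := by positivity
      have t2 : 0 ≤ 2 * (8 / (a * b)) * A * (E.area * Q) := mul_nonneg (by positivity) hAQ
      have e1 : 1 / (3 * a ^ 2) * (E.area * Q) * 2 = 2 / (3 * a ^ 2) * (E.area * Q) := by ring
      linarith
    have h7 := mul_le_mul_of_nonneg_left h6 hK₁.le
    have h8 : 0 ≤ B * K₂ * E.massB c β β :=
      mul_nonneg (by positivity) (massB_self_nonneg h β)
    linarith
  · set β := E.vals v with hβ
    -- For the converse both parts of the mass form are bounded by the vertex values, which the `L²`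
    -- norm controls.
    have h1 := hlow E c H h v g hv
    set S := ∑ i, β i ^ 2 with hS
    have hS0 : 0 ≤ S := sum_sq_nonneg _
    have hm := vals_le_sqrt_sum β
    have h2 := integral_sq_le (f := E.proj c β) fun x hx => h.abs_proj_le hm hx
    have h3 := sum_dev_sq_le h hm
    rw [mul_pow, ← hS, Real.sq_sqrt hS0] at h2
    rw [← hS, Real.sq_sqrt hS0] at h3
    have hAr := h.area_le
    have h4 : E.massB c β β ≤ B * (H ^ 2 * S) := by
      have e : E.massB c β β = (∫ x in E.carrier, E.proj c β x ^ 2) +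
          E.area * ∑ i, E.dev c β i * E.dev c β i := by simp only [massB, sq]
      rw [e, hB]
      have t1 := mul_le_mul_of_nonneg_right hAr
        (by positivity : 0 ≤ (1 + 16 / (3 * a ^ 3)) ^ 2 * S)
      have t2 := (mul_le_mul_of_nonneg_left h3 h.area_pos.le).trans (mul_le_mul_of_nonneg_right hAr
        (by positivity : 0 ≤ 8 / (a * b) * (2 + 16 / (3 * a ^ 3)) ^ 2 * S))
      linarith
    have h5 := mul_le_mul_of_nonneg_left h1 hB0.le
    have h6 : 0 ≤ K₁ * D * ∫ x in E.carrier, v x ^ 2 :=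
      mul_nonneg (by positivity) (LocalVE.integral_sq_nonneg v)
    linarith

/-- Equivalence of the discrete stiffness form with the `H¹` seminorm. -/
theorem exists_stiffB_equiv {a b : ℝ} (ha : 0 < a) (hb : 0 < b) : ∃ K : ℝ, 0 < K ∧
    ∀ (E : Polygon2) (c : Plane) (H : ℝ), E.Reg c H a b → ∀ (v : Plane → ℝ) (g : Plane → Plane),
      E.LocalVE c v g → ∫ x in E.carrier, ‖g x‖ ^ 2 ≤ K * E.stiffB c (E.vals v) (E.vals v) ∧
        E.stiffB c (E.vals v) (E.vals v) ≤ K * ∫ x in E.carrier, ‖g x‖ ^ 2 := by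
  obtain ⟨K₁, hK₁, hgrad⟩ := exists_grad_bound ha hb
  obtain ⟨K₂, hK₂, hosc⟩ := exists_oscillation_bound ha hb
  set B := 4 * (8 / (3 * a ^ 3)) ^ 2 + 8 / (a * b) * (2 + 16 / (3 * a ^ 3)) ^ 2 with hB
  have hB0 : 0 < B := by positivity
  set D := 2 + 2 / (3 * a ^ 2) with hD
  have hD0 : 0 < D := by positivity
  refine ⟨K₁ * D + B * K₂, by positivity, fun E c H h v g hv => ⟨?_, ?_⟩⟩
  · set β := E.vals v with hβ
    -- Subtracting the value of the projection at the centre leaves the deviation plus the linear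
    -- part, and these are precisely the quantities measured by the stiffness form.
    set k := E.projVal c β with hk
    have hH := h.H_pos
    set Q := ∑ i, E.dev c β i * E.dev c β i with hQ
    have hQ0 : 0 ≤ Q := Finset.sum_nonneg fun i _ => mul_self_nonneg _
    have hs : E.stiffB c β β = E.area * ‖E.projGrad c β‖ ^ 2 + Q := by
      rw [stiffB, real_inner_self_eq_norm_sq]
    have h1 : ∀ i, (β i - k) ^ 2 ≤ D * E.stiffB c β β := fun i => by
      have e : β i - k = E.dev c β i + ⟪E.projGrad c β, E.vertex i - c⟫ := by
        rw [dev, proj_apply]; ring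
      have h2 : ⟪E.projGrad c β, E.vertex i - c⟫ ^ 2 ≤ H ^ 2 * ‖E.projGrad c β‖ ^ 2 := by
        rw [← sq_abs, ← mul_pow]
        refine pow_le_pow_left₀ (abs_nonneg _) ((abs_real_inner_le_norm _ _).trans ?_) 2
        rw [mul_comm]
        exact mul_le_mul_of_nonneg_right (h.norm_le _ (E.vertex_mem_carrier i)) (norm_nonneg _)
      have h3 : E.dev c β i * E.dev c β i ≤ Q := Finset.single_le_sum
        (f := fun j => E.dev c β j * E.dev c β j) (fun j _ => mul_self_nonneg _)
        (Finset.mem_univ i)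
      have h4 : H ^ 2 * ‖E.projGrad c β‖ ^ 2 ≤ 1 / (3 * a ^ 2) *
          (E.area * ‖E.projGrad c β‖ ^ 2) := by
        have := mul_le_mul_of_nonneg_right h.le_area (sq_nonneg ‖E.projGrad c β‖)
        rw [one_div, ← div_eq_inv_mul, le_div_iff₀ (by positivity)]
        linarith
      rw [e, hs, hD]
      have h5 := sq_nonneg (E.dev c β i - ⟪E.projGrad c β, E.vertex i - c⟫)
      have t1 : 0 ≤ 2 / (3 * a ^ 2) * Q := by positivity
      have t2 : 0 ≤ E.area * ‖E.projGrad c β‖ ^ 2 := mul_nonneg h.area_pos.le (sq_nonneg _)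
      have e1 : 1 / (3 * a ^ 2) * (E.area * ‖E.projGrad c β‖ ^ 2) * 2 =
        2 / (3 * a ^ 2) * (E.area * ‖E.projGrad c β‖ ^ 2) := by ring
      linarith
    have hst0 := stiffB_self_nonneg h β
    have h2 := hgrad E c H h _ g (hv.sub_const h.star k) (√(D * E.stiffB c β β))
      fun i => Real.abs_le_sqrt (h1 i)
    rw [Real.sq_sqrt (by positivity)] at h2
    have h8 : 0 ≤ B * K₂ * E.stiffB c β β := mul_nonneg (by positivity) hst0
    linarith
  -- The stiffness form does not see constants, so the vertex values may be shifted until they are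
  -- bounded by the gradient.
  · obtain ⟨k, hk⟩ := hosc E c H h v g hv
    set X := ∫ x in E.carrier, ‖g x‖ ^ 2 with hX
    have hX0 : 0 ≤ X := integral_nonneg fun x => sq_nonneg _
    have hm : ∀ i, |(fun i => E.vals v i - k) i| ≤ √(K₂ * X) := fun i => Real.abs_le_sqrt (hk i)
    rw [← stiffB_sub_const E c (E.vals v) k]
    set β := (fun i => E.vals v i - k) with hβ
    have h1 := h.norm_projGrad_le hm
    have h2 := sum_dev_sq_le h hm
    have h3 := pow_le_pow_left₀ (by have := h.H_pos; positivity) h1 2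
    rw [mul_pow, mul_pow, Real.sq_sqrt (by positivity)] at h3
    rw [Real.sq_sqrt (by positivity)] at h2
    have h4 := mul_le_mul_of_nonneg_right h.area_le (sq_nonneg ‖E.projGrad c β‖)
    have h5 : E.stiffB c β β ≤ B * (K₂ * X) := by
      rw [stiffB, real_inner_self_eq_norm_sq, hB]
      linarith
    have h6 : 0 ≤ K₁ * D * X := by positivity
    linarith

/-- Stability of the nonlinear load term. -/
theorem exists_load_bound {a b : ℝ} (ha : 0 < a) {q : ℝ → ℝ} {Kq : NNReal}
    (hq : LipschitzWith Kq q) : ∃ K : ℝ, 0 < K ∧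
    ∀ (E : Polygon2) (c : Plane) (H : ℝ), E.Reg c H a b → ∀ (p : Plane →ᵃ[ℝ] ℝ) (θ : Fin E.n → ℝ),
      (∀ i, θ i = q (p (E.vertex i))) →
      ∫ x in E.carrier, E.proj c θ x ^ 2 ≤ K * (E.area + ∫ x in E.carrier, p x ^ 2) := by
  set A := 200 * (4 / a) ^ 2 * (1 + 4 / a) ^ 2 with hA
  have hA0 : 0 < A := by positivity
  set B := (1 + 16 / (3 * a ^ 3)) ^ 2 with hB
  have hB0 : 0 < B := by positivity
  refine ⟨B * (2 * q 0 ^ 2 + 8 * Kq ^ 2 * A + 1), by positivity, fun E c H h p θ hθ => ?_⟩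
  have hH := h.H_pos
  -- A bound for |p| on the whole polygon, and by the inverse estimate itself bounded by the mean
  -- square of `p`. This gives the nodal values of `q ∘ p`, and therefore the projection of their
  -- interpolant.
  set Y := |p c| + H * ‖affGrad p‖ with hY
  have hY0 : 0 ≤ Y := by positivity
  have h1 : ∀ i, |θ i| ≤ |q 0| + Kq * Y := fun i => by
    rw [hθ i]
    have h2 := hq.dist_le_mul (p (E.vertex i)) 0
    rw [Real.dist_eq, Real.dist_eq, sub_zero] at h2
    have h3 := mul_le_mul_of_nonneg_left
      (abs_affine_le p (h.norm_le _ (E.vertex_mem_carrier i))) Kq.2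
    have h4 := abs_sub_abs_le_abs_sub (q (p (E.vertex i))) (q 0)
    change _ ≤ |q 0| + (Kq : ℝ) * Y
    change (Kq : ℝ) * _ ≤ (Kq : ℝ) * _ at h3
    linarith
  have h2 := integral_sq_le (f := E.proj c θ) fun x hx => h.abs_proj_le h1 hx
  have h3 := h.sq_affine_le p
  rw [← hA, ← hY] at h3
  set X := ∫ x in E.carrier, p x ^ 2 with hX
  have hX0 : 0 ≤ X := integral_nonneg fun x => sq_nonneg _
  have h4 : E.area * (|q 0| + Kq * Y) ^ 2 ≤ 2 * q 0 ^ 2 * E.area + 8 * Kq ^ 2 * A * X := by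
    have h5 : (|q 0| + Kq * Y) ^ 2 ≤ 2 * (q 0 ^ 2 + Kq ^ 2 * Y ^ 2) := by
      have := add_sq_le (a := |q 0|) (b := (Kq : ℝ) * Y)
      rwa [sq_abs, mul_pow] at this
    have h6 := mul_le_mul_of_nonneg_left h5 h.area_pos.le
    have h7 := mul_le_mul_of_nonneg_right h.area_le
      (by positivity : (0 : ℝ) ≤ 2 * (Kq ^ 2 * Y ^ 2))
    have h8 := mul_le_mul_of_nonneg_left h3 (by positivity : (0 : ℝ) ≤ 8 * Kq ^ 2)
    linarith
  rw [mul_pow, ← hB] at h2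
  have h5 := mul_le_mul_of_nonneg_left h4 hB0.le
  have t1 : 0 ≤ B * (8 * Kq ^ 2 * A + 1) * E.area :=
    mul_nonneg (by positivity) h.area_pos.le
  have t2 : 0 ≤ B * (2 * q 0 ^ 2 + 1) * X := by positivity
  linarith

end Polygon2

/-! ### Pairs of adjacent elements -/

/-- An endpoint is an extreme point: writing `P` as a convex combination of `P'` and `Q'`, and these
as points of the segment from `P` to `Q`, forces a weight to vanish. -/
lemma segment_endpoint {P Q P' Q' : Plane} (hne : P ≠ Q)
    (h : segment ℝ P Q = segment ℝ P' Q') : P = P' ∨ P = Q' := by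
  obtain ⟨a, b, ha, hb, hab, h1⟩ : P ∈ segment ℝ P' Q' := h ▸ left_mem_segment ℝ P Q
  obtain ⟨a₁, b₁, ha₁, hb₁, hab₁, h2⟩ : P' ∈ segment ℝ P Q := h ▸ left_mem_segment ℝ P' Q'
  obtain ⟨a₂, b₂, ha₂, hb₂, hab₂, h3⟩ : Q' ∈ segment ℝ P Q := h ▸ right_mem_segment ℝ P' Q'
  have h4 : (a * b₁ + b * b₂) • (Q - P) = 0 := by
    have e1 : a₁ = 1 - b₁ := by linarith
    have e2 : a₂ = 1 - b₂ := by linarith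
    have e3 : a = 1 - b := by linarith
    rw [← h2, ← h3, e1, e2, e3] at h1
    have : (a * b₁ + b * b₂) • (Q - P) = ((1 - b) • ((1 - b₁) • P + b₁ • Q) +
        b • ((1 - b₂) • P + b₂ • Q)) - P := by rw [e3]; module
    rw [this, h1, sub_self]
  have h5 : a * b₁ + b * b₂ = 0 := by
    rcases smul_eq_zero.1 h4 with h5 | h5
    · exact h5
    · exact absurd (sub_eq_zero.1 h5).symm hne
  have h6 : a * b₁ = 0 := by nlinarith [mul_nonneg ha hb₁, mul_nonneg hb hb₂]
  have h7 : b * b₂ = 0 := by nlinarith [mul_nonneg ha hb₁, mul_nonneg hb hb₂]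
  rcases mul_eq_zero.1 h6 with h8 | h8
  · right
    have : b = 1 := by linarith
    rw [h8, this] at h1; simpa using h1.symm
  · left
    have : a₁ = 1 := by linarith
    rw [h8, this] at h2; simpa using h2

namespace Polygon2

variable {E E' : Polygon2} {c c' : Plane} {r r' : ℝ}

lemma edgePt_mem_Ioo_ne_vertex (h : E.StarAt c r) {i : Fin E.n} {t : ℝ} (ht : t ∈ Ioo (0 : ℝ) 1)
    (j : Fin E.n) : E.edgePt i t ≠ E.vertex j := fun he => by
  have hj := h.mem_cone_of_mem_edge (E.vertex_mem_edge j)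
  rw [← he] at hj
  have hij := h.eq_of_mem_interior_cone (i := i) (by rw [h.coneA_edgePt]; linarith [ht.2])
    (by rw [h.coneB_edgePt]; exact ht.1) hj.1
  subst hij
  have h1 := h.coneB_edgePt i t
  have h2 := h.coneB_edgePt i 0
  have h3 : E.edgePt i 0 = E.vertex i := by simp [edgePt_eq]
  rw [h3, ← he, h1] at h2
  exact ht.1.ne' h2

lemma eq_of_edgePt_mem_edge (h : E.StarAt c r) {i j : Fin E.n} {t : ℝ} (ht : t ∈ Ioo (0 : ℝ) 1)
    (hj : E.edgePt i t ∈ E.edge j) : i = j :=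
  h.eq_of_mem_interior_cone (by rw [h.coneA_edgePt]; linarith [ht.2])
    (by rw [h.coneB_edgePt]; exact ht.1) (h.mem_cone_of_mem_edge hj).1

/-- Near an inner point of an edge, the polygon is a half-plane. -/
lemma eventually_mem_carrier_iff (h : E.StarAt c r) {i : Fin E.n} {t : ℝ}
    (ht : t ∈ Ioo (0 : ℝ) 1) : ∀ᶠ z in 𝓝 (E.edgePt i t),
      (z ∈ E.carrier ↔ E.orient c * det2 (z - E.vertex i) (E.tau i) ≤ 0) := by
  have hA : ∀ᶠ z in 𝓝 (E.edgePt i t), 0 < E.coneA c i z :=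
    (E.continuous_coneA c i).continuousAt.eventually_const_lt
      (by rw [h.coneA_edgePt]; linarith [ht.2])
  have hB : ∀ᶠ z in 𝓝 (E.edgePt i t), 0 < E.coneB c i z :=
    (E.continuous_coneB c i).continuousAt.eventually_const_lt (by rw [h.coneB_edgePt]; exact ht.1)
  filter_upwards [hA, hB] with z h1 h2
  rw [h.mem_carrier_iff ⟨h1.le, h2.le⟩]
  have hD : 0 < |E.coneDet c i| := abs_pos.2 (h.coneDet_ne i)
  -- Gauge minus one is, up to a positive factor, the oriented distance from the line of the edge.
  have e : (E.coneA c i z + E.coneB c i z - 1) * |E.coneDet c i| =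
      E.orient c * det2 (z - E.vertex i) (E.tau i) := by
    rw [← h.orient_mul_coneDet, coneA, coneB]
    have h3 := h.coneDet_ne i
    have e2 : det2 (z - c) (E.nextVertex i - c) + det2 (E.vertex i - c) (z - c) - E.coneDet c i =
        det2 (z - E.vertex i) (E.tau i) := by
      simp only [coneDet, tau, det2, PiLp.sub_apply]; ring
    rw [← e2]; field_simp
  rw [← e]
  constructor
  · intro h3; nlinarith
  · intro h3
    by_contra hlt
    push Not at hlt
    have : 0 < (E.coneA c i z + E.coneB c i z - 1) * |E.coneDet c i| :=
      mul_pos (by linarith) hD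
    linarith

lemma vertices_of_edge_eq {i : Fin E.n} {j : Fin E'.n} (he : E.edge i = E'.edge j) :
    (E.vertex i = E'.vertex j ∧ E.nextVertex i = E'.nextVertex j) ∨
      (E.vertex i = E'.nextVertex j ∧ E.nextVertex i = E'.vertex j) := by
  have h1 := segment_endpoint (E.vertex_ne_nextVertex i) he
  have h2 := segment_endpoint (P := E.nextVertex i) (Q := E.vertex i) (P' := E'.vertex j)
    (Q' := E'.nextVertex j) (E.vertex_ne_nextVertex i).symm (by rw [segment_symm]; exact he)
  have h3 := E.vertex_ne_nextVertex i
  rcases h1 with h1 | h1 <;> rcases h2 with h2 | h2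
  · exact absurd (h1.trans h2.symm) h3
  · exact Or.inl ⟨h1, h2⟩
  · exact Or.inr ⟨h1, h2⟩
  · exact absurd (h1.trans h2.symm) h3

lemma integral_edge_eq {i : Fin E.n} {j : Fin E'.n} (he : E.edge i = E'.edge j) (f : Plane → ℝ) :
    ∫ t in (0 : ℝ)..1, f (E.edgePt i t) = ∫ t in (0 : ℝ)..1, f (E'.edgePt j t) := by
  rcases vertices_of_edge_eq he with ⟨h1, h2⟩ | ⟨h1, h2⟩
  · simp only [edgePt, h1, h2]
  · have := intervalIntegral.integral_comp_sub_left (a := 0) (b := 1)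
      (fun t => f (E'.edgePt j t)) (1 : ℝ)
    rw [sub_self, sub_zero] at this
    rw [← this]
    refine intervalIntegral.integral_congr fun t _ => ?_
    simp only [edgePt, h1, h2, AffineMap.lineMap_apply_one_sub]

/-- Two polygons without common area have opposite orientations along a common edge. -/
lemma orient_smul_tau_opposite (h : E.StarAt c r) (h' : E'.StarAt c' r')
    (hvol : volume (E.carrier ∩ E'.carrier) = 0) {i : Fin E.n} {j : Fin E'.n}
    (he : E.edge i = E'.edge j) : E.orient c • E.tau i = -(E'.orient c' • E'.tau j) := by
  by_contra hne
  -- Otherwise the oriented edge vectors agree. Near the midpoint of the edge both polygons are then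
  -- the same half-plane, so they share an open set.
  have hsame : E'.orient c' • E'.tau j = E.orient c • E.tau i := by
    have hτ : E'.tau j = E.tau i ∨ E'.tau j = -E.tau i := by
      rcases vertices_of_edge_eq he with ⟨h1, h2⟩ | ⟨h1, h2⟩
      · left; simp only [tau, h1, h2]
      · right; simp only [tau, h1, h2, neg_sub]
    rcases h.orient_eq with h1 | h1 <;> rcases h'.orient_eq with h2 | h2 <;>
      rcases hτ with h3 | h3 <;> rw [h1, h2, h3] at hne ⊢ <;> simp at hne ⊢
  have hhalf : (1 / 2 : ℝ) ∈ Ioo (0 : ℝ) 1 := by constructor <;> norm_num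
  set x := E.edgePt i (1 / 2) with hx
  have hx' : E'.edgePt j (1 / 2) = x := by
    rcases vertices_of_edge_eq he with ⟨h1, h2⟩ | ⟨h1, h2⟩
    · simp only [hx, edgePt, h1, h2]
    · have e : (1 / 2 : ℝ) = 1 - 1 / 2 := by norm_num
      simp only [hx, edgePt, h1, h2]
      conv_rhs => rw [e, AffineMap.lineMap_apply_one_sub]
  have h1 := eventually_mem_carrier_iff h (i := i) hhalf
  have h2 := eventually_mem_carrier_iff h' (i := j) hhalf
  rw [hx'] at h2
  have hiff : ∀ᶠ z in 𝓝 x, z ∈ E.carrier → z ∈ E'.carrier := by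
    filter_upwards [h1, h2] with z hz1 hz2 hz
    rw [hz2]
    rw [hz1] at hz
    have e1 : E'.orient c' * det2 (z - E'.vertex j) (E'.tau j) =
        det2 (z - E'.vertex j) (E'.orient c' • E'.tau j) := by
      simp [det2]; ring
    have e2 : det2 (z - E'.vertex j) (E.orient c • E.tau i) =
        E.orient c * det2 (z - E.vertex i) (E.tau i) := by
      rcases vertices_of_edge_eq he with ⟨h1, h2⟩ | ⟨h1, h2⟩
      · rw [h1]; simp [det2]; ring
      · rw [← h2]; simp [det2, tau]; ring
    rw [e1, hsame, e2]; exact hz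
  obtain ⟨W, hW, hWo, hxW⟩ := eventually_nhds_iff.1 hiff
  have hxc : x ∈ closure (interior E.carrier) := by
    rw [E.closure_interior]
    exact E.edge_subset_carrier i (E.edgePt_mem_edge i (Ioo_subset_Icc_self hhalf))
  obtain ⟨z, hzW, hzi⟩ := mem_closure_iff.1 hxc W hWo hxW
  have hpos := (hWo.inter (isOpen_interior (s := E.carrier))).measure_pos volume ⟨z, hzW, hzi⟩
  refine hpos.ne' (measure_mono_null (fun y hy => ?_) hvol)
  exact ⟨interior_subset hy.2, hW y hy.1 (interior_subset hy.2)⟩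

end Polygon2

/-! ### Conforming meshes and cancellation of inner fluxes -/

namespace PolyMesh

variable {M : PolyMesh} {Ω : Set Plane} {h a b : ℝ} {ctr : Polygon2 → Plane}

/-- A conforming mesh of regular polygons with given star centres. -/
structure Shaped (M : PolyMesh) (a b : ℝ) (ctr : Polygon2 → Plane) : Prop where
  conforming : ∀ E₁ ∈ M.elems, ∀ E₂ ∈ M.elems, E₁ ≠ E₂ →
    E₁.carrier ∩ E₂.carrier = ∅ ∨
    (∃ i j, E₁.vertex i = E₂.vertex j ∧ E₁.carrier ∩ E₂.carrier = {E₁.vertex i}) ∨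
    (∃ i j, E₁.edge i = E₂.edge j ∧ E₁.carrier ∩ E₂.carrier = E₁.edge i)
  reg : ∀ E ∈ M.elems, E.Reg (ctr E) E.diam a b

lemma IsBSMesh.exists_shaped {γ₁ γ₂ : ℝ} (hM : M.IsBSMesh Ω h γ₁ γ₂) (hγ₁ : 0 < γ₁)
    (hγ₂ : 0 < γ₂) : ∃ ctr, M.Shaped γ₁ γ₂ ctr := by
  have key : ∀ E : Polygon2, ∃ c, E ∈ M.elems → E.Reg c E.diam γ₁ γ₂ := fun E => by
    by_cases hE : E ∈ M.elems
    · obtain ⟨c, hb, hs⟩ := hM.starShaped E hE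
      have hdist : ∀ x ∈ E.carrier, ∀ y ∈ E.carrier, ‖x - y‖ ≤ E.diam := fun x hx y hy => by
        rw [← dist_eq_norm]; exact Metric.dist_le_diam_of_mem E.isCompact_carrier.isBounded hx hy
      have hd : 0 < E.diam := by
        have h1 := hdist _ (E.edge_subset_carrier E.zeroIdx (E.nextVertex_mem_edge _)) _
          (E.vertex_mem_carrier E.zeroIdx)
        exact (E.norm_tau_pos E.zeroIdx).trans_le h1
      have hst : E.StarAt c (γ₁ * E.diam) := ⟨by positivity, hb, hs⟩
      exact ⟨c, fun _ => ⟨hst, hd, hγ₁, hγ₂,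
        fun x hx => hdist x hx c (hb hst.center_mem_ball), fun i => by
          rw [E.norm_tau]
          exact hM.vertex_dist E hE _ _ (E.finRotate_ne i).symm⟩⟩
    · exact ⟨0, fun h => absurd h hE⟩
  choose ctr hctr using key
  exact ⟨ctr, hM.conforming, hctr⟩

namespace Shaped

lemma star (hM : M.Shaped a b ctr) {E : Polygon2} (hE : E ∈ M.elems) :
    E.StarAt (ctr E) (a * E.diam) := (hM.reg E hE).star

lemma volume_inter (hM : M.Shaped a b ctr) {E₁ E₂ : Polygon2} (h₁ : E₁ ∈ M.elems)
    (h₂ : E₂ ∈ M.elems) (hne : E₁ ≠ E₂) : volume (E₁.carrier ∩ E₂.carrier) = 0 := by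
  rcases hM.conforming E₁ h₁ E₂ h₂ hne with h3 | ⟨i, j, -, h3⟩ | ⟨i, j, -, h3⟩
  · rw [h3, measure_empty]
  · rw [h3, measure_singleton]
  · rw [h3, E₁.volume_edge]

lemma opposite (hM : M.Shaped a b ctr) {E₁ E₂ : Polygon2} (h₁ : E₁ ∈ M.elems)
    (h₂ : E₂ ∈ M.elems) (hne : E₁ ≠ E₂) {i : Fin E₁.n} {j : Fin E₂.n}
    (he : E₁.edge i = E₂.edge j) :
    E₁.orient (ctr E₁) • E₁.tau i = -(E₂.orient (ctr E₂) • E₂.tau j) :=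
  Polygon2.orient_smul_tau_opposite (hM.star h₁) (hM.star h₂) (hM.volume_inter h₁ h₂ hne) he

/-- An edge that is not on the boundary belongs to a second element. -/
lemma exists_partner (hM : M.Shaped a b ctr) {E : Polygon2} (hE : E ∈ M.elems) {i : Fin E.n}
    (hi : ¬ E.edge i ⊆ M.surf) : ∃ E' ∈ M.elems, E' ≠ E ∧ ∃ j, E.edge i = E'.edge j := by
  have hst := hM.star hE
  have hsub : E.carrier ⊆ M.bulk := fun x hx => mem_biUnion hE hx
  -- If no relative interior point of the edge were interior to the bulk, the open edge would lie in
  -- the closed set `M.surf`, and so would the whole edge.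
  obtain ⟨t, ht, htb⟩ : ∃ t ∈ Ioo (0 : ℝ) 1, E.edgePt i t ∈ interior M.bulk := by
    by_contra! hcon
    apply hi
    have h1 : ∀ t ∈ Icc (0 : ℝ) 1, E.edgePt i t ∈ M.surf := by
      have hcl : IsClosed {t | E.edgePt i t ∈ M.surf} :=
        isClosed_frontier.preimage (E.continuous_edgePt i)
      have h2 : Ioo (0 : ℝ) 1 ⊆ {t | E.edgePt i t ∈ M.surf} := fun t ht =>
        ⟨subset_closure (hsub (E.edge_subset_carrier i
          (E.edgePt_mem_edge i (Ioo_subset_Icc_self ht)))), hcon t ht⟩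
      have h3 := hcl.closure_subset_iff.2 h2
      rw [closure_Ioo zero_ne_one] at h3
      exact h3
    intro x hx
    obtain ⟨t, ht, rfl⟩ := (E.mem_edge_iff i x).1 hx
    exact h1 t ht
  classical
  set x := E.edgePt i t with hx
  have hxe : x ∈ E.edge i := E.edgePt_mem_edge i (Ioo_subset_Icc_self ht)
  have hxE : x ∈ E.carrier := E.edge_subset_carrier i hxe
  -- Near the boundary point `x` of `E` there are bulk points outside `E`; these belong to other
  -- elements, whose finite union is closed.
  have hxcl : x ∈ closure (⋃ E' ∈ M.elems.erase E, E'.carrier) := by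
    rw [mem_closure_iff]
    intro W hW hxW
    have h1 := (E.edge_subset_frontier i hxe)
    rw [frontier_eq_closure_inter_closure] at h1
    obtain ⟨z, hzW, hz⟩ := mem_closure_iff.1 h1.2 (W ∩ interior M.bulk)
      (hW.inter isOpen_interior) ⟨hxW, htb⟩
    obtain ⟨E', hE', hzE'⟩ := mem_iUnion₂.1 (interior_subset hzW.2 : z ∈ M.bulk)
    refine ⟨z, hzW.1, mem_iUnion₂.2 ⟨E', Finset.mem_erase.2 ⟨?_, hE'⟩, hzE'⟩⟩
    rintro rfl
    exact hz hzE'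
  have hcl : IsClosed (⋃ E' ∈ M.elems.erase E, E'.carrier) :=
    (M.elems.erase E).finite_toSet.isClosed_biUnion fun E' _ => E'.isClosed_carrier
  rw [hcl.closure_eq] at hxcl
  obtain ⟨E', hE', hxE'⟩ := mem_iUnion₂.1 hxcl
  obtain ⟨hne, hE'M⟩ := Finset.mem_erase.1 hE'
  refine ⟨E', hE'M, hne, ?_⟩
  -- Since `x` is not a vertex, conformity leaves only a common edge, and that edge must be edge
  -- `i`.
  rcases hM.conforming E hE E' hE'M hne.symm with h3 | ⟨k, j, -, h3⟩ | ⟨k, j, h4, h3⟩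
  · exact absurd (h3 ▸ ⟨hxE, hxE'⟩ : x ∈ (∅ : Set Plane)) (notMem_empty x)
  · have : x ∈ ({E.vertex k} : Set Plane) := h3 ▸ ⟨hxE, hxE'⟩
    exact absurd this (Polygon2.edgePt_mem_Ioo_ne_vertex hst ht k)
  · have hxk : x ∈ E.edge k := h3 ▸ ⟨hxE, hxE'⟩
    have := Polygon2.eq_of_edgePt_mem_edge hst ht hxk
    subst this
    exact ⟨j, h4⟩

/-- All edges of all elements. -/
def _root_.PolyMesh.allEdges (M : PolyMesh) : Finset (Σ E : Polygon2, Fin E.n) :=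
  M.elems.sigma fun _ => Finset.univ

lemma mem_allEdges {e : Σ E : Polygon2, Fin E.n} : e ∈ M.allEdges ↔ e.1 ∈ M.elems := by
  simp [allEdges]

lemma mem_bdryEdges {e : Σ E : Polygon2, Fin E.n} :
    e ∈ M.bdryEdges ↔ e.1 ∈ M.elems ∧ e.1.edge e.2 ⊆ M.surf := by
  simp [bdryEdges]

/-- Fluxes through inner edges cancel. -/
theorem sum_flux (hM : M.Shaped a b ctr) (f : Plane → ℝ) (p : Plane) :
    ∑ E ∈ M.elems, E.orient (ctr E) * ∑ i, det2 p (E.tau i) *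
      (∫ t in (0 : ℝ)..1, f (E.edgePt i t)) =
    ∑ e ∈ M.bdryEdges, det2 p (e.1.orient (ctr e.1) • e.1.tau e.2) *
      ∫ t in (0 : ℝ)..1, f (e.1.edgePt e.2 t) := by
  set F : (Σ E : Polygon2, Fin E.n) → ℝ := fun e =>
    det2 p (e.1.orient (ctr e.1) • e.1.tau e.2) * ∫ t in (0 : ℝ)..1, f (e.1.edgePt e.2 t) with hF
  have h1 : ∑ E ∈ M.elems, E.orient (ctr E) * ∑ i, det2 p (E.tau i) *
      (∫ t in (0 : ℝ)..1, f (E.edgePt i t)) = ∑ e ∈ M.allEdges, F e := by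
    rw [allEdges, Finset.sum_sigma]
    refine Finset.sum_congr rfl fun E _ => ?_
    rw [Finset.mul_sum]
    refine Finset.sum_congr rfl fun i _ => ?_
    simp [hF, det2]; ring
  classical
  have hsub : M.bdryEdges ⊆ M.allEdges := fun e he => mem_allEdges.2 (mem_bdryEdges.1 he).1
  rw [h1, ← Finset.sum_sdiff hsub]
  have hpart : ∀ e ∈ M.allEdges \ M.bdryEdges, ∃ e' : Σ E : Polygon2, Fin E.n,
      e'.1 ∈ M.elems ∧ e'.1 ≠ e.1 ∧ e.1.edge e.2 = e'.1.edge e'.2 := fun e he => by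
    rw [Finset.mem_sdiff, mem_allEdges, mem_bdryEdges] at he
    obtain ⟨E', hE', hne, j, hj⟩ := hM.exists_partner he.1 (fun hs => he.2 ⟨he.1, hs⟩)
    exact ⟨⟨E', j⟩, hE', hne, hj⟩
  -- The partner map will be shown to be an involution without fixed points on the inner edges, and
  -- the contributions of partners cancel.
  choose! π hπ using hpart
  have hπm : ∀ e ∈ M.allEdges \ M.bdryEdges, π e ∈ M.allEdges \ M.bdryEdges := fun e he => by
    obtain ⟨g1, g2, g3⟩ := hπ e he
    rw [Finset.mem_sdiff, mem_allEdges, mem_bdryEdges] at he ⊢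
    exact ⟨g1, fun hs => he.2 ⟨he.1, g3 ▸ hs.2⟩⟩
  have hz : ∑ e ∈ M.allEdges \ M.bdryEdges, F e = 0 := by
    refine Finset.sum_involution (fun e _ => π e) (fun e he => ?_) (fun e he _ heq => ?_)
      (fun e he => hπm e he) (fun e he => ?_)
    · obtain ⟨g1, g2, g3⟩ := hπ e he
      have hm := mem_allEdges.1 (Finset.mem_sdiff.1 he).1
      have h2 := hM.opposite hm g1 g2.symm g3
      simp only [hF]
      rw [h2, Polygon2.integral_edge_eq g3 f]
      simp [det2]; ring
    · exact (hπ e he).2.1 (congrArg Sigma.fst heq)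
    · obtain ⟨g1, g2, g3⟩ := hπ e he
      obtain ⟨k1, k2, k3⟩ := hπ (π e) (hπm e he)
      have hm := mem_allEdges.1 (Finset.mem_sdiff.1 he).1
      -- An edge cannot belong to three elements: three oriented edge vectors that are pairwise
      -- opposite would vanish.
      have hE : (π (π e)).1 = e.1 := by
        by_contra hne
        have o1 := hM.opposite hm g1 g2.symm g3
        have o2 := hM.opposite g1 k1 k2.symm k3
        have o3 := hM.opposite k1 hm hne (g3.trans k3).symm
        rw [o2, neg_neg, o3] at o1
        have o4 : e.1.orient (ctr e.1) • e.1.tau e.2 = 0 := by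
          have : (2 : ℝ) • (e.1.orient (ctr e.1) • e.1.tau e.2) = 0 := by
            rw [two_smul]; nth_rewrite 1 [o1]; exact neg_add_cancel _
          exact (smul_eq_zero.1 this).resolve_left two_ne_zero
        rcases smul_eq_zero.1 o4 with h5 | h5
        · have := (hM.star hm).orient_sq
          rw [h5] at this; norm_num at this
        · exact (e.1.norm_tau_pos e.2).ne' (by rw [h5, norm_zero])
      have key : ∀ e₁ e₂ : Σ E : Polygon2, Fin E.n, e₁.1 ∈ M.elems → e₁.1 = e₂.1 →
          e₁.1.edge e₁.2 = e₂.1.edge e₂.2 → e₁ = e₂ := by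
        rintro ⟨E₁, i₁⟩ ⟨E₂, i₂⟩ hm₁ h12 he12
        obtain rfl : E₁ = E₂ := h12
        have hhalf : (1 / 2 : ℝ) ∈ Ioo (0 : ℝ) 1 := by constructor <;> norm_num
        have : i₁ = i₂ := Polygon2.eq_of_edgePt_mem_edge (hM.star hm₁) hhalf
          (he12 ▸ E₁.edgePt_mem_edge i₁ (Ioo_subset_Icc_self hhalf))
        rw [this]
      exact key _ _ (hE ▸ hm) hE (g3.trans k3).symm
  rw [hz, zero_add]

end Shaped

end PolyMesh

/-! ### Weak gradients on the bulk -/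

lemma IsH1Grad.mono {O O' : Set Plane} (hO : MeasurableSet O)
    (hsub : O' ⊆ O) {v : Plane → ℝ} {g : Plane → Plane}
    (h : IsH1Grad O v g) : IsH1Grad O' v g := by
  refine ⟨h.1.mono_measure (Measure.restrict_mono_set _ hsub),
    h.2.1.mono_measure (Measure.restrict_mono_set _ hsub), fun φ hφ hc hs => ?_⟩
  have h1 := h.2.2 φ hφ hc (hs.trans hsub)
  have hz : ∀ x ∉ O', gradient φ x = 0 := fun x hx => by
    have : x ∉ tsupport (fderiv ℝ φ) := fun h => hx (hs (tsupport_fderiv_subset ℝ h))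
    rw [gradient, image_eq_zero_of_notMem_tsupport this, map_zero]
  have hz' : ∀ x ∉ O', φ x = 0 := fun x hx => image_eq_zero_of_notMem_tsupport fun h => hx (hs h)
  rw [setIntegral_eq_of_subset_of_forall_sdiff_eq_zero hO hsub
      (fun x hx => by rw [hz x hx.2, smul_zero]),
    setIntegral_eq_of_subset_of_forall_sdiff_eq_zero hO hsub
      (fun x hx => by rw [hz' x hx.2, zero_smul])] at h1
  exact h1

lemma IsH1Grad.ae_eq {O : Set Plane} (hO : IsOpen O) {v : Plane → ℝ} {g g' : Plane → Plane}
    (h : IsH1Grad O v g) (h' : IsH1Grad O v g') : g =ᵐ[volume.restrict O] g' := by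
  have hloc : LocallyIntegrable (fun x => g x - g' x) (volume.restrict O) :=
    (h.2.1.sub h'.2.1).locallyIntegrable (by norm_num)
  have hi : ∀ {f : Plane → Plane}, MemLp f 2 (volume.restrict O) → ∀ {φ : Plane → ℝ},
      ContDiff ℝ ∞ φ → HasCompactSupport φ → Integrable (fun x => φ x • f x)
        (volume.restrict O) := fun hf φ hφ hc =>
    memLp_one_iff_integrable.1 (MemLp.smul (p := 2) (q := 2) (r := 1) hf
      ((hφ.continuous.memLp_of_hasCompactSupport (μ := volume) hc).restrict O))
  have h1 := hO.ae_eq_zero_of_integral_contDiff_smul_eq_zero (μ := volume.restrict O)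
    (f := fun x => g x - g' x) (hloc.locallyIntegrableOn O) (fun φ hφ hc hs => by
      simp only [smul_sub]
      rw [integral_sub (hi h.2.1 hφ hc) (hi h'.2.1 hφ hc), sub_eq_zero]
      exact neg_injective ((h.2.2 φ hφ hc hs).symm.trans (h'.2.2 φ hφ hc hs)))
  filter_upwards [h1, ae_restrict_mem hO.measurableSet] with x hx hxO
  exact sub_eq_zero.1 (hx hxO)

lemma lintegral_enorm_sq_eq {F : Type*} [NormedAddCommGroup F] {μ : Measure Plane}
    {f : Plane → F} (hf : MemLp f 2 μ) :
    ∫⁻ x, ‖f x‖ₑ ^ 2 ∂μ = ENNReal.ofReal (∫ x, ‖f x‖ ^ 2 ∂μ) := by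
  rw [ofReal_integral_eq_lintegral_ofReal ((memLp_two_iff_integrable_sq_norm hf.1).1 hf)
    (Filter.Eventually.of_forall fun x => sq_nonneg _)]
  refine lintegral_congr fun x => ?_
  rw [ENNReal.ofReal_pow (norm_nonneg _), ofReal_norm]

namespace PolyMesh

variable {M : PolyMesh} {Ω : Set Plane} {h a b : ℝ} {ctr : Polygon2 → Plane}

lemma isCompact_bulk (M : PolyMesh) : IsCompact M.bulk :=
  M.elems.finite_toSet.isCompact_biUnion fun E _ => E.isCompact_carrier

lemma carrier_subset_bulk {E : Polygon2} (hE : E ∈ M.elems) : E.carrier ⊆ M.bulk :=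
  fun _ hx => mem_biUnion hE hx

lemma interior_ae_eq_bulk (M : PolyMesh) : interior M.bulk =ᵐ[volume] M.bulk := by
  refine Filter.EventuallyLE.antisymm interior_subset.eventuallyLE ?_
  rw [ae_le_set]
  refine measure_mono_null (t := ⋃ E ∈ M.elems, frontier E.carrier) (fun x hx => ?_) ?_
  · obtain ⟨E, hE, hxE⟩ := mem_iUnion₂.1 hx.1
    refine mem_biUnion hE ⟨subset_closure hxE, fun h => hx.2 ?_⟩
    exact interior_mono (carrier_subset_bulk hE) h
  · exact (measure_biUnion_null_iff M.elems.countable_toSet).2 fun E _ => E.volume_frontier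

lemma restrict_interior_bulk (M : PolyMesh) :
    volume.restrict (interior M.bulk) = volume.restrict M.bulk :=
  Measure.restrict_congr_set M.interior_ae_eq_bulk

namespace Shaped

lemma restrict_bulk (hM : M.Shaped a b ctr) :
    volume.restrict M.bulk = ∑ E ∈ M.elems, volume.restrict E.carrier := by
  have h1 : M.bulk = ⋃ E : M.elems, E.1.carrier := by
    ext x; simp [bulk]
  rw [h1, Measure.restrict_iUnion_ae (fun E₁ E₂ hne => hM.volume_inter E₁.2 E₂.2
    fun he => hne (Subtype.ext he)) fun E => E.1.isClosed_carrier.measurableSet.nullMeasurableSet,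
    Measure.sum_fintype, Finset.univ_eq_attach, Finset.sum_attach M.elems
      fun E => volume.restrict E.carrier]

lemma lintegral_bulk (hM : M.Shaped a b ctr) (f : Plane → ℝ≥0∞) :
    ∫⁻ x in M.bulk, f x = ∑ E ∈ M.elems, ∫⁻ x in E.carrier, f x := by
  rw [hM.restrict_bulk, lintegral_finsetSum_measure]

lemma integral_bulk (hM : M.Shaped a b ctr) {f : Plane → ℝ}
    (hf : ∀ E ∈ M.elems, IntegrableOn f E.carrier volume) :
    ∫ x in M.bulk, f x = ∑ E ∈ M.elems, ∫ x in E.carrier, f x := by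
  rw [hM.restrict_bulk, integral_finsetSum_measure hf]

/-- Discrete functions have a weak gradient, given elementwise. -/
theorem exists_isH1Grad_bulk (hM : M.Shaped a b ctr) {v : Plane → ℝ}
    (hc : ContinuousOn v M.bulk) {gE : Polygon2 → Plane → Plane}
    (hg : ∀ E ∈ M.elems, IsH1Grad (interior E.carrier) v (gE E)) :
    ∃ g, IsH1Grad (interior M.bulk) v g ∧
      ∀ E ∈ M.elems, g =ᵐ[volume.restrict E.carrier] gE E := by
  have hgL : ∀ E ∈ M.elems, MemLp (gE E) 2 (volume.restrict E.carrier) := fun E hE => by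
    have := (hg E hE).2.1
    rwa [E.restrict_interior] at this
  -- Overlaps of elements are null sets, so this sum of indicators equals `gE E` almost everywhere
  -- on each element.
  set g : Plane → Plane := fun x => ∑ E ∈ M.elems, E.carrier.indicator (gE E) x with hgd
  have hae : ∀ E ∈ M.elems, g =ᵐ[volume.restrict E.carrier] gE E := fun E hE => by
    have hnull : ∀ E' ∈ M.elems, ∀ᵐ x ∂(volume.restrict E.carrier),
        E' ≠ E → x ∉ E'.carrier := fun E' hE' => by
      by_cases hne : E' = E
      · exact Filter.Eventually.of_forall fun x h => absurd hne h
      · have h0 := hM.volume_inter hE' hE hne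
        rw [← Measure.restrict_apply' E.isClosed_carrier.measurableSet] at h0
        filter_upwards [measure_eq_zero_iff_ae_notMem.1 h0] with x hx _
        exact hx
    have hall := (Finset.eventually_all M.elems).2 hnull
    filter_upwards [hall, ae_restrict_mem E.isClosed_carrier.measurableSet] with x hx hxE
    simp only [hgd]
    rw [Finset.sum_eq_single_of_mem E hE fun E' hE' hne => indicator_of_notMem (hx E' hE' hne) _,
      indicator_of_mem hxE]
  have hvL : MemLp v 2 (volume.restrict M.bulk) := by
    obtain ⟨K, hK⟩ := M.isCompact_bulk.exists_bound_of_continuousOn hc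
    have : IsFiniteMeasure (volume.restrict M.bulk) :=
      ⟨by rw [Measure.restrict_apply_univ]; exact M.isCompact_bulk.measure_lt_top⟩
    exact MemLp.of_bound (hc.aestronglyMeasurable M.isCompact_bulk.isClosed.measurableSet) K
      ((ae_restrict_iff' M.isCompact_bulk.isClosed.measurableSet).2
        (Filter.Eventually.of_forall hK))
  have hgLb : MemLp g 2 (volume.restrict M.bulk) := by
    have h1 : MemLp g 2 volume := by
      refine memLp_finsetSum M.elems fun E hE => ?_
      exact memLp_indicator_of_restrict E.isClosed_carrier.measurableSet (hgL E hE)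
    exact h1.restrict _
  refine ⟨g, isH1Grad_of_scalar ?_ ?_ fun φ hφ hcs hs p => ?_, hae⟩
  · rwa [restrict_interior_bulk]
  · rwa [restrict_interior_bulk]
  rw [restrict_interior_bulk]
  have hφ1 : ContDiff ℝ 1 φ := hφ.of_le (by norm_num)
  have hcg := continuous_gradient hφ1
  have hvc : ∀ E ∈ M.elems, ContinuousOn v E.carrier := fun E hE =>
    hc.mono (carrier_subset_bulk hE)
  have i1 : ∀ E ∈ M.elems, IntegrableOn (fun x => v x * ⟪gradient φ x, p⟫) E.carrier volume :=
    fun E hE => ((hvc E hE).mul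
      (hcg.inner continuous_const).continuousOn).integrableOn_compact E.isCompact_carrier
  have i2 : ∀ E ∈ M.elems, IntegrableOn (fun x => φ x * ⟪gE E x, p⟫) E.carrier volume :=
    fun E hE => integrable_mul_inner_of_memLp
      (E.memLp_of_continuousOn hφ.continuous.continuousOn) (hgL E hE) p
  have e2 : ∀ E ∈ M.elems, (fun x => φ x * ⟪g x, p⟫) =ᵐ[volume.restrict E.carrier]
      fun x => φ x * ⟪gE E x, p⟫ := fun E hE => by
    filter_upwards [hae E hE] with x hx
    rw [hx]
  rw [hM.integral_bulk i1, hM.integral_bulk fun E hE => (i2 E hE).congr (e2 E hE).symm,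
    eq_neg_iff_add_eq_zero, ← Finset.sum_add_distrib]
  have h1 : ∀ E ∈ M.elems, (∫ x in E.carrier, v x * ⟪gradient φ x, p⟫) +
      (∫ x in E.carrier, φ x * ⟪g x, p⟫) = E.orient (ctr E) * ∑ i, det2 p (E.tau i) *
        ∫ t in (0 : ℝ)..1, v (E.edgePt i t) * φ (E.edgePt i t) := fun E hE => by
    rw [integral_congr_ae (e2 E hE), add_comm]
    exact (hM.star hE).integral_inner_const_eq (hg E hE) (hvc E hE) hφ1 p
  -- Continuity of `v` across elements is used here: the inner edge terms cancel, and on boundary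
  -- edges the test function vanishes.
  rw [Finset.sum_congr rfl h1, hM.sum_flux (fun x => v x * φ x) p]
  refine Finset.sum_eq_zero fun e he => ?_
  rw [intervalIntegral.integral_congr (g := fun _ => 0), intervalIntegral.integral_zero, mul_zero]
  intro t ht
  rw [uIcc_of_le zero_le_one] at ht
  have h2 := (mem_bdryEdges.1 he).2 (e.1.edgePt_mem_edge e.2 ht)
  have h3 : φ (e.1.edgePt e.2 t) = 0 := image_eq_zero_of_notMem_tsupport fun h4 => h2.2 (hs h4)
  simp [h3]

/-- Weak gradients are unique almost everywhere, so the infimum is over equal values, and the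
gradient glued from the elements attains it. -/
lemma h1SemiSq_eq (hM : M.Shaped a b ctr) {v : Plane → ℝ}
    (hc : ContinuousOn v M.bulk) {gE : Polygon2 → Plane → Plane}
    (hg : ∀ E ∈ M.elems, IsH1Grad (interior E.carrier) v (gE E)) :
    h1SemiSq (interior M.bulk) v =
      ENNReal.ofReal (∑ E ∈ M.elems, ∫ x in E.carrier, ‖gE E x‖ ^ 2) := by
  have key : ∀ g, (∀ E ∈ M.elems, g =ᵐ[volume.restrict E.carrier] gE E) →
      ∫⁻ x in interior M.bulk, ‖g x‖ₑ ^ 2 =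
      ENNReal.ofReal (∑ E ∈ M.elems, ∫ x in E.carrier, ‖gE E x‖ ^ 2) := fun g hae => by
    rw [restrict_interior_bulk, hM.lintegral_bulk, ENNReal.ofReal_sum_of_nonneg
      fun E _ => integral_nonneg fun x => sq_nonneg _]
    refine Finset.sum_congr rfl fun E hE => ?_
    have hgL := (hg E hE).2.1
    rw [E.restrict_interior] at hgL
    rw [← lintegral_enorm_sq_eq hgL]
    refine lintegral_congr_ae ?_
    filter_upwards [hae E hE] with x hx
    rw [hx]
  obtain ⟨g, hg1, hg2⟩ := hM.exists_isH1Grad_bulk hc hg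
  refine le_antisymm ((iInf₂_le g hg1).trans (key g hg2).le) (le_iInf₂ fun g' hg' => ?_)
  refine (key g' fun E hE => ?_).ge
  have h1 := (hg'.mono isOpen_interior.measurableSet
    (interior_mono (carrier_subset_bulk hE))).ae_eq isOpen_interior (hg E hE)
  rwa [E.restrict_interior] at h1

lemma l2Sq_bulk_eq (hM : M.Shaped a b ctr) {v : Plane → ℝ} (hc : ContinuousOn v M.bulk) :
    l2Sq M.bulk v = ENNReal.ofReal (∑ E ∈ M.elems, ∫ x in E.carrier, v x ^ 2) := by
  rw [l2Sq, hM.lintegral_bulk, ENNReal.ofReal_sum_of_nonneg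
      fun E _ => integral_nonneg fun x => sq_nonneg _]
  refine Finset.sum_congr rfl fun E hE => ?_
  rw [lintegral_enorm_sq_eq (E.memLp_of_continuousOn (hc.mono (carrier_subset_bulk hE)))]
  simp only [Real.norm_eq_abs, sq_abs]

/-- The divergence theorem on the bulk for `v² χ ν`. -/
lemma sum_sq_flux (hM : M.Shaped a b ctr) {v χ : Plane → ℝ}
    (hc : ContinuousOn v M.bulk) {gE : Polygon2 → Plane → Plane}
    (hg : ∀ E ∈ M.elems, IsH1Grad (interior E.carrier) v (gE E)) (hχ : ContDiff ℝ 1 χ)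
    (ν : Plane) :
    ∑ E ∈ M.elems, (2 * (∫ x in E.carrier, v x * χ x * ⟪gE E x, ν⟫) +
      ∫ x in E.carrier, v x * v x * ⟪gradient χ x, ν⟫) =
    ∑ e ∈ M.bdryEdges, det2 ν (e.1.orient (ctr e.1) • e.1.tau e.2) *
      ∫ t in (0 : ℝ)..1, v (e.1.edgePt e.2 t) * v (e.1.edgePt e.2 t) * χ (e.1.edgePt e.2 t) := by
  rw [← hM.sum_flux (fun x => v x * v x * χ x) ν]
  refine Finset.sum_congr rfl fun E hE => ?_
  have hvc := hc.mono (carrier_subset_bulk hE)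
  rw [← (hM.star hE).gauss_green (hg E hE) hvc (hg E hE) hvc hχ ν]
  ring

end Shaped

end PolyMesh

/-! ### A transversal field near the boundary of the exact domain -/

lemma exists_pos_le_of_finset {ι : Type*} (s : Finset ι) (f : ι → ℝ) (hf : ∀ k ∈ s, 0 < f k) :
    ∃ δ : ℝ, 0 < δ ∧ ∀ k ∈ s, δ ≤ f k := by
  classical
  induction s using Finset.induction_on with
  | empty => exact ⟨1, one_pos, by simp⟩
  | insert k s hk ih =>
    obtain ⟨δ, hδ, h⟩ := ih fun j hj => hf j (Finset.mem_insert_of_mem hj)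
    refine ⟨min δ (f k), lt_min hδ (hf k (Finset.mem_insert_self _ _)), fun j hj => ?_⟩
    rcases Finset.mem_insert.1 hj with rfl | hj
    · exact min_le_right _ _
    · exact (min_le_left _ _).trans (h j hj)

/-- Near a boundary point, the domain is almost a half-plane. -/
lemma IsC3Domain.exists_normal {Ω : Set Plane} (hΩ : IsC3Domain Ω) {x₀ : Plane}
    (hx₀ : x₀ ∈ frontier Ω) {ε : ℝ} (hε : 0 < ε) : ∃ (R : ℝ) (ν : Plane), 0 < R ∧ ‖ν‖ = 1 ∧
      ∀ P ∈ frontier Ω, P ∈ Metric.ball x₀ R → ∀ Y ∈ Ω, Y ∈ Metric.ball x₀ R →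
        ⟪ν, Y - P⟫ ≤ ε * ‖Y - P‖ ∧ (Y ∈ frontier Ω → |⟪ν, Y - P⟫| ≤ ε * ‖Y - P‖) := by
  obtain ⟨ρ, hρ, hne, hiff⟩ := hΩ.2 x₀ hx₀
  set g := gradient ρ x₀ with hg
  have hg0 : 0 < ‖g‖ := by
    rw [hg, gradient, LinearIsometryEquiv.norm_map]; exact norm_pos_iff.2 hne
  -- Strict differentiability makes the linear approximation uniform over pairs of points near `x₀`,
  -- not only for pairs containing `x₀`. The direction ν is the normalised gradient of the defining
  -- function.
  have hst : HasStrictFDerivAt ρ (fderiv ℝ ρ x₀) x₀ := hρ.hasStrictFDerivAt (by norm_num)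
  have hb : ∀ᶠ p : Plane × Plane in 𝓝 (x₀, x₀),
      ‖ρ p.1 - ρ p.2 - fderiv ℝ ρ x₀ (p.1 - p.2)‖ ≤ ε * ‖g‖ * ‖p.1 - p.2‖ :=
    hst.isLittleO.def (by positivity)
  have hcont : ∀ᶠ y in 𝓝 x₀, ContinuousAt ρ y :=
    (hρ.eventually (by simp)).mono fun y hy => hy.continuousAt
  rw [nhds_prod_eq] at hb
  obtain ⟨t₁, ht₁, hb2⟩ := Filter.eventually_prod_self_iff'.1 hb
  obtain ⟨R₁, hR₁, hb1⟩ := Metric.mem_nhds_iff.1 ht₁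
  obtain ⟨R₂, hR₂, hc2⟩ := Metric.eventually_nhds_iff_ball.1 hcont
  obtain ⟨R₃, hR₃, hi3⟩ := Metric.eventually_nhds_iff_ball.1 hiff
  set R := min R₁ (min R₂ R₃) with hR
  have hRR₁ : R ≤ R₁ := min_le_left _ _
  have hRR₂ : R ≤ R₂ := (min_le_right _ _).trans (min_le_left _ _)
  have hRR₃ : R ≤ R₃ := (min_le_right _ _).trans (min_le_right _ _)
  -- A negative value of `ρ` at a point of the domain would persist nearby and make the point
  -- interior.
  have hzero : ∀ P ∈ frontier Ω, P ∈ Metric.ball x₀ R → ρ P = 0 := fun P hP hPR => by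
    have hPΩ : P ∈ Ω := hΩ.1.isClosed.frontier_subset hP
    have h1 := (hi3 P (Metric.ball_subset_ball hRR₃ hPR)).1 hPΩ
    by_contra hne0
    have h2 : ρ P < 0 := lt_of_le_of_ne h1 hne0
    refine hP.2 (mem_interior_iff_mem_nhds.2 ?_)
    filter_upwards [(hc2 P (Metric.ball_subset_ball hRR₂ hPR)).eventually_lt_const h2,
      Metric.isOpen_ball.mem_nhds (Metric.ball_subset_ball hRR₃ hPR)] with y hy hyb
    exact (hi3 y hyb).2 hy.le
  have hng : ∀ z : Plane, ⟪‖g‖⁻¹ • g, z⟫ = ‖g‖⁻¹ * fderiv ℝ ρ x₀ z := fun z => by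
    rw [inner_smul_left, conj_trivial, hg, inner_gradient_left]
  refine ⟨R, ‖g‖⁻¹ • g, by positivity, by
    rw [norm_smul, norm_inv, norm_norm, inv_mul_cancel₀ hg0.ne'], fun P hP hPR Y hY hYR => ?_⟩
  have h1 := hb2 Y (hb1 (Metric.ball_subset_ball hRR₁ hYR)) P
    (hb1 (Metric.ball_subset_ball hRR₁ hPR))
  rw [hzero P hP hPR, sub_zero, Real.norm_eq_abs] at h1
  have h2 := abs_le.1 h1
  rw [hng]
  constructor
  · have h3 := (hi3 Y (Metric.ball_subset_ball hRR₃ hYR)).1 hY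
    rw [inv_mul_le_iff₀ hg0]
    linarith [h2.1]
  · intro hYf
    rw [hzero Y hYf hYR, zero_sub, abs_neg] at h1
    rw [abs_mul, abs_of_pos (inv_pos.2 hg0), inv_mul_le_iff₀ hg0]
    linarith

/-- Both vectors are expanded in the orthonormal frame of `ν` and its rotation by a right angle. -/
lemma det2_eq_of_norm_eq_one {ν : Plane} (hν : ‖ν‖ = 1) (p q : Plane) :
    det2 p q = ⟪ν, p⟫ * det2 ν q - ⟪ν, q⟫ * det2 ν p := by
  have h1 : ν 0 ^ 2 + ν 1 ^ 2 = 1 := by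
    rw [← plane_norm_sq, hν, one_pow]
  rw [plane_inner_eq, plane_inner_eq]
  simp only [det2]
  linear_combination (-(p 0 * q 1 - p 1 * q 0)) * h1

namespace Polygon2

/-- An approximate outer normal is transversal to the edge. -/
lemma half_norm_tau_le_det2 {E : Polygon2} {c ν : Plane} {H a ε : ℝ} (h : E.StarAt c (a * H))
    (hH : 0 < H) (hn : ∀ x ∈ E.carrier, ‖x - c‖ ≤ H) (hν : ‖ν‖ = 1) (hε0 : 0 < ε)
    (hεa : ε ≤ a / 4) (hε : ε ≤ 1 / 2) {i : Fin E.n} (hτ : |⟪ν, E.tau i⟫| ≤ ε * ‖E.tau i‖)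
    (hv : ∀ j, ⟪ν, E.vertex j - E.vertex i⟫ ≤ ε * H) :
    1 / 2 * ‖E.tau i‖ ≤ det2 ν (E.orient c • E.tau i) := by
  have hr := h.pos
  have hτ0 := E.norm_tau_pos i
  have hν0 : ν ≠ 0 := fun h0 => by simp [h0] at hν
  obtain ⟨s, hs0, hs⟩ := h.exists_ray_frontier hν0
  have hsr : a * H ≤ s := by
    by_contra! hlt
    refine hs.2 (h.ball_subset_interior ?_)
    rw [Metric.mem_ball, dist_eq_norm, add_sub_cancel_left, norm_smul, hν, mul_one,
      Real.norm_eq_abs, abs_of_pos hs0]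
    exact hlt
  -- The ray from `c` in direction ν leaves the polygon at distance at least `a * H`, yet no
  -- boundary point is more than `ε * H` above vertex `i`. Hence `c` lies strictly below that vertex
  -- in direction ν.
  have h1 : ⟪ν, c - E.vertex i⟫ + s ≤ ε * H := by
    obtain ⟨j, hj⟩ := (StarAt.mem_frontier_iff _).1 hs
    obtain ⟨t, ht, hte⟩ := (E.mem_edge_iff j _).1 hj
    have e1 : c + s • ν - E.vertex i = (1 - t) • (E.vertex j - E.vertex i) +
        t • (E.nextVertex j - E.vertex i) := by
      rw [← hte, edgePt_eq, tau]; module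
    have e2 : ⟪ν, c - E.vertex i⟫ + s = ⟪ν, c + s • ν - E.vertex i⟫ := by
      have : c + s • ν - E.vertex i = (c - E.vertex i) + s • ν := by abel
      rw [this, inner_add_right, inner_smul_right, real_inner_self_eq_norm_sq, hν]; ring
    rw [e2, e1, inner_add_right, inner_smul_right, inner_smul_right]
    have t1 := mul_le_mul_of_nonneg_left (hv j) (by linarith [ht.2] : 0 ≤ 1 - t)
    have t2 := mul_le_mul_of_nonneg_left (hv (finRotate E.n j)) ht.1
    change t * ⟪ν, E.nextVertex j - E.vertex i⟫ ≤ _ at t2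
    linarith
  have ha : 0 < a := pos_of_mul_pos_left hr hH.le
  have h2 : 0 < ⟪ν, E.vertex i - c⟫ := by
    have e : ⟪ν, E.vertex i - c⟫ = -⟪ν, c - E.vertex i⟫ := by rw [← inner_neg_right, neg_sub]
    rw [e]; nlinarith
  have h3 : a * H * ‖E.tau i‖ ≤ E.orient c * det2 (E.vertex i - c) (E.tau i) := by
    rw [← E.coneDet_eq, h.orient_mul_coneDet]; exact h.le_abs_det i
  have h4 : det2 ν (E.orient c • E.tau i) = E.orient c * det2 ν (E.tau i) := by
    simp [det2]; ring
  rw [h4]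
  set D := E.orient c * det2 ν (E.tau i) with hD
  -- This fixes the sign. Expanding the cone determinant in the frame of ν, the tangential error is
  -- at most `ε * H * ‖τ‖`, too small against `a * H * ‖τ‖` unless `D` is positive.
  have h5 : 0 < D := by
    by_contra! hle
    rw [det2_eq_of_norm_eq_one hν] at h3
    have h6 : |E.orient c * (⟪ν, E.tau i⟫ * det2 ν (E.vertex i - c))| ≤ ε * ‖E.tau i‖ * H := by
      rw [abs_mul, h.abs_orient, one_mul, abs_mul]
      refine mul_le_mul hτ ?_ (abs_nonneg _) (by positivity)
      refine (abs_det2_le _ _).trans ?_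
      rw [hν, one_mul]
      exact hn _ (E.vertex_mem_carrier i)
    have h7 := (abs_le.1 h6).1
    have h8 : ⟪ν, E.vertex i - c⟫ * D ≤ 0 := mul_nonpos_of_nonneg_of_nonpos h2.le hle
    have h9 : a * H * ‖E.tau i‖ ≤ ε * ‖E.tau i‖ * H := by
      calc _ ≤ _ := h3
        _ = ⟪ν, E.vertex i - c⟫ * D -
          E.orient c * (⟪ν, E.tau i⟫ * det2 ν (E.vertex i - c)) := by rw [hD]; ring
        _ ≤ _ := by linarith
    have h10 : 0 < H * ‖E.tau i‖ := by positivity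
    nlinarith
  -- By Pythagoras, and since the component along ν is at most half the length, D² ≥ (3/4)‖τ‖².
  have h6 : D ^ 2 + ⟪ν, E.tau i⟫ ^ 2 = ‖E.tau i‖ ^ 2 := by
    have h7 := det2_sq_add_inner_sq ν (E.tau i)
    rw [hν, one_pow, one_mul] at h7
    rw [← h7, hD, mul_pow, sq (E.orient c), h.orient_sq, one_mul]
  have h7 : ⟪ν, E.tau i⟫ ^ 2 ≤ (1 / 2 * ‖E.tau i‖) ^ 2 := by
    rw [← sq_abs]
    exact pow_le_pow_left₀ (abs_nonneg _) (hτ.trans (mul_le_mul_of_nonneg_right hε hτ0.le)) 2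
  refine le_of_sq_le_sq ?_ h5.le
  nlinarith

end Polygon2

/-- Smooth cut-offs and directions that are transversal to all boundary edges of fine meshes. -/
theorem IsC3Domain.exists_transversal {Ω : Set Plane} (hΩ : IsC3Domain Ω) {γ₁ : ℝ}
    (hγ₁ : 0 < γ₁) : ∃ (h₀ G : ℝ) (s : Finset Plane) (χ : Plane → Plane → ℝ) (ν : Plane → Plane),
      0 < h₀ ∧ 0 ≤ G ∧ (∀ k ∈ s, ContDiff ℝ ∞ (χ k) ∧ (∀ x, 0 ≤ χ k x) ∧ (∀ x, χ k x ≤ 1) ∧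
        (∀ x, ‖gradient (χ k) x‖ ≤ G) ∧ ‖ν k‖ = 1) ∧
      ∀ (M : PolyMesh) (h γ₂ : ℝ), h ≤ h₀ → M.IsBSMesh Ω h γ₁ γ₂ → ∀ e ∈ M.bdryEdges,
        ∀ c, e.1.Reg c e.1.diam γ₁ γ₂ → ∀ x ∈ e.1.edge e.2, 1 ≤ ∑ k ∈ s, χ k x ∧
          ∀ k ∈ s, 0 < χ k x → 1 / 2 * ‖e.1.tau e.2‖ ≤
            det2 (ν k) (e.1.orient c • e.1.tau e.2) := by
  -- The flatness required by `half_norm_tau_le_det2`.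
  set ε := min (γ₁ / 4) (1 / 2) with hε
  have hε0 : 0 < ε := by positivity
  have h1 : ∀ x₀ : Plane, ∃ (R : ℝ) (ν : Plane), 0 < R ∧ ‖ν‖ = 1 ∧ (x₀ ∈ frontier Ω →
      ∀ P ∈ frontier Ω, P ∈ Metric.ball x₀ R → ∀ Y ∈ Ω, Y ∈ Metric.ball x₀ R →
        ⟪ν, Y - P⟫ ≤ ε * ‖Y - P‖ ∧ (Y ∈ frontier Ω → |⟪ν, Y - P⟫| ≤ ε * ‖Y - P‖)) := fun x₀ => by
    by_cases hx : x₀ ∈ frontier Ω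
    · obtain ⟨R, ν, hR, hν, H⟩ := hΩ.exists_normal hx hε0
      exact ⟨R, ν, hR, hν, fun _ => H⟩
    · exact ⟨1, EuclideanSpace.single 0 1, one_pos, by simp, fun h => absurd h hx⟩
  choose R ν hR hν hprop using h1
  obtain ⟨Kb, hKb, hbump⟩ := exists_bump
  choose χ hχs hχc hχt hχ1 hχ0 hχle hχg using fun k => hbump k (R k / 2) (half_pos (hR k))
  have hfc : IsCompact (frontier Ω) := hΩ.1.of_isClosed_subset isClosed_frontier
    hΩ.1.isClosed.frontier_subset
  -- The radii fit together as follows. An edge with a vertex in a ball of radius `R / 8` has length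
  -- at most `R / 8`, so it stays where the cut-off equals 1, within `R / 4`. An element touching
  -- the support, within `R / 2`, stays in the ball of radius `R` where ν is an approximate normal.
  obtain ⟨s, hsf, hcov⟩ := hfc.elim_nhds_subcover (fun k => Metric.ball k (R k / 8))
    fun k _ => Metric.ball_mem_nhds k (by have := hR k; positivity)
  obtain ⟨h₀, hh₀, hle⟩ := exists_pos_le_of_finset s (fun k => R k / 8)
    fun k _ => by have := hR k; positivity
  have hterm : ∀ k, 0 ≤ Kb / (R k / 2) := fun k => by have := hR k; positivity
  refine ⟨h₀, ∑ k ∈ s, Kb / (R k / 2), s, χ, ν, hh₀, Finset.sum_nonneg fun k _ => hterm k,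
    fun k hk => ⟨hχs k, hχ0 k, hχle k, fun x => (hχg k x).trans
      (Finset.single_le_sum (f := fun k => Kb / (R k / 2)) (fun k _ => hterm k) hk), hν k⟩, ?_⟩
  intro M h γ₂ hh hM e he c hreg x hx
  have heE := (PolyMesh.Shaped.mem_bdryEdges.1 he).1
  have hes := (PolyMesh.Shaped.mem_bdryEdges.1 he).2
  have hdiam : ∀ y ∈ e.1.carrier, ∀ z ∈ e.1.carrier, ‖y - z‖ ≤ e.1.diam := fun y hy z hz => by
    rw [← dist_eq_norm]; exact Metric.dist_le_diam_of_mem e.1.isCompact_carrier.isBounded hy hz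
  have hxE := e.1.edge_subset_carrier e.2 hx
  have hP : e.1.vertex e.2 ∈ frontier Ω :=
    hM.vertex_mem_frontier _ heE _ (hes (e.1.vertex_mem_edge e.2))
  have hQ : e.1.nextVertex e.2 ∈ frontier Ω :=
    hM.vertex_mem_frontier _ heE _ (hes (e.1.nextVertex_mem_edge e.2))
  have hdh : e.1.diam ≤ h₀ := (hM.diam_le _ heE).trans hh
  constructor
  · obtain ⟨k, hk, hkP⟩ := mem_iUnion₂.1 (hcov hP)
    rw [Metric.mem_ball, dist_eq_norm] at hkP
    have h2 : ‖x - k‖ ≤ R k / 2 / 2 := by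
      have h3 := norm_sub_le_norm_sub_add_norm_sub x (e.1.vertex e.2) k
      have h4 := hdiam x hxE _ (e.1.vertex_mem_carrier e.2)
      have h5 := hle k hk
      linarith
    have h3 := Finset.single_le_sum (f := fun k => χ k x) (fun k _ => hχ0 k x) hk
    simp only [hχ1 k x h2] at h3
    exact h3
  · intro k hk hpos
    have hxt : x ∈ tsupport (χ k) := subset_tsupport _ hpos.ne'
    have hxk := hχt k hxt
    rw [Metric.mem_closedBall, dist_eq_norm] at hxk
    have hball : ∀ y ∈ e.1.carrier, y ∈ Metric.ball k (R k) := fun y hy => by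
      rw [Metric.mem_ball, dist_eq_norm]
      have h3 := norm_sub_le_norm_sub_add_norm_sub y x k
      have h4 := hdiam y hy x hxE
      have h5 := hle k hk
      have h6 := hR k
      linarith
    have hprop' := hprop k (hsf k hk) _ hP (hball _ (e.1.vertex_mem_carrier e.2))
    refine Polygon2.half_norm_tau_le_det2 hreg.star hreg.H_pos hreg.norm_le (hν k) hε0
      (min_le_left _ _) (min_le_right _ _) ?_ fun j => ?_
    · exact (hprop' _ (hΩ.1.isClosed.frontier_subset hQ)
        (hball _ (e.1.edge_subset_carrier e.2 (e.1.nextVertex_mem_edge e.2)))).2 hQ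
    · refine (hprop' _ (hM.vertex_mem _ heE j) (hball _ (e.1.vertex_mem_carrier j))).1.trans ?_
      exact mul_le_mul_of_nonneg_left (hdiam _ (e.1.vertex_mem_carrier j) _
        (e.1.vertex_mem_carrier e.2)) hε0.le

namespace PolyMesh

variable {M : PolyMesh} {Ω : Set Plane} {h a b : ℝ} {ctr : Polygon2 → Plane}

/-! ### Trace inequality -/

/-- The squared `L²` norm on the boundary edges, as a real number. -/
def bdrySq (M : PolyMesh) (v : Plane → ℝ) : ℝ :=
  ∑ e ∈ M.bdryEdges, ‖e.1.tau e.2‖ * ∫ t in (0 : ℝ)..1, v (e.1.edgePt e.2 t) ^ 2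

/-- Cut-offs and directions that are transversal to the boundary edges. -/
structure Transversal (M : PolyMesh) (ctr : Polygon2 → Plane) (G : ℝ) (s : Finset Plane)
    (χ : Plane → Plane → ℝ) (ν : Plane → Plane) : Prop where
  smooth : ∀ k ∈ s, ContDiff ℝ ∞ (χ k)
  nonneg : ∀ k ∈ s, ∀ x, 0 ≤ χ k x
  le_one : ∀ k ∈ s, ∀ x, χ k x ≤ 1
  grad_le : ∀ k ∈ s, ∀ x, ‖gradient (χ k) x‖ ≤ G
  norm_eq : ∀ k ∈ s, ‖ν k‖ = 1
  one_le : ∀ e ∈ M.bdryEdges, ∀ x ∈ e.1.edge e.2, 1 ≤ ∑ k ∈ s, χ k x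
  le_det : ∀ e ∈ M.bdryEdges, ∀ x ∈ e.1.edge e.2, ∀ k ∈ s, 0 < χ k x →
    1 / 2 * ‖e.1.tau e.2‖ ≤ det2 (ν k) (e.1.orient (ctr e.1) • e.1.tau e.2)

namespace Shaped

/-- Where a cut-off is positive somewhere on an edge, the flux coefficient is at least half the edge
length; otherwise the term is zero. Since the cut-offs add up to at least 1 on the boundary, the
fluxes dominate. -/
lemma bdrySq_le_sum_flux {G : ℝ} {s : Finset Plane}
    {χ : Plane → Plane → ℝ} {ν : Plane → Plane} (hT : M.Transversal ctr G s χ ν) {v : Plane → ℝ}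
    (hc : ContinuousOn v M.bulk) : 1 / 2 * M.bdrySq v ≤ ∑ k ∈ s, ∑ e ∈ M.bdryEdges,
      det2 (ν k) (e.1.orient (ctr e.1) • e.1.tau e.2) *
      ∫ t in (0 : ℝ)..1, v (e.1.edgePt e.2 t) * v (e.1.edgePt e.2 t) * χ k (e.1.edgePt e.2 t) := by
  rw [Finset.sum_comm, bdrySq, Finset.mul_sum]
  refine Finset.sum_le_sum fun e he => ?_
  have hve : ContinuousOn (fun t => v (e.1.edgePt e.2 t)) (uIcc 0 1) := by
    refine hc.comp (e.1.continuous_edgePt e.2).continuousOn fun t ht => ?_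
    rw [uIcc_of_le zero_le_one] at ht
    exact carrier_subset_bulk (mem_bdryEdges.1 he).1
      (e.1.edge_subset_carrier e.2 (e.1.edgePt_mem_edge e.2 ht))
  have hi : ∀ k ∈ s, IntervalIntegrable (fun t => v (e.1.edgePt e.2 t) * v (e.1.edgePt e.2 t) *
      χ k (e.1.edgePt e.2 t)) volume 0 1 := fun k hk =>
    ((hve.mul hve).mul ((hT.smooth k hk).continuous.comp
      (e.1.continuous_edgePt e.2)).continuousOn).intervalIntegrable
  have h1 : ∀ k ∈ s, 1 / 2 * ‖e.1.tau e.2‖ * (∫ t in (0 : ℝ)..1, v (e.1.edgePt e.2 t) *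
      v (e.1.edgePt e.2 t) * χ k (e.1.edgePt e.2 t)) ≤
      det2 (ν k) (e.1.orient (ctr e.1) • e.1.tau e.2) * ∫ t in (0 : ℝ)..1,
        v (e.1.edgePt e.2 t) * v (e.1.edgePt e.2 t) * χ k (e.1.edgePt e.2 t) := fun k hk => by
    by_cases hex : ∃ t ∈ Icc (0 : ℝ) 1, 0 < χ k (e.1.edgePt e.2 t)
    · obtain ⟨t, ht, htp⟩ := hex
      refine mul_le_mul_of_nonneg_right
        (hT.le_det e he _ (e.1.edgePt_mem_edge e.2 ht) k hk htp) ?_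
      exact intervalIntegral.integral_nonneg zero_le_one fun t _ =>
        mul_nonneg (mul_self_nonneg _) (hT.nonneg k hk _)
    · push Not at hex
      rw [intervalIntegral.integral_congr (g := fun _ => 0)]
      · simp
      · intro t ht
        rw [uIcc_of_le zero_le_one] at ht
        have : χ k (e.1.edgePt e.2 t) = 0 := le_antisymm (hex t ht) (hT.nonneg k hk _)
        simp [this]
  refine le_trans ?_ (Finset.sum_le_sum h1)
  rw [← Finset.mul_sum, ← intervalIntegral.integral_finsetSum hi, ← mul_assoc]
  refine mul_le_mul_of_nonneg_left ?_ (by positivity)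
  refine intervalIntegral.integral_mono_on zero_le_one (hve.pow 2).intervalIntegrable
    ?_ fun t ht => ?_
  · simpa [Finset.sum_fn] using IntervalIntegrable.sum s hi
  · rw [← Finset.mul_sum, ← sq]
    exact le_mul_of_one_le_right (sq_nonneg _) (hT.one_le e he _ (e.1.edgePt_mem_edge e.2 ht))

/-- Trace inequality, with a small factor in front of the gradient. -/
theorem bdrySq_le (hM : M.Shaped a b ctr) {G : ℝ} {s : Finset Plane}
    {χ : Plane → Plane → ℝ} {ν : Plane → Plane} (hT : M.Transversal ctr G s χ ν)
    {v : Plane → ℝ} (hc : ContinuousOn v M.bulk) {gE : Polygon2 → Plane → Plane}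
    (hg : ∀ E ∈ M.elems, IsH1Grad (interior E.carrier) v (gE E)) {δ : ℝ} (hδ : 0 < δ) :
    M.bdrySq v ≤ 2 * s.card * (δ * ∑ E ∈ M.elems, (∫ x in E.carrier, ‖gE E x‖ ^ 2)) +
      2 * s.card * ((δ⁻¹ + G) * ∑ E ∈ M.elems, ∫ x in E.carrier, v x ^ 2) := by
  have key : ∀ k ∈ s, ∑ e ∈ M.bdryEdges, det2 (ν k) (e.1.orient (ctr e.1) • e.1.tau e.2) *
      (∫ t in (0 : ℝ)..1, v (e.1.edgePt e.2 t) * v (e.1.edgePt e.2 t) * χ k (e.1.edgePt e.2 t)) ≤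
      δ * (∑ E ∈ M.elems, ∫ x in E.carrier, ‖gE E x‖ ^ 2) +
      (δ⁻¹ + G) * ∑ E ∈ M.elems, ∫ x in E.carrier, v x ^ 2 := fun k hk => by
    have hχ1 : ContDiff ℝ 1 (χ k) := (hT.smooth k hk).of_le (by norm_num)
    rw [← hM.sum_sq_flux hc hg hχ1 (ν k), Finset.mul_sum, Finset.mul_sum,
      ← Finset.sum_add_distrib]
    refine Finset.sum_le_sum fun E hE => ?_
    have hvc := hc.mono (carrier_subset_bulk hE)
    have hgL := (hg E hE).2.1
    rw [E.restrict_interior] at hgL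
    set X := ∫ x in E.carrier, ‖gE E x‖ ^ 2 with hX
    set Y := ∫ x in E.carrier, v x ^ 2 with hY
    have hX0 : 0 ≤ X := integral_nonneg fun x => sq_nonneg _
    have hY0 : 0 ≤ Y := integral_nonneg fun x => sq_nonneg _
    have hiv : IntegrableOn (fun x => v x ^ 2) E.carrier volume :=
      (hvc.pow 2).integrableOn_compact E.isCompact_carrier
    have h1 : (∫ x in E.carrier, v x * χ k x * ⟪gE E x, ν k⟫) ^ 2 ≤ X * Y := by
      have hw : ContinuousOn (fun x => (v x * χ k x) • ν k) E.carrier :=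
        (hvc.mul hχ1.continuous.continuousOn).smul continuousOn_const
      have e : ∫ x in E.carrier, v x * χ k x * ⟪gE E x, ν k⟫ =
          ∫ x in E.carrier, ⟪gE E x, (v x * χ k x) • ν k⟫ := by
        simp only [inner_smul_right]
      rw [e]
      refine (sq_integral_inner_le hgL (E.memLp_of_continuousOn hw)).trans
        (mul_le_mul_of_nonneg_left ?_ hX0)
      refine setIntegral_mono_on ((hw.norm.pow 2).integrableOn_compact E.isCompact_carrier) hiv
        E.isClosed_carrier.measurableSet fun x _ => ?_
      rw [norm_smul, hT.norm_eq k hk, mul_one, Real.norm_eq_abs, sq_abs, mul_pow]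
      exact mul_le_of_le_one_right (sq_nonneg _)
        (pow_le_one₀ (hT.nonneg k hk x) (hT.le_one k hk x))
    -- Young's inequality with weight `δ`: this is where the gradient receives its small factor.
    have h2 : 2 * (∫ x in E.carrier, v x * χ k x * ⟪gE E x, ν k⟫) ≤ δ * X + δ⁻¹ * Y := by
      have h3 : |∫ x in E.carrier, v x * χ k x * ⟪gE E x, ν k⟫| ≤ (δ * X + δ⁻¹ * Y) / 2 := by
        refine abs_le_of_sq_le_sq (h1.trans ?_) (by positivity)
        have h4 := sq_nonneg (δ * X - δ⁻¹ * Y)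
        have h5 : X * Y = (δ * X) * (δ⁻¹ * Y) := by field_simp
        rw [h5]; nlinarith
      linarith [(abs_le.1 h3).2]
    have h3 : ∫ x in E.carrier, v x * v x * ⟪gradient (χ k) x, ν k⟫ ≤ G * Y := by
      rw [hY, ← integral_const_mul]
      refine setIntegral_mono_on ?_ (hiv.const_mul G) E.isClosed_carrier.measurableSet
        fun x _ => ?_
      · exact ((hvc.mul hvc).mul ((continuous_gradient hχ1).inner
          continuous_const).continuousOn).integrableOn_compact E.isCompact_carrier
      · have h4 : ⟪gradient (χ k) x, ν k⟫ ≤ G := by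
          refine (real_inner_le_norm _ _).trans ?_
          rw [hT.norm_eq k hk, mul_one]; exact hT.grad_le k hk x
        have := mul_le_mul_of_nonneg_left h4 (sq_nonneg (v x))
        linarith
    linarith
  have h1 := bdrySq_le_sum_flux hT hc
  have h2 := Finset.sum_le_card_nsmul s _ _ key
  rw [nsmul_eq_mul] at h2
  linarith

/-- The trace inequality for `v = 1` and `δ = 1` bounds the length of the polygonal boundary. -/
lemma bdry_length_le (hM : M.Shaped a b ctr) {G : ℝ} {s : Finset Plane}
    {χ : Plane → Plane → ℝ} {ν : Plane → Plane} (hT : M.Transversal ctr G s χ ν) :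
    ∑ e ∈ M.bdryEdges, ‖e.1.tau e.2‖ ≤ 2 * s.card * ((1 + G) * ∑ E ∈ M.elems, E.area) := by
  have h1 := hM.bdrySq_le hT (v := fun _ => 1) continuousOn_const
    (gE := fun _ _ => 0) (fun E hE => (hM.star hE).isH1Grad_one) one_pos
  simpa [bdrySq, Polygon2.integral_const_carrier, Polygon2.area, Measure.real] using h1

/-- All nodes lie in the domain, so every element lies in its closed `h₀`-neighbourhood; elements
overlap in null sets. -/
lemma sum_area_le (hM : M.Shaped a b ctr) {γ₁ γ₂ h₀ : ℝ} (hB : M.IsBSMesh Ω h γ₁ γ₂)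
    (hΩ : IsCompact Ω) (hh : h ≤ h₀) :
    ∑ E ∈ M.elems, E.area ≤ (volume (Metric.cthickening h₀ Ω)).toReal := by
  have hfin : volume (Metric.cthickening h₀ Ω) ≠ ⊤ :=
    (hΩ.isBounded.cthickening).measure_lt_top.ne
  have h1 := hM.lintegral_bulk (fun _ => 1)
  simp only [lintegral_one, Measure.restrict_apply_univ] at h1
  have h2 : ∑ E ∈ M.elems, E.area = (volume M.bulk).toReal := by
    rw [h1, ENNReal.toReal_sum fun E _ => E.volume_carrier_ne_top]
    rfl
  rw [h2]
  refine ENNReal.toReal_mono hfin (measure_mono fun x hx => ?_)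
  obtain ⟨E, hE, hxE⟩ := mem_iUnion₂.1 hx
  refine Metric.mem_cthickening_of_dist_le x _ h₀ Ω (hB.vertex_mem E hE E.zeroIdx) ?_
  exact (Metric.dist_le_diam_of_mem E.isCompact_carrier.isBounded hxE
    (E.vertex_mem_carrier _)).trans ((hB.diam_le E hE).trans hh)

end Shaped

/-! ### Functions that are affine along the boundary edges -/

/-- `v` is affine along each boundary edge. -/
def BdryLinear (M : PolyMesh) (v : Plane → ℝ) : Prop :=
  ∀ e ∈ M.bdryEdges, ∃ p : Plane →ᵃ[ℝ] ℝ, EqOn v p (e.1.edge e.2)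

/-- First vertex value on an edge. -/
def valP (v : Plane → ℝ) (e : Σ E : Polygon2, Fin E.n) : ℝ := v (e.1.vertex e.2)

/-- Second vertex value on an edge. -/
def valQ (v : Plane → ℝ) (e : Σ E : Polygon2, Fin E.n) : ℝ := v (e.1.nextVertex e.2)

/-- The length of an edge. -/
def len (e : Σ E : Polygon2, Fin E.n) : ℝ := ‖e.1.tau e.2‖

lemma len_pos (e : Σ E : Polygon2, Fin E.n) : 0 < len e := e.1.norm_tau_pos e.2

/-- The mass form on the boundary in terms of vertex values. -/
def edgeMass (M : PolyMesh) (v w : Plane → ℝ) : ℝ := ∑ e ∈ M.bdryEdges, len e *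
  ((2 * (valP v e * valP w e) + 2 * (valQ v e * valQ w e) + valP v e * valQ w e +
    valQ v e * valP w e) / 6)

/-- The stiffness form on the boundary in terms of vertex values. -/
def edgeStiff (M : PolyMesh) (v w : Plane → ℝ) : ℝ := ∑ e ∈ M.bdryEdges,
  (valQ v e - valP v e) * (valQ w e - valP w e) / len e

/-- The lumped mass form on the boundary. -/
def edgeLump (M : PolyMesh) (v w : Plane → ℝ) : ℝ := ∑ e ∈ M.bdryEdges, len e / 2 *
  (valP v e * valP w e + valQ v e * valQ w e)

lemma BdryLinear.apply {v : Plane → ℝ} (hv : M.BdryLinear v) {e : Σ E : Polygon2, Fin E.n}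
    (he : e ∈ M.bdryEdges) {t : ℝ} (ht : t ∈ Icc (0 : ℝ) 1) :
    v (e.1.edgePt e.2 t) = (1 - t) * valP v e + t * valQ v e := by
  obtain ⟨p, hp⟩ := hv e he
  rw [valP, valQ, hp (e.1.edgePt_mem_edge e.2 ht), hp (e.1.vertex_mem_edge e.2),
    hp (e.1.nextVertex_mem_edge e.2), Polygon2.edgePt, AffineMap.apply_lineMap,
    AffineMap.lineMap_apply]
  simp; ring

lemma intervalIntegral_linear_mul (p q p' q' : ℝ) :
    ∫ t in (0 : ℝ)..1, ((1 - t) * p + t * q) * ((1 - t) * p' + t * q') =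
      (2 * (p * p') + 2 * (q * q') + p * q' + q * p') / 6 := by
  have h1 := intervalIntegral_linear_sq (p + p') (q + q')
  have h2 := intervalIntegral_linear_sq p q
  have h3 := intervalIntegral_linear_sq p' q'
  have hi : ∀ x y x' y' : ℝ, IntervalIntegrable
      (fun t : ℝ => ((1 - t) * x + t * y) * ((1 - t) * x' + t * y')) volume 0 1 :=
    fun x y x' y' => (by fun_prop : Continuous _).intervalIntegrable _ _
  have e : ∫ t in (0 : ℝ)..1, ((1 - t) * (p + p') + t * (q + q')) *
      ((1 - t) * (p + p') + t * (q + q')) =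
      (∫ t in (0 : ℝ)..1, ((1 - t) * p + t * q) * ((1 - t) * p + t * q)) +
      (∫ t in (0 : ℝ)..1, ((1 - t) * p' + t * q') * ((1 - t) * p' + t * q')) +
      2 * ∫ t in (0 : ℝ)..1, ((1 - t) * p + t * q) * ((1 - t) * p' + t * q') := by
    rw [← intervalIntegral.integral_const_mul, ← intervalIntegral.integral_add (hi _ _ _ _)
      (hi _ _ _ _), ← intervalIntegral.integral_add ((hi _ _ _ _).add (hi _ _ _ _))
      ((hi _ _ _ _).const_mul 2)]
    refine intervalIntegral.integral_congr fun t _ => ?_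
    ring
  rw [h1, h2, h3] at e
  linarith

lemma BdryLinear.surfInt_mul {v w : Plane → ℝ} (hv : M.BdryLinear v) (hw : M.BdryLinear w) :
    M.surfInt (fun x => v x * w x) = M.edgeMass v w := by
  refine Finset.sum_congr rfl fun e he => ?_
  rw [segInt, ← e.1.norm_tau, ← intervalIntegral_linear_mul]
  congr 1
  refine intervalIntegral.integral_congr fun t ht => ?_
  rw [uIcc_of_le zero_le_one] at ht
  rw [← hv.apply he ht, ← hw.apply he ht]
  rfl

lemma BdryLinear.bdrySq_eq {v : Plane → ℝ} (hv : M.BdryLinear v) :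
    M.bdrySq v = M.edgeMass v v := by
  rw [← hv.surfInt_mul hv]
  refine Finset.sum_congr rfl fun e he => ?_
  rw [segInt, ← e.1.norm_tau]
  simp only [sq]
  rfl

lemma BdryLinear.segDeriv_eq {v : Plane → ℝ} (hv : M.BdryLinear v)
    {e : Σ E : Polygon2, Fin E.n} (he : e ∈ M.bdryEdges) {t : ℝ} (ht : t ∈ Ioo (0 : ℝ) 1) :
    segDeriv (e.1.vertex e.2) (e.1.nextVertex e.2) v t = (valQ v e - valP v e) / len e := by
  have h1 : (fun τ : ℝ => v (AffineMap.lineMap (e.1.vertex e.2) (e.1.nextVertex e.2) τ)) =ᶠ[𝓝 t]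
      fun τ => (1 - τ) * valP v e + τ * valQ v e := by
    filter_upwards [isOpen_Ioo.mem_nhds ht] with τ hτ
    exact hv.apply he (Ioo_subset_Icc_self hτ)
  have h2 : HasDerivAt (fun τ : ℝ => (1 - τ) * valP v e + τ * valQ v e)
      (valQ v e - valP v e) t := by
    have h3 := (((hasDerivAt_id t).const_sub 1).mul_const (valP v e)).add
      ((hasDerivAt_id t).mul_const (valQ v e))
    exact h3.congr_deriv (by ring)
  rw [segDeriv, h1.deriv_eq, h2.deriv, len, e.1.norm_tau]

lemma BdryLinear.surfStiff_eq {v w : Plane → ℝ} (hv : M.BdryLinear v) (hw : M.BdryLinear w) :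
    M.surfStiff v w = M.edgeStiff v w := by
  refine Finset.sum_congr rfl fun e he => ?_
  have h1 : ∫ t in (0 : ℝ)..1, segDeriv (e.1.vertex e.2) (e.1.nextVertex e.2) v t *
      segDeriv (e.1.vertex e.2) (e.1.nextVertex e.2) w t =
      ∫ t in (0 : ℝ)..1, (valQ v e - valP v e) / len e * ((valQ w e - valP w e) / len e) := by
    -- The derivative is only known on the open interval: at the endpoints `deriv` sees values off
    -- the edge.
    rw [intervalIntegral.integral_of_le zero_le_one, intervalIntegral.integral_of_le zero_le_one,
      integral_Ioc_eq_integral_Ioo, integral_Ioc_eq_integral_Ioo]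
    refine setIntegral_congr_fun measurableSet_Ioo fun t ht => ?_
    rw [hv.segDeriv_eq he ht, hw.segDeriv_eq he ht]
  rw [h1, intervalIntegral.integral_const, ← e.1.norm_tau]
  have := len_pos e
  rw [len] at this ⊢
  simp; field_simp

lemma BdryLinear.surfL2Sq_eq {v : Plane → ℝ} (hv : M.BdryLinear v) :
    M.surfL2Sq v = ENNReal.ofReal (M.edgeMass v v) := by
  rw [← hv.bdrySq_eq, bdrySq, ENNReal.ofReal_sum_of_nonneg fun e _ => mul_nonneg (norm_nonneg _)
    (intervalIntegral.integral_nonneg zero_le_one fun t _ => sq_nonneg _)]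
  refine Finset.sum_congr rfl fun e he => ?_
  rw [ENNReal.ofReal_mul (norm_nonneg _), e.1.norm_tau]
  congr 1
  have hc : ContinuousOn (fun t => v (e.1.edgePt e.2 t) ^ 2) (Icc 0 1) := by
    refine ContinuousOn.congr (f := fun t => ((1 - t) * valP v e + t * valQ v e) ^ 2)
      (by fun_prop) fun t ht => ?_
    rw [hv.apply he ht]
  rw [intervalIntegral.integral_of_le zero_le_one, ← integral_Icc_eq_integral_Ioc,
    ofReal_integral_eq_lintegral_ofReal (hc.integrableOn_compact isCompact_Icc)
      (Filter.Eventually.of_forall fun t => sq_nonneg _)]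
  refine lintegral_congr fun t => ?_
  rw [← sq_abs, ENNReal.ofReal_pow (abs_nonneg _), ← Real.norm_eq_abs, ofReal_norm]
  rfl

lemma BdryLinear.surfH1SemiSq_eq {v : Plane → ℝ} (hv : M.BdryLinear v) :
    M.surfH1SemiSq v = ENNReal.ofReal (M.edgeStiff v v) := by
  rw [edgeStiff, ENNReal.ofReal_sum_of_nonneg fun e _ => div_nonneg (mul_self_nonneg _)
    (len_pos e).le]
  refine Finset.sum_congr rfl fun e he => ?_
  have h1 : ∫⁻ t in Icc (0 : ℝ) 1,
      ‖segDeriv (e.1.vertex e.2) (e.1.nextVertex e.2) v t‖ₑ ^ 2 =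
      ∫⁻ _ in Icc (0 : ℝ) 1, ENNReal.ofReal (((valQ v e - valP v e) / len e) ^ 2) := by
    rw [← restrict_Ioo_eq_restrict_Icc]
    refine setLIntegral_congr_fun measurableSet_Ioo fun t ht => ?_
    rw [hv.segDeriv_eq he ht, ← sq_abs, ENNReal.ofReal_pow (abs_nonneg _), ← Real.norm_eq_abs,
      ofReal_norm]
  rw [h1, lintegral_const, Measure.restrict_apply_univ, Real.volume_Icc, sub_zero,
    ENNReal.ofReal_one, mul_one, ← ENNReal.ofReal_mul dist_nonneg, ← e.1.norm_tau]
  congr 1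
  have := len_pos e
  rw [len] at this ⊢
  field_simp

lemma edgeMass_self_nonneg (M : PolyMesh) (v : Plane → ℝ) : 0 ≤ M.edgeMass v v :=
  Finset.sum_nonneg fun e _ => mul_nonneg (len_pos e).le (by
    nlinarith [sq_nonneg (valP v e), sq_nonneg (valQ v e), sq_nonneg (valP v e + valQ v e)])

lemma edgeStiff_self_nonneg (M : PolyMesh) (v : Plane → ℝ) : 0 ≤ M.edgeStiff v v :=
  Finset.sum_nonneg fun e _ => div_nonneg (mul_self_nonneg _) (len_pos e).le

lemma edgeLump_le (M : PolyMesh) (v : Plane → ℝ) : M.edgeLump v v ≤ 3 * M.edgeMass v v := by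
  rw [edgeLump, edgeMass, Finset.mul_sum]
  refine Finset.sum_le_sum fun e _ => ?_
  have := mul_nonneg (len_pos e).le (sq_nonneg (valP v e + valQ v e))
  nlinarith

lemma edgeMass_le_edgeLump (M : PolyMesh) (v : Plane → ℝ) : M.edgeMass v v ≤ M.edgeLump v v := by
  rw [edgeLump, edgeMass]
  refine Finset.sum_le_sum fun e _ => ?_
  have := mul_nonneg (len_pos e).le (sq_nonneg (valP v e - valQ v e))
  nlinarith

/-- The error of the trapezoidal rule for a product of affine functions is a product of increments.
Hence lumping is accurate wherever increments are under control. -/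
lemma edgeMass_eq (M : PolyMesh) (v w : Plane → ℝ) : M.edgeMass v w = M.edgeLump v w -
    ∑ e ∈ M.bdryEdges, len e / 6 * ((valQ v e - valP v e) * (valQ w e - valP w e)) := by
  rw [edgeLump, edgeMass, ← Finset.sum_sub_distrib]
  refine Finset.sum_congr rfl fun e _ => ?_
  ring

/-- Young's inequality for the boundary mass form. -/
lemma edgeMass_le_young (M : PolyMesh) (v w : Plane → ℝ) {δ : ℝ} (hδ : 0 < δ) :
    M.edgeMass v w ≤ δ * M.edgeMass w w + (4 * δ)⁻¹ * M.edgeMass v v := by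
  rw [edgeMass, edgeMass, edgeMass, Finset.mul_sum, Finset.mul_sum, ← Finset.sum_add_distrib]
  refine Finset.sum_le_sum fun e _ => ?_
  have hl := len_pos e
  set p := valP v e
  set q := valQ v e
  set p' := valP w e
  set q' := valQ w e
  have h1 : 0 ≤ len e / (6 * (4 * δ)) * ((p - 2 * δ * p') ^ 2 + (q - 2 * δ * q') ^ 2 +
      ((p - 2 * δ * p') + (q - 2 * δ * q')) ^ 2) := by positivity
  have h2 : len e / (6 * (4 * δ)) * ((p - 2 * δ * p') ^ 2 + (q - 2 * δ * q') ^ 2 +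
      ((p - 2 * δ * p') + (q - 2 * δ * q')) ^ 2) =
      δ * (len e * ((2 * (p' * p') + 2 * (q' * q') + p' * q' + q' * p') / 6)) +
      (4 * δ)⁻¹ * (len e * ((2 * (p * p) + 2 * (q * q) + p * q + q * p) / 6)) -
      len e * ((2 * (p * p') + 2 * (q * q') + p * q' + q * p') / 6) := by
    field_simp; ring
  linarith

end PolyMesh

/-! ### Absolutely continuous functions of time -/

/-- `f` is absolutely continuous on `[0, T]` with almost everywhere derivative `f'`. -/
def HasAEDeriv (T : ℝ) (f f' : ℝ → ℝ) : Prop :=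
  AbsolutelyContinuousOnInterval f 0 T ∧
    ∀ᵐ t ∂(volume.restrict (Icc 0 T)), HasDerivAt f (f' t) t

namespace HasAEDeriv

variable {T : ℝ} {f f' g g' : ℝ → ℝ}

lemma add (hf : HasAEDeriv T f f') (hg : HasAEDeriv T g g') :
    HasAEDeriv T (fun t => f t + g t) (fun t => f' t + g' t) :=
  ⟨hf.1.add hg.1, by filter_upwards [hf.2, hg.2] with t h1 h2 using h1.add h2⟩

lemma const_mul (k : ℝ) (hf : HasAEDeriv T f f') :
    HasAEDeriv T (fun t => k * f t) (fun t => k * f' t) :=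
  ⟨hf.1.const_mul k, by filter_upwards [hf.2] with t h1 using h1.const_mul k⟩

lemma mul (hf : HasAEDeriv T f f') (hg : HasAEDeriv T g g') :
    HasAEDeriv T (fun t => f t * g t) (fun t => f' t * g t + f t * g' t) :=
  ⟨hf.1.mul hg.1, by filter_upwards [hf.2, hg.2] with t h1 h2 using h1.mul h2⟩

lemma of_contDiff (hf : ContDiff ℝ 1 f) : HasAEDeriv T f (deriv f) :=
  ⟨hf.contDiffOn.absolutelyContinuousOnInterval,
    Filter.Eventually.of_forall fun t => (hf.differentiable one_ne_zero t).hasDerivAt⟩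

lemma sum {ι : Type*} (s : Finset ι) {f f' : ι → ℝ → ℝ} (h : ∀ i ∈ s, HasAEDeriv T (f i) (f' i)) :
    HasAEDeriv T (fun t => ∑ i ∈ s, f i t) (fun t => ∑ i ∈ s, f' i t) := by
  classical
  induction s using Finset.induction_on with
  | empty => simpa using (of_contDiff (T := T) (contDiff_const (c := (0 : ℝ))))
  | insert i s hi ih =>
    simp only [Finset.sum_insert hi]
    exact (h i (Finset.mem_insert_self i s)).add
      (ih fun j hj => h j (Finset.mem_insert_of_mem hj))

lemma continuousOn (hT : 0 ≤ T) (hf : HasAEDeriv T f f') : ContinuousOn f (Icc 0 T) := by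
  have := hf.1.continuousOn
  rwa [uIcc_of_le hT] at this

lemma of_integral (hT : 0 ≤ T) (hi : IntegrableOn f' (Icc 0 T))
    (h : ∀ t ∈ Icc 0 T, f t = f 0 + ∫ τ in (0 : ℝ)..t, f' τ) : HasAEDeriv T f f' := by
  have hi' : IntervalIntegrable f' volume 0 T :=
    (intervalIntegrable_iff_integrableOn_Icc_of_le hT).2 hi
  have h0 : (0 : ℝ) ∈ uIcc 0 T := left_mem_uIcc
  constructor
  · have h1 := hi'.absolutelyContinuousOnInterval_intervalIntegral h0
    rw [absolutelyContinuousOnInterval_iff] at h1 ⊢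
    intro ε hε
    obtain ⟨δ, hδ, h2⟩ := h1 ε hε
    refine ⟨δ, hδ, fun P hP hl => ?_⟩
    refine lt_of_eq_of_lt (Finset.sum_congr rfl fun i hi => ?_) (h2 P hP hl)
    have h3 := hP.1 i hi
    rw [uIcc_of_le hT] at h3
    rw [h _ h3.1, h _ h3.2, dist_add_left]
  -- Endpoints are dropped because the integral formula holds only inside `[0, T]`, while
  -- `HasDerivAt` is two-sided.
  · rw [← restrict_Ioo_eq_restrict_Icc, ae_restrict_iff' measurableSet_Ioo]
    filter_upwards [hi'.ae_hasDerivAt_integral] with t ht hmem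
    have h1 := ht (by rw [uIcc_of_le hT]; exact Ioo_subset_Icc_self hmem) 0 h0
    refine (h1.const_add (f 0)).congr_of_eventuallyEq ?_
    filter_upwards [isOpen_Ioo.mem_nhds hmem] with τ hτ
    exact h τ (Ioo_subset_Icc_self hτ)

/-- A differential inequality can be integrated. -/
lemma le_integral (hf : HasAEDeriv T f f') {φ : ℝ → ℝ} (hφ : IntegrableOn φ (Icc 0 T))
    (h : ∀ᵐ t ∂(volume.restrict (Icc 0 T)), f' t ≤ φ t) {t : ℝ} (ht : t ∈ Icc 0 T) :
    f t ≤ f 0 + ∫ τ in (0 : ℝ)..t, φ τ := by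
  have hsub : Icc 0 t ⊆ Icc 0 T := Icc_subset_Icc_right ht.2
  have hac : AbsolutelyContinuousOnInterval f 0 t := hf.1.mono (by
    rw [uIcc_of_le ht.1, uIcc_of_le (ht.1.trans ht.2)]; exact hsub)
  have h1 := hac.integral_deriv_eq_sub
  have h2 : ∫ τ in (0 : ℝ)..t, deriv f τ ≤ ∫ τ in (0 : ℝ)..t, φ τ := by
    refine intervalIntegral.integral_mono_ae_restrict ht.1 hac.intervalIntegrable_deriv
      ((intervalIntegrable_iff_integrableOn_Icc_of_le ht.1).2 (hφ.mono_set hsub)) ?_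
    filter_upwards [ae_restrict_of_ae_restrict_of_subset hsub hf.2,
      ae_restrict_of_ae_restrict_of_subset hsub h] with τ h3 h4
    rw [h3.deriv]; exact h4
  linarith

/-- Gronwall's inequality with a dissipation term. -/
lemma gronwall (hf : HasAEDeriv T f f') {A : ℝ → ℝ} (hA : ContinuousOn A (Icc 0 T))
    (hA0 : ∀ t ∈ Icc 0 T, 0 ≤ A t) {K : ℝ} (hK : 0 ≤ K)
    (h : ∀ᵐ t ∂(volume.restrict (Icc 0 T)), f' t + A t ≤ K * (1 + f t)) {t : ℝ}
    (ht : t ∈ Icc 0 T) :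
    1 + f t + ∫ τ in (0 : ℝ)..t, A τ ≤ Real.exp (K * t) * (1 + f 0) := by
  have hexp : HasAEDeriv T (fun t => Real.exp (-K * t)) (fun t => Real.exp (-K * t) * -K) := by
    have h1 := of_contDiff (T := T) (f := fun t => Real.exp (-K * t)) (by fun_prop)
    refine ⟨h1.1, Filter.Eventually.of_forall fun t => ?_⟩
    simpa using ((hasDerivAt_id t).const_mul (-K)).exp
  have hone : HasAEDeriv T (fun _ => 1) (fun _ => 0) := by
    simpa using of_contDiff (T := T) (contDiff_const (c := (1 : ℝ)))
  -- The function e^{-Kt}(1 + f) has derivative at most -e^{-Kt}A.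
  have hz := hexp.mul (hone.add hf)
  have hE : ContinuousOn (fun t => Real.exp (-K * t) * A t) (Icc 0 T) :=
    (by fun_prop : Continuous fun t : ℝ => Real.exp (-K * t)).continuousOn.mul hA
  have h1 := hz.le_integral (hE.neg.integrableOn_compact isCompact_Icc) (by
    filter_upwards [h] with τ hτ
    have := mul_le_mul_of_nonneg_left hτ (Real.exp_pos (-K * τ)).le
    simp only [Pi.neg_apply]
    linarith) ht
  have hsub : Icc 0 t ⊆ Icc 0 T := Icc_subset_Icc_right ht.2
  -- The decreasing weight is replaced by its smallest value, so that the dissipation survives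
  -- multiplication by e^{Kt} at full strength.
  have h2 : Real.exp (-K * t) * (∫ τ in (0 : ℝ)..t, A τ) ≤
      ∫ τ in (0 : ℝ)..t, Real.exp (-K * τ) * A τ := by
    rw [← intervalIntegral.integral_const_mul]
    refine intervalIntegral.integral_mono_on ht.1
      (ContinuousOn.intervalIntegrable_of_Icc ht.1 (continuousOn_const.mul (hA.mono hsub)))
      (ContinuousOn.intervalIntegrable_of_Icc ht.1 (hE.mono hsub)) fun τ hτ => ?_
    refine mul_le_mul_of_nonneg_right (Real.exp_le_exp.2 ?_) (hA0 τ (hsub hτ))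
    nlinarith [hτ.2]
  have h3 : ∫ τ in (0 : ℝ)..t, (-fun t => Real.exp (-K * t) * A t) τ =
      -∫ τ in (0 : ℝ)..t, Real.exp (-K * τ) * A τ := by
    simp only [Pi.neg_apply, intervalIntegral.integral_neg]
  rw [h3, mul_zero, Real.exp_zero, one_mul] at h1
  have h4 : Real.exp (-K * t) * (1 + f t + ∫ τ in (0 : ℝ)..t, A τ) ≤ 1 + f 0 := by
    rw [mul_add]; linarith
  have h5 := mul_le_mul_of_nonneg_left h4 (Real.exp_pos (K * t)).le
  rwa [← mul_assoc, ← Real.exp_add, show K * t + -K * t = 0 by ring, Real.exp_zero,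
    one_mul] at h5

/-- Bilinear forms of absolutely continuous vectors. -/
lemma bilin {n : ℕ} (B : (Fin n → ℝ) →ₗ[ℝ] (Fin n → ℝ) →ₗ[ℝ] ℝ) {x x' y y' : ℝ → Fin n → ℝ}
    (hx : ∀ i, HasAEDeriv T (fun t => x t i) (fun t => x' t i))
    (hy : ∀ i, HasAEDeriv T (fun t => y t i) (fun t => y' t i)) :
    HasAEDeriv T (fun t => B (x t) (y t)) (fun t => B (x' t) (y t) + B (x t) (y' t)) := by
  have e : ∀ u w : Fin n → ℝ, B u w =
      ∑ i, ∑ j, B (Pi.single i 1) (Pi.single j 1) * (u i * w j) := fun u w => by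
    conv_lhs => rw [LinearMap.pi_apply_eq_sum_univ B u]
    rw [LinearMap.sum_apply]
    refine Finset.sum_congr rfl fun i _ => ?_
    rw [LinearMap.smul_apply, LinearMap.pi_apply_eq_sum_univ (B _) w, smul_eq_mul, Finset.mul_sum]
    refine Finset.sum_congr rfl fun j _ => ?_
    have e1 : ∀ k : Fin n, (fun j => if k = j then (1 : ℝ) else 0) = Pi.single k 1 := fun k => by
      ext j; simp [Pi.single_apply, eq_comm]
    rw [e1, e1, smul_eq_mul]; ring
  have h1 := sum Finset.univ fun i _ => sum Finset.univ fun j _ =>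
    ((hx i).mul (hy j)).const_mul (B (Pi.single i 1) (Pi.single j 1))
  simp only [mul_add, Finset.sum_add_distrib, ← e] at h1
  exact h1

end HasAEDeriv

/-! ### The chain rule for a primitive in one variable -/

/-- A primitive of `s` with respect to its first argument. -/
def primitive (s : ℝ × ℝ → ℝ) (u v : ℝ) : ℝ := ∫ w in (0 : ℝ)..u, s (w, v)

section Primitive

variable {s : ℝ × ℝ → ℝ} {L : NNReal}

lemma LipschitzWith.abs_sub_le_add (hs : LipschitzWith L s) (x y : ℝ × ℝ) :
    |s x - s y| ≤ L * (|x.1 - y.1| + |x.2 - y.2|) := by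
  have h1 := hs.dist_le_mul x y
  rw [Real.dist_eq, Prod.dist_eq, Real.dist_eq, Real.dist_eq] at h1
  refine h1.trans (mul_le_mul_of_nonneg_left ?_ L.2)
  exact max_le_add_of_nonneg (abs_nonneg _) (abs_nonneg _)

lemma LipschitzWith.abs_le_add (hs : LipschitzWith L s) (u v : ℝ) :
    |s (u, v)| ≤ |s 0| + L * (|u| + |v|) := by
  have h1 := LipschitzWith.abs_sub_le_add hs (u, v) 0
  have h2 := abs_sub_abs_le_abs_sub (s (u, v)) (s 0)
  simp only [Prod.fst_zero, Prod.snd_zero, sub_zero] at h1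
  linarith

lemma abs_primitive_le (hs : LipschitzWith L s) (u v : ℝ) :
    |primitive s u v| ≤ (|s 0| + 2 * L) * (1 + u ^ 2 + v ^ 2) := by
  have h1 : ‖primitive s u v‖ ≤ (|s 0| + L * (|u| + |v|)) * |u - 0| := by
    refine intervalIntegral.norm_integral_le_of_norm_le_const fun w hw => ?_
    refine (LipschitzWith.abs_le_add hs w v).trans ?_
    have : |w| ≤ |u| := by
      have h2 := uIoc_subset_uIcc hw
      simpa using abs_sub_left_of_mem_uIcc h2
    have hL := L.2
    gcongr
  rw [Real.norm_eq_abs, sub_zero] at h1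
  refine h1.trans ?_
  have hL : (0 : ℝ) ≤ L := L.2
  have h0 := abs_nonneg (s 0)
  rw [← sq_abs u, ← sq_abs v]
  have hu := abs_nonneg u
  have hv := abs_nonneg v
  have e1 := mul_nonneg h0 (by nlinarith [sq_nonneg (|u| - 1)] : 0 ≤ 1 + |u| ^ 2 + |v| ^ 2 - |u|)
  have e2 := mul_nonneg hL (by nlinarith [sq_nonneg (|u| - |v|)] :
    0 ≤ 2 * (1 + |u| ^ 2 + |v| ^ 2) - (|u| + |v|) * |u|)
  nlinarith

lemma primitive_intervalIntegrable (hs : LipschitzWith L s) (v x y : ℝ) :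
    IntervalIntegrable (fun w => s (w, v)) volume x y :=
  (hs.continuous.comp (by fun_prop : Continuous fun w : ℝ => (w, v))).intervalIntegrable _ _

lemma abs_primitive_sub_right_le (hs : LipschitzWith L s) (u v v' : ℝ) :
    |primitive s u v - primitive s u v'| ≤ L * |v - v'| * |u| := by
  rw [primitive, primitive, ← intervalIntegral.integral_sub (primitive_intervalIntegrable hs _ _ _)
    (primitive_intervalIntegrable hs _ _ _)]
  have h1 := intervalIntegral.norm_integral_le_of_norm_le_const (a := 0) (b := u)
    (f := fun w => s (w, v) - s (w, v')) (C := L * |v - v'|) fun w _ => by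
      simpa using LipschitzWith.abs_sub_le_add hs (w, v) (w, v')
  simpa using h1

lemma primitive_sub_left (hs : LipschitzWith L s) (u u' v : ℝ) :
    primitive s u v - primitive s u' v = ∫ w in u'..u, s (w, v) :=
  intervalIntegral.integral_interval_sub_left (primitive_intervalIntegrable hs _ _ _)
    (primitive_intervalIntegrable hs _ _ _)

/-- Chain rule for the primitive, as an inequality. -/
lemma exists_hasAEDeriv_primitive (hs : LipschitzWith L s) {T : ℝ} (hT : 0 ≤ T)
    {u u' v v' : ℝ → ℝ} (hu : HasAEDeriv T u u') (hv : HasAEDeriv T v v') :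
    ∃ p' : ℝ → ℝ, HasAEDeriv T (fun t => primitive s (u t) (v t)) p' ∧
      ∀ᵐ t ∂(volume.restrict (Icc 0 T)), s (u t, v t) * u' t ≤ p' t + L * (|u t| * |v' t|) := by
  have hL : (0 : ℝ) ≤ L := L.2
  set p := fun t => primitive s (u t) (v t) with hp
  -- On the bounded ranges of `u` and `v` the primitive is Lipschitz in both variables, so
  -- increments of `p` are bounded by those of `u` and `v`.
  have hac : AbsolutelyContinuousOnInterval p 0 T := by
    obtain ⟨R, hR⟩ := hu.1.exists_bound
    obtain ⟨S, hS⟩ := hv.1.exists_bound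
    have hR0 : 0 ≤ R := (norm_nonneg _).trans (hR 0 left_mem_uIcc)
    have hS0 : 0 ≤ S := (norm_nonneg _).trans (hS 0 left_mem_uIcc)
    have hu1 : Filter.Tendsto _ _ _ := hu.1
    have hv1 : Filter.Tendsto _ _ _ := hv.1
    refine squeeze_zero' (Filter.Eventually.of_forall fun _ =>
      Finset.sum_nonneg fun _ _ => dist_nonneg) ?_
      (by simpa using (hu1.const_mul (|s 0| + L * (R + S))).add (hv1.const_mul (L * R)))
    rw [Filter.eventually_inf_principal]
    filter_upwards with P hP
    simp only [Finset.mul_sum, ← Finset.sum_add_distrib]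
    refine Finset.sum_le_sum fun i hi => ?_
    obtain ⟨hx, hy⟩ := hP.1 i hi
    set x := (P.2 i).1
    set y := (P.2 i).2
    have e1 : p x - p y = (primitive s (u x) (v x) - primitive s (u y) (v x)) +
      (primitive s (u y) (v x) - primitive s (u y) (v y)) := by simp only [hp]; ring
    rw [Real.dist_eq, Real.dist_eq, Real.dist_eq, e1]
    refine (abs_add_le _ _).trans (add_le_add ?_ ?_)
    · rw [primitive_sub_left hs, ← Real.norm_eq_abs, ← Real.norm_eq_abs (u x - u y)]
      refine intervalIntegral.norm_integral_le_of_norm_le_const fun w hw => ?_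
      refine (LipschitzWith.abs_le_add hs w _).trans ?_
      have hw' : |w| ≤ R := by
        have h1 := hR x hx
        have h2 := hR y hy
        rw [Real.norm_eq_abs, abs_le] at h1 h2
        have h3 := uIoc_subset_uIcc hw
        rw [mem_uIcc] at h3
        rw [abs_le]
        rcases h3 with h3 | h3 <;> constructor <;> linarith [h3.1, h3.2]
      have hv' : |v x| ≤ S := hS x hx
      gcongr
    · refine (abs_primitive_sub_right_le hs _ _ _).trans ?_
      rw [mul_assoc, mul_comm |v x - v y|, ← mul_assoc]
      have hu' : |u y| ≤ R := hR y hy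
      gcongr
  refine ⟨deriv p, ⟨hac, ?_⟩, ?_⟩
  · rw [ae_restrict_iff' measurableSet_Icc]
    filter_upwards [hac.ae_differentiableAt] with t ht hmem
    exact (ht (by rwa [uIcc_of_le hT])).hasDerivAt
  · have hd : ∀ᵐ t ∂(volume.restrict (Icc 0 T)), DifferentiableAt ℝ p t := by
      rw [ae_restrict_iff' measurableSet_Icc]
      filter_upwards [hac.ae_differentiableAt] with t ht hmem
      exact ht (by rwa [uIcc_of_le hT])
    filter_upwards [hu.2, hv.2, hd] with t h1 h2 h3
    -- As `s` need not be differentiable in its second variable, there is no genuine chain rule. The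
    -- part that varies the upper limit is differentiable by hand: replacing the integrand by `s (u
    -- t, v t)` costs a product of a null function and an increment of `u`.
    have hA : HasDerivAt (fun τ => primitive s (u τ) (v τ) - primitive s (u t) (v τ))
        (s (u t, v t) * u' t) t := by
      rw [hasDerivAt_iff_isLittleO]
      have hlin : (fun τ : ℝ => (u τ - u t) * s (u t, v t) - (τ - t) * (s (u t, v t) * u' t))
          =o[𝓝 t] fun τ => τ - t := by
        have := hasDerivAt_iff_isLittleO.1 (HasDerivAt.mul_const h1 (s (u t, v t)))
        refine this.congr_left fun τ => ?_
        simp only [smul_eq_mul]; ring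
      have hq : (fun τ => (primitive s (u τ) (v τ) - primitive s (u t) (v τ)) -
          (u τ - u t) * s (u t, v t)) =o[𝓝 t] fun τ => τ - t := by
        have hO : (fun τ => u τ - u t) =O[𝓝 t] fun τ => τ - t := h1.isBigO_sub
        have hsm : (fun τ => L * (|u τ - u t| + |v τ - v t|)) =o[𝓝 t] fun _ => (1 : ℝ) := by
          rw [Asymptotics.isLittleO_one_iff]
          have c1 : Filter.Tendsto (fun τ => L * (|u τ - u t| + |v τ - v t|)) (𝓝 t)
              (𝓝 (L * (|u t - u t| + |v t - v t|))) :=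
            ((((h1.continuousAt.sub continuousAt_const).abs).add
              ((h2.continuousAt.sub continuousAt_const).abs)).const_mul _)
          simpa using c1
        have hprod := hsm.mul_isBigO hO
        simp only [one_mul] at hprod
        refine Asymptotics.IsBigO.trans_isLittleO
          (Asymptotics.IsBigO.of_bound 1 (Filter.Eventually.of_forall fun τ => ?_)) hprod
        rw [primitive_sub_left hs, one_mul, norm_mul, Real.norm_of_nonneg
          (mul_nonneg hL (add_nonneg (abs_nonneg _) (abs_nonneg _)))]
        have e1 : (∫ w in (u t)..(u τ), s (w, v τ)) - (u τ - u t) * s (u t, v t) =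
            ∫ w in (u t)..(u τ), (s (w, v τ) - s (u t, v t)) := by
          rw [intervalIntegral.integral_sub (primitive_intervalIntegrable hs _ _ _)
            intervalIntegrable_const, intervalIntegral.integral_const, smul_eq_mul]
        rw [e1, Real.norm_eq_abs (u τ - u t)]
        refine intervalIntegral.norm_integral_le_of_norm_le_const fun w hw => ?_
        refine (LipschitzWith.abs_sub_le_add hs _ _).trans ?_
        have : |w - u t| ≤ |u τ - u t| := abs_sub_left_of_mem_uIcc (uIoc_subset_uIcc hw)
        gcongr
      refine (hq.add hlin).congr_left fun τ => ?_
      simp only [smul_eq_mul]; ring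
    -- The remaining part is differentiable because it is a difference of differentiable functions.
    -- Its derivative is not computed, only bounded through difference quotients.
    have hB : HasDerivAt (fun τ => primitive s (u t) (v τ))
        (deriv p t - s (u t, v t) * u' t) t := by
      refine (h3.hasDerivAt.sub hA).congr_of_eventuallyEq (Filter.Eventually.of_forall fun τ => ?_)
      simp [hp]
    have hC : |deriv p t - s (u t, v t) * u' t| ≤ L * |u t| * |v' t| := by
      have t1 := hB.tendsto_slope.abs
      have t2 := (h2.tendsto_slope.abs).const_mul (L * |u t|)
      refine le_of_tendsto_of_tendsto' t1 t2 fun τ => ?_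
      rw [slope_def_field, slope_def_field, abs_div, abs_div, ← mul_div_assoc]
      refine div_le_div_of_nonneg_right ?_ (abs_nonneg _)
      refine (abs_primitive_sub_right_le hs _ _ _).trans (le_of_eq (by ring))
    have := (abs_le.1 hC).1
    linarith

end Primitive

namespace PolyMesh

variable {M : PolyMesh} {Ω : Set Plane} {h a b : ℝ} {ctr : Polygon2 → Plane}

open Shaped

/-! ### Mesh-level estimates -/

/-- The mass form on the bulk space. -/
def mB (M : PolyMesh) (ctr : Polygon2 → Plane) (v w : Plane → ℝ) : ℝ :=
  ∑ E ∈ M.elems, E.massB (ctr E) (E.vals v) (E.vals w)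

/-- The stiffness form on the bulk space. -/
def aB (M : PolyMesh) (ctr : Polygon2 → Plane) (v w : Plane → ℝ) : ℝ :=
  ∑ E ∈ M.elems, E.stiffB (ctr E) (E.vals v) (E.vals w)

lemma MemBulkSpace.bdryLinear {v : Plane → ℝ} (hv : M.MemBulkSpace v) : M.BdryLinear v :=
  fun e he => (hv.1 e.1 (mem_bdryEdges.1 he).1).edgeLinear e.2

lemma MemSurfSpace.bdryLinear {v : Plane → ℝ} (hv : M.MemSurfSpace v) : M.BdryLinear v := hv.2

lemma sum_bdryEdges_le {f : (Σ E : Polygon2, Fin E.n) → ℝ} (hf : ∀ e, 0 ≤ f e) :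
    ∑ e ∈ M.bdryEdges, f e ≤ ∑ E ∈ M.elems, ∑ i, f ⟨E, i⟩ := by
  rw [Finset.sum_sigma' M.elems (fun _ => Finset.univ) fun E i => f ⟨E, i⟩]
  refine Finset.sum_le_sum_of_subset_of_nonneg (fun e he => ?_) fun e _ _ => hf e
  exact Finset.mem_sigma.2 ⟨(mem_bdryEdges.1 he).1, Finset.mem_univ _⟩

/-- The estimates for the discrete spaces and forms that enter the stability analysis. -/
structure Estimates (M : PolyMesh) (ctr : Polygon2 → Plane) (q : ℝ → ℝ) (K : ℝ) : Prop where
  mass_nonneg : ∀ v, 0 ≤ M.mB ctr v v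
  stiff_nonneg : ∀ v, 0 ≤ M.aB ctr v v
  l2_le : ∀ v, M.MemBulkSpace v → l2Sq M.bulk v ≤ ENNReal.ofReal (K * M.mB ctr v v)
  le_l2 : ∀ v, M.MemBulkSpace v →
    ENNReal.ofReal (M.mB ctr v v) ≤ ENNReal.ofReal K * l2Sq M.bulk v
  h1_le : ∀ v, M.MemBulkSpace v →
    h1SemiSq (interior M.bulk) v ≤ ENNReal.ofReal (K * M.aB ctr v v)
  le_h1 : ∀ v, M.MemBulkSpace v →
    ENNReal.ofReal (M.aB ctr v v) ≤ ENNReal.ofReal K * h1SemiSq (interior M.bulk) v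
  trace : ∀ v, M.MemBulkSpace v → ∀ δ, 0 < δ →
    M.edgeMass v v ≤ K * (δ * M.aB ctr v v + (δ⁻¹ + 1) * M.mB ctr v v)
  sum_len : ∑ e ∈ M.bdryEdges, len e ≤ K
  len_le : ∀ e ∈ M.bdryEdges, len e ≤ K
  load : ∀ (v φ : Plane → ℝ) (W : Polygon2 → Plane → ℝ), M.MemBulkSpace v → M.MemBulkSpace φ →
    (∀ E ∈ M.elems, E.IsInterpolant (fun x => q (E.l2Proj v x)) (W E)) → ∀ η, 0 < η →
      M.massForm (fun E => E.l2Proj (W E)) (fun _ => φ) ≤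
        η * M.mB ctr φ φ + (4 * η)⁻¹ * (K * (1 + M.mB ctr v v))
  incr : ∀ v, M.MemBulkSpace v →
    ∑ e ∈ M.bdryEdges, (valQ v e - valP v e) ^ 2 ≤ K * M.aB ctr v v
  inverse : ∀ v, M.MemBulkSpace v →
    ∑ e ∈ M.bdryEdges, len e ^ 2 * (valQ v e - valP v e) ^ 2 ≤ K * M.mB ctr v v

lemma Shaped.massForm_eq (hM : M.Shaped a b ctr) {v w : Plane → ℝ} (hv : M.MemBulkSpace v)
    (hw : M.MemBulkSpace w) : M.massForm (fun _ => v) (fun _ => w) = M.mB ctr v w :=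
  Finset.sum_congr rfl fun E hE => (hv.1 E hE).massForm_eq (hw.1 E hE) (hM.star hE)

lemma Shaped.stiffForm_eq (hM : M.Shaped a b ctr) {v w : Plane → ℝ} (hv : M.MemBulkSpace v)
    (hw : M.MemBulkSpace w) : M.stiffForm (fun _ => v) (fun _ => w) = M.aB ctr v w :=
  Finset.sum_congr rfl fun E hE => (hv.1 E hE).stiffForm_eq (hw.1 E hE) (hM.star hE)

lemma integral_affine_mul_le (E : Polygon2) (p p' : Plane →ᵃ[ℝ] ℝ) {η : ℝ} (hη : 0 < η) :
    ∫ x in E.carrier, p x * p' x ≤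
      η * (∫ x in E.carrier, p' x ^ 2) + (4 * η)⁻¹ * ∫ x in E.carrier, p x ^ 2 := by
  have hp := (contDiff_affine p).continuous
  have hp' := (contDiff_affine p').continuous
  have hi : ∀ f : Plane → ℝ, Continuous f → IntegrableOn f E.carrier := fun f hf =>
    hf.continuousOn.integrableOn_compact E.isCompact_carrier
  rw [← integral_const_mul, ← integral_const_mul,
    ← integral_add (hi _ (by fun_prop)) (hi _ (by fun_prop))]
  refine integral_mono (hi _ (by fun_prop)) (hi _ (by fun_prop)) fun x => ?_
  have h1 : 0 ≤ (4 * η)⁻¹ * (p x - 2 * η * p' x) ^ 2 := by positivity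
  have h2 : (4 * η)⁻¹ * (p x - 2 * η * p' x) ^ 2 =
      η * p' x ^ 2 + (4 * η)⁻¹ * p x ^ 2 - p x * p' x := by field_simp; ring
  simp only
  linarith

/-- Everything the time-dependent argument needs to know about the mesh, with one constant. The
meshsize threshold comes from the transversal cut-offs alone, so it is fixed before `q` is given. -/
theorem _root_.IsC3Domain.exists_estimates (hΩ : IsC3Domain Ω) {γ₁ γ₂ : ℝ} (hγ₁ : 0 < γ₁)
    (hγ₂ : 0 < γ₂) : ∃ h₀ : ℝ, 0 < h₀ ∧ ∀ (q : ℝ → ℝ), (∃ L, LipschitzWith L q) →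
      ∃ K : ℝ, 1 ≤ K ∧ ∀ (M : PolyMesh) (h : ℝ), h ≤ h₀ → M.IsBSMesh Ω h γ₁ γ₂ →
        ∃ ctr, M.Shaped γ₁ γ₂ ctr ∧ M.Estimates ctr q K := by
  obtain ⟨h₀, G, s, χ, ν, hh₀, hG, hχ, htr⟩ := hΩ.exists_transversal hγ₁
  obtain ⟨K₁, hK₁, hmass⟩ := Polygon2.exists_massB_equiv hγ₁ hγ₂
  obtain ⟨K₂, hK₂, hstiff⟩ := Polygon2.exists_stiffB_equiv hγ₁ hγ₂
  obtain ⟨K₃, hK₃, hinc⟩ := Polygon2.exists_increment_bound hγ₁ hγ₂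
  obtain ⟨K₄, hK₄, hlow⟩ := Polygon2.exists_l2_lower hγ₁ hγ₂
  refine ⟨h₀, hh₀, fun q ⟨L, hq⟩ => ?_⟩
  obtain ⟨K₅, hK₅, hload⟩ := Polygon2.exists_load_bound hγ₁ hq
  set A := (volume (Metric.cthickening h₀ Ω)).toReal with hA
  have hA0 : 0 ≤ A := ENNReal.toReal_nonneg
  set S : ℝ := (s.card : ℝ) with hS
  have hS0 : 0 ≤ S := Nat.cast_nonneg _
  -- A sum of nonnegative terms, one for each estimate below, so that `K` dominates each of them.
  set K := 1 + K₁ + K₂ + 2 * S * K₂ + 2 * S * K₁ * (1 + G) + 2 * S * ((1 + G) * A) + h₀ +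
    K₅ * (A + 1) + 8 / (γ₁ * γ₂) * K₃ * K₂ + 16 * K₄ * K₁ with hK
  have e1 : 0 ≤ 2 * S * K₂ := by positivity
  have e2 : 0 ≤ 2 * S * K₁ * (1 + G) := by positivity
  have e3 : 0 ≤ 2 * S * ((1 + G) * A) := by positivity
  have e4 : 0 ≤ K₅ * (A + 1) := by positivity
  have e5 : 0 ≤ 8 / (γ₁ * γ₂) * K₃ * K₂ := by positivity
  have e6 : 0 ≤ 16 * K₄ * K₁ := by positivity
  refine ⟨K, by linarith, fun M h hh hB => ?_⟩
  obtain ⟨ctr, hM⟩ := hB.exists_shaped hγ₁ hγ₂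
  have hT : M.Transversal ctr G s χ ν := ⟨fun k hk => (hχ k hk).1, fun k hk => (hχ k hk).2.1,
    fun k hk => (hχ k hk).2.2.1, fun k hk => (hχ k hk).2.2.2.1, fun k hk => (hχ k hk).2.2.2.2,
    fun e he x hx => (htr M h γ₂ hh hB e he _ (hM.reg e.1 (mem_bdryEdges.1 he).1) x hx).1,
    fun e he x hx => (htr M h γ₂ hh hB e he _ (hM.reg e.1 (mem_bdryEdges.1 he).1) x hx).2⟩
  have hve : ∀ v, M.MemBulkSpace v → ∀ E ∈ M.elems,
      E.LocalVE (ctr E) v (weakGrad (interior E.carrier) v) := fun v hv E hE =>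
    (hv.1 E hE).localVE (hM.star hE)
  have hmn : ∀ E ∈ M.elems, ∀ β, 0 ≤ E.massB (ctr E) β β := fun E hE β =>
    Polygon2.massB_self_nonneg (hM.reg E hE) β
  have han : ∀ E ∈ M.elems, ∀ β, 0 ≤ E.stiffB (ctr E) β β := fun E hE β =>
    Polygon2.stiffB_self_nonneg (hM.reg E hE) β
  have hm0 : ∀ v, 0 ≤ M.mB ctr v v := fun v => Finset.sum_nonneg fun E hE => hmn E hE _
  have ha0 : ∀ v, 0 ≤ M.aB ctr v v := fun v => Finset.sum_nonneg fun E hE => han E hE _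
  have hl2 : ∀ v, M.MemBulkSpace v → ∑ E ∈ M.elems, ∫ x in E.carrier, v x ^ 2 ≤
      K₁ * M.mB ctr v v := fun v hv => by
    rw [mB, Finset.mul_sum]
    exact Finset.sum_le_sum fun E hE =>
      (hmass E _ _ (hM.reg E hE) v _ (hve v hv E hE)).1
  have hl2' : ∀ v, M.MemBulkSpace v → M.mB ctr v v ≤
      K₁ * ∑ E ∈ M.elems, ∫ x in E.carrier, v x ^ 2 := fun v hv => by
    rw [mB, Finset.mul_sum]
    exact Finset.sum_le_sum fun E hE =>
      (hmass E _ _ (hM.reg E hE) v _ (hve v hv E hE)).2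
  have hh1 : ∀ v, M.MemBulkSpace v → ∑ E ∈ M.elems, ∫ x in E.carrier,
      ‖weakGrad (interior E.carrier) v x‖ ^ 2 ≤ K₂ * M.aB ctr v v := fun v hv => by
    rw [aB, Finset.mul_sum]
    exact Finset.sum_le_sum fun E hE =>
      (hstiff E _ _ (hM.reg E hE) v _ (hve v hv E hE)).1
  have hh1' : ∀ v, M.MemBulkSpace v → M.aB ctr v v ≤ K₂ * ∑ E ∈ M.elems, ∫ x in E.carrier,
      ‖weakGrad (interior E.carrier) v x‖ ^ 2 := fun v hv => by
    rw [aB, Finset.mul_sum]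
    exact Finset.sum_le_sum fun E hE =>
      (hstiff E _ _ (hM.reg E hE) v _ (hve v hv E hE)).2
  have hX0 : ∀ v : Plane → ℝ, 0 ≤ ∑ E ∈ M.elems, ∫ x in E.carrier, v x ^ 2 := fun v =>
    Finset.sum_nonneg fun E _ => integral_nonneg fun x => sq_nonneg _
  have hY0 : ∀ v, 0 ≤ ∑ E ∈ M.elems, ∫ x in E.carrier,
      ‖weakGrad (interior E.carrier) v x‖ ^ 2 := fun v =>
    Finset.sum_nonneg fun E _ => integral_nonneg fun x => sq_nonneg _
  have harea := hM.sum_area_le hB hΩ.1 hh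
  have hK1 : K₁ ≤ K := by linarith
  have hK2 : K₂ ≤ K := by linarith
  refine ⟨ctr, hM, hm0, ha0, fun v hv => ?_, fun v hv => ?_, fun v hv => ?_, fun v hv => ?_,
    fun v hv δ hδ => ?_, ?_, fun e he => ?_, fun v φ W hv hφ hW η hη => ?_, fun v hv => ?_,
    fun v hv => ?_⟩
  · rw [hM.l2Sq_bulk_eq hv.2]
    exact ENNReal.ofReal_le_ofReal ((hl2 v hv).trans (mul_le_mul_of_nonneg_right hK1 (hm0 v)))
  · rw [hM.l2Sq_bulk_eq hv.2, ← ENNReal.ofReal_mul (by linarith)]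
    exact ENNReal.ofReal_le_ofReal ((hl2' v hv).trans (mul_le_mul_of_nonneg_right hK1 (hX0 v)))
  · rw [hM.h1SemiSq_eq hv.2 fun E hE => (hve v hv E hE).isH1]
    exact ENNReal.ofReal_le_ofReal ((hh1 v hv).trans (mul_le_mul_of_nonneg_right hK2 (ha0 v)))
  · rw [hM.h1SemiSq_eq hv.2 fun E hE => (hve v hv E hE).isH1, ← ENNReal.ofReal_mul (by linarith)]
    exact ENNReal.ofReal_le_ofReal ((hh1' v hv).trans (mul_le_mul_of_nonneg_right hK2 (hY0 v)))
  · rw [← hv.bdryLinear.bdrySq_eq]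
    have h1 := hM.bdrySq_le hT hv.2 (fun E hE => (hve v hv E hE).isH1) hδ
    have h2 : 2 * S * (δ * ∑ E ∈ M.elems, ∫ x in E.carrier,
        ‖weakGrad (interior E.carrier) v x‖ ^ 2) ≤ 2 * S * K₂ * (δ * M.aB ctr v v) := by
      have := mul_le_mul_of_nonneg_left (hh1 v hv) (by positivity : 0 ≤ 2 * S * δ)
      linarith
    have h3 : 2 * S * ((δ⁻¹ + G) * ∑ E ∈ M.elems, ∫ x in E.carrier, v x ^ 2) ≤
        2 * S * K₁ * (1 + G) * ((δ⁻¹ + 1) * M.mB ctr v v) := by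
      have hδi : 0 < δ⁻¹ := by positivity
      have h4 := mul_le_mul_of_nonneg_left (hl2 v hv) (by positivity : 0 ≤ 2 * S * (δ⁻¹ + G))
      have h5 : δ⁻¹ + G ≤ (1 + G) * (δ⁻¹ + 1) := by nlinarith
      have h6 := mul_le_mul_of_nonneg_left h5 (mul_nonneg (mul_nonneg
        (mul_nonneg zero_le_two hS0) hK₁.le) (hm0 v))
      linarith
    have h7 : 2 * S * K₂ * (δ * M.aB ctr v v) ≤ K * (δ * M.aB ctr v v) :=
      mul_le_mul_of_nonneg_right (by linarith) (mul_nonneg hδ.le (ha0 v))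
    have h8 : 2 * S * K₁ * (1 + G) * ((δ⁻¹ + 1) * M.mB ctr v v) ≤
        K * ((δ⁻¹ + 1) * M.mB ctr v v) :=
      mul_le_mul_of_nonneg_right (by linarith) (mul_nonneg (by positivity) (hm0 v))
    linarith
  · refine (hM.bdry_length_le hT).trans (le_trans ?_ (by linarith :
      2 * S * ((1 + G) * A) ≤ K))
    gcongr
  · have hE := (mem_bdryEdges.1 he).1
    have : len e ≤ e.1.diam := by
      rw [len, e.1.norm_tau]
      exact Metric.dist_le_diam_of_mem e.1.isCompact_carrier.isBounded
        (e.1.vertex_mem_carrier _) (e.1.vertex_mem_carrier _)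
    linarith [hB.diam_le e.1 hE]
  · have h1 : ∀ E ∈ M.elems, E.massForm (E.l2Proj (W E)) φ ≤
        η * E.massB (ctr E) (E.vals φ) (E.vals φ) +
          (4 * η)⁻¹ * (K₅ * (E.area + E.massB (ctr E) (E.vals v) (E.vals v))) := fun E hE => by
      have hr := hM.reg E hE
      rw [(hφ.1 E hE).massForm_affine (hM.star hE), (hW E hE).1.l2Proj_eq (hM.star hE)]
      refine (integral_affine_mul_le E _ _ hη).trans (add_le_add ?_ ?_)
      · exact mul_le_mul_of_nonneg_left (Polygon2.integral_proj_sq_le_massB hr _) hη.le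
      · refine mul_le_mul_of_nonneg_left ?_ (by positivity)
        refine (hload E _ _ hr (E.l2Proj v) _ fun i => (hW E hE).2 i).trans ?_
        refine mul_le_mul_of_nonneg_left (add_le_add le_rfl ?_) hK₅.le
        rw [(hv.1 E hE).l2Proj_eq (hM.star hE)]
        exact Polygon2.integral_proj_sq_le_massB hr _
    refine (Finset.sum_le_sum h1).trans ?_
    rw [Finset.sum_add_distrib, ← Finset.mul_sum, ← Finset.mul_sum, ← Finset.mul_sum,
      Finset.sum_add_distrib]
    refine add_le_add le_rfl (mul_le_mul_of_nonneg_left ?_ (by positivity))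
    have h2 : K₅ * (A + M.mB ctr v v) ≤ K₅ * (A + 1) * (1 + M.mB ctr v v) := by
      have := mul_nonneg (mul_nonneg hK₅.le hA0) (hm0 v)
      nlinarith
    have h3 : K₅ * (A + 1) * (1 + M.mB ctr v v) ≤ K * (1 + M.mB ctr v v) :=
      mul_le_mul_of_nonneg_right (by linarith) (by linarith [hm0 v])
    refine le_trans (mul_le_mul_of_nonneg_left (add_le_add harea le_rfl) hK₅.le) (h2.trans h3)
  · refine (sum_bdryEdges_le fun e => sq_nonneg _).trans ?_
    refine le_trans ?_ (mul_le_mul_of_nonneg_right (by linarith :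
      8 / (γ₁ * γ₂) * K₃ * K₂ ≤ K) (ha0 v))
    rw [mul_assoc]
    refine le_trans ?_ (mul_le_mul_of_nonneg_left (hh1 v hv) (by positivity))
    rw [Finset.mul_sum]
    refine Finset.sum_le_sum fun E hE => ?_
    have hr := hM.reg E hE
    have h1 := Finset.sum_le_card_nsmul Finset.univ _ _ fun i _ =>
      hinc E _ _ hr v _ (hve v hv E hE) i
    rw [Finset.card_univ, Fintype.card_fin, nsmul_eq_mul] at h1
    refine h1.trans ?_
    have h2 : (E.n : ℝ) ≤ 8 / (γ₁ * γ₂) := by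
      rw [le_div_iff₀ (by positivity)]; linarith [hr.card_le]
    rw [mul_assoc]
    exact mul_le_mul_of_nonneg_right h2 (mul_nonneg hK₃.le (integral_nonneg fun x => sq_nonneg _))
  · refine (sum_bdryEdges_le fun e => by positivity).trans ?_
    refine le_trans ?_ (mul_le_mul_of_nonneg_right (by linarith :
      16 * K₄ * K₁ ≤ K) (hm0 v))
    rw [mul_assoc]
    refine le_trans ?_ (mul_le_mul_of_nonneg_left (hl2 v hv) (by positivity))
    rw [Finset.mul_sum]
    refine Finset.sum_le_sum fun E hE => ?_
    have hr := hM.reg E hE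
    have h1 := hlow E _ _ hr v _ (hve v hv E hE)
    -- Inverse estimate: the edge length is at most the diameter, and the squared vertex values
    -- times the squared diameter are bounded by the `L²` norm.
    have h2 : ∑ i, len ⟨E, i⟩ ^ 2 * (valQ v ⟨E, i⟩ - valP v ⟨E, i⟩) ^ 2 ≤
        ∑ i, E.diam ^ 2 * (2 * E.vals v (finRotate E.n i) ^ 2 + 2 * E.vals v i ^ 2) := by
      refine Finset.sum_le_sum fun i _ => ?_
      have h3 : len ⟨E, i⟩ ≤ E.diam := by
        rw [len, E.norm_tau]
        exact Metric.dist_le_diam_of_mem E.isCompact_carrier.isBounded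
          (E.vertex_mem_carrier _) (E.vertex_mem_carrier _)
      have h4 := (len_pos ⟨E, i⟩).le
      refine mul_le_mul (by gcongr) ?_ (sq_nonneg _) (sq_nonneg _)
      change (E.vals v (finRotate E.n i) - E.vals v i) ^ 2 ≤ _
      nlinarith [sq_nonneg (E.vals v (finRotate E.n i) + E.vals v i)]
    rw [← Finset.mul_sum, Finset.sum_add_distrib, ← Finset.mul_sum, ← Finset.mul_sum,
      Equiv.sum_comp (finRotate E.n) fun i => E.vals v i ^ 2] at h2
    have h5 : 0 ≤ K₄ * ∫ x in E.carrier, v x ^ 2 :=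
      mul_nonneg hK₄.le (integral_nonneg fun x => sq_nonneg _)
    nlinarith

end PolyMesh

/-! ### Time derivatives of the discrete forms -/

lemma HasAEDeriv.congr {T : ℝ} {f f' g g' : ℝ → ℝ} (h : HasAEDeriv T f f')
    (e : ∀ t, f t = g t) (e' : ∀ t, f' t = g' t) : HasAEDeriv T g g' := by
  rwa [← funext e, ← funext e']

namespace Polygon2

lemma massB_comm (E : Polygon2) (c : Plane) (β β' : Fin E.n → ℝ) :
    E.massB c β β' = E.massB c β' β := by
  simp only [massB, mul_comm]

lemma stiffB_comm (E : Polygon2) (c : Plane) (β β' : Fin E.n → ℝ) :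
    E.stiffB c β β' = E.stiffB c β' β := by
  simp only [stiffB, real_inner_comm, mul_comm]

lemma dev_add (E : Polygon2) (c : Plane) (β β' : Fin E.n → ℝ) (i : Fin E.n) :
    E.dev c (β + β') i = E.dev c β i + E.dev c β' i := by
  simp only [dev, map_add, Pi.add_apply, AffineMap.coe_add]; ring

lemma dev_smul (E : Polygon2) (c : Plane) (k : ℝ) (β : Fin E.n → ℝ) (i : Fin E.n) :
    E.dev c (k • β) i = k * E.dev c β i := by
  simp only [dev, map_smul, Pi.smul_apply, AffineMap.coe_smul, smul_eq_mul]; ring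

lemma massB_add_left (E : Polygon2) (c : Plane) (β₁ β₂ β : Fin E.n → ℝ) :
    E.massB c (β₁ + β₂) β = E.massB c β₁ β + E.massB c β₂ β := by
  have hi : ∀ p p' : Plane →ᵃ[ℝ] ℝ, IntegrableOn (fun x => p x * p' x) E.carrier := fun p p' =>
    ((contDiff_affine p).continuous.mul
      (contDiff_affine p').continuous).continuousOn.integrableOn_compact E.isCompact_carrier
  simp only [massB, dev_add, map_add, AffineMap.coe_add, Pi.add_apply, add_mul,
    Finset.sum_add_distrib]
  rw [integral_add (hi _ _) (hi _ _)]
  ring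

lemma massB_smul_left (E : Polygon2) (c : Plane) (k : ℝ) (β₁ β : Fin E.n → ℝ) :
    E.massB c (k • β₁) β = k * E.massB c β₁ β := by
  simp only [massB, dev_smul, map_smul, AffineMap.coe_smul, Pi.smul_apply, smul_eq_mul, mul_assoc,
    ← Finset.mul_sum, integral_const_mul]
  ring

lemma stiffB_add_left (E : Polygon2) (c : Plane) (β₁ β₂ β : Fin E.n → ℝ) :
    E.stiffB c (β₁ + β₂) β = E.stiffB c β₁ β + E.stiffB c β₂ β := by
  simp only [stiffB, dev_add, map_add, inner_add_left, add_mul, Finset.sum_add_distrib]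
  ring

lemma stiffB_smul_left (E : Polygon2) (c : Plane) (k : ℝ) (β₁ β : Fin E.n → ℝ) :
    E.stiffB c (k • β₁) β = k * E.stiffB c β₁ β := by
  simp only [stiffB, dev_smul, map_smul, real_inner_smul_left, mul_assoc, ← Finset.mul_sum]
  ring

end Polygon2

lemma HasAEDeriv.symm_bilin {T : ℝ} {n : ℕ} {B : (Fin n → ℝ) → (Fin n → ℝ) → ℝ}
    (hadd : ∀ x y z, B (x + y) z = B x z + B y z) (hsmul : ∀ (k : ℝ) x y, B (k • x) y = k * B x y)
    (hcomm : ∀ x y, B x y = B y x) {x x' : ℝ → Fin n → ℝ}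
    (hx : ∀ i, HasAEDeriv T (fun t => x t i) (fun t => x' t i)) :
    HasAEDeriv T (fun t => B (x t) (x t)) (fun t => 2 * B (x' t) (x t)) := by
  have h := HasAEDeriv.bilin (LinearMap.mk₂ ℝ B hadd (fun k x y => hsmul k x y)
    (fun x y z => by rw [hcomm, hadd, hcomm y, hcomm z])
    (fun k x y => by rw [hcomm, hsmul, hcomm y]; rfl)) hx hx
  refine h.congr (fun t => rfl) fun t => ?_
  simp only [LinearMap.mk₂_apply]
  rw [hcomm (x t) (x' t)]; ring

namespace PolyMesh

variable {M : PolyMesh} {ctr : Polygon2 → Plane} {T : ℝ} {U dU : ℝ → Plane → ℝ}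

lemma hasAEDeriv_mB (h : ∀ E ∈ M.elems, ∀ i, HasAEDeriv T (fun t => U t (E.vertex i))
    (fun t => dU t (E.vertex i))) :
    HasAEDeriv T (fun t => M.mB ctr (U t) (U t)) (fun t => 2 * M.mB ctr (dU t) (U t)) := by
  refine (HasAEDeriv.sum M.elems fun E hE => HasAEDeriv.symm_bilin (E.massB_add_left (ctr E))
    (E.massB_smul_left (ctr E)) (E.massB_comm (ctr E)) (x := fun t => E.vals (U t))
    (x' := fun t => E.vals (dU t)) (h E hE)).congr (fun t => rfl) fun t => ?_
  rw [mB, Finset.mul_sum]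

lemma hasAEDeriv_aB (h : ∀ E ∈ M.elems, ∀ i, HasAEDeriv T (fun t => U t (E.vertex i))
    (fun t => dU t (E.vertex i))) :
    HasAEDeriv T (fun t => M.aB ctr (U t) (U t)) (fun t => 2 * M.aB ctr (dU t) (U t)) := by
  refine (HasAEDeriv.sum M.elems fun E hE => HasAEDeriv.symm_bilin (E.stiffB_add_left (ctr E))
    (E.stiffB_smul_left (ctr E)) (E.stiffB_comm (ctr E)) (x := fun t => E.vals (U t))
    (x' := fun t => E.vals (dU t)) (h E hE)).congr (fun t => rfl) fun t => ?_
  rw [aB, Finset.mul_sum]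

lemma aB_comm (M : PolyMesh) (ctr : Polygon2 → Plane) (v w : Plane → ℝ) :
    M.aB ctr v w = M.aB ctr w v := Finset.sum_congr rfl fun E _ => E.stiffB_comm _ _ _

lemma edgeStiff_comm (M : PolyMesh) (v w : Plane → ℝ) : M.edgeStiff v w = M.edgeStiff w v :=
  Finset.sum_congr rfl fun e _ => by rw [mul_comm]

lemma hasAEDeriv_edgeMass
    (hP : ∀ e ∈ M.bdryEdges, HasAEDeriv T (fun t => valP (U t) e) (fun t => valP (dU t) e))
    (hQ : ∀ e ∈ M.bdryEdges, HasAEDeriv T (fun t => valQ (U t) e) (fun t => valQ (dU t) e)) :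
    HasAEDeriv T (fun t => M.edgeMass (U t) (U t)) (fun t => 2 * M.edgeMass (dU t) (U t)) := by
  refine (HasAEDeriv.sum M.bdryEdges fun e he => (((((hP e he).mul (hP e he)).const_mul 2).add
    (((hQ e he).mul (hQ e he)).const_mul 2)).add (((hP e he).mul (hQ e he)).const_mul 2)).const_mul
    (len e / 6)).congr (fun t => ?_) fun t => ?_
  · exact Finset.sum_congr rfl fun e _ => by ring
  · rw [edgeMass, Finset.mul_sum]
    exact Finset.sum_congr rfl fun e _ => by ring

lemma hasAEDeriv_edgeStiff
    (hP : ∀ e ∈ M.bdryEdges, HasAEDeriv T (fun t => valP (U t) e) (fun t => valP (dU t) e))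
    (hQ : ∀ e ∈ M.bdryEdges, HasAEDeriv T (fun t => valQ (U t) e) (fun t => valQ (dU t) e)) :
    HasAEDeriv T (fun t => M.edgeStiff (U t) (U t)) (fun t => 2 * M.edgeStiff (dU t) (U t)) := by
  refine (HasAEDeriv.sum M.bdryEdges fun e he =>
    (((hQ e he).add ((hP e he).const_mul (-1))).mul
      ((hQ e he).add ((hP e he).const_mul (-1)))).const_mul
    (len e)⁻¹).congr (fun t => ?_) fun t => ?_
  · exact Finset.sum_congr rfl fun e _ => by ring
  · rw [edgeStiff, Finset.mul_sum]
    exact Finset.sum_congr rfl fun e _ => by ring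

/-! ### Estimates for the boundary terms -/

lemma neg_edgeMass_le_young (M : PolyMesh) (v w : Plane → ℝ) {δ : ℝ} (hδ : 0 < δ) :
    -M.edgeMass v w ≤ δ * M.edgeMass w w + (4 * δ)⁻¹ * M.edgeMass v v := by
  have h := M.edgeMass_le_young (fun x => -v x) w hδ
  have e1 : M.edgeMass (fun x => -v x) w = -M.edgeMass v w := by
    rw [edgeMass, edgeMass, ← Finset.sum_neg_distrib]
    exact Finset.sum_congr rfl fun e _ => by simp only [valP, valQ]; ring
  have e2 : M.edgeMass (fun x => -v x) (fun x => -v x) = M.edgeMass v v :=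
    Finset.sum_congr rfl fun e _ => by simp only [valP, valQ]; ring
  rwa [e1, e2] at h

/-- `S` has the vertex values of `s(u, v)` on the boundary edges. -/
def IsNodal (M : PolyMesh) (s : ℝ × ℝ → ℝ) (u v S : Plane → ℝ) : Prop :=
  ∀ e ∈ M.bdryEdges, valP S e = s (valP u e, valP v e) ∧ valQ S e = s (valQ u e, valQ v e)

lemma IsSurfInterpolant.isNodal {s : ℝ × ℝ → ℝ} {u v S : Plane → ℝ}
    (h : M.IsSurfInterpolant (fun x => s (u x, v x)) S) : M.IsNodal s u v S := fun e he => by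
  obtain ⟨hE, hsub⟩ := Shaped.mem_bdryEdges.1 he
  exact ⟨h.2 e.1 hE e.2 (hsub (e.1.vertex_mem_edge e.2)),
    h.2 e.1 hE (finRotate e.1.n e.2) (hsub (e.1.nextVertex_mem_edge e.2))⟩

variable {s : ℝ × ℝ → ℝ} {L : NNReal} {u v S du dv : Plane → ℝ} {K : ℝ} {q : ℝ → ℝ}

lemma sq_le_of_lipschitz (hs : LipschitzWith L s) (x y : ℝ) :
    s (x, y) ^ 2 ≤ 3 * s 0 ^ 2 + 3 * L ^ 2 * (x ^ 2 + y ^ 2) := by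
  have h1 := LipschitzWith.abs_le_add hs x y
  have h2 := pow_le_pow_left₀ (abs_nonneg _) h1 2
  rw [sq_abs] at h2
  have h3 := sq_abs (s 0)
  have h4 := sq_abs x
  have h5 := sq_abs y
  nlinarith [sq_nonneg (|s 0| - L * |x|), sq_nonneg (|s 0| - L * |y|),
    sq_nonneg (L * |x| - L * |y|)]

/-- In the lumped form the linear growth of `s` applies vertex by vertex. Returning to the
consistent form costs the factor 3 of `edgeLump_le`. -/
lemma IsNodal.edgeMass_le (hS : M.IsNodal s u v S) (hs : LipschitzWith L s)
    (hK : ∑ e ∈ M.bdryEdges, len e ≤ K) : M.edgeMass S S ≤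
      (3 * s 0 ^ 2 * K + 9 * L ^ 2) * (1 + M.edgeMass u u + M.edgeMass v v) := by
  have h1 : M.edgeLump S S ≤ 3 * s 0 ^ 2 * (∑ e ∈ M.bdryEdges, len e) +
      3 * L ^ 2 * (M.edgeLump u u + M.edgeLump v v) := by
    rw [edgeLump, edgeLump, edgeLump, ← Finset.sum_add_distrib, Finset.mul_sum, Finset.mul_sum,
      ← Finset.sum_add_distrib]
    refine Finset.sum_le_sum fun e he => ?_
    rw [(hS e he).1, (hS e he).2]
    have h2 := mul_le_mul_of_nonneg_left (add_le_add (sq_le_of_lipschitz hs (valP u e) (valP v e))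
      (sq_le_of_lipschitz hs (valQ u e) (valQ v e))) (half_pos (len_pos e)).le
    linarith
  have h2 := M.edgeMass_le_edgeLump S
  have h3 := mul_le_mul_of_nonneg_left (add_le_add (M.edgeLump_le u) (M.edgeLump_le v))
    (by positivity : 0 ≤ 3 * (L : ℝ) ^ 2)
  have h4 := mul_le_mul_of_nonneg_left hK (by positivity : 0 ≤ 3 * s 0 ^ 2)
  have h0 : 0 ≤ ∑ e ∈ M.bdryEdges, len e := Finset.sum_nonneg fun e _ => (len_pos e).le
  have h5 := mul_nonneg (mul_nonneg (by positivity : 0 ≤ 3 * s 0 ^ 2) (h0.trans hK))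
    (add_nonneg (M.edgeMass_self_nonneg u) (M.edgeMass_self_nonneg v))
  have h6 : 0 ≤ 9 * (L : ℝ) ^ 2 := by positivity
  linarith

/-- The difference between the consistent and the lumped boundary load. -/
lemma IsNodal.edgeMass_le_edgeLump (hE : M.Estimates ctr q K) (hK : 1 ≤ K)
    (hS : M.IsNodal s u v S) (hs : LipschitzWith L s) (hu : M.MemBulkSpace u)
    (hdu : M.MemBulkSpace du) : M.edgeMass S du ≤ M.edgeLump S du + 1 / 4 * M.mB ctr du du +
      L ^ 2 * K ^ 2 / 18 * (M.aB ctr u u + M.edgeStiff v v) := by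
  have hL : (0 : ℝ) ≤ L := L.2
  -- Edges have length at most `K`, so increments of `v` are controlled by the boundary stiffness
  -- form.
  have hσ : ∑ e ∈ M.bdryEdges, (valQ v e - valP v e) ^ 2 ≤ K * M.edgeStiff v v := by
    rw [edgeStiff, Finset.mul_sum]
    refine Finset.sum_le_sum fun e he => ?_
    have hl := len_pos e
    rw [← mul_div_assoc, le_div_iff₀ hl, ← sq, mul_comm]
    exact mul_le_mul_of_nonneg_right (hE.len_le e he) (sq_nonneg _)
  -- The lumping defect. Increments of `S` are bounded by those of `u` and `v`. The increment of
  -- `du` keeps the factor `len e`, which is what the inverse estimate requires; the weight `1 / (4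
  -- * K)` makes its cost a quarter of the mass of `du`.
  have h1 : -∑ e ∈ M.bdryEdges, len e / 6 * ((valQ S e - valP S e) * (valQ du e - valP du e)) ≤
      1 / (4 * K) * (∑ e ∈ M.bdryEdges, len e ^ 2 * (valQ du e - valP du e) ^ 2) +
      L ^ 2 * K / 18 * (∑ e ∈ M.bdryEdges, (valQ u e - valP u e) ^ 2 +
        ∑ e ∈ M.bdryEdges, (valQ v e - valP v e) ^ 2) := by
    rw [← Finset.sum_neg_distrib, ← Finset.sum_add_distrib, Finset.mul_sum, Finset.mul_sum,
      ← Finset.sum_add_distrib]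
    refine Finset.sum_le_sum fun e he => ?_
    have hl := len_pos e
    set X := |valQ u e - valP u e|
    set Y := |valQ v e - valP v e|
    set Z := len e * |valQ du e - valP du e| with hZ
    have h2 : |valQ S e - valP S e| ≤ L * (X + Y) := by
      rw [(hS e he).1, (hS e he).2]
      exact LipschitzWith.abs_sub_le_add hs _ _
    have h3 : -(len e / 6 * ((valQ S e - valP S e) * (valQ du e - valP du e))) ≤
        1 / 6 * (L * (X + Y)) * Z := by
      have h4 := neg_abs_le ((valQ S e - valP S e) * (valQ du e - valP du e))
      rw [abs_mul] at h4
      have h5 := mul_le_mul_of_nonneg_right h2 (abs_nonneg (valQ du e - valP du e))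
      have h6 := mul_le_mul_of_nonneg_left (h4.trans' (neg_le_neg h5)) hl.le
      rw [hZ]; linarith
    have h4 : len e ^ 2 * (valQ du e - valP du e) ^ 2 = Z ^ 2 := by
      rw [hZ, mul_pow, sq_abs]
    rw [h4, ← sq_abs (valQ u e - valP u e), ← sq_abs (valQ v e - valP v e)]
    refine h3.trans ?_
    have hKp : 0 < K := by linarith
    have h5 : 0 ≤ 1 / (8 * K) * ((Z - 2 / 3 * K * L * X) ^ 2 + (Z - 2 / 3 * K * L * Y) ^ 2) := by
      positivity
    have h6 : 1 / (8 * K) * ((Z - 2 / 3 * K * L * X) ^ 2 + (Z - 2 / 3 * K * L * Y) ^ 2) =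
        1 / (4 * K) * Z ^ 2 + L ^ 2 * K / 18 * (X ^ 2 + Y ^ 2) - 1 / 6 * (L * (X + Y)) * Z := by
      field_simp; ring
    linarith
  have h2 := mul_le_mul_of_nonneg_left (hE.inverse du hdu) (by positivity : 0 ≤ 1 / (4 * K))
  have e2 : 1 / (4 * K) * (K * M.mB ctr du du) = 1 / 4 * M.mB ctr du du := by
    have : K ≠ 0 := by positivity
    field_simp
  have h3 := mul_le_mul_of_nonneg_left (add_le_add (hE.incr u hu) hσ)
    (by positivity : 0 ≤ (L : ℝ) ^ 2 * K / 18)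
  rw [M.edgeMass_eq]
  linarith

end PolyMesh

namespace PolyMesh

variable {M : PolyMesh} {ctr : Polygon2 → Plane} {a b d_u d_v K : ℝ} {q : ℝ → ℝ}
  {r s : ℝ × ℝ → ℝ} {u v du dv : Plane → ℝ}

/-! ### Energy estimates at a fixed time -/

/-- The semi-discrete equations at a fixed time. -/
def IsInstant (M : PolyMesh) (d_u d_v : ℝ) (q : ℝ → ℝ) (r s : ℝ × ℝ → ℝ)
    (u v du dv : Plane → ℝ) : Prop :=
  ∃ (W : Polygon2 → Plane → ℝ) (S R : Plane → ℝ),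
    (∀ E ∈ M.elems, E.IsInterpolant (fun x => q (E.l2Proj u x)) (W E)) ∧
    M.IsSurfInterpolant (fun x => s (u x, v x)) S ∧
    M.IsSurfInterpolant (fun x => r (u x, v x)) R ∧
    (∀ φ : Plane → ℝ, M.MemBulkSpace φ →
      M.massForm (fun _ => du) (fun _ => φ) + d_u * M.stiffForm (fun _ => u) (fun _ => φ) =
        M.massForm (fun E => E.l2Proj (W E)) (fun _ => φ) + M.surfInt (fun x => S x * φ x)) ∧
    (∀ ψ : Plane → ℝ, M.MemSurfSpace ψ →
      M.surfInt (fun x => dv x * ψ x) + d_v * M.surfStiff v ψ +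
        M.surfInt (fun x => S x * ψ x) = M.surfInt (fun x => R x * ψ x))

/-- The equations at one time, rewritten in vertex forms, with the bulk load already estimated; the
Young parameter is left free for the two uses below. -/
lemma IsInstant.exists_test (h : M.IsInstant d_u d_v q r s u v du dv) (hM : M.Shaped a b ctr)
    (hE : M.Estimates ctr q K) (hu : M.MemBulkSpace u) (hdu : M.MemBulkSpace du)
    (hv : M.MemSurfSpace v) (hdv : M.MemSurfSpace dv) :
    ∃ S R : Plane → ℝ, M.IsNodal s u v S ∧ M.IsNodal r u v R ∧
      (∀ φ, M.MemBulkSpace φ → ∀ η, 0 < η → M.mB ctr du φ + d_u * M.aB ctr u φ ≤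
        η * M.mB ctr φ φ + (4 * η)⁻¹ * (K * (1 + M.mB ctr u u)) + M.edgeMass S φ) ∧
      ∀ ψ, M.MemSurfSpace ψ → M.edgeMass dv ψ + d_v * M.edgeStiff v ψ + M.edgeMass S ψ =
        M.edgeMass R ψ := by
  obtain ⟨W, S, R, hW, hS, hR, h1, h2⟩ := h
  refine ⟨S, R, hS.isNodal, hR.isNodal, fun φ hφ η hη => ?_, fun ψ hψ => ?_⟩
  · have h3 := h1 φ hφ
    rw [hM.massForm_eq hdu hφ, hM.stiffForm_eq hu hφ, hS.1.bdryLinear.surfInt_mul hφ.bdryLinear]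
      at h3
    linarith [hE.load u φ W hu hφ hW η hη]
  · have h3 := h2 ψ hψ
    rwa [hdv.bdryLinear.surfInt_mul hψ.bdryLinear, hv.bdryLinear.surfStiff_eq hψ.bdryLinear,
      hS.1.bdryLinear.surfInt_mul hψ.bdryLinear, hR.1.bdryLinear.surfInt_mul hψ.bdryLinear] at h3

/-- Test with `u` and `v`. All loads are bounded by masses and by the boundary mass of `u`, and the
latter is absorbed into half of the diffusion by the trace inequality. -/
lemma exists_energy_l2 (hdu : 0 < d_u) (hK : 1 ≤ K) {Lr Ls : NNReal} (hr : LipschitzWith Lr r)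
    (hs : LipschitzWith Ls s) : ∃ K₁ : ℝ, 0 ≤ K₁ ∧
    ∀ (M : PolyMesh) (ctr : Polygon2 → Plane) (a b d_v : ℝ) (q : ℝ → ℝ) (u v du dv : Plane → ℝ),
      0 < d_v → M.Shaped a b ctr → M.Estimates ctr q K → M.MemBulkSpace u → M.MemBulkSpace du →
      M.MemSurfSpace v → M.MemSurfSpace dv → M.IsInstant d_u d_v q r s u v du dv →
      M.mB ctr du u + M.edgeMass dv v + 1 / 2 * (d_u * M.aB ctr u u + d_v * M.edgeStiff v v) ≤
        K₁ * (1 + 1 / 2 * (M.mB ctr u u + M.edgeMass v v)) := by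
  set Cs := 3 * s 0 ^ 2 * K + 9 * (Ls : ℝ) ^ 2 with hCs
  set Cr := 3 * r 0 ^ 2 * K + 9 * (Lr : ℝ) ^ 2 with hCr
  have hCs0 : 0 ≤ Cs := by positivity
  have hCr0 : 0 ≤ Cr := by positivity
  set N := 2 + K + Cs + Cr with hN
  have hN0 : 0 < N := by positivity
  -- Chosen so that `N * K * δ = d_u / 2`, where `N` bounds the coefficient of the boundary mass of
  -- `u`.
  set δ := d_u / (2 * N * K) with hδ
  have hδ0 : 0 < δ := by positivity
  refine ⟨2 * N * (1 + K * (δ⁻¹ + 1)), by positivity,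
    fun M ctr a b d_v q u v du dv hdv hM hE hu hdu' hv hdv' h => ?_⟩
  obtain ⟨S, R, hS, hR, h1, h2⟩ := h.exists_test hM hE hu hdu' hv hdv'
  have t1 := h1 u hu 1 one_pos
  have t2 := h2 v hv
  have y1 := M.edgeMass_le_young S u one_pos
  have y2 := M.neg_edgeMass_le_young S v one_pos
  have y3 := M.edgeMass_le_young R v one_pos
  have s1 := hS.edgeMass_le hs hE.sum_len
  have s2 := hR.edgeMass_le hr hE.sum_len
  have tr := mul_le_mul_of_nonneg_left (hE.trace u hu δ hδ0) hN0.le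
  have m0 := hE.mass_nonneg u
  have a0 := hE.stiff_nonneg u
  have g0 := M.edgeMass_self_nonneg u
  have b0 := M.edgeMass_self_nonneg v
  set m := M.mB ctr u u
  set A := M.aB ctr u u
  set g := M.edgeMass u u
  set B := M.edgeMass v v
  have e1 : N * (K * (δ * A + (δ⁻¹ + 1) * m)) = 1 / 2 * (d_u * A) + N * K * (δ⁻¹ + 1) * m := by
    rw [hδ]; field_simp
  rw [e1] at tr
  have f1 : 0 ≤ K * m := by positivity
  have f2 : 0 ≤ N * (K * (δ⁻¹ + 1)) * B := by positivity
  have f3 : 0 ≤ N * (K * (δ⁻¹ + 1)) := by positivity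
  have f4 := mul_nonneg hCs0 (by linarith : 0 ≤ 1 + g + B)
  have f5 := mul_nonneg hCr0 (by linarith : 0 ≤ 1 + g + B)
  have f6 := mul_nonneg (by linarith : 0 ≤ K) (by linarith : 0 ≤ g + B)
  have f7 := mul_nonneg hCs0 m0
  have f8 := mul_nonneg hCr0 m0
  have s0' := mul_nonneg hdv.le (M.edgeStiff_self_nonneg v)
  have bound : M.mB ctr du u + d_u * A + (M.edgeMass dv v + d_v * M.edgeStiff v v) ≤
      N * (1 + m + B) + N * g := by
    have : N * (1 + m + B) + N * g = (2 + K + Cs + Cr) * (1 + m + B + g) := by rw [hN]; ring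
    rw [this]
    norm_num at t1 y1 y2 y3
    linarith
  linarith

/-- Test with `du` and `dv`. The load paired with `du` is only lumped, not estimated, since its
trace would require the gradient of `du`. -/
lemma exists_energy_h1 (hK : 1 ≤ K) {Lr Ls : NNReal} (hr : LipschitzWith Lr r)
    (hs : LipschitzWith Ls s) : ∃ K₂ : ℝ, 0 ≤ K₂ ∧
    ∀ (M : PolyMesh) (ctr : Polygon2 → Plane) (a b d_u d_v : ℝ) (q : ℝ → ℝ)
      (u v du dv : Plane → ℝ), M.Shaped a b ctr → M.Estimates ctr q K → M.MemBulkSpace u →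
      M.MemBulkSpace du → M.MemSurfSpace v → M.MemSurfSpace dv →
      M.IsInstant d_u d_v q r s u v du dv → ∃ S, M.IsNodal s u v S ∧
      d_u * M.aB ctr du u + d_v * M.edgeStiff dv v +
        1 / 2 * (M.mB ctr du du + M.edgeMass dv dv) ≤ M.edgeLump S du +
        K₂ * (1 + M.mB ctr u u + M.edgeMass v v + M.aB ctr u u + M.edgeStiff v v) := by
  set Cs := 3 * s 0 ^ 2 * K + 9 * (Ls : ℝ) ^ 2 with hCs
  set Cr := 3 * r 0 ^ 2 * K + 9 * (Lr : ℝ) ^ 2 with hCr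
  have hCs0 : 0 ≤ Cs := by positivity
  have hCr0 : 0 ≤ Cr := by positivity
  refine ⟨K + Ls ^ 2 * K ^ 2 / 18 + (Cs + Cr) * (1 + 2 * K), by positivity,
    fun M ctr a b d_u d_v q u v du dv hM hE hu hdu hv hdv h => ?_⟩
  obtain ⟨S, R, hS, hR, h1, h2⟩ := h.exists_test hM hE hu hdu hv hdv
  refine ⟨S, hS, ?_⟩
  -- For `du`, one quarter of the mass pays for the bulk load and one for the lumping defect; for
  -- `dv`, the two quarters pay for the two surface loads. Half remains in both cases.
  have t1 := h1 du hdu (1 / 4) (by norm_num)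
  have t2 := h2 dv hdv
  have y1 := hS.edgeMass_le_edgeLump hE hK hs hu hdu
  have y2 := M.neg_edgeMass_le_young S dv (δ := 1 / 4) (by norm_num)
  have y3 := M.edgeMass_le_young R dv (δ := 1 / 4) (by norm_num)
  have s1 := hS.edgeMass_le hs hE.sum_len
  have s2 := hR.edgeMass_le hr hE.sum_len
  have tr := hE.trace u hu 1 one_pos
  rw [aB_comm, edgeStiff_comm]
  have m0 := hE.mass_nonneg u
  have a0 := hE.stiff_nonneg u
  have b0 := M.edgeMass_self_nonneg v
  have σ0 := M.edgeStiff_self_nonneg v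
  norm_num at t1 y2 y3 tr
  set m := M.mB ctr u u
  set A := M.aB ctr u u
  set g := M.edgeMass u u
  set B := M.edgeMass v v
  set σ := M.edgeStiff v v
  have g1 : 1 + g + B ≤ (1 + 2 * K) * (1 + m + B + A + σ) := by
    have f2 : 0 ≤ K * (1 + B + σ) := by positivity
    have f3 : 0 ≤ K * A := by positivity
    linarith
  have g2 := mul_le_mul_of_nonneg_left g1 (add_nonneg hCs0 hCr0)
  have f1 : 0 ≤ K * (B + A + σ) := by positivity
  have f2 : 0 ≤ Ls ^ 2 * K ^ 2 / 18 * (1 + m + B) := by positivity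
  linarith

/-! ### The lumped boundary load as a time derivative -/

/-- The primitive of the boundary load. -/
def loadPrim (M : PolyMesh) (s : ℝ × ℝ → ℝ) (u v : Plane → ℝ) : ℝ := ∑ e ∈ M.bdryEdges,
  len e / 2 * (primitive s (valP u e) (valP v e) + primitive s (valQ u e) (valQ v e))

lemma abs_loadPrim_le {L : NNReal} (hs : LipschitzWith L s)
    (hK : ∑ e ∈ M.bdryEdges, len e ≤ K) : |M.loadPrim s u v| ≤
      (|s 0| + 2 * L) * (K + 3 * M.edgeMass u u + 3 * M.edgeMass v v) := by
  have hC : 0 ≤ |s 0| + 2 * (L : ℝ) := by positivity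
  have h1 : |M.loadPrim s u v| ≤ (|s 0| + 2 * L) *
      ((∑ e ∈ M.bdryEdges, len e) + M.edgeLump u u + M.edgeLump v v) := by
    refine (Finset.abs_sum_le_sum_abs _ _).trans ?_
    rw [edgeLump, edgeLump, ← Finset.sum_add_distrib, ← Finset.sum_add_distrib, Finset.mul_sum]
    refine Finset.sum_le_sum fun e _ => ?_
    have hl := half_pos (len_pos e)
    rw [abs_mul, abs_of_pos hl]
    have h2 := mul_le_mul_of_nonneg_left ((abs_add_le _ _).trans
      (add_le_add (abs_primitive_le hs (valP u e) (valP v e))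
        (abs_primitive_le hs (valQ u e) (valQ v e)))) hl.le
    linarith
  refine h1.trans (mul_le_mul_of_nonneg_left ?_ hC)
  linarith [M.edgeLump_le u, M.edgeLump_le v]

/-- The primitive has no sign but grows only quadratically. With a small trace parameter its
gradient part is at most half of the `H¹` energy. -/
lemma exists_loadPrim_bound {L : NNReal} (hs : LipschitzWith L s) (hdu : 0 < d_u) (hK : 1 ≤ K) :
    ∃ K₃ : ℝ, 0 ≤ K₃ ∧ ∀ (M : PolyMesh) (ctr : Polygon2 → Plane) (q : ℝ → ℝ) (u v : Plane → ℝ),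
      M.Estimates ctr q K → M.MemBulkSpace u → |M.loadPrim s u v| ≤
        1 / 4 * (d_u * M.aB ctr u u) + K₃ * (1 + M.mB ctr u u + M.edgeMass v v) := by
  set c := |s 0| + 2 * (L : ℝ) + 1 with hc
  have hc0 : 0 < c := by positivity
  set δ := d_u / (12 * c * K) with hδ
  have hδ0 : 0 < δ := by positivity
  refine ⟨c * K + 3 * c + 3 * c * K * (δ⁻¹ + 1), by positivity, fun M ctr q u v hE hu => ?_⟩
  have h1 := M.abs_loadPrim_le (u := u) (v := v) hs hE.sum_len
  have tr := mul_le_mul_of_nonneg_left (hE.trace u hu δ hδ0) (by positivity : 0 ≤ 3 * c)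
  have m0 := hE.mass_nonneg u
  have b0 := M.edgeMass_self_nonneg v
  have g0 := M.edgeMass_self_nonneg u
  set m := M.mB ctr u u
  set A := M.aB ctr u u
  set g := M.edgeMass u u
  set B := M.edgeMass v v
  have e1 : 3 * c * (K * (δ * A + (δ⁻¹ + 1) * m)) =
      1 / 4 * (d_u * A) + 3 * c * K * (δ⁻¹ + 1) * m := by
    rw [hδ]; field_simp; ring
  rw [e1] at tr
  have h2 : (|s 0| + 2 * L) * (K + 3 * g + 3 * B) ≤ c * (K + 3 * g + 3 * B) :=
    mul_le_mul_of_nonneg_right (by linarith) (by linarith)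
  have f1 : 0 ≤ c * K * (m + B) := by positivity
  have f2 : 0 ≤ c * (1 + m) := by positivity
  have f3 : 0 ≤ c * K * (δ⁻¹ + 1) * (1 + B) := by positivity
  linarith

/-- The chain rule at every vertex. The error |U||dV| is split by Young with weight 1/12 on |dV|²,
which becomes 1/4 after `edgeLump_le`, so that it can be absorbed. -/
lemma exists_hasAEDeriv_loadPrim {L : NNReal} (hs : LipschitzWith L s) {T : ℝ} (hT : 0 ≤ T)
    {U V dU dV : ℝ → Plane → ℝ}
    (huP : ∀ e ∈ M.bdryEdges, HasAEDeriv T (fun t => valP (U t) e) (fun t => valP (dU t) e))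
    (huQ : ∀ e ∈ M.bdryEdges, HasAEDeriv T (fun t => valQ (U t) e) (fun t => valQ (dU t) e))
    (hvP : ∀ e ∈ M.bdryEdges, HasAEDeriv T (fun t => valP (V t) e) (fun t => valP (dV t) e))
    (hvQ : ∀ e ∈ M.bdryEdges, HasAEDeriv T (fun t => valQ (V t) e) (fun t => valQ (dV t) e)) :
    ∃ p' : ℝ → ℝ, HasAEDeriv T (fun t => M.loadPrim s (U t) (V t)) p' ∧
      ∀ᵐ t ∂(volume.restrict (Icc 0 T)), ∀ S, M.IsNodal s (U t) (V t) S →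
        M.edgeLump S (dU t) ≤ p' t + 1 / 4 * M.edgeMass (dV t) (dV t) +
          9 * L ^ 2 * M.edgeMass (U t) (U t) := by
  choose! p hp hp' using fun e he =>
    exists_hasAEDeriv_primitive hs hT (huP e he) (hvP e he)
  choose! p₂ hp₂ hp₂' using fun e he =>
    exists_hasAEDeriv_primitive hs hT (huQ e he) (hvQ e he)
  refine ⟨_, HasAEDeriv.sum M.bdryEdges fun e he =>
    ((hp e he).add (hp₂ e he)).const_mul (len e / 2), ?_⟩
  filter_upwards [(Finset.eventually_all M.bdryEdges).2 hp',
    (Finset.eventually_all M.bdryEdges).2 hp₂'] with t h1 h2 S hS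
  have key : M.edgeLump S (dU t) ≤ (∑ e ∈ M.bdryEdges, len e / 2 * (p e t + p₂ e t)) +
      (1 / 12 * M.edgeLump (dV t) (dV t) + 3 * L ^ 2 * M.edgeLump (U t) (U t)) := by
    rw [edgeLump, edgeLump, edgeLump, Finset.mul_sum, Finset.mul_sum, ← Finset.sum_add_distrib,
      ← Finset.sum_add_distrib]
    refine Finset.sum_le_sum fun e he => ?_
    have hl := half_pos (len_pos e)
    rw [(hS e he).1, (hS e he).2]
    have h3 := h1 e he
    have h4 := h2 e he
    have young : ∀ x y : ℝ, L * (|x| * |y|) ≤ 1 / 12 * (y * y) + 3 * L ^ 2 * (x * x) :=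
      fun x y => by
        have hx := abs_mul_abs_self x
        have hy := abs_mul_abs_self y
        nlinarith [sq_nonneg (|y| - 6 * L * |x|)]
    have h5 := young (valP (U t) e) (valP (dV t) e)
    have h6 := young (valQ (U t) e) (valQ (dV t) e)
    have h7 := mul_le_mul_of_nonneg_left (add_le_add (h3.trans (add_le_add le_rfl h5))
      (h4.trans (add_le_add le_rfl h6))) hl.le
    linarith
  have h3 := M.edgeLump_le (dV t)
  have h4 := mul_le_mul_of_nonneg_left (M.edgeLump_le (U t)) (by positivity : 0 ≤ 3 * (L : ℝ) ^ 2)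
  linarith

end PolyMesh

/-- Almost everywhere `X` lies below the integrable function `φ - deriv f`, so its lower integral is
bounded without asking whether `X` is measurable. -/
lemma HasAEDeriv.lintegral_le {T : ℝ} (hT : 0 ≤ T) {f f' φ X : ℝ → ℝ} (hf : HasAEDeriv T f f')
    (hφ : IntegrableOn φ (Icc 0 T)) (hX : ∀ᵐ t ∂(volume.restrict (Icc 0 T)), 0 ≤ X t)
    (h : ∀ᵐ t ∂(volume.restrict (Icc 0 T)), f' t + X t ≤ φ t) :
    ∫⁻ t in Icc 0 T, ENNReal.ofReal (X t) ≤
      ENNReal.ofReal (f 0 - f T + ∫ τ in (0 : ℝ)..T, φ τ) := by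
  have hi' := hf.1.intervalIntegrable_deriv
  have hφ' : IntervalIntegrable φ volume 0 T :=
    (intervalIntegrable_iff_integrableOn_Icc_of_le hT).2 hφ
  have hi : IntegrableOn (fun t => φ t - deriv f t) (Icc 0 T) :=
    hφ.sub ((intervalIntegrable_iff_integrableOn_Icc_of_le hT).1 hi')
  have key : ∀ᵐ t ∂(volume.restrict (Icc 0 T)), X t ≤ φ t - deriv f t := by
    filter_upwards [h, hf.2] with t h1 h2
    rw [h2.deriv]; linarith
  have e : f 0 - f T + ∫ τ in (0 : ℝ)..T, φ τ = ∫ t in Icc 0 T, (φ t - deriv f t) := by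
    rw [integral_Icc_eq_integral_Ioc, ← intervalIntegral.integral_of_le hT,
      intervalIntegral.integral_sub hφ' hi', hf.1.integral_deriv_eq_sub]
    ring
  rw [e, ofReal_integral_eq_lintegral_ofReal hi]
  · refine lintegral_mono_ae ?_
    filter_upwards [key] with t ht using ENNReal.ofReal_le_ofReal ht
  · filter_upwards [key, hX] with t h1 h2 using h2.trans h1

namespace PolyMesh

variable {M : PolyMesh} {ctr : Polygon2 → Plane} {a b d_u d_v K T : ℝ} {q : ℝ → ℝ}
  {r s : ℝ × ℝ → ℝ} {U V dU dV : ℝ → Plane → ℝ}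

/-! ### Energy estimates in time -/

namespace IsSemidiscreteSolution

lemma hasAEDeriv_bulk (h : M.IsSemidiscreteSolution d_u d_v q r s T U V dU dV) (hT : 0 ≤ T)
    {x : Plane} (hx : x ∈ M.bulk) : HasAEDeriv T (fun t => U t x) (fun t => dU t x) :=
  HasAEDeriv.of_integral hT ((h.bulk_memLp x hx).integrable (by norm_num)) (h.bulk_deriv x hx)

lemma hasAEDeriv_surf (h : M.IsSemidiscreteSolution d_u d_v q r s T U V dU dV) (hT : 0 ≤ T)
    {x : Plane} (hx : x ∈ M.surf) : HasAEDeriv T (fun t => V t x) (fun t => dV t x) :=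
  HasAEDeriv.of_integral hT ((h.surf_memLp x hx).integrable (by norm_num)) (h.surf_deriv x hx)

lemma hasAEDeriv_vertex (h : M.IsSemidiscreteSolution d_u d_v q r s T U V dU dV) (hT : 0 ≤ T)
    {E : Polygon2} (hE : E ∈ M.elems) (i : Fin E.n) :
    HasAEDeriv T (fun t => U t (E.vertex i)) (fun t => dU t (E.vertex i)) :=
  h.hasAEDeriv_bulk hT (carrier_subset_bulk hE (E.vertex_mem_carrier i))

lemma hasAEDeriv_edge (h : M.IsSemidiscreteSolution d_u d_v q r s T U V dU dV) (hT : 0 ≤ T)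
    {e : Σ E : Polygon2, Fin E.n} (he : e ∈ M.bdryEdges) :
    (HasAEDeriv T (fun t => valP (U t) e) (fun t => valP (dU t) e) ∧
      HasAEDeriv T (fun t => valQ (U t) e) (fun t => valQ (dU t) e)) ∧
    HasAEDeriv T (fun t => valP (V t) e) (fun t => valP (dV t) e) ∧
      HasAEDeriv T (fun t => valQ (V t) e) (fun t => valQ (dV t) e) := by
  obtain ⟨hE, hsub⟩ := Shaped.mem_bdryEdges.1 he
  exact ⟨⟨h.hasAEDeriv_vertex hT hE _, h.hasAEDeriv_vertex hT hE _⟩,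
    h.hasAEDeriv_surf hT (hsub (e.1.vertex_mem_edge e.2)),
    h.hasAEDeriv_surf hT (hsub (e.1.nextVertex_mem_edge e.2))⟩

end IsSemidiscreteSolution

/-- The `L²` energy. -/
def energy0 (M : PolyMesh) (ctr : Polygon2 → Plane) (u v : Plane → ℝ) : ℝ :=
  1 / 2 * (M.mB ctr u u + M.edgeMass v v)

/-- The `H¹` energy. -/
def energy1 (M : PolyMesh) (ctr : Polygon2 → Plane) (d_u d_v : ℝ) (u v : Plane → ℝ) : ℝ :=
  1 / 2 * (d_u * M.aB ctr u u + d_v * M.edgeStiff v v)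

namespace IsSemidiscreteSolution

lemma hasAEDeriv_energy0 (h : M.IsSemidiscreteSolution d_u d_v q r s T U V dU dV) (hT : 0 ≤ T) :
    HasAEDeriv T (fun t => M.energy0 ctr (U t) (V t))
      (fun t => M.mB ctr (dU t) (U t) + M.edgeMass (dV t) (V t)) :=
  (((hasAEDeriv_mB fun E hE i => h.hasAEDeriv_vertex hT hE i).add
    (hasAEDeriv_edgeMass (fun e he => (h.hasAEDeriv_edge hT he).2.1)
      fun e he => (h.hasAEDeriv_edge hT he).2.2)).const_mul (1 / 2)).congr (fun t => rfl)
    fun t => by ring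

lemma hasAEDeriv_energy1 (h : M.IsSemidiscreteSolution d_u d_v q r s T U V dU dV) (hT : 0 ≤ T) :
    HasAEDeriv T (fun t => M.energy1 ctr d_u d_v (U t) (V t))
      (fun t => d_u * M.aB ctr (dU t) (U t) + d_v * M.edgeStiff (dV t) (V t)) :=
  ((((hasAEDeriv_aB fun E hE i => h.hasAEDeriv_vertex hT hE i).const_mul d_u).add
    ((hasAEDeriv_edgeStiff (fun e he => (h.hasAEDeriv_edge hT he).2.1)
      fun e he => (h.hasAEDeriv_edge hT he).2.2).const_mul d_v)).const_mul (1 / 2)).congr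
    (fun t => rfl) fun t => by ring

end IsSemidiscreteSolution

lemma Estimates.energy0_nonneg (hE : M.Estimates ctr q K) (u v : Plane → ℝ) :
    0 ≤ M.energy0 ctr u v :=
  mul_nonneg (by norm_num) (add_nonneg (hE.mass_nonneg u) (M.edgeMass_self_nonneg v))

lemma Estimates.energy1_nonneg (hE : M.Estimates ctr q K) (hdu : 0 < d_u) (hdv : 0 < d_v)
    (u v : Plane → ℝ) : 0 ≤ M.energy1 ctr d_u d_v u v :=
  mul_nonneg (by norm_num) (add_nonneg (mul_nonneg hdu.le (hE.stiff_nonneg u))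
    (mul_nonneg hdv.le (M.edgeStiff_self_nonneg v)))

theorem exists_gronwall (hdu : 0 < d_u) (hdv : 0 < d_v) (hK : 1 ≤ K) {Lr Ls : NNReal}
    (hr : LipschitzWith Lr r) (hs : LipschitzWith Ls s) : ∃ K₁ : ℝ, 0 ≤ K₁ ∧
    ∀ (M : PolyMesh) (ctr : Polygon2 → Plane) (a b T : ℝ) (q : ℝ → ℝ)
      (U V dU dV : ℝ → Plane → ℝ), 0 < T → M.Shaped a b ctr → M.Estimates ctr q K →
      M.IsSemidiscreteSolution d_u d_v q r s T U V dU dV → ∀ t ∈ Icc 0 T,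
      1 + M.energy0 ctr (U t) (V t) + ∫ τ in (0 : ℝ)..t, M.energy1 ctr d_u d_v (U τ) (V τ) ≤
        Real.exp (K₁ * T) * (1 + M.energy0 ctr (U 0) (V 0)) := by
  obtain ⟨K₁, hK₁, H⟩ := exists_energy_l2 hdu hK hr hs
  refine ⟨K₁, hK₁, fun M ctr a b T q U V dU dV hT hM hE h t ht => ?_⟩
  refine ((h.hasAEDeriv_energy0 (ctr := ctr) hT.le).gronwall
    ((h.hasAEDeriv_energy1 (ctr := ctr) hT.le).continuousOn hT.le)
    (fun t _ => hE.energy1_nonneg hdu hdv _ _) hK₁ ?_ ht).trans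
    (mul_le_mul_of_nonneg_right (Real.exp_le_exp.2 (mul_le_mul_of_nonneg_left ht.2 hK₁))
      (by linarith [hE.energy0_nonneg (U 0) (V 0)]))
  filter_upwards [h.equations, ae_restrict_mem measurableSet_Icc] with t h1 ht
  exact H M ctr a b d_v q (U t) (V t) (dU t) (dV t) hdv hM hE (h.bulk_mem t ht).1
    (h.bulk_mem t ht).2 (h.surf_mem t ht).1 (h.surf_mem t ht).2 h1

/-- The differential inequality is written for the `H¹` energy minus the primitive of the load.
After integration the primitive costs at most half the energy, at the final and at the initial time,
and the integrated energy on the right is bounded by the first estimate. -/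
theorem exists_energy1_bound (hdu : 0 < d_u) (hdv : 0 < d_v) (hK : 1 ≤ K) {Lr Ls : NNReal}
    (hr : LipschitzWith Lr r) (hs : LipschitzWith Ls s) : ∃ Q : ℝ, 1 ≤ Q ∧
    ∀ (M : PolyMesh) (ctr : Polygon2 → Plane) (a b T : ℝ) (q : ℝ → ℝ)
      (U V dU dV : ℝ → Plane → ℝ), 0 < T → M.Shaped a b ctr → M.Estimates ctr q K →
      M.IsSemidiscreteSolution d_u d_v q r s T U V dU dV →
      (∀ t ∈ Icc 0 T, 1 + M.energy0 ctr (U t) (V t) +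
        ∫ τ in (0 : ℝ)..t, M.energy1 ctr d_u d_v (U τ) (V τ) ≤
        Real.exp (Q * T) * (1 + M.energy0 ctr (U 0) (V 0))) ∧
      (∀ t ∈ Icc 0 T, M.energy1 ctr d_u d_v (U t) (V t) ≤ Q * (Real.exp (Q * T) *
        (1 + M.energy0 ctr (U 0) (V 0) + M.energy1 ctr d_u d_v (U 0) (V 0)))) ∧
      ∫⁻ t in Icc 0 T, ENNReal.ofReal (M.mB ctr (dU t) (dU t) + M.edgeMass (dV t) (dV t)) ≤
        ENNReal.ofReal (Q * (Real.exp (Q * T) *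
        (1 + M.energy0 ctr (U 0) (V 0) + M.energy1 ctr d_u d_v (U 0) (V 0)))) := by
  obtain ⟨K₁, hK₁, H₁⟩ := exists_gronwall hdu hdv hK hr hs
  obtain ⟨K₂, hK₂, H₂⟩ := exists_energy_h1 hK hr hs
  obtain ⟨K₃, hK₃, H₃⟩ := exists_loadPrim_bound hs hdu hK
  set κ := 2 / d_u + 2 / d_v with hκ
  have hκ0 : 0 < κ := by positivity
  set K₄ := K₂ + 18 * (Ls : ℝ) ^ 2 * K with hK₄
  have hK₄0 : 0 ≤ K₄ := by positivity
  have hX : 0 ≤ K₄ * (2 + κ) := by positivity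
  set Q := 6 + 4 * (K₄ * (2 + κ)) + 16 * K₃ + K₁ with hQ
  refine ⟨Q, by linarith, fun M ctr a b T q U V dU dV hT hM hE h => ?_⟩
  -- Constants must not depend on `T`: the factors `T` and 1 that arise from integrating in time are
  -- absorbed into the exponential.
  have hT1 : T ≤ Real.exp T := by linarith [Real.add_one_le_exp T]
  have hT2 : 1 ≤ Real.exp T := Real.one_le_exp hT.le
  set y := fun t => M.energy0 ctr (U t) (V t) with hy
  set D := fun t => M.energy1 ctr d_u d_v (U t) (V t) with hD
  have hy0 : ∀ t, 0 ≤ y t := fun t => hE.energy0_nonneg _ _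
  have hD0 : ∀ t, 0 ≤ D t := fun t => hE.energy1_nonneg hdu hdv _ _
  have hyd := h.hasAEDeriv_energy0 (ctr := ctr) hT.le
  have hDd := h.hasAEDeriv_energy1 (ctr := ctr) hT.le
  have hyc : ContinuousOn y (Icc 0 T) := hyd.continuousOn hT.le
  have hDc : ContinuousOn D (Icc 0 T) := hDd.continuousOn hT.le
  set R := Real.exp (K₁ * T) * (1 + y 0) with hR
  have hR0 : 0 ≤ R := mul_nonneg (Real.exp_pos _).le (by linarith [hy0 0])
  have h1 : ∀ t ∈ Icc 0 T, 1 + y t + ∫ τ in (0 : ℝ)..t, D τ ≤ R :=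
    H₁ M ctr a b T q U V dU dV hT hM hE h
  have hDi0 : ∀ t ∈ Icc 0 T, 0 ≤ ∫ τ in (0 : ℝ)..t, D τ := fun t ht =>
    intervalIntegral.integral_nonneg ht.1 fun τ _ => hD0 τ
  have hyR : ∀ t ∈ Icc 0 T, 1 + y t ≤ R := fun t ht => by linarith [h1 t ht, hDi0 t ht]
  obtain ⟨p', hp, hp'⟩ := exists_hasAEDeriv_loadPrim hs hT.le (M := M) (U := U) (dU := dU)
    (V := V) (dV := dV)
    (fun e he => (h.hasAEDeriv_edge hT.le he).1.1) (fun e he => (h.hasAEDeriv_edge hT.le he).1.2)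
    (fun e he => (h.hasAEDeriv_edge hT.le he).2.1) (fun e he => (h.hasAEDeriv_edge hT.le he).2.2)
  set J := fun t => M.loadPrim s (U t) (V t) with hJ
  have hJb : ∀ t ∈ Icc 0 T, |J t| ≤ 1 / 2 * D t + 2 * K₃ * (1 + y t) := fun t ht => by
    have h2 := H₃ M ctr q (U t) (V t) hE (h.bulk_mem t ht).1
    have h3 := mul_nonneg hdv.le (M.edgeStiff_self_nonneg (V t))
    have e1 : D t = 1 / 2 * (d_u * M.aB ctr (U t) (U t) + d_v * M.edgeStiff (V t) (V t)) := rfl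
    have e2 : y t = 1 / 2 * (M.mB ctr (U t) (U t) + M.edgeMass (V t) (V t)) := rfl
    rw [e1, e2]
    linarith
  -- The modified energy `D - J`, whose derivative no longer contains the lumped load.
  have hz := hDd.add (hp.const_mul (-1))
  set φ := fun t => K₄ * (2 * (1 + y t) + κ * D t) with hφ
  have hφc : ContinuousOn φ (Icc 0 T) := continuousOn_const.mul
    ((continuousOn_const.mul (continuousOn_const.add hyc)).add (continuousOn_const.mul hDc))
  have hφi := hφc.integrableOn_compact isCompact_Icc (μ := volume)
  have hineq : ∀ᵐ t ∂(volume.restrict (Icc 0 T)),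
      (d_u * M.aB ctr (dU t) (U t) + d_v * M.edgeStiff (dV t) (V t) + -1 * p' t) +
        1 / 4 * (M.mB ctr (dU t) (dU t) + M.edgeMass (dV t) (dV t)) ≤ φ t := by
    filter_upwards [h.equations, hp', ae_restrict_mem measurableSet_Icc] with t g1 g2 ht
    obtain ⟨S, hS, g3⟩ := H₂ M ctr a b d_u d_v q (U t) (V t) (dU t) (dV t) hM hE
      (h.bulk_mem t ht).1 (h.bulk_mem t ht).2 (h.surf_mem t ht).1 (h.surf_mem t ht).2 g1
    have g4 := g2 S hS
    have tr := hE.trace (U t) (h.bulk_mem t ht).1 1 one_pos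
    norm_num at tr
    have m0 := hE.mass_nonneg (U t)
    have a0 := hE.stiff_nonneg (U t)
    have b0 := M.edgeMass_self_nonneg (V t)
    have σ0 := M.edgeStiff_self_nonneg (V t)
    have n0 := hE.mass_nonneg (dU t)
    have e1 : D t = 1 / 2 * (d_u * M.aB ctr (U t) (U t) + d_v * M.edgeStiff (V t) (V t)) := rfl
    have e2 : y t = 1 / 2 * (M.mB ctr (U t) (U t) + M.edgeMass (V t) (V t)) := rfl
    have e3 : φ t = K₄ * (2 * (1 + y t) + κ * D t) := rfl
    rw [e3, e1, e2]
    set m := M.mB ctr (U t) (U t)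
    set A := M.aB ctr (U t) (U t)
    set B := M.edgeMass (V t) (V t)
    set σ := M.edgeStiff (V t) (V t)
    have k1 : A + σ ≤ κ * (1 / 2 * (d_u * A + d_v * σ)) := by
      have : κ * (1 / 2 * (d_u * A + d_v * σ)) = A + σ + d_v / d_u * σ + d_u / d_v * A := by
        rw [hκ]; field_simp; ring
      have k2 : 0 ≤ d_v / d_u * σ + d_u / d_v * A := by positivity
      linarith
    have k2 := mul_le_mul_of_nonneg_left k1 hK₄0
    have k3 := mul_le_mul_of_nonneg_left tr (by positivity : 0 ≤ 9 * (Ls : ℝ) ^ 2)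
    have k4 : 0 ≤ (Ls : ℝ) ^ 2 * K * (1 + B + A + σ) := by positivity
    have k6 : 0 ≤ (Ls : ℝ) ^ 2 * K * (1 + B + σ) := by positivity
    have k7 : 0 ≤ (Ls : ℝ) ^ 2 * K * A := by positivity
    have k5 : 0 ≤ K₄ * (1 + m + B) := by positivity
    have k8 : K₂ * (1 + m + B + A + σ) + 9 * (Ls : ℝ) ^ 2 * (K * (A + 2 * m)) ≤
        K₄ * (1 + m + B + A + σ) := by rw [hK₄]; linarith
    linarith
  -- The right-hand side contains only the `L²` energy, bounded by `R`, and the `H¹` energy, whose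
  -- time integral is bounded by `R`.
  have hΦ : ∀ t ∈ Icc 0 T, ∫ τ in (0 : ℝ)..t, φ τ ≤ K₄ * (2 + κ) * (Real.exp T * R) :=
    fun t ht => by
    have hsub : Icc 0 t ⊆ Icc 0 T := Icc_subset_Icc_right ht.2
    have g1 : ∫ τ in (0 : ℝ)..t, φ τ ≤ ∫ τ in (0 : ℝ)..t, (K₄ * (2 * R) + K₄ * κ * D τ) := by
      refine intervalIntegral.integral_mono_on ht.1
        (ContinuousOn.intervalIntegrable_of_Icc ht.1 (hφc.mono hsub))
        (ContinuousOn.intervalIntegrable_of_Icc ht.1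
          (continuousOn_const.add (continuousOn_const.mul (hDc.mono hsub)))) fun τ hτ => ?_
      have := mul_le_mul_of_nonneg_left (hyR τ (hsub hτ)) (by positivity : 0 ≤ 2 * K₄)
      have e3 : φ τ = K₄ * (2 * (1 + y τ) + κ * D τ) := rfl
      rw [e3]; linarith
    have hi : IntervalIntegrable (fun τ => K₄ * κ * D τ) volume 0 t :=
      ContinuousOn.intervalIntegrable_of_Icc ht.1 (continuousOn_const.mul (hDc.mono hsub))
    rw [intervalIntegral.integral_add intervalIntegrable_const hi,
      intervalIntegral.integral_const, intervalIntegral.integral_const_mul (K₄ * κ) D, sub_zero,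
      smul_eq_mul] at g1
    have g2 : ∫ τ in (0 : ℝ)..t, D τ ≤ Real.exp T * R := by
      have := le_mul_of_one_le_left hR0 hT2
      linarith [h1 t ht, hy0 t]
    have g3 : t * R ≤ Real.exp T * R := mul_le_mul_of_nonneg_right (ht.2.trans hT1) hR0
    have g4 := mul_le_mul_of_nonneg_left g2 (by positivity : 0 ≤ K₄ * κ)
    have g5 := mul_le_mul_of_nonneg_left g3 (by positivity : 0 ≤ 2 * K₄)
    linarith
  have h0 : (0 : ℝ) ∈ Icc 0 T := left_mem_Icc.2 hT.le
  have hTT : T ∈ Icc 0 T := right_mem_Icc.2 hT.le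
  have hJ0 := abs_le.1 (hJb 0 h0)
  have hy00 := hy0 0
  have hD00 := hD0 0
  set P := Real.exp (Q * T) * (1 + y 0 + D 0) with hP
  -- The two exponentials merge because `1 + K₁ ≤ Q`.
  have hP1 : Real.exp T * R ≤ P := by
    rw [hR, ← mul_assoc, ← Real.exp_add, hP]
    refine mul_le_mul (Real.exp_le_exp.2 ?_) (by linarith) (by linarith) (Real.exp_pos _).le
    have : (1 + K₁) * T ≤ Q * T := mul_le_mul_of_nonneg_right (by linarith) hT.le
    linarith
  have hP2 : R ≤ P := (le_mul_of_one_le_left hR0 hT2).trans hP1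
  have hP3 : D 0 ≤ P := by
    have := le_mul_of_one_le_left (by linarith : 0 ≤ 1 + y 0 + D 0)
      (Real.one_le_exp (by positivity : 0 ≤ Q * T))
    linarith
  have b1 := mul_le_mul_of_nonneg_left hP1 hX
  have b2 := mul_le_mul_of_nonneg_left hP2 hK₃
  have b3 := mul_le_mul_of_nonneg_left (hyR 0 h0) hK₃
  have hP0 : 0 ≤ P := hR0.trans hP2
  have c1 := mul_nonneg hX hP0
  have c2 := mul_nonneg hK₃ hP0
  have c3 := mul_nonneg hK₁ hP0
  have hQP : Q * P = 6 * P + 4 * (K₄ * (2 + κ) * P) + 16 * (K₃ * P) + K₁ * P := by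
    rw [hQ]; ring
  have hn : ∀ t, 0 ≤ M.mB ctr (dU t) (dU t) + M.edgeMass (dV t) (dV t) := fun t =>
    add_nonneg (hE.mass_nonneg _) (M.edgeMass_self_nonneg _)
  refine ⟨fun t ht => (h1 t ht).trans ?_, fun t ht => ?_, ?_⟩
  · refine mul_le_mul_of_nonneg_right (Real.exp_le_exp.2 ?_) (by linarith)
    exact mul_le_mul_of_nonneg_right (by linarith) hT.le
  · have g1 := hz.le_integral hφi (by
      filter_upwards [hineq] with t g1
      linarith [hn t]) ht
    have g2 := hΦ t ht
    have g3 := (abs_le.1 (hJb t ht)).2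
    have g4 := mul_le_mul_of_nonneg_left (hyR t ht) hK₃
    change D t + -1 * J t ≤ D 0 + -1 * J 0 + _ at g1
    change D t ≤ Q * P
    linarith [hJ0.1]
  · have g1 := hz.lintegral_le hT.le hφi (Filter.Eventually.of_forall fun t =>
      mul_nonneg (by norm_num : (0 : ℝ) ≤ 1 / 4) (hn t)) hineq
    have g2 := hΦ T hTT
    have g3 := (abs_le.1 (hJb T hTT)).2
    have g4 := mul_le_mul_of_nonneg_left (hyR T hTT) hK₃
    have g5 := hD0 T
    have e4 : ∀ x : ℝ, ENNReal.ofReal (1 / 4 * x) = ENNReal.ofReal (1 / 4) * ENNReal.ofReal x :=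
      fun x => ENNReal.ofReal_mul (by norm_num)
    simp only [e4] at g1
    rw [lintegral_const_mul' _ _ ENNReal.ofReal_ne_top] at g1
    have g6 := mul_le_mul_right g1 (ENNReal.ofReal 4)
    rw [← mul_assoc, ← ENNReal.ofReal_mul (by norm_num), ← ENNReal.ofReal_mul (by norm_num),
      show (4 : ℝ) * (1 / 4) = 1 by norm_num, ENNReal.ofReal_one, one_mul] at g6
    refine g6.trans (ENNReal.ofReal_le_ofReal ?_)
    change 4 * (D 0 + -1 * J 0 - (D T + -1 * J T) + _) ≤ Q * P
    linarith [hJ0.1]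

end PolyMesh

namespace PolyMesh

/-! ### Estimates for the norms -/

variable {M : PolyMesh} {ctr : Polygon2 → Plane} {K : ℝ} {q : ℝ → ℝ} {u v : Plane → ℝ}

lemma Estimates.l2_norm_le (hE : M.Estimates ctr q K) (hK : 1 ≤ K) (hu : M.MemBulkSpace u)
    (hv : M.MemSurfSpace v) : l2Sq M.bulk u + M.surfL2Sq v ≤
      ENNReal.ofReal K * ENNReal.ofReal (M.mB ctr u u + M.edgeMass v v) := by
  have h0 := M.edgeMass_self_nonneg v
  rw [hv.bdryLinear.surfL2Sq_eq, ← ENNReal.ofReal_mul (by linarith), mul_add,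
    ENNReal.ofReal_add (mul_nonneg (by linarith) (hE.mass_nonneg u))
      (mul_nonneg (by linarith) h0)]
  exact add_le_add (hE.l2_le u hu)
    (ENNReal.ofReal_le_ofReal (le_mul_of_one_le_left h0 hK))

lemma Estimates.le_l2_norm (hE : M.Estimates ctr q K) (hK : 1 ≤ K) (hu : M.MemBulkSpace u)
    (hv : M.MemSurfSpace v) : ENNReal.ofReal (M.mB ctr u u + M.edgeMass v v) ≤
      ENNReal.ofReal K * (l2Sq M.bulk u + M.surfL2Sq v) := by
  have h0 := M.edgeMass_self_nonneg v
  rw [hv.bdryLinear.surfL2Sq_eq, ENNReal.ofReal_add (hE.mass_nonneg u) h0, mul_add,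
    ← ENNReal.ofReal_mul (by linarith)]
  exact add_le_add (hE.le_l2 u hu) (ENNReal.ofReal_le_ofReal (le_mul_of_one_le_left h0 hK))

lemma Estimates.h1_norm_le (hE : M.Estimates ctr q K) (hK : 1 ≤ K) (hu : M.MemBulkSpace u)
    (hv : M.MemSurfSpace v) : h1SemiSq (interior M.bulk) u + M.surfH1SemiSq v ≤
      ENNReal.ofReal K * ENNReal.ofReal (M.aB ctr u u + M.edgeStiff v v) := by
  have h0 := M.edgeStiff_self_nonneg v
  rw [hv.bdryLinear.surfH1SemiSq_eq, ← ENNReal.ofReal_mul (by linarith), mul_add,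
    ENNReal.ofReal_add (mul_nonneg (by linarith) (hE.stiff_nonneg u))
      (mul_nonneg (by linarith) h0)]
  exact add_le_add (hE.h1_le u hu)
    (ENNReal.ofReal_le_ofReal (le_mul_of_one_le_left h0 hK))

lemma Estimates.le_h1_norm (hE : M.Estimates ctr q K) (hK : 1 ≤ K) (hu : M.MemBulkSpace u)
    (hv : M.MemSurfSpace v) : ENNReal.ofReal (M.aB ctr u u + M.edgeStiff v v) ≤
      ENNReal.ofReal K * (h1SemiSq (interior M.bulk) u + M.surfH1SemiSq v) := by
  have h0 := M.edgeStiff_self_nonneg v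
  rw [hv.bdryLinear.surfH1SemiSq_eq, ENNReal.ofReal_add (hE.stiff_nonneg u) h0, mul_add,
    ← ENNReal.ofReal_mul (by linarith)]
  exact add_le_add (hE.le_h1 u hu) (ENNReal.ofReal_le_ofReal (le_mul_of_one_le_left h0 hK))

lemma lintegral_ofReal_le_of_intervalIntegral_le {f : ℝ → ℝ} {T B : ℝ} (hT : 0 ≤ T)
    (hf : ContinuousOn f (Icc 0 T)) (hf0 : ∀ t, 0 ≤ f t) (hB : ∫ t in (0 : ℝ)..T, f t ≤ B) :
    ∫⁻ t in Icc 0 T, ENNReal.ofReal (f t) ≤ ENNReal.ofReal B := by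
  rw [← ofReal_integral_eq_lintegral_ofReal (hf.integrableOn_compact isCompact_Icc)
    (Filter.Eventually.of_forall hf0), integral_Icc_eq_integral_Ioc,
    ← intervalIntegral.integral_of_le hT]
  exact ENNReal.ofReal_le_ofReal hB

end PolyMesh

namespace PolyMesh

variable {M : PolyMesh} {ctr : Polygon2 → Plane} {d_u d_v K T : ℝ} {q : ℝ → ℝ}
  {u v : Plane → ℝ}

lemma Estimates.le_energy1 (hE : M.Estimates ctr q K) (hdu : 0 < d_u) (hdv : 0 < d_v) :
    M.aB ctr u u + M.edgeStiff v v ≤ (2 / d_u + 2 / d_v) * M.energy1 ctr d_u d_v u v := by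
  have a0 := hE.stiff_nonneg u
  have σ0 := M.edgeStiff_self_nonneg v
  have e : (2 / d_u + 2 / d_v) * M.energy1 ctr d_u d_v u v = M.aB ctr u u + M.edgeStiff v v +
      (d_v / d_u * M.edgeStiff v v + d_u / d_v * M.aB ctr u u) := by
    rw [energy1]; field_simp; ring
  have : 0 ≤ d_v / d_u * M.edgeStiff v v + d_u / d_v * M.aB ctr u u := by positivity
  linarith

lemma Estimates.energy_le (hE : M.Estimates ctr q K) (hdu : 0 < d_u) (hdv : 0 < d_v) :
    1 + M.energy0 ctr u v + M.energy1 ctr d_u d_v u v ≤ (1 + d_u + d_v) *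
      (1 + (M.mB ctr u u + M.edgeMass v v) + (M.aB ctr u u + M.edgeStiff v v)) := by
  have m0 := hE.mass_nonneg u
  have b0 := M.edgeMass_self_nonneg v
  have a0 := hE.stiff_nonneg u
  have σ0 := M.edgeStiff_self_nonneg v
  rw [energy0, energy1]
  have f1 := mul_nonneg (add_nonneg hdu.le hdv.le) (add_nonneg m0 b0)
  have f2 := mul_nonneg hdu.le a0
  have f3 := mul_nonneg hdv.le σ0
  have f4 := mul_nonneg hdu.le σ0
  have f5 := mul_nonneg hdv.le a0
  linarith

/-- Passage from bounds in terms of the discrete forms to bounds in terms of norms. -/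
lemma ennreal_bound {X Y Z : ℝ≥0∞} {x y z c₁ c₂ Q C : ℝ} (hK : 1 ≤ K) (hc₁ : 0 ≤ c₁)
    (hc₂ : 0 ≤ c₂) (hT : 0 ≤ T) (hX : X ≤ ENNReal.ofReal K * ENNReal.ofReal x)
    (hY : Y ≤ ENNReal.ofReal K * ENNReal.ofReal y) (hx : x ≤ c₁ * (Real.exp (Q * T) * z))
    (hy : y ≤ c₂ * (Real.exp (Q * T) * z)) (hZ : ENNReal.ofReal z ≤ ENNReal.ofReal K * Z)
    (hC : K ^ 2 * (c₁ + c₂) ≤ C) (hQ : Q ≤ C) :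
    X + Y ≤ ENNReal.ofReal C * Z * ENNReal.ofReal (Real.exp (C * T)) := by
  have hK0 : 0 ≤ K := by linarith
  have hexp : Real.exp (Q * T) ≤ Real.exp (C * T) :=
    Real.exp_le_exp.2 (mul_le_mul_of_nonneg_right hQ hT)
  have h1 : ∀ c w : ℝ, 0 ≤ c → w ≤ c * (Real.exp (Q * T) * z) → ENNReal.ofReal w ≤
      ENNReal.ofReal c * (ENNReal.ofReal (Real.exp (Q * T)) * (ENNReal.ofReal K * Z)) :=
    fun c w hc hw => by
      refine (ENNReal.ofReal_le_ofReal hw).trans ?_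
      rw [ENNReal.ofReal_mul hc, ENNReal.ofReal_mul (Real.exp_pos _).le]
      gcongr
  calc X + Y ≤ ENNReal.ofReal K * (ENNReal.ofReal c₁ *
        (ENNReal.ofReal (Real.exp (Q * T)) * (ENNReal.ofReal K * Z))) + ENNReal.ofReal K *
        (ENNReal.ofReal c₂ * (ENNReal.ofReal (Real.exp (Q * T)) * (ENNReal.ofReal K * Z))) := by
        refine add_le_add (hX.trans ?_) (hY.trans ?_)
        · gcongr; exact h1 c₁ x hc₁ hx
        · gcongr; exact h1 c₂ y hc₂ hy
    _ = ENNReal.ofReal (K ^ 2 * (c₁ + c₂)) * Z * ENNReal.ofReal (Real.exp (Q * T)) := by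
        rw [ENNReal.ofReal_mul (by positivity), ENNReal.ofReal_pow hK0,
          ENNReal.ofReal_add hc₁ hc₂]
        ring
    _ ≤ _ := by gcongr

end PolyMesh

end

/-! ### The stability estimates in terms of norms -/

theorem mainTheorem7 (Ω : Set Plane) (hΩ : IsC3Domain Ω) (γ₁ γ₂ : ℝ) (hγ₁ : 0 < γ₁)
    (hγ₂ : 0 < γ₂) :
    ∃ h₀ : ℝ, 0 < h₀ ∧
      ∀ (d_u d_v : ℝ), 0 < d_u → 0 < d_v →
      ∀ (q : ℝ → ℝ) (r s : ℝ × ℝ → ℝ),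
        (∃ K, LipschitzWith K q) → (∃ K, LipschitzWith K r) → (∃ K, LipschitzWith K s) →
      ∃ C : ℝ, 0 < C ∧
      ∀ (h : ℝ), 0 < h → h ≤ h₀ → ∀ M : PolyMesh, M.IsBSMesh Ω h γ₁ γ₂ →
      ∀ (T : ℝ), 0 < T → ∀ U V dU dV : ℝ → Plane → ℝ,
        M.IsSemidiscreteSolution d_u d_v q r s T U V dU dV →
        ((⨆ t ∈ Set.Icc (0 : ℝ) T, (l2Sq M.bulk (U t) + M.surfL2Sq (V t))) +
            ∫⁻ t in Set.Icc (0 : ℝ) T,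
              (h1SemiSq (interior M.bulk) (U t) + M.surfH1SemiSq (V t))
          ≤ ENNReal.ofReal C * (1 + l2Sq M.bulk (U 0) + M.surfL2Sq (V 0)) *
              ENNReal.ofReal (Real.exp (C * T))) ∧
        ((⨆ t ∈ Set.Icc (0 : ℝ) T,
              (h1SemiSq (interior M.bulk) (U t) + M.surfH1SemiSq (V t))) +
            ∫⁻ t in Set.Icc (0 : ℝ) T, (l2Sq M.bulk (dU t) + M.surfL2Sq (dV t))
          ≤ ENNReal.ofReal C *
              (1 + (l2Sq M.bulk (U 0) + h1SemiSq (interior M.bulk) (U 0)) +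
                (M.surfL2Sq (V 0) + M.surfH1SemiSq (V 0))) *
              ENNReal.ofReal (Real.exp (C * T))) := by
  obtain ⟨h₀, hh₀, H⟩ := hΩ.exists_estimates hγ₁ hγ₂
  refine ⟨h₀, hh₀, fun d_u d_v hdu hdv q r s hq ⟨Lr, hr⟩ ⟨Ls, hs⟩ => ?_⟩
  obtain ⟨K, hK, hest⟩ := H q hq
  obtain ⟨Q, hQ, hsol⟩ := PolyMesh.exists_energy1_bound hdu hdv hK hr hs
  have hκ0 : 0 < 2 / d_u + 2 / d_v := by positivity
  set κ := 2 / d_u + 2 / d_v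
  -- The factor `1 + d_u + d_v` converts the weighted initial energies into unweighted discrete
  -- forms, as `κ` converts the energy back at later times. The power `K ^ 2` below stems from
  -- passing between forms and norms once at time `t` and once at time zero.
  set c := (1 + d_u + d_v) * Q with hc
  have hQc : Q ≤ c := le_mul_of_one_le_left (by linarith) (by linarith)
  have hcC : K ^ 2 * (κ * c + c) ≤ K ^ 2 * ((2 + κ) * c) := by
    refine mul_le_mul_of_nonneg_left ?_ (by positivity)
    linarith
  have hQC : Q ≤ K ^ 2 * ((2 + κ) * c) := by
    have h1 : Q ≤ (2 + κ) * c := hQc.trans (le_mul_of_one_le_left (by linarith) (by linarith))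
    exact h1.trans (le_mul_of_one_le_left (by linarith) (one_le_pow₀ hK))
  refine ⟨K ^ 2 * ((2 + κ) * c), by linarith, fun h _ hh M hB T hT U V dU dV hU => ?_⟩
  obtain ⟨ctr, hM, hE⟩ := hest M h hh hB
  obtain ⟨b1, b2, b3⟩ := hsol M ctr γ₁ γ₂ T q U V dU dV hT hM hE hU
  have h0 : (0 : ℝ) ∈ Icc 0 T := left_mem_Icc.2 hT.le
  have hU0 := (hU.bulk_mem 0 h0).1
  have hV0 := (hU.surf_mem 0 h0).1
  have hP := Real.exp_pos (Q * T)
  have m0 := hE.mass_nonneg (U 0)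
  have n0 := M.edgeMass_self_nonneg (V 0)
  have a0 := hE.stiff_nonneg (U 0)
  have σ0 := M.edgeStiff_self_nonneg (V 0)
  have hen := hE.energy_le (u := U 0) (v := V 0) hdu hdv
  have hD0 : ∀ t, 0 ≤ M.energy1 ctr d_u d_v (U t) (V t) := fun t => hE.energy1_nonneg hdu hdv _ _
  have hDc := (hU.hasAEDeriv_energy1 (ctr := ctr) hT.le).continuousOn hT.le
  have hZ0 : ENNReal.ofReal (1 + (M.mB ctr (U 0) (U 0) + M.edgeMass (V 0) (V 0))) ≤
      ENNReal.ofReal K * (1 + l2Sq M.bulk (U 0) + M.surfL2Sq (V 0)) := by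
    rw [ENNReal.ofReal_add zero_le_one (by linarith), ENNReal.ofReal_one, add_assoc, mul_add,
      mul_one]
    exact add_le_add (ENNReal.one_le_ofReal.2 hK) (hE.le_l2_norm hK hU0 hV0)
  have hZ1 : ENNReal.ofReal (1 + (M.mB ctr (U 0) (U 0) + M.edgeMass (V 0) (V 0)) +
      (M.aB ctr (U 0) (U 0) + M.edgeStiff (V 0) (V 0))) ≤ ENNReal.ofReal K *
      (1 + (l2Sq M.bulk (U 0) + h1SemiSq (interior M.bulk) (U 0)) +
        (M.surfL2Sq (V 0) + M.surfH1SemiSq (V 0))) := by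
    rw [ENNReal.ofReal_add (by linarith) (by linarith)]
    refine (add_le_add hZ0 (hE.le_h1_norm hK hU0 hV0)).trans (le_of_eq ?_)
    ring
  constructor
  -- The factor 2 for the supremum undoes the 1/2 in `energy0`; the time integral needs `κ`, as only
  -- `energy1` is bounded there.
  · refine PolyMesh.ennreal_bound (z := 1 + (M.mB ctr (U 0) (U 0) + M.edgeMass (V 0) (V 0)))
      (c₁ := 2) (c₂ := κ) (x := _) (y := _) hK zero_le_two hκ0.le hT.le
      (iSup₂_le fun t ht => (hE.l2_norm_le hK (hU.bulk_mem t ht).1 (hU.surf_mem t ht).1).trans ?_)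
      ((setLIntegral_mono' measurableSet_Icc fun t ht =>
        (hE.h1_norm_le hK (hU.bulk_mem t ht).1 (hU.surf_mem t ht).1).trans
          (mul_le_mul_right (ENNReal.ofReal_le_ofReal (hE.le_energy1 hdu hdv)) _)).trans ?_)
      le_rfl le_rfl hZ0 ?_ hQC
    · gcongr
      have h1 := b1 t ht
      have h2 : 0 ≤ ∫ τ in (0 : ℝ)..t, M.energy1 ctr d_u d_v (U τ) (V τ) :=
        intervalIntegral.integral_nonneg ht.1 fun τ _ => hD0 τ
      have h3 : Real.exp (Q * T) * (1 + M.energy0 ctr (U 0) (V 0)) ≤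
          Real.exp (Q * T) * (1 + (M.mB ctr (U 0) (U 0) + M.edgeMass (V 0) (V 0))) :=
        mul_le_mul_of_nonneg_left (by rw [PolyMesh.energy0]; linarith) hP.le
      have h4 : M.energy0 ctr (U t) (V t) =
        1 / 2 * (M.mB ctr (U t) (U t) + M.edgeMass (V t) (V t)) := rfl
      linarith
    · rw [lintegral_const_mul' _ _ ENNReal.ofReal_ne_top]
      gcongr
      refine PolyMesh.lintegral_ofReal_le_of_intervalIntegral_le hT.le
        (continuousOn_const.mul hDc) (fun t => mul_nonneg hκ0.le (hD0 t)) ?_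
      rw [intervalIntegral.integral_const_mul]
      refine mul_le_mul_of_nonneg_left ?_ hκ0.le
      have h1 := b1 T (right_mem_Icc.2 hT.le)
      have h2 := hE.energy0_nonneg (U T) (V T)
      have h3 : Real.exp (Q * T) * (1 + M.energy0 ctr (U 0) (V 0)) ≤
          Real.exp (Q * T) * (1 + (M.mB ctr (U 0) (U 0) + M.edgeMass (V 0) (V 0))) :=
        mul_le_mul_of_nonneg_left (by rw [PolyMesh.energy0]; linarith) hP.le
      linarith
    · refine mul_le_mul_of_nonneg_left ?_ (by positivity)
      exact le_mul_of_one_le_right (by linarith) (by linarith)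
  · have key : Q * (Real.exp (Q * T) * (1 + M.energy0 ctr (U 0) (V 0) +
        M.energy1 ctr d_u d_v (U 0) (V 0))) ≤ c * (Real.exp (Q * T) *
        (1 + (M.mB ctr (U 0) (U 0) + M.edgeMass (V 0) (V 0)) +
          (M.aB ctr (U 0) (U 0) + M.edgeStiff (V 0) (V 0)))) := by
      have := mul_le_mul_of_nonneg_left hen (mul_nonneg (by linarith : 0 ≤ Q) hP.le)
      rw [hc]; linarith
    -- Here the supremum carries the factor `κ` from `energy1`, while the time integral is already
    -- expressed in the mass forms of the derivatives.
    refine PolyMesh.ennreal_bound (z := 1 + (M.mB ctr (U 0) (U 0) + M.edgeMass (V 0) (V 0)) +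
        (M.aB ctr (U 0) (U 0) + M.edgeStiff (V 0) (V 0))) (c₁ := κ * c) (c₂ := c) hK
      (mul_nonneg hκ0.le (by linarith)) (by linarith) hT.le
      (iSup₂_le fun t ht => (hE.h1_norm_le hK (hU.bulk_mem t ht).1 (hU.surf_mem t ht).1).trans ?_)
      ((setLIntegral_mono' measurableSet_Icc fun t ht =>
        hE.l2_norm_le hK (hU.bulk_mem t ht).2 (hU.surf_mem t ht).2).trans ?_)
      le_rfl le_rfl hZ1 hcC hQC
    · gcongr
      refine (hE.le_energy1 hdu hdv).trans ?_
      rw [mul_assoc]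
      exact mul_le_mul_of_nonneg_left ((b2 t ht).trans key) hκ0.le
    · rw [lintegral_const_mul' _ _ ENNReal.ofReal_ne_top]
      gcongr
      exact b3.trans (ENNReal.ofReal_le_ofReal key)
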